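/- **Conventions.** An (oriented) ideal triangulation $\mathcal T$ consists of finitely many oriented tetrahedra $T_1,\dots,T_N$ and orientation-reversing pairings of all their faces such that the quotient minus the vertices is the interior of a compact oriented 3-manifold $M$ whose boundary components are tori; $\partial M$ is triangulated by the truncation triangles of the tetrahedra. The three quad types of $T_j$ (pairs of opposite edges) are cyclically ordered $q_j\to q_j'\to q_j''\to q_j$ by the orientation, and $\bar a_{ij},\bar b_{ij},\bar c_{ij}$ denote the number of edges of $T_j$ facing $q_j,q_j',q_j''$ that are identified with the edge $e_i$ of $\mathcal T$. A *generalised angle structure* is a real function $\alpha$ on the quad types such that $\alpha(q_j)+\alpha(q'_j)+\alpha(q''_j)=\pi$ for all $j$ and $\sum_j(\bar a_{ij}\alpha(q_j)+\bar b_{ij}\alpha(q_j')+\bar c_{ij}\alpha(q_j''))=2\pi$ for all $i$. An *index structure* is a family of generalised angle structures $\alpha_Q$, one for each choice $Q=(Q_1,\dots,Q_N)$ of one quad type in each tetrahedron, with $\alpha_Q(Q_j)>0$ for all $j$. The tetrahedron index is $$I_\Delta(m,e)=\sum_{n\ge\max(0,-e)}(-1)^n\frac{q^{\frac12n(n+1)-(n+\frac12e)m}}{(q)_n(q)_{n+e}}\in\mathbb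 Z((q^{1/2})),\qquad (q)_n=\prod_{i=1}^n(1-q^i).$$ For an oriented normal multi-curve $\varpi$ on $\partial M$ (a disjoint union of oriented simple closed normal curves, none of them null-homologous; possibly empty), let $\bar a_{\varpi,j},\bar b_{\varpi,j},\bar c_{\varpi,j}$ be the signed numbers of normal arcs of $\varpi$ that turn anticlockwise around the corners of the four truncation triangles of $T_j$ on the edges facing $q_j,q_j',q_j''$. Put $a_{ij}=\bar a_{ij}-\bar b_{ij}$, $b_{ij}=\bar c_{ij}-\bar b_{ij}$, $a_{\varpi,j}=\bar a_{\varpi,j}-\bar b_{\varpi,j}$, $b_{\varpi,j}=\bar c_{\varpi,j}-\bar b_{\varpi,j}$, $\nu_i=2-\sum_j\bar b_{ij}$ and $\nu_\varpi=-\sum_j\bar b_{\varpi,j}$. A set $\mathcal B$ of edges is *basic* if the corresponding rows of the matrix $(a_{ij}\mid b_{ij})$ form a $\mathbb Z$-basis of the lattice spanned by all its rows. The *3D index* of a class $[\varpi]\in H_1(\partial M;\mathbb Z)$ is $$I_{\mathcal T}([\varpi])=\sum_{\boldsymbol k\in\mathbb Z^{\mathcal B}}(-q^{1/2})^{\sum_i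 k_i\nu_i+\nu_\varpi}\prod_{j=1}^N I_\Delta\Big(-b_{\varpi,j}-\sum_{i\in\mathcal B}k_ib_{ij},\ a_{\varpi,j}+\sum_{i\in\mathcal B}k_ia_{ij}\Big).$$ It is said to be *well defined* if basic sets of edges and multi-curves $\varpi$ representing the class exist, and if this sum converges in $\mathbb Z((q^{1/2}))$ to a value that does not depend on the choice of $\mathcal B$, on the multi-curve $\varpi$ representing the class, or on the cyclic relabelling of the quad types in each tetrahedron (i.e. on the quad-choice that is eliminated). A *0–2 move* is performed on two distinct triangles of $\mathcal T$ that share an edge $e=uv$: the tetrahedra identified across these triangles $uvx$ and $uvy$ are unglued, which duplicates the two triangles and $e$, and two new tetrahedra with vertices $u,v,x,y$, glued to each other along their faces $uxy$ and $vxy$, are glued into the resulting hole, one to each of the two half-books of tetrahedra into which the triangles separate the tetrahedra around $e$. The result is another ideal triangulation $\widetilde{\mathcal T}$ of $M$; its truncation triangles are the old ones, separated along sides by bigons consisting of new ones, and collapsing these bigons identifies the homology of the two triangulations of the boundary. **Theorem.** Suppose that $\mathcal T$ and $\widetilde{\mathcal T}$ are ideal triangulations of $M$, that $\widetilde{\mathcal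 T}$ is obtained from $\mathcal T$ by a 0–2 move, and that both admit an index structure. Then for every $[\varpi]\in H_1(\partial M;\mathbb Z)$ the 3D indices $I_{\mathcal T}([\varpi])$ and $I_{\widetilde{\mathcal T}}([\varpi])$ are well defined, and $$I_{\mathcal T}([\varpi])=I_{\widetilde{\mathcal T}}([\varpi]).$$ -/

import Mathlib

open Equiv

/-! ## The tetrahedron index

Elements of `ℤ((q^{1/2}))` are Laurent series over `ℤ` in the variable `z = q^{1/2}`, so that
`single k` stands for `q^{k/2}`. -/

namespace TetIndex

/-- `(-q^{1/2})^k` for an integer `k`. -/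
noncomputable def negSqrtQPow (k : ℤ) : LaurentSeries ℤ :=
  HahnSeries.single k ((Int.negOnePow k : ℤˣ) : ℤ)

/-- `1/(q)_n`, where `(q)_n = ∏_{i=1}^n (1 - q^i)` and `q = z^2`. -/
noncomputable def invQPochhammer (n : ℕ) : LaurentSeries ℤ :=
  HahnSeries.ofPowerSeries ℤ ℤ
    (PowerSeries.invOfUnit
      (∏ i ∈ Finset.Icc 1 n, (1 - (PowerSeries.X : PowerSeries ℤ) ^ (2 * i))) 1)

/-- The `n`-th term
`(-1)^n q^{n(n+1)/2 - (n+e/2)m} / ((q)_n (q)_{n+e})` of the tetrahedron index, which is `0`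
when `n < (-e)_+`. -/
noncomputable def term (m e : ℤ) (n : ℕ) : LaurentSeries ℤ :=
  if 0 ≤ (n : ℤ) + e then
    HahnSeries.single ((n : ℤ) * (n + 1) - (2 * n + e) * m) ((-1 : ℤ) ^ n) *
      (invQPochhammer n * invQPochhammer ((n : ℤ) + e).toNat)
  else 0

theorem le_of_coeff_term_ne_zero {m e : ℤ} {n : ℕ} {d : ℤ} (h : (term m e n).coeff d ≠ 0) :
    (n : ℤ) ≤ d + m * m + e * m := by
  unfold term at h
  split_ifs at h with hn
  · by_contra hlt
    apply h
    unfold invQPochhammer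
    rw [← map_mul, HahnSeries.coeff_single_mul, PowerSeries.coeff_coe, if_pos, mul_zero]
    nlinarith [sq_nonneg ((n : ℤ) - m)]
  · simp at h

/-- The terms of the tetrahedron index, as a formally summable family. -/
noncomputable def family (m e : ℤ) : HahnSeries.SummableFamily ℤ ℤ ℕ where
  toFun := term m e
  isPWO_iUnion_support' := by
    apply Set.IsWF.isPWO
    apply BddBelow.isWF
    refine ⟨-(m * m) - e * m, ?_⟩
    intro d hd
    obtain ⟨n, hn⟩ := Set.mem_iUnion.1 hd
    have := le_of_coeff_term_ne_zero (HahnSeries.mem_support _ _ |>.1 hn)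
    have : (0 : ℤ) ≤ n := Int.natCast_nonneg n
    linarith
  finite_co_support' := by
    intro d
    refine (Set.finite_Iic (d + m * m + e * m).toNat).subset ?_
    intro n hn
    have := le_of_coeff_term_ne_zero hn
    simp only [Set.mem_Iic]
    omega

/-- The tetrahedron index `I_Δ(m,e)`. -/
noncomputable def tetIndex (m e : ℤ) : LaurentSeries ℤ := (family m e).hsum

/-- The (unordered, possibly infinite) sum of the family `g` converges in `ℤ((q^{1/2}))`,
coefficient by coefficient and with degrees bounded below, and its value is `s`. -/
def HasLaurentSum {ι : Type*} (g : ι → LaurentSeries ℤ) (s : LaurentSeries ℤ) : Prop :=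
  ∃ F : HahnSeries.SummableFamily ℤ ℤ ι, (∀ i, F i = g i) ∧ F.hsum = s

end TetIndex

/-! ## Oriented ideal triangulations

The vertices of each tetrahedron `t : τ` are `0, 1, 2, 3`, and the face `f` of `t` is the one
opposite the vertex `f`.  The tetrahedra are oriented in such a way that for an even permutation
`(v, w, x, y)` of `(0, 1, 2, 3)` the vertices `w, x, y` appear anticlockwise when viewed from the
vertex `v`. -/

/-- Orientation-reversing face pairings of the tetrahedra `τ`, with quotient an oriented
pseudo-manifold: the face `f` of `t` is glued to a face of `adj t f`, the permutation `glue t f`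
tells to which vertex of `adj t f` each vertex of `t` on the face `f` is glued, and it sends `f`
to the vertex of `adj t f` opposite the face to which the face `f` of `t` is glued. -/
structure FacePairing (τ : Type*) where
  adj : τ → Fin 4 → τ
  glue : τ → Fin 4 → Perm (Fin 4)
  adj_adj : ∀ t f, adj (adj t f) (glue t f f) = t
  glue_glue : ∀ t f, glue (adj t f) (glue t f f) = (glue t f)⁻¹
  not_self : ∀ t f, (adj t f, glue t f f) ≠ (t, f)
  sign_glue : ∀ t f, Perm.sign (glue t f) = -1

/-- A tetrahedron with an ordering `(ρ 0, ρ 1, ρ 2, ρ 3)` of its vertices. -/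
abbrev TetFlag (τ : Type*) := τ × Perm (Fin 4)

/-- A corner `(t, v, w)` with `v ≠ w`: the tetrahedron `t` is truncated at its vertex `v`, and the
resulting triangle `(t, v)` has one corner on the edge `vw` for each `w ≠ v`. -/
abbrev Corner (τ : Type*) := {c : τ × Fin 4 × Fin 4 // c.2.1 ≠ c.2.2}

namespace TetFlag

variable {τ : Type*}

/-- The corner on the edge `(ρ 0)(ρ 1)` of the triangle at the vertex `ρ 0`. -/
def corner (x : TetFlag τ) : Corner τ := ⟨(x.1, x.2 0, x.2 1), by simp⟩

/-- Reorder the vertices of a flag. -/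
def reorder (x : TetFlag τ) (π : Perm (Fin 4)) : TetFlag τ := (x.1, x.2 * π)

/-- `(v, w, x, y) ↦ (v, x, w, y)`: the other corner of the triangle at `v` on the side in the
face `vwx`. -/
def other (x : TetFlag τ) : TetFlag τ := x.reorder (swap 1 2)

end TetFlag

/-- The type of the normal quadrilateral facing the edge `vw` (and the opposite edge):
`0` for `01|23`, `1` for `02|13` and `2` for `03|12`.  The cyclic order `0 → 1 → 2 → 0` is the
order `q → q' → q'' → q` (or `Z → Z' → Z'' → Z`) of the quad types in each tetrahedron. -/
def quadType (v w : Fin 4) : Fin 3 :=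
  if (v = 0 ∧ w = 1) ∨ (v = 1 ∧ w = 0) ∨ (v = 2 ∧ w = 3) ∨ (v = 3 ∧ w = 2) then 0
  else if (v = 0 ∧ w = 2) ∨ (v = 2 ∧ w = 0) ∨ (v = 1 ∧ w = 3) ∨ (v = 3 ∧ w = 1) then 1
  else 2

namespace FacePairing

variable {τ : Type*} (T : FacePairing τ)

/-- Pass through the face opposite the last vertex of the flag into the neighbouring
tetrahedron. -/
def cross (x : TetFlag τ) : TetFlag τ := (T.adj x.1 (x.2 3), T.glue x.1 (x.2 3) * x.2)

/-- Rotate about the edge `(ρ 0)(ρ 1)`: a flag `(t, ρ)` is seen as the tetrahedron `t` entered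
through its face opposite `ρ 3` and left through its face opposite `ρ 2`, the two faces of `t`
that contain this edge.  The new flag is the next tetrahedron around the edge, entered through
the face through which `t` was left. -/
def rotate (x : TetFlag τ) : TetFlag τ := T.cross (x.reorder (swap 2 3))

/-- The cusps, i.e. the classes of vertices `(t, v)` of tetrahedra under the face pairings. -/
def Cusp : Type _ :=
  Quot fun a b : τ × Fin 4 =>
    ∃ x : TetFlag τ, a = (x.1, x.2 0) ∧ b = ((T.cross x).1, (T.cross x).2 0)

/-- The vertices of the triangulation of the boundary by the truncation triangles, i.e. the ends
of the edges of the triangulation: classes of corners under the face pairings. -/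
def EdgeEnd : Type _ :=
  Quot fun a b : Corner τ => ∃ x : TetFlag τ, a = x.corner ∧ b = (T.cross x).corner

/-- The edges of the triangulation: classes of edges of tetrahedra under the face pairings
(the edge `vw` is represented by the corners `(v, w)` and `(w, v)`). -/
def Edge : Type _ :=
  Quot fun a b : Corner τ => ∃ x : TetFlag τ, a = x.corner ∧
    (b = (T.cross x).corner ∨ b = (x.reorder (swap 0 1)).corner)

def cusp (a : τ × Fin 4) : T.Cusp := Quot.mk _ a

def edgeEnd (c : Corner τ) : T.EdgeEnd := Quot.mk _ c

def edge (c : Corner τ) : T.Edge := Quot.mk _ c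

/-- The face pairing is an ideal triangulation of the interior of a compact oriented 3-manifold
with torus boundary components: each vertex link, which is a connected closed oriented surface
triangulated by `F` triangles with `E = 3F/2` edges and `V` vertices, has Euler characteristic
`V - E + F = 0`, i.e. `2V = F`. -/
def IsIdealTriangulation : Prop :=
  ∀ κ : T.Cusp,
    2 * {p : T.EdgeEnd | ∃ c : Corner τ, T.edgeEnd c = p ∧ T.cusp (c.1.1, c.1.2.1) = κ}.ncard =
      {a : τ × Fin 4 | T.cusp a = κ}.ncard

/-! ### Angle structures and index structures -/

open Classical in
/-- The coefficient of the angle of the quad type `a` of the tetrahedron `t` in the equation of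
the edge `E`, i.e. the number of edges of `t` facing this quad type that are glued to `E`.  These
are the entries of the matrices `Ā`, `B̄`, `C̄` for `a = 0, 1, 2`. -/
noncomputable def edgeCoeff (E : T.Edge) (t : τ) (a : Fin 3) : ℤ :=
  ∑ v : Fin 4, ∑ w : Fin 4,
    if h : v < w then if quadType v w = a ∧ T.edge ⟨(t, v, w), h.ne⟩ = E then 1 else 0 else 0

/-- Generalised angle structures. -/
structure IsGeneralisedAngleStructure [Fintype τ] (α : τ → Fin 3 → ℝ) : Prop where
  tetrahedron : ∀ t, α t 0 + α t 1 + α t 2 = Real.pi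
  edge : ∀ E : T.Edge, ∑ t, ∑ a, (T.edgeCoeff E t a : ℝ) * α t a = 2 * Real.pi

/-- The triangulation admits an index structure: for each quad-choice `Q` a generalised angle
structure that is positive on the quad types in `Q`. -/
def HasIndexStructure [Fintype τ] : Prop :=
  ∃ α : (τ → Fin 3) → τ → Fin 3 → ℝ,
    ∀ Q, T.IsGeneralisedAngleStructure (α Q) ∧ ∀ t, 0 < α Q t (Q t)

/-! ### The homology of the boundary

The boundary `∂M` is the union of the truncation triangles.  We use the cell structure on `∂M`
whose vertices are the midpoints of the sides of these triangles, and whose edges are the normal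
arcs, one for each corner `(t, v, w)`, oriented anticlockwise around the corner as viewed from
the cusp.  Its 2-cells are a triangle inside each truncation triangle and a polygon
around each vertex of the triangulation of `∂M`. -/

/-- Cellular 1-cycles: at the midpoint of each side of each truncation triangle, the arcs that
arrive from the one triangle balance those that leave into the other one. -/
def cycles : AddSubgroup (Corner τ → ℤ) where
  carrier := {c | ∀ x : TetFlag τ, c x.corner - c x.other.corner =
    c (T.cross x).corner - c (T.cross x).other.corner}
  zero_mem' := by intro x; simp
  add_mem' := by
    intro a b ha hb x
    have h1 := ha x
    have h2 := hb x
    simp only [Pi.add_apply]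
    linarith
  neg_mem' := by
    intro a ha x
    have h1 := ha x
    simp only [Pi.neg_apply]
    linarith

open Classical in
/-- The sum of the three arcs in the truncation triangle `(t, v)`, which is up to sign the
boundary of the middle triangle. -/
noncomputable def triangleChain (a : τ × Fin 4) : Corner τ → ℤ :=
  fun c => if (c.1.1, c.1.2.1) = a then 1 else 0

open Classical in
/-- The sum of the arcs around a vertex of the triangulation of the boundary. -/
noncomputable def vertexChain (p : T.EdgeEnd) : Corner τ → ℤ :=
  fun c => if T.edgeEnd c = p then 1 else 0

/-- Cellular 1-boundaries. -/
noncomputable def boundaries : AddSubgroup (Corner τ → ℤ) :=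
  AddSubgroup.closure (Set.range (triangleChain (τ := τ)) ∪ Set.range T.vertexChain)

/-- `H_1(∂M; ℤ)`. -/
abbrev H1 : Type _ := T.cycles ⧸ T.boundaries.addSubgroupOf T.cycles

/-! ### Oriented normal multi-curves -/

/-- An embedded normal multi-curve on the boundary, given by its normal coordinates: the number of
arcs around each corner.  On each side of each truncation triangle, as many arcs end from the one
triangle as from the other one. -/
structure NormalCurve where
  num : Corner τ → ℕ
  matching : ∀ x : TetFlag τ, num x.corner + num x.other.corner =
    num (T.cross x).corner + num (T.cross x).other.corner

namespace NormalCurve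

variable {T} (n : T.NormalCurve)

/-- The arcs around the corner `c` are numbered `0, 1, …, num c - 1`, starting from the corner.
The arc number `i` around the corner of the flag `x = (v, w, x, y)` ends on the side of the triangle
at `v` in the face `vwx`, as the `i`-th point from the corner on `vw`.  It continues in the
adjacent triangle on the other side, by an arc around the same vertex of the boundary if there are
more than `i` of these, and else by an arc around the other end point of the side. -/
def next (x : TetFlag τ) (i : ℕ) : Corner τ × ℕ :=
  if i < n.num (T.cross x).corner then ((T.cross x).corner, i)
  else ((T.cross x).other.corner, n.num x.corner + n.num x.other.corner - 1 - i)

/-- Two arcs that share an end point. -/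
def Consecutive (a b : Corner τ × ℕ) : Prop :=
  ∃ (x : TetFlag τ) (i : ℕ), i < n.num x.corner ∧ a = (x.corner, i) ∧ b = n.next x i

/-- The arcs `a` and `b` lie on the same component of the curve. -/
def SameComponent : Corner τ × ℕ → Corner τ × ℕ → Prop := Relation.EqvGen n.Consecutive

end NormalCurve

/-- An oriented normal multi-curve: `orient c i` is `1` if the arc number `i` around the corner `c`
runs anticlockwise around `c`, and `-1` if it runs clockwise.  An arc that continues around the same
vertex keeps its sense of rotation, and else the sense of rotation changes. -/
structure OrientedCurve extends T.NormalCurve where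
  orient : Corner τ → ℕ → ℤˣ
  orient_same : ∀ (x : TetFlag τ) (i : ℕ), i < num x.corner → i < num (T.cross x).corner →
    orient (T.cross x).corner i = orient x.corner i
  orient_other : ∀ (x : TetFlag τ) (i : ℕ), i < num x.corner → num (T.cross x).corner ≤ i →
    orient (T.cross x).other.corner (num x.corner + num x.other.corner - 1 - i) =
      - orient x.corner i

namespace OrientedCurve

variable {T} (ϖ : T.OrientedCurve)

/-- The signed number of arcs of the curve that turn anticlockwise around a corner. -/
def turning (c : Corner τ) : ℤ := ∑ i ∈ Finset.range (ϖ.num c), (ϖ.orient c i : ℤ)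

theorem turning_mem_cycles : ϖ.turning ∈ T.cycles := by
  intro x
  set A := ϖ.num x.corner with hA
  set B := ϖ.num x.other.corner with hB
  set A' := ϖ.num (T.cross x).corner with hA'
  set B' := ϖ.num (T.cross x).other.corner with hB'
  have hm : A + B = A' + B' := ϖ.matching x
  have hc : T.cross x.other = (T.cross x).other := by
    simp [cross, TetFlag.other, TetFlag.reorder, mul_assoc, swap_apply_of_ne_of_ne]
  have ho : ∀ y : TetFlag τ, y.other.other = y := by
    intro y
    simp [TetFlag.other, TetFlag.reorder, mul_assoc]
  have key : ∀ y : TetFlag τ, ϖ.turning y.corner - ϖ.turning y.other.corner =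
      ∑ i ∈ Finset.range (ϖ.num y.corner + ϖ.num y.other.corner),
        if i < ϖ.num y.corner then (ϖ.orient y.corner i : ℤ)
        else - (ϖ.orient y.other.corner
          (ϖ.num y.corner + ϖ.num y.other.corner - 1 - i) : ℤ) := by
    intro y
    rw [Finset.sum_range_add, sub_eq_add_neg]
    congr 1
    · exact Finset.sum_congr rfl fun i hi => by rw [if_pos (Finset.mem_range.1 hi)]
    · rw [turning, ← Finset.sum_range_reflect, ← Finset.sum_neg_distrib]
      refine Finset.sum_congr rfl fun i hi => ?_
      rw [if_neg (by omega)]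
      congr 3
      omega
  rw [key x, key (T.cross x), ← hA, ← hB, ← hA', ← hB', ← hm]
  refine Finset.sum_congr rfl fun i hi => ?_
  have hi : i < A + B := Finset.mem_range.1 hi
  by_cases h1 : i < A
  · by_cases h2 : i < A'
    · rw [if_pos h1, if_pos h2, ϖ.orient_same x i h1 h2]
    · rw [if_pos h1, if_neg h2, ϖ.orient_other x i h1 (not_lt.1 h2)]
      simp
  · by_cases h2 : i < A'
    · have := ϖ.orient_other x.other (A + B - 1 - i) (by omega) (by rw [hc]; omega)
      rw [hc, ho, ho, ← hA, ← hB, show B + A - 1 - (A + B - 1 - i) = i by omega] at this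
      rw [if_neg h1, if_pos h2, this]
      simp
    · have := ϖ.orient_same x.other (A + B - 1 - i) (by omega) (by rw [hc]; omega)
      rw [hc] at this
      rw [if_neg h1, if_neg h2, this]

/-- The homology class in `H_1(∂M; ℤ)` of an oriented multi-curve. -/
noncomputable def homologyClass : T.H1 :=
  QuotientAddGroup.mk (s := T.boundaries.addSubgroupOf T.cycles) ⟨ϖ.turning, ϖ.turning_mem_cycles⟩

open Classical in
/-- The contribution of the component of the arc `a` to the signed numbers of arcs. -/
noncomputable def componentTurning (a : Corner τ × ℕ) (c : Corner τ) : ℤ :=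
  ∑ i ∈ Finset.range (ϖ.num c),
    if ϖ.toNormalCurve.SameComponent a (c, i) then (ϖ.orient c i : ℤ) else 0

/-- No component of the curve is homologically trivial (equivalently, on a torus, no component
bounds a disc). -/
def Essential : Prop :=
  ∀ (c : Corner τ) (i : ℕ), i < ϖ.num c → ϖ.componentTurning (c, i) ∉ T.boundaries

end OrientedCurve

/-! ### The 3D index

A quad-choice `Q` tells which one of the three angles of each tetrahedron is eliminated: the angle
`Z'` of the quad type `Q t`, so that `Z''` and `Z` belong to the next two quad types `Q t + 1` and
`Q t + 2` in the cyclic order. -/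

/-- The entries of the matrix `A = Ā - B̄`. -/
noncomputable def nzA (Q : τ → Fin 3) (E : T.Edge) (t : τ) : ℤ :=
  T.edgeCoeff E t (Q t + 2) - T.edgeCoeff E t (Q t)

/-- The entries of the matrix `B = C̄ - B̄`. -/
noncomputable def nzB (Q : τ → Fin 3) (E : T.Edge) (t : τ) : ℤ :=
  T.edgeCoeff E t (Q t + 1) - T.edgeCoeff E t (Q t)

/-- The entries of the vector `ν = 2 (1, …, 1)ᵀ - B̄ (1, …, 1)ᵀ`. -/
noncomputable def nu [Fintype τ] (Q : τ → Fin 3) (E : T.Edge) : ℤ :=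
  2 - ∑ t, T.edgeCoeff E t (Q t)

/-- The row of the Neumann-Zagier matrix `(A | B)` of the edge `E`. -/
noncomputable def nzRow (Q : τ → Fin 3) (E : T.Edge) : τ → ℤ × ℤ :=
  fun t => (T.nzA Q E t, T.nzB Q E t)

/-- `S` is a set of basic edges: their rows form an integer basis of the integer row space of the
Neumann-Zagier matrix. -/
def IsBasic (Q : τ → Fin 3) (S : Finset T.Edge) : Prop :=
  LinearIndependent ℤ (fun E : S => T.nzRow Q E) ∧
    Submodule.span ℤ (Set.range fun E : S => T.nzRow Q E) =
      Submodule.span ℤ (Set.range (T.nzRow Q))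

/-- The turning number `ā_ϖ`, `b̄_ϖ` or `c̄_ϖ` (for `a = 0, 1, 2`) at the tetrahedron `t` of a curve
with the signed numbers of arcs `c`: the sum over the corners on the edges that face the quad
type `a`. -/
def turningNumber (c : Corner τ → ℤ) (t : τ) (a : Fin 3) : ℤ :=
  ∑ v : Fin 4, ∑ w : Fin 4,
    if h : v ≠ w then if quadType v w = a then c ⟨(t, v, w), h⟩ else 0 else 0

/-- The summand
`(-q^{1/2})^{k·ν + ν_ϖ} ∏_j I_Δ(-b_{ϖ,j} - k·b_j, a_{ϖ,j} + k·a_j)`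
of the 3D index. -/
noncomputable def indexTerm [Fintype τ] (Q : τ → Fin 3) (ϖ : T.OrientedCurve)
    (S : Finset T.Edge) (k : S → ℤ) : LaurentSeries ℤ :=
  TetIndex.negSqrtQPow (∑ E, k E * T.nu Q E - ∑ t, turningNumber ϖ.turning t (Q t)) *
    ∏ t, TetIndex.tetIndex
      (-(turningNumber ϖ.turning t (Q t + 1) - turningNumber ϖ.turning t (Q t))
        - ∑ E, k E * T.nzB Q E t)
      ((turningNumber ϖ.turning t (Q t + 2) - turningNumber ϖ.turning t (Q t))
        + ∑ E, k E * T.nzA Q E t)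

/-- The 3D index `I_T(h)` of the homology class `h` is well defined and equal to `I`: for each
quad-choice there are basic edges, there is an oriented multi-curve that represents `h`, and for
all such choices the sum that defines the index converges to `I`. -/
def IsIndex [Fintype τ] (h : T.H1) (I : LaurentSeries ℤ) : Prop :=
  (∀ Q, ∃ S, T.IsBasic Q S) ∧
  (∃ ϖ : T.OrientedCurve, ϖ.Essential ∧ ϖ.homologyClass = h) ∧
  ∀ (Q : τ → Fin 3) (S : Finset T.Edge) (ϖ : T.OrientedCurve),
    T.IsBasic Q S → ϖ.Essential → ϖ.homologyClass = h →
      TetIndex.HasLaurentSum (T.indexTerm Q ϖ S) I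

end FacePairing

/-! ## The 0-2 move -/

/-- `T'` is obtained from `T` by a 0-2 move.

The flag `start = (u, v, x, ·)` is the first tetrahedron of a half-book about the edge `e = uv`,
which has `len + 1` tetrahedra `start, rotate start, …, rotate^len start`.  The two triangles
are the face `uvx` through which `start` is entered and the face `uvy` through which the last
tetrahedron of the half-book is left.  The two triangles are unglued; two new tetrahedra
`T₁ = inr 0` and `T₂ = inr 1`, whose vertices `0, 1, 2, 3` are `u, v, x, y` and `v, u, x, y`,
are glued to each other along the triangles `vxy` and `uxy`, and they are glued into the hole,
`T₁` to the half-book and `T₂` to the other half-book.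

The tetrahedra of `T'` are identified with the old and the new ones through `tet`, and their
vertices are relabelled, preserving the orientation, by `lab`.  That `start.2` is odd makes `T₁` and
`T₂` positively oriented, and is no restriction since `u` and `v` can be exchanged. -/
structure ZeroTwoMove {τ τ' : Type*} (T : FacePairing τ) (T' : FacePairing τ') where
  start : TetFlag τ
  len : ℕ
  sign_start : Perm.sign start.2 = -1
  tet : τ ⊕ Fin 2 ≃ τ'
  lab : τ ⊕ Fin 2 → Perm (Fin 4)
  sign_lab : ∀ s, Perm.sign (lab s) = 1
  /-- The two triangles are distinct: the second one is neither side of the first one. -/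
  distinct₁ : ((T.rotate^[len] start).1, (T.rotate^[len] start).2 2) ≠ (start.1, start.2 3)
  distinct₂ : ((T.rotate^[len] start).1, (T.rotate^[len] start).2 2) ≠
    ((T.cross start).1, (T.cross start).2 3)
  /-- The face pairings away from the two triangles are unchanged. -/
  glue_old : ∀ (t : τ) (f : Fin 4),
    (t, f) ≠ (start.1, start.2 3) →
    (t, f) ≠ ((T.cross start).1, (T.cross start).2 3) →
    (t, f) ≠ ((T.rotate^[len] start).1, (T.rotate^[len] start).2 2) →
    (t, f) ≠ ((T.rotate^[len + 1] start).1, (T.rotate^[len + 1] start).2 3) →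
    T'.adj (tet (.inl t)) (lab (.inl t) f) = tet (.inl (T.adj t f)) ∧
    T'.glue (tet (.inl t)) (lab (.inl t) f) =
      lab (.inl (T.adj t f)) * T.glue t f * (lab (.inl t))⁻¹
  /-- The face `uvx` of `T₁` is glued to the half-book. -/
  glue_one_three :
    T'.adj (tet (.inr 0)) (lab (.inr 0) 3) = tet (.inl start.1) ∧
    T'.glue (tet (.inr 0)) (lab (.inr 0) 3) = lab (.inl start.1) * start.2 * (lab (.inr 0))⁻¹
  /-- The face `uvy` of `T₁` is glued to the half-book. -/
  glue_one_two :
    T'.adj (tet (.inr 0)) (lab (.inr 0) 2) = tet (.inl (T.rotate^[len] start).1) ∧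
    T'.glue (tet (.inr 0)) (lab (.inr 0) 2) =
      lab (.inl (T.rotate^[len] start).1) * (T.rotate^[len] start).2 * (lab (.inr 0))⁻¹
  /-- The face `uvx` of `T₂` is glued to the other half-book. -/
  glue_two_three :
    T'.adj (tet (.inr 1)) (lab (.inr 1) 3) = tet (.inl (T.cross start).1) ∧
    T'.glue (tet (.inr 1)) (lab (.inr 1) 3) =
      lab (.inl (T.cross start).1) * ((T.cross start).2 * swap 0 1) * (lab (.inr 1))⁻¹
  /-- The face `uvy` of `T₂` is glued to the other half-book. -/
  glue_two_two :
    T'.adj (tet (.inr 1)) (lab (.inr 1) 2) = tet (.inl (T.rotate^[len + 1] start).1) ∧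
    T'.glue (tet (.inr 1)) (lab (.inr 1) 2) =
      lab (.inl (T.rotate^[len + 1] start).1) *
        ((T.rotate^[len + 1] start).2 * swap 2 3 * swap 0 1) * (lab (.inr 1))⁻¹
  /-- `T₁` and `T₂` are glued along `vxy`. -/
  glue_zero :
    T'.adj (tet (.inr 0)) (lab (.inr 0) 0) = tet (.inr 1) ∧
    T'.glue (tet (.inr 0)) (lab (.inr 0) 0) = lab (.inr 1) * swap 0 1 * (lab (.inr 0))⁻¹
  /-- `T₁` and `T₂` are glued along `uxy`. -/
  glue_one :
    T'.adj (tet (.inr 0)) (lab (.inr 0) 1) = tet (.inr 1) ∧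
    T'.glue (tet (.inr 0)) (lab (.inr 0) 1) = lab (.inr 1) * swap 0 1 * (lab (.inr 0))⁻¹

namespace ZeroTwoMove

variable {τ τ' : Type*} {T : FacePairing τ} {T' : FacePairing τ'} (m : ZeroTwoMove T T')

/-- The part of a chain on the boundary of `T'` that lies in the old tetrahedra. -/
def restrict (c : Corner τ' → ℤ) : Corner τ → ℤ :=
  fun d => c ⟨(m.tet (.inl d.1.1), m.lab (.inl d.1.1) d.1.2.1, m.lab (.inl d.1.1) d.1.2.2), by
    simpa using d.2⟩

/-- `h` and `h'` are the same class in `H_1(∂M; ℤ)`, expressed by means of the triangulations `T`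
and `T'` of the same manifold `M`: there is a cycle that represents `h'` and which, when the
bigons between the old truncation triangles that consist of new ones are collapsed, becomes a cycle
that represents `h`. -/
def SameClass (h : T.H1) (h' : T'.H1) : Prop :=
  ∃ (c : T.cycles) (c' : T'.cycles),
    QuotientAddGroup.mk (s := T.boundaries.addSubgroupOf T.cycles) c = h ∧
    QuotientAddGroup.mk (s := T'.boundaries.addSubgroupOf T'.cycles) c' = h' ∧
    (c : Corner τ → ℤ) = m.restrict (c' : Corner τ' → ℤ)

end ZeroTwoMove

/-! # Invariance of the 3D index under 0-2 moves

**The tetrahedron index.** In the variables attached to the three quad types the tetrahedron index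
becomes a symmetric function `TetIndex.symIndex a b c`, which is multiplied by `(-q^{1/2})^{-s}` when
`s` is added to all three variables. Its symmetry consists of a reindexing of the defining series and
of a duality, which follows from Euler's expansion of `∏_{i > N} (1 - q^i)`. It implies a quadratic
lower bound for the degree, `lowerBound_symIndex`. The identity behind the 0-2 move is
`hasLaurentSum_symIndex_mul_symIndex`: the sum over `a` of
`(-q^{1/2})^{2a} symIndex a b c * symIndex (a + d) b c` is `1` if `d = 0` and `0` otherwise.

**The index as a sum over a lattice.** By the symmetry, the summand of the 3D index at a function on
the edges is a product over the tetrahedra that involves no quad choice, and it depends only on the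
class in `EdgeLattice`, the functions on the edges modulo the *flat* ones, whose sums over the three
pairs of opposite edges agree in each tetrahedron. Flat functions are the relations among the rows of
`(a | b)`, so basic sets of edges are those that parametrise this lattice
(`hasLaurentSum_indexTerm_iff`). Flat functions are also the half sums over end points of functions on
the cusps, which gives the existence of basic sets (`exists_isBasic`). An angle structure turns the
degree bound into a sum over the tetrahedra of terms bounded below; in each part of the lattice where
given quad types have the largest sums, the angle structure of the index structure that is positive
there makes the bound proper, and the sum converges (`exists_hasLaurentSum_quotTerm`).

**Independence of the curve.** If two cycles differ by the coboundary of a vertex function `n` and a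
triangle function `m`, the summands differ by a translation of the lattice and by the power of
`-q^{1/2}` with exponent `-(2 ∑ n + ∑ m)`, up to sign the *defect* (`hasLaurentSum_quotTerm_iff`). The
topological input is that homologous essential curves on a torus have defect zero
(`Essential.hasDefect_total_sub`). To see this, a component of an essential curve is compared with a
cocycle `c` in the same class, or in that of a multiple, without local minima and maxima of the height
function that it defines on the universal cover. The curve and the sides of the triangles divide the
torus into cells, and the incidence coefficients of their dual complex modulo two can be deformed by
powers of a parameter `X` in two ways, according to the jumps across the curve and according to the
heights of `c`. At `X = 0` both deformations are acyclic: the first because the component is not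
null-homologous, the second because `c` has no local extrema. As they are related by rescaling the
cells, the multiplicativity of torsion (`sum_exponents_eq`) shows that the alternating sum of the
exponents vanishes, which expresses the defect in terms of `c` alone (`defect_eq`). Disjoint components
are homologous up to sign by the same complex (`exists_isCob_sub`), so that multi-curves reduce to
multiples of one component.

**The 0-2 move.** A shortest cycle in a homology class is represented by an essential curve, and so
is its extension to the new triangulation that does not turn around the edge `uv` in the new
tetrahedra, since a boundary split off from the extension would restrict to one split off from the
shortest cycle (`exists_shortest`, `exists_essential`). With this choice of curves the labels of the
two new tetrahedra agree except at the two copies of `uv`. The sum over the value at the new edge `xy`,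
which is opposite to `uv` in both of them, is evaluated by the quadratic identity; it vanishes unless
the two copies of `uv` carry the same value, and then it is the summand of the old triangulation
(`hasLaurentSum_latticeTerm`). It remains to compare the two lattices (`hasLaurentSum_quotTerm`). -/

/-! ### Sums of families of Laurent series -/

namespace TetIndex

/-- All coefficients of `f` in degrees below `B` vanish. -/
def LowerBound (B : ℤ) (f : LaurentSeries ℤ) : Prop := ∀ d < B, f.coeff d = 0

theorem LowerBound.mono {B C : ℤ} {f : LaurentSeries ℤ} (h : LowerBound B f) (hC : C ≤ B) :
    LowerBound C f := fun d hd => h d (by omega)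

theorem LowerBound.mul {B C : ℤ} {f g : LaurentSeries ℤ} (hf : LowerBound B f)
    (hg : LowerBound C g) : LowerBound (B + C) (f * g) := by
  intro d hd
  rw [HahnSeries.coeff_mul]
  refine Finset.sum_eq_zero fun ij hij => ?_
  obtain ⟨_, _, h3⟩ := Finset.mem_antidiagonal.1 hij
  by_cases h : ij.1 < B
  · rw [hf _ h, zero_mul]
  · rw [hg _ (by omega), mul_zero]

theorem lowerBound_one : LowerBound 0 1 := by
  intro d hd
  rw [HahnSeries.coeff_one, if_neg (by omega)]

theorem LowerBound.prod {ι : Type*} (s : Finset ι) {B : ι → ℤ} {f : ι → LaurentSeries ℤ}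
    (h : ∀ i ∈ s, LowerBound (B i) (f i)) : LowerBound (∑ i ∈ s, B i) (∏ i ∈ s, f i) := by
  classical
  induction s using Finset.induction_on with
  | empty => simpa using lowerBound_one
  | insert a s ha ih =>
    rw [Finset.sum_insert ha, Finset.prod_insert ha]
    exact (h a (Finset.mem_insert_self a s)).mul
      (ih fun i hi => h i (Finset.mem_insert_of_mem hi))

theorem lowerBound_single (k : ℤ) (r : ℤ) : LowerBound k (HahnSeries.single k r) := by
  intro d hd
  rw [HahnSeries.coeff_single_of_ne (by omega)]

theorem lowerBound_ofPowerSeries (p : PowerSeries ℤ) :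
    LowerBound 0 (HahnSeries.ofPowerSeries ℤ ℤ p) := by
  intro d hd
  rw [PowerSeries.coeff_coe, if_pos hd]

theorem finsum_of_support_subset_range {ι κ : Type*} {u : ι → ℤ} {e : κ → ι}
    (he : Function.Injective e) (hu : Function.support u ⊆ Set.range e) :
    ∑ᶠ i, u i = ∑ᶠ k, u (e k) := by
  rw [← finsum_mem_range he, ← finsum_mem_univ]
  exact finsum_mem_inter_support_eq u _ _ (by
    rw [Set.univ_inter, Set.inter_eq_right.2 hu])

section Sums

variable {ι κ : Type*} {f g : ι → LaurentSeries ℤ} {s t : LaurentSeries ℤ}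

theorem exists_hasLaurentSum_of_finite (B : ℤ) (hB : ∀ i, LowerBound B (f i))
    (hfin : ∀ d, {i | (f i).coeff d ≠ 0}.Finite) : ∃ s, HasLaurentSum f s := by
  refine ⟨_, ⟨⟨f, ?_, hfin⟩, fun i => rfl, rfl⟩⟩
  apply Set.IsWF.isPWO
  apply BddBelow.isWF
  refine ⟨B, ?_⟩
  intro d hd
  obtain ⟨n, hn⟩ := Set.mem_iUnion.1 hd
  by_contra hlt
  exact hn (hB n d (by omega))

/-- A family converges when its members are bounded below by a proper function of the index. -/
theorem exists_hasLaurentSum (deg : ι → ℤ) (hB : ∀ i, LowerBound (deg i) (f i))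
    (hfin : ∀ d, {i | deg i ≤ d}.Finite) : ∃ s, HasLaurentSum f s := by
  obtain ⟨B, hB0⟩ := ((hfin 0).image deg).bddBelow
  refine exists_hasLaurentSum_of_finite (min B 0) (fun i => ?_) (fun d => ?_)
  · by_cases h : deg i ≤ 0
    · exact (hB i).mono (min_le_of_left_le (hB0 ⟨i, h, rfl⟩))
    · exact (hB i).mono (min_le_of_right_le (by omega))
  · refine (hfin d).subset fun i hi => ?_
    by_contra h
    exact hi (hB i d (not_le.1 h))

theorem HasLaurentSum.coeff_eq (h : HasLaurentSum f s) (d : ℤ) :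
    s.coeff d = ∑ᶠ i, (f i).coeff d := by
  obtain ⟨F, hF, rfl⟩ := h
  rw [HahnSeries.SummableFamily.coeff_hsum]
  simp only [hF]

theorem HasLaurentSum.finite (h : HasLaurentSum f s) (d : ℤ) :
    {i | (f i).coeff d ≠ 0}.Finite := by
  obtain ⟨F, hF, rfl⟩ := h
  have := F.finite_co_support d
  simp only [hF] at this
  exact this

theorem HasLaurentSum.exists_lowerBound (h : HasLaurentSum f s) :
    ∃ B, ∀ i, LowerBound B (f i) := by
  obtain ⟨F, hF, rfl⟩ := h
  by_cases hne : (⋃ i, (F i).support).Nonempty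
  · refine ⟨F.isPWO_iUnion_support.isWF.min hne, fun i d hd => ?_⟩
    by_contra hne'
    refine Set.IsWF.not_lt_min F.isPWO_iUnion_support.isWF hne (a := d) ?_ hd
    refine Set.mem_iUnion.2 ⟨i, ?_⟩
    rw [hF]
    exact hne'
  · refine ⟨0, fun i d _ => ?_⟩
    by_contra hne'
    refine hne ⟨d, Set.mem_iUnion.2 ⟨i, ?_⟩⟩
    rw [hF]
    exact hne'

theorem HasLaurentSum.unique (h : HasLaurentSum f s) (h' : HasLaurentSum f t) : s = t := by
  ext d
  rw [h.coeff_eq, h'.coeff_eq]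

theorem hasLaurentSum_of_coeff (B : ℤ) (hB : ∀ i, LowerBound B (f i))
    (hfin : ∀ d, {i | (f i).coeff d ≠ 0}.Finite)
    (hs : ∀ d, s.coeff d = ∑ᶠ i, (f i).coeff d) : HasLaurentSum f s := by
  obtain ⟨t, ht⟩ := exists_hasLaurentSum_of_finite B hB hfin
  have : s = t := by
    ext d
    rw [hs, ht.coeff_eq]
  rwa [this]

theorem HasLaurentSum.congr (h : HasLaurentSum f s) (hfg : ∀ i, f i = g i) :
    HasLaurentSum g s := by
  rwa [← funext hfg]

theorem HasLaurentSum.comp_equiv (h : HasLaurentSum f s) (e : κ ≃ ι) :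
    HasLaurentSum (fun k => f (e k)) s := by
  obtain ⟨F, hF, rfl⟩ := h
  refine ⟨HahnSeries.SummableFamily.Equiv e.symm F, fun k => hF (e k),
    HahnSeries.SummableFamily.hsum_equiv _ _⟩

theorem hasLaurentSum_comp_equiv_iff (e : κ ≃ ι) :
    HasLaurentSum (fun k => f (e k)) s ↔ HasLaurentSum f s :=
  ⟨fun h => (h.comp_equiv e.symm).congr fun i => by simp, fun h => h.comp_equiv e⟩

/-- Members that vanish may be dropped from a sum. -/
theorem hasLaurentSum_comp_injective_iff {e : κ → ι} (he : Function.Injective e)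
    (h0 : ∀ i, i ∉ Set.range e → f i = 0) :
    HasLaurentSum (fun k => f (e k)) s ↔ HasLaurentSum f s := by
  have hsub : ∀ d, Function.support (fun i => (f i).coeff d) ⊆ Set.range e := by
    intro d i hi
    by_contra hne
    exact hi (by simp [h0 i hne])
  constructor
  · intro h
    obtain ⟨B, hB⟩ := h.exists_lowerBound
    refine hasLaurentSum_of_coeff B (fun i => ?_) (fun d => ?_) (fun d => ?_)
    · by_cases hi : i ∈ Set.range e
      · obtain ⟨k, rfl⟩ := hi
        exact hB k
      · intro d _
        simp [h0 i hi]
    · refine ((h.finite d).image e).subset fun i hi => ?_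
      obtain ⟨k, rfl⟩ := hsub d hi
      exact ⟨k, hi, rfl⟩
    · rw [h.coeff_eq]
      exact (finsum_of_support_subset_range he (hsub d)).symm
  · intro h
    obtain ⟨B, hB⟩ := h.exists_lowerBound
    refine hasLaurentSum_of_coeff B (fun i => hB _) (fun d => ?_) (fun d => ?_)
    · exact Set.Finite.preimage he.injOn (h.finite d)
    · rw [h.coeff_eq]
      exact finsum_of_support_subset_range he (hsub d)

/-- Summation along the fibres of a map. -/
theorem HasLaurentSum.fiberwise (h : HasLaurentSum f s) (π : ι → κ) {t : κ → LaurentSeries ℤ}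
    (ht : ∀ k, HasLaurentSum (fun i : {i // π i = k} => f i) (t k)) : HasLaurentSum t s := by
  classical
  obtain ⟨B, hB⟩ := h.exists_lowerBound
  have key : ∀ d k, (t k).coeff d = ∑ᶠ i : {i // π i = k}, (f i).coeff d :=
    fun d k => (ht k).coeff_eq d
  refine hasLaurentSum_of_coeff B (fun k d hd => ?_) (fun d => ?_) (fun d => ?_)
  · rw [key]
    exact finsum_eq_zero_of_forall_eq_zero fun i => hB _ d hd
  · refine ((h.finite d).image π).subset fun k hk => ?_
    by_contra hne
    refine hk ?_
    rw [key]
    refine finsum_eq_zero_of_forall_eq_zero fun i => ?_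
    by_contra hi
    exact hne ⟨i, hi, i.2⟩
  · rw [h.coeff_eq]
    simp only [key]
    have hfin := h.finite d
    rw [finsum_eq_sum_of_support_subset (s := hfin.toFinset) _ (by
      intro i hi; simpa using hi)]
    have h2 : Function.support (fun k => ∑ᶠ i : {i // π i = k}, (f i).coeff d) ⊆
        (hfin.toFinset.image π : Finset κ) := by
      intro k hk
      by_contra hne
      refine hk (finsum_eq_zero_of_forall_eq_zero fun i => ?_)
      by_contra hi
      exact hne (by
        simp only [Finset.coe_image, Set.mem_image]
        exact ⟨i, by simpa using hi, i.2⟩)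
    rw [finsum_eq_sum_of_support_subset _ h2]
    rw [← Finset.sum_fiberwise_of_maps_to (g := π) (t := hfin.toFinset.image π)
      (fun i hi => Finset.mem_image_of_mem _ hi)]
    refine Finset.sum_congr rfl fun k _ => ?_
    symm
    calc ∑ᶠ i : {i // π i = k}, (f i).coeff d
        = ∑ᶠ (i : ι) (_ : π i = k), (f i).coeff d := by
          rw [← finsum_subtype_eq_finsum_cond]
      _ = _ := by
          refine finsum_mem_eq_sum_of_inter_support_eq (s := {i | π i = k}) _ ?_
          ext i
          simp +contextual [and_comm]

theorem hasLaurentSum_zero : HasLaurentSum (fun _ : ι => 0) 0 :=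
  ⟨0, fun _ => rfl, by simp⟩

theorem hasLaurentSum_unique [Unique ι] : HasLaurentSum f (f default) := by
  refine hasLaurentSum_of_coeff (f := f) (s := f default) ((f default).order) (fun i => ?_)
    (fun d => Set.toFinite _) (fun d => ?_)
  · rw [Subsingleton.elim i default]
    intro d hd
    exact HahnSeries.coeff_eq_zero_of_lt_order hd
  · rw [finsum_unique]

theorem hasLaurentSum_single (i : ι) (h0 : ∀ j, j ≠ i → f j = 0) : HasLaurentSum f (f i) := by
  have := hasLaurentSum_comp_injective_iff (f := f) (s := f i) (e := fun _ : Unit => i)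
    (fun _ _ _ => rfl) (fun j hj => h0 j fun h => hj ⟨(), h.symm⟩)
  exact this.1 hasLaurentSum_unique

theorem HasLaurentSum.const_mul (h : HasLaurentSum f s) (a : LaurentSeries ℤ) :
    HasLaurentSum (fun i => a * f i) (a * s) := by
  obtain ⟨F, hF, rfl⟩ := h
  refine ⟨a • F, fun i => ?_, HahnSeries.SummableFamily.hsum_smul⟩
  simp only [← hF]
  rw [HahnSeries.SummableFamily.smul_apply, HahnSeries.of_symm_smul_of_eq_mul]

theorem HasLaurentSum.mul {g : κ → LaurentSeries ℤ} (h : HasLaurentSum f s)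
    (h' : HasLaurentSum g t) : HasLaurentSum (fun p : ι × κ => f p.1 * g p.2) (s * t) := by
  obtain ⟨F, hF, rfl⟩ := h
  obtain ⟨G, hG, rfl⟩ := h'
  exact ⟨F.mul G, fun i => by simp only [← hF, ← hG]; rfl, HahnSeries.SummableFamily.hsum_mul _ _⟩

theorem HasLaurentSum.sub (h : HasLaurentSum f s) (h' : HasLaurentSum g t) :
    HasLaurentSum (fun i => f i - g i) (s - t) := by
  obtain ⟨F, hF, rfl⟩ := h
  obtain ⟨G, hG, rfl⟩ := h'
  exact ⟨F - G, fun i => by simp [hF, hG], by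
    rw [HahnSeries.SummableFamily.hsum_sub]⟩

theorem HasLaurentSum.lowerBound (h : HasLaurentSum f s) {B : ℤ} (hB : ∀ i, LowerBound B (f i)) :
    LowerBound B s := by
  intro d hd
  rw [h.coeff_eq]
  exact finsum_eq_zero_of_forall_eq_zero fun i => hB i d hd

end Sums

theorem hasLaurentSum_tetIndex (m e : ℤ) : HasLaurentSum (term m e) (tetIndex m e) :=
  ⟨family m e, fun _ => rfl, rfl⟩

end TetIndex

/-! ### Identities of the tetrahedron index -/

namespace TetIndex

/-- The monomial `z ^ k`, where `z = q^{1/2}`. -/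
noncomputable def zpow (k : ℤ) : LaurentSeries ℤ := HahnSeries.single k 1

theorem zpow_add (a b : ℤ) : zpow (a + b) = zpow a * zpow b := by
  simp [zpow]

@[simp] theorem zpow_zero : zpow 0 = 1 := rfl

theorem one_sub_zpow_ne_zero {k : ℤ} (hk : k ≠ 0) : 1 - zpow k ≠ 0 := by
  intro h
  have := congrArg (fun f => HahnSeries.coeff f 0) h
  simp [zpow, HahnSeries.coeff_single_of_ne hk.symm] at this

/-- The sign `(-1)^k` as a Laurent series. -/
noncomputable def sgn (k : ℤ) : LaurentSeries ℤ := (((Int.negOnePow k : ℤˣ) : ℤ) : LaurentSeries ℤ)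

theorem sgn_add (a b : ℤ) : sgn (a + b) = sgn a * sgn b := by
  simp [sgn, Int.negOnePow_add]

@[simp] theorem sgn_zero : sgn 0 = 1 := by simp [sgn]

@[simp] theorem sgn_one : sgn 1 = -1 := by simp [sgn]

theorem sgn_mul_self (a : ℤ) : sgn a * sgn a = 1 := by
  rw [← sgn_add, sgn, Int.negOnePow_even _ ⟨a, rfl⟩]
  simp

theorem single_eq (k r : ℤ) :
    (HahnSeries.single k r : LaurentSeries ℤ) = (r : LaurentSeries ℤ) * zpow k := by
  rw [zpow, ← HahnSeries.single_zero_intCast (Γ := ℤ) r, HahnSeries.single_mul_single]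
  simp

theorem negSqrtQPow_eq (k : ℤ) : negSqrtQPow k = sgn k * zpow k := by
  rw [negSqrtQPow, single_eq, sgn]

theorem negSqrtQPow_add (a b : ℤ) :
    negSqrtQPow (a + b) = negSqrtQPow a * negSqrtQPow b := by
  simp only [negSqrtQPow_eq, zpow_add, sgn_add]
  ring

@[simp] theorem negSqrtQPow_zero : negSqrtQPow 0 = 1 := by
  simp [negSqrtQPow_eq]

theorem lowerBound_negSqrtQPow (k : ℤ) : LowerBound k (negSqrtQPow k) := lowerBound_single _ _

theorem lowerBound_zpow (k : ℤ) : LowerBound k (zpow k) := lowerBound_single _ _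

theorem lowerBound_sgn (k : ℤ) : LowerBound 0 (sgn k) := by
  have := lowerBound_single 0 ((Int.negOnePow k : ℤˣ) : ℤ)
  rwa [single_eq, zpow_zero, mul_one] at this

/-- `1/(q)_N` for an integer `N`, which is `0` when `N < 0`. -/
noncomputable def invQ (N : ℤ) : LaurentSeries ℤ :=
  if 0 ≤ N then invQPochhammer N.toNat else 0

theorem invQ_of_neg {N : ℤ} (h : N < 0) : invQ N = 0 := if_neg (by omega)

theorem invQ_natCast (n : ℕ) : invQ n = invQPochhammer n := by
  simp [invQ]

theorem invQPochhammer_mul (n : ℕ) :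
    invQPochhammer n * HahnSeries.ofPowerSeries ℤ ℤ
      (∏ i ∈ Finset.Icc 1 n, (1 - (PowerSeries.X : PowerSeries ℤ) ^ (2 * i))) = 1 := by
  rw [invQPochhammer, ← map_mul, PowerSeries.invOfUnit_mul, map_one]
  rw [map_prod]
  simp only [Units.val_one]
  refine Finset.prod_eq_one fun i hi => ?_
  have := (Finset.mem_Icc.1 hi).1
  rw [map_sub, map_pow, PowerSeries.constantCoeff_X, zero_pow (by omega)]
  simp

@[simp] theorem invQ_zero : invQ 0 = 1 := by
  have := invQPochhammer_mul 0
  simpa [invQ] using this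

theorem invQ_sub_one (N : ℤ) : invQ (N - 1) = (1 - zpow (2 * N)) * invQ N := by
  rcases lt_trichotomy N 0 with h | h | h
  · rw [invQ_of_neg h, invQ_of_neg (by omega), mul_zero]
  · subst h
    rw [invQ_of_neg (by omega)]
    simp
  · obtain ⟨n, rfl⟩ : ∃ n : ℕ, N = (n : ℤ) + 1 := ⟨(N - 1).toNat, by omega⟩
    have h1 := invQPochhammer_mul n
    have h2 := invQPochhammer_mul (n + 1)
    rw [Finset.prod_Icc_succ_top (by omega), map_mul] at h2
    have h3 : HahnSeries.ofPowerSeries ℤ ℤ (1 - (PowerSeries.X : PowerSeries ℤ) ^ (2 * (n + 1))) =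
        1 - zpow (2 * ((n : ℤ) + 1)) := by
      rw [map_sub, map_one, HahnSeries.ofPowerSeries_X_pow, zpow]
      push_cast
      rfl
    rw [h3] at h2
    rw [add_sub_cancel_right, invQ_natCast, show ((n : ℤ) + 1) = ((n + 1 : ℕ) : ℤ) by simp,
      invQ_natCast]
    push_cast
    linear_combination ((1 - zpow (2 * ((n : ℤ) + 1))) * invQPochhammer (n + 1)) * h1
      - invQPochhammer n * h2

theorem lowerBound_invQ (N : ℤ) : LowerBound 0 (invQ N) := by
  unfold invQ
  split_ifs
  · exact lowerBound_ofPowerSeries _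
  · intro d _
    rfl

/-- The terms of the tetrahedron index, indexed by all integers. -/
noncomputable def termZ (m e n : ℤ) : LaurentSeries ℤ :=
  sgn n * zpow (n * (n + 1) - (2 * n + e) * m) * (invQ n * invQ (n + e))

theorem hasLaurentSum_termZ (m e : ℤ) : HasLaurentSum (termZ m e) (tetIndex m e) := by
  refine (hasLaurentSum_comp_injective_iff (e := fun n : ℕ => (n : ℤ))
    (fun a b h => by simpa using h) ?_).1 ((hasLaurentSum_tetIndex m e).congr fun n => ?_)
  · intro i hi
    have : i < 0 := by
      by_contra h
      exact hi ⟨i.toNat, by simp; omega⟩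
    rw [termZ, invQ_of_neg this]
    simp
  · unfold term termZ
    rw [invQ_natCast, single_eq]
    split_ifs with h
    · have : sgn (n : ℤ) = (((-1 : ℤ) ^ n : ℤ) : LaurentSeries ℤ) := by
        simp [sgn, Int.negOnePow_def]
      rw [this, show invQ ((n : ℤ) + e) = invQPochhammer ((n : ℤ) + e).toNat from if_pos h]
    · rw [invQ_of_neg (N := (n : ℤ) + e) (by omega)]
      simp

/-- The symmetry of the tetrahedron index that comes from the exchange of `n` and `n + e`. -/
theorem tetIndex_add_neg (m e : ℤ) :
    tetIndex (m + e) (-e) = negSqrtQPow e * tetIndex m e := by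
  refine ((hasLaurentSum_termZ (m + e) (-e)).comp_equiv (Equiv.addRight e)).unique
    (((hasLaurentSum_termZ m e).const_mul (negSqrtQPow e)).congr fun n => ?_)
  simp only [termZ, Equiv.coe_addRight, negSqrtQPow_eq]
  rw [show n + e + -e = n by ring, show (n + e) * (n + e + 1) - (2 * (n + e) + -e) * (m + e) =
    e + (n * (n + 1) - (2 * n + e) * m) by ring, zpow_add, sgn_add]
  ring

/-- The terms of Euler's expansion of `∏_{i > N} (1 - q^i)`. -/
noncomputable def eulerTerm (N : ℤ) (k : ℕ) : LaurentSeries ℤ :=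
  sgn k * zpow (k * (k + 1) + 2 * k * N) * invQ k

theorem lowerBound_eulerTerm (N : ℤ) (k : ℕ) :
    LowerBound (k * (k + 1) + 2 * k * N) (eulerTerm N k) := by
  have := ((lowerBound_sgn k).mul (lowerBound_zpow (k * (k + 1) + 2 * k * N))).mul
    (lowerBound_invQ k)
  simpa [eulerTerm] using this

theorem exists_hasLaurentSum_eulerTerm (N : ℤ) : ∃ s, HasLaurentSum (eulerTerm N) s := by
  refine exists_hasLaurentSum _ (lowerBound_eulerTerm N) fun d => ?_
  refine (Set.finite_Iic (d + N * N).toNat).subset fun k hk => ?_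
  simp only [Set.mem_ofPred_eq, Set.mem_Iic] at hk ⊢
  have : (k : ℤ) ≤ d + N * N := by nlinarith [sq_nonneg ((k : ℤ) + N)]
  omega

/-- Euler's series for `∏_{i > N} (1 - q^i)`. -/
noncomputable def euler (N : ℤ) : LaurentSeries ℤ := (exists_hasLaurentSum_eulerTerm N).choose

theorem hasLaurentSum_euler (N : ℤ) : HasLaurentSum (eulerTerm N) (euler N) :=
  (exists_hasLaurentSum_eulerTerm N).choose_spec

/-- The recursion that characterises Euler's product. -/
theorem euler_sub_one (N : ℤ) : euler (N - 1) = (1 - zpow (2 * N)) * euler N := by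
  have h1 := (hasLaurentSum_euler (N - 1)).sub (hasLaurentSum_euler N)
  have h2 : HasLaurentSum (fun k : ℕ => eulerTerm (N - 1) (k + 1) - eulerTerm N (k + 1))
      (euler (N - 1) - euler N) := by
    refine (hasLaurentSum_comp_injective_iff (e := Nat.succ) Nat.succ_injective ?_).2 h1
    intro i hi
    have : i = 0 := by
      by_contra h
      exact hi ⟨i - 1, by simp; omega⟩
    subst this
    simp [eulerTerm]
  have h3 := h2.unique (((hasLaurentSum_euler N).const_mul (-zpow (2 * N))).congr fun k => ?_)
  · linear_combination h3
  · have h4 := invQ_sub_one ((k : ℤ) + 1)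
    rw [add_sub_cancel_right] at h4
    simp only [eulerTerm]
    push_cast
    rw [h4, sgn_add, sgn_one,
      show ((k : ℤ) + 1) * (k + 1 + 1) + 2 * (k + 1) * (N - 1) =
        2 * N + (k * (k + 1) + 2 * k * N) by ring,
      show ((k : ℤ) + 1) * (k + 1 + 1) + 2 * (k + 1) * N =
        2 * N + (k * (k + 1) + 2 * k * N) + 2 * (k + 1) by ring,
      zpow_add (2 * N + (k * (k + 1) + 2 * k * N)), zpow_add (2 * N)]
    ring

theorem euler_zero_ne_zero : euler 0 ≠ 0 := by
  intro h
  have h1 := (hasLaurentSum_euler 0).coeff_eq 0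
  rw [h, finsum_eq_single _ 0] at h1
  · simp [eulerTerm] at h1
  · intro k hk
    refine lowerBound_eulerTerm 0 k 0 ?_
    have : (0 : ℤ) < k := by omega
    positivity

/-- Euler's identity `(q)_∞ / (q)_N = ∏_{i > N} (1 - q^i)`. -/
theorem euler_zero_mul_invQ (N : ℤ) : euler 0 * invQ N = euler N := by
  have hneg : ∀ n : ℕ, euler (-1 - n) = 0 := by
    intro n
    induction n with
    | zero =>
      have := euler_sub_one 0
      simpa using this
    | succ n ih =>
      have := euler_sub_one (-1 - n)
      rw [ih, mul_zero] at this
      rw [← this]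
      congr 1
      push_cast
      ring
  have hpos : ∀ n : ℕ, euler 0 * invQ n = euler n := by
    intro n
    induction n with
    | zero => simp
    | succ n ih =>
      have h1 := euler_sub_one (n + 1)
      have h2 := invQ_sub_one (n + 1)
      rw [add_sub_cancel_right] at h1 h2
      refine mul_left_cancel₀ (one_sub_zpow_ne_zero (k := 2 * ((n : ℤ) + 1)) (by omega)) ?_
      push_cast
      rw [← h1, ← ih, h2]
      ring
  by_cases h : 0 ≤ N
  · obtain ⟨n, rfl⟩ := Int.eq_ofNat_of_zero_le h
    exact hpos n
  · rw [invQ_of_neg (by omega), mul_zero, ← hneg (-1 - N).toNat]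
    congr 1
    omega

/-- The terms of the double series for `(q)_∞ I_Δ(m,e)`. -/
noncomputable def doubleTerm (m e : ℤ) (p : ℕ × ℕ) : LaurentSeries ℤ :=
  sgn p.1 * sgn p.2 * zpow (p.1 * (p.1 + 1) + p.2 * (p.2 + 1) + 2 * p.1 * p.2
    - 2 * p.1 * m + 2 * p.2 * e - e * m) * (invQ p.1 * invQ p.2)

/-- The double series, which is symmetric under `(m, e) ↦ (-e, -m)`. -/
theorem hasLaurentSum_doubleTerm (m e : ℤ) :
    HasLaurentSum (doubleTerm m e) (euler 0 * tetIndex m e) := by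
  obtain ⟨s, hs⟩ := exists_hasLaurentSum (f := doubleTerm m e)
    (fun p => p.1 * (p.1 + 1) + p.2 * (p.2 + 1) + 2 * p.1 * p.2
      - 2 * p.1 * m + 2 * p.2 * e - e * m)
    (fun p => by
      have := (((lowerBound_sgn p.1).mul (lowerBound_sgn p.2)).mul (lowerBound_zpow
        (p.1 * (p.1 + 1) + p.2 * (p.2 + 1) + 2 * p.1 * p.2
          - 2 * p.1 * m + 2 * p.2 * e - e * m))).mul
        ((lowerBound_invQ p.1).mul (lowerBound_invQ p.2))
      simpa [doubleTerm] using this)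
    (fun d => by
      set C := |m| + |e| with hC
      refine ((Set.finite_Iic (d + C * C + e * m).toNat).prod
        (Set.finite_Iic (d + C * C + e * m).toNat)).subset fun p hp => ?_
      obtain ⟨a, b⟩ := p
      simp only [Set.mem_ofPred_eq, Set.mem_prod, Set.mem_Iic] at hp ⊢
      have h1 := le_abs_self m
      have h2 := neg_abs_le e
      have h3 := abs_nonneg m
      have h4 := abs_nonneg e
      have ha : (0 : ℤ) ≤ a := by positivity
      have hb : (0 : ℤ) ≤ b := by positivity
      have h5 : (a : ℤ) * m ≤ a * C := by nlinarith
      have h6 : -(b * C) ≤ (b : ℤ) * e := by nlinarith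
      have : (a : ℤ) + b ≤ d + C * C + e * m := by nlinarith [sq_nonneg ((a : ℤ) + b - C)]
      omega)
  -- summing over the second index first gives Euler's series, that is `(q)_∞ / (q)_{n+e}`
  have h := hs.fiberwise Prod.fst (t := fun n => euler 0 * termZ m e n) fun n => by
    have h1 := (hasLaurentSum_euler (n + e)).const_mul
      (sgn n * zpow (n * (n + 1) - (2 * n + e) * m) * invQ n)
    rw [← euler_zero_mul_invQ] at h1
    have h2 := h1.comp_equiv (⟨fun i => i.1.2, fun k => ⟨(n, k), rfl⟩, by
      rintro ⟨⟨a, b⟩, rfl⟩; rfl, fun k => rfl⟩ : {i : ℕ × ℕ // i.1 = n} ≃ ℕ)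
    convert h2 using 1
    · funext i
      obtain ⟨⟨a, b⟩, rfl⟩ := i
      simp only [doubleTerm, eulerTerm, Equiv.coe_fn_mk]
      rw [show (a : ℤ) * (a + 1) + b * (b + 1) + 2 * a * b - 2 * a * m + 2 * b * e - e * m =
        (a * (a + 1) - (2 * a + e) * m) + (b * (b + 1) + 2 * b * (a + e)) by ring, zpow_add]
      ring
    · simp only [termZ]
      ring
  have h' := (hasLaurentSum_termZ m e).const_mul (euler 0)
  have h'' := (hasLaurentSum_comp_injective_iff (e := fun n : ℕ => (n : ℤ))
    (fun a b h => by simpa using h) (fun i hi => by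
      have : i < 0 := by
        by_contra h
        exact hi ⟨i.toNat, by simp; omega⟩
      rw [termZ, invQ_of_neg this]
      simp)).2 h'
  rwa [h.unique h''] at hs

/-- The duality of the tetrahedron index. -/
theorem tetIndex_dual (m e : ℤ) : tetIndex (-e) (-m) = tetIndex m e := by
  refine mul_left_cancel₀ euler_zero_ne_zero ?_
  refine ((hasLaurentSum_doubleTerm (-e) (-m)).comp_equiv (Equiv.prodComm ℕ ℕ)).unique
    ((hasLaurentSum_doubleTerm m e).congr ?_)
  rintro ⟨a, b⟩
  simp only [doubleTerm, Equiv.prodComm_apply, Prod.swap]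
  rw [show (a : ℤ) * (a + 1) + b * (b + 1) + 2 * a * b - 2 * a * m + 2 * b * e - e * m =
    b * (b + 1) + a * (a + 1) + 2 * b * a - 2 * b * -e + 2 * a * -m - -m * -e by ring]
  ring

theorem lowerBound_tetIndex {m : ℤ} (hm : m ≤ 0) (e : ℤ) :
    LowerBound (-(e * m)) (tetIndex m e) := by
  refine (hasLaurentSum_termZ m e).lowerBound fun n => ?_
  by_cases hn : 0 ≤ n
  · have := ((lowerBound_sgn n).mul (lowerBound_zpow (n * (n + 1) - (2 * n + e) * m))).mul
      ((lowerBound_invQ n).mul (lowerBound_invQ (n + e)))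
    refine this.mono ?_
    nlinarith [mul_nonneg hn hn, mul_nonneg hn (neg_nonneg.2 hm)]
  · intro d _
    rw [termZ, invQ_of_neg (by omega)]
    simp

/-! ### The symmetric form of the tetrahedron index -/

/-- The tetrahedron index in the variables attached to the three quad types, in which it is
symmetric. -/
noncomputable def symIndex (a b c : ℤ) : LaurentSeries ℤ :=
  negSqrtQPow (-b) * tetIndex (b - c) (a - b)

theorem symIndex_swap₁₂ (a b c : ℤ) : symIndex b a c = symIndex a b c := by
  have := tetIndex_add_neg (b - c) (a - b)
  rw [show b - c + (a - b) = a - c by ring, show -(a - b) = b - a by ring] at this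
  rw [symIndex, symIndex, this, ← mul_assoc, ← negSqrtQPow_add]
  congr 2
  ring

theorem symIndex_swap₁₃ (a b c : ℤ) : symIndex c b a = symIndex a b c := by
  have := tetIndex_dual (b - c) (a - b)
  rw [neg_sub, neg_sub] at this
  rw [symIndex, symIndex, this]

theorem symIndex_swap₂₃ (a b c : ℤ) : symIndex a c b = symIndex a b c := by
  rw [← symIndex_swap₁₂ a c b, ← symIndex_swap₁₃ c a b, symIndex_swap₁₂]

theorem symIndex_add (a b c s : ℤ) :
    symIndex (a + s) (b + s) (c + s) = negSqrtQPow (-s) * symIndex a b c := by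
  rw [symIndex, symIndex, ← mul_assoc, ← negSqrtQPow_add]
  congr 2 <;> [ring; ring; ring]

/-- The degree of the tetrahedron index is at least
`(a - s)(b - s) + (b - s)(c - s) + (c - s)(a - s) - s`, where `s` is the minimum of `a, b, c`. -/
theorem lowerBound_symIndex {a b c s : ℤ} (ha : s ≤ a) (hb : s ≤ b) (hc : s ≤ c)
    (h : a = s ∨ b = s ∨ c = s) :
    LowerBound ((a - s) * (b - s) + (b - s) * (c - s) + (c - s) * (a - s) - s)
      (symIndex a b c) := by
  have key : ∀ {a b c : ℤ}, b ≤ c → LowerBound ((a - b) * (c - b) - b)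
      (symIndex a b c) := by
    intro a b c hc
    refine ((lowerBound_negSqrtQPow (-b)).mul (lowerBound_tetIndex (m := b - c)
      (by omega) (a - b))).mono (le_of_eq ?_)
    ring
  rcases h with rfl | rfl | rfl
  · rw [← symIndex_swap₁₂]
    exact (key hc).mono (le_of_eq (by ring))
  · exact (key hc).mono (le_of_eq (by ring))
  · rw [← symIndex_swap₂₃]
    exact (key hb).mono (le_of_eq (by ring))

/-! ### The quadratic identity -/

/-- The terms of the alternating sum of `q`-binomial coefficients, divided by `(q)_N`. -/
noncomputable def binomTerm (N n : ℤ) : LaurentSeries ℤ :=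
  sgn n * zpow (n * (n - 1)) * (invQ n * invQ (N - n))

theorem exists_hasLaurentSum_binomTerm (N : ℤ) : ∃ s, HasLaurentSum (binomTerm N) s := by
  have h0 : ∀ n, n ∉ Set.Icc 0 N → binomTerm N n = 0 := by
    intro n hn
    rw [binomTerm]
    by_cases h : 0 ≤ n
    · rw [invQ_of_neg (N := N - n) (by
        by_contra h'
        exact hn ⟨h, by omega⟩)]
      simp
    · rw [invQ_of_neg (by omega)]
      simp
  refine exists_hasLaurentSum_of_finite 0 (fun n => ?_) fun d => ?_
  · have := ((lowerBound_sgn n).mul (lowerBound_zpow (n * (n - 1)))).mul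
      ((lowerBound_invQ n).mul (lowerBound_invQ (N - n)))
    refine this.mono ?_
    rcases le_or_gt n 0 with h | h <;> nlinarith
  · refine (Set.finite_Icc 0 N).subset fun n hn => ?_
    by_contra h
    exact hn (by rw [h0 n h]; rfl)

/-- The alternating sum of `q`-binomial coefficients vanishes unless `N = 0`. -/
theorem hasLaurentSum_binomTerm (N : ℤ) :
    HasLaurentSum (binomTerm N) (if N = 0 then 1 else 0) := by
  choose s hs using exists_hasLaurentSum_binomTerm
  -- a first-order recursion in `N`, from the recursions of `1/(q)_n` and `1/(q)_{N-n}`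
  have hrec : ∀ N, (1 - zpow (2 * N)) * s N = (1 - zpow (2 * (N - 1))) * s (N - 1) := by
    intro N
    have h1 := (hs N).const_mul (1 - zpow (2 * N))
    have h2 := (hs (N - 1)).sub (((hs (N - 1)).comp_equiv (Equiv.subRight 1)).const_mul
      (zpow (2 * (N - 1))))
    have h3 := h1.unique (h2.congr fun n => ?_)
    · rw [h3]; ring
    · have h4 := invQ_sub_one (N - n)
      have h5 := invQ_sub_one n
      have h6 : sgn n = - sgn (n - 1) := by
        conv_lhs => rw [show n = (n - 1) + 1 by ring, sgn_add, sgn_one]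
        ring
      simp only [binomTerm, Equiv.subRight_apply]
      rw [show N - 1 - n = N - n - 1 by ring, show N - 1 - (n - 1) = N - n by ring, h4, h5, h6,
        show n * (n - 1) = (n - 1) * (n - 1 - 1) + 2 * (n - 1) by ring,
        show 2 * N = 2 * (N - n) + 2 * (n - 1) + 2 by ring,
        show 2 * (N - 1) = 2 * (N - n) + 2 * (n - 1) by ring,
        show 2 * n = 2 * (n - 1) + 2 by ring]
      simp only [zpow_add]
      ring
  -- the initial values; the factor `1 - q^{N-1}` at `N = 1` then makes `s 1` vanish
  have hneg : ∀ N < 0, s N = 0 := by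
    intro N hN
    refine (hs N).unique (hasLaurentSum_zero.congr fun n => ?_)
    rw [binomTerm]
    by_cases h : 0 ≤ n
    · rw [invQ_of_neg (N := N - n) (by omega)]
      simp
    · rw [invQ_of_neg (by omega)]
      simp
  have hzero : s 0 = 1 := by
    refine (hs 0).unique ?_
    have := hasLaurentSum_single (f := binomTerm 0) 0 fun n hn => by
      rw [binomTerm]
      by_cases h : 0 ≤ n
      · rw [invQ_of_neg (N := 0 - n) (by omega)]
        simp
      · rw [invQ_of_neg (by omega)]
        simp
    simpa [binomTerm] using this
  have hpos : ∀ n : ℕ, s (n + 1) = 0 := by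
    intro n
    refine mul_left_cancel₀ (one_sub_zpow_ne_zero (k := 2 * ((n : ℤ) + 1)) (by omega)) ?_
    rw [hrec, add_sub_cancel_right, mul_zero]
    induction n with
    | zero => simp
    | succ n ih =>
      push_cast
      rw [hrec, add_sub_cancel_right, ih]
  have : s N = if N = 0 then 1 else 0 := by
    split_ifs with h
    · rw [h, hzero]
    · rcases lt_or_ge N 0 with h' | h'
      · exact hneg N h'
      · rw [← hpos (N - 1).toNat]
        congr 1
        omega
  rw [← this]
  exact hs N

/-- The first factor of a term of the tetrahedron index. -/
noncomputable def alpha (m n : ℤ) : LaurentSeries ℤ := sgn n * zpow (n * (n + 1) - n * m) * invQ n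

/-- The second factor of a term of the tetrahedron index. -/
noncomputable def beta (m k : ℤ) : LaurentSeries ℤ := zpow (-(k * m)) * invQ k

theorem hasLaurentSum_alpha_mul_beta (m e : ℤ) :
    HasLaurentSum (fun n => alpha m n * beta m (n + e)) (tetIndex m e) := by
  refine (hasLaurentSum_termZ m e).congr fun n => ?_
  rw [termZ, alpha, beta, show n * (n + 1) - (2 * n + e) * m =
    n * (n + 1) - n * m + -((n + e) * m) by ring, zpow_add]
  ring

theorem alpha_of_neg {m n : ℤ} (h : n < 0) : alpha m n = 0 := by
  rw [alpha, invQ_of_neg h, mul_zero]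

theorem beta_of_neg {m n : ℤ} (h : n < 0) : beta m n = 0 := by
  rw [beta, invQ_of_neg h, mul_zero]

theorem lowerBound_alpha {m : ℤ} (hm : m ≤ 0) (n : ℤ) :
    LowerBound (n * (n + 1)) (alpha m n) := by
  rcases lt_or_ge n 0 with h | h
  · rw [alpha_of_neg h]
    intro d _
    rfl
  · have := ((lowerBound_sgn n).mul (lowerBound_zpow (n * (n + 1) - n * m))).mul
      (lowerBound_invQ n)
    exact this.mono (by nlinarith)

theorem lowerBound_beta {m : ℤ} (hm : m ≤ 0) (n : ℤ) : LowerBound 0 (beta m n) := by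
  rcases lt_or_ge n 0 with h | h
  · rw [beta_of_neg h]
    intro d _
    rfl
  · have := (lowerBound_zpow (-(n * m))).mul (lowerBound_invQ n)
    exact this.mono (by nlinarith)

/-- The quadratic identity, in the region in which the fourfold series converges: the
factors `alpha` and `beta` of the two tetrahedron indices are regrouped so that the finite
`q`-binomial sums appear. -/
theorem hasLaurentSum_tetIndex_mul_tetIndex {m : ℤ} (hm : m ≤ 0) (d : ℤ) :
    HasLaurentSum (fun e => zpow (2 * e) * (tetIndex m e * tetIndex m (e + d)))
      (if d = 0 then 1 else 0) := by
  -- the index is `(n, n', k)` with `e = k - n`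
  set G : ℤ × ℤ × ℤ → LaurentSeries ℤ := fun p =>
    zpow (2 * (p.2.2 - p.1)) * ((alpha m p.1 * beta m p.2.2) *
      (alpha m p.2.1 * beta m (p.2.1 + (p.2.2 - p.1 + d)))) with hG
  have hLB : ∀ p, LowerBound (2 * (p.2.2 - p.1) + (p.1 * (p.1 + 1) + p.2.1 * (p.2.1 + 1)))
      (G p) := by
    intro p
    refine ((lowerBound_zpow _).mul (((lowerBound_alpha hm _).mul (lowerBound_beta hm _)).mul
      ((lowerBound_alpha hm _).mul (lowerBound_beta hm _)))).mono (le_of_eq ?_)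
    ring
  -- the terms with a negative index vanish, and on natural numbers the degree is proper
  have hex : ∃ s, HasLaurentSum G s := by
    set e : ℕ × ℕ × ℕ → ℤ × ℤ × ℤ := fun p => (p.1, p.2.1, p.2.2)
    have he : Function.Injective e := by
      rintro ⟨a, b, c⟩ ⟨a', b', c'⟩ h
      simpa [e] using h
    obtain ⟨s, hs⟩ := exists_hasLaurentSum (f := fun p => G (e p)) _ (fun p => hLB (e p))
      fun D => by
        refine ((Set.finite_Iic (D + 1).toNat).prod
          ((Set.finite_Iic (D + 1).toNat).prod (Set.finite_Iic (D + 1).toNat))).subset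
            fun p hp => ?_
        obtain ⟨a, b, c⟩ := p
        simp only [Set.mem_ofPred_eq, Set.mem_prod, Set.mem_Iic, e] at hp ⊢
        have ha : (0 : ℤ) ≤ a := by positivity
        have hb : (0 : ℤ) ≤ b := by positivity
        have h1 : (a : ℤ) ≤ D + 1 := by nlinarith [sq_nonneg ((a : ℤ) - 1)]
        have h2 : (b : ℤ) ≤ D + 1 := by
          nlinarith [sq_nonneg ((a : ℤ) - 1), Int.le_self_sq (a : ℤ)]
        have h3 : (c : ℤ) ≤ D + 1 := by
          nlinarith [sq_nonneg ((a : ℤ) - 1), Int.le_self_sq (a : ℤ)]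
        omega
    refine ⟨s, (hasLaurentSum_comp_injective_iff he fun p hp => ?_).1 hs⟩
    obtain ⟨a, b, c⟩ := p
    simp only [hG]
    rcases lt_or_ge a 0 with h | h
    · rw [alpha_of_neg h]; simp
    rcases lt_or_ge b 0 with h' | h'
    · rw [alpha_of_neg h']; simp
    rcases lt_or_ge c 0 with h'' | h''
    · rw [beta_of_neg h'']; simp
    exact absurd ⟨(a.toNat, b.toNat, c.toNat), by simp [e]; omega⟩ hp
  obtain ⟨s, hs⟩ := hex
  -- for fixed `e = k - n` the sum is the product of two tetrahedron indices
  have h1 := hs.fiberwise (fun p => p.2.2 - p.1)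
    (t := fun e => zpow (2 * e) * (tetIndex m e * tetIndex m (e + d))) fun e => by
      have := (((hasLaurentSum_alpha_mul_beta m e).mul
        (hasLaurentSum_alpha_mul_beta m (e + d))).const_mul (zpow (2 * e))).comp_equiv
        (⟨fun i => (i.1.1, i.1.2.1), fun p => ⟨(p.1, p.2, p.1 + e), by simp⟩, by
          rintro ⟨⟨a, b, c⟩, rfl⟩; simp, fun k => rfl⟩ :
            {p : ℤ × ℤ × ℤ // p.2.2 - p.1 = e} ≃ ℤ × ℤ)
      refine this.congr ?_
      rintro ⟨⟨a, b, c⟩, rfl⟩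
      simp [hG]
  -- for fixed `N = n' + k` it is a product of two alternating binomial sums
  have h2 := hs.fiberwise (fun p => p.2.1 + p.2.2)
    (t := fun N => zpow (-((N + d) * m) - N * m + 2 * N) *
      ((if N + d = 0 then 1 else 0) * (if N = 0 then 1 else 0))) fun N => by
      have := (((hasLaurentSum_binomTerm (N + d)).mul (hasLaurentSum_binomTerm N)).const_mul
        (zpow (-((N + d) * m) - N * m + 2 * N))).comp_equiv
        (⟨fun i => (i.1.1, i.1.2.1), fun p => ⟨(p.1, p.2, N - p.2), by simp⟩, by
          rintro ⟨⟨a, b, c⟩, rfl⟩; simp, fun k => rfl⟩ :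
            {p : ℤ × ℤ × ℤ // p.2.1 + p.2.2 = N} ≃ ℤ × ℤ)
      refine this.congr ?_
      rintro ⟨⟨a, b, c⟩, rfl⟩
      simp only [hG, binomTerm, alpha, beta, Equiv.coe_fn_mk]
      rw [show b + c + d - a = b + (c - a + d) by ring, show b + c - b = c by ring,
        show (b + c + d) * m = (b + (c - a + d)) * m + a * m by ring]
      have e1 : zpow (-((b + (c - a + d)) * m + a * m) - (b + c) * m + 2 * (b + c)) *
          (zpow (a * (a - 1)) * zpow (b * (b - 1))) =
          zpow (2 * (c - a)) * (zpow (a * (a + 1) - a * m) * zpow (-(c * m))) *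
            (zpow (b * (b + 1) - b * m) * zpow (-((b + (c - a + d)) * m))) := by
        simp only [← zpow_add]
        congr 1
        ring
      linear_combination (sgn a * (invQ a * invQ (b + (c - a + d))) *
        (sgn b * (invQ b * invQ c))) * e1
  have h3 : s = if d = 0 then 1 else 0 := by
    refine h2.unique ?_
    have := hasLaurentSum_single (f := fun N => zpow (-((N + d) * m) - N * m + 2 * N) *
      ((if N + d = 0 then (1 : LaurentSeries ℤ) else 0) * (if N = 0 then 1 else 0))) 0
      fun N hN => by simp [hN]
    convert this using 1
    by_cases hd : d = 0 <;> simp [hd]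
  rwa [h3] at h1

/-- The quadratic identity for the symmetric tetrahedron index. -/
theorem hasLaurentSum_symIndex_mul_symIndex (d b c : ℤ) :
    HasLaurentSum (fun a => negSqrtQPow (2 * a) * (symIndex a b c * symIndex (a + d) b c))
      (if d = 0 then 1 else 0) := by
  wlog hbc : b ≤ c generalizing b c
  · refine (this c b (by omega)).congr fun a => ?_
    rw [symIndex_swap₂₃ a, symIndex_swap₂₃ (a + d)]
  have h := (hasLaurentSum_tetIndex_mul_tetIndex (m := b - c) (by omega) d).comp_equiv
    (Equiv.subRight b)
  refine h.congr fun a => ?_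
  have h1 : negSqrtQPow (2 * a) * (negSqrtQPow (-b) * negSqrtQPow (-b)) = zpow (2 * (a - b)) := by
    rw [← negSqrtQPow_add, ← negSqrtQPow_add, negSqrtQPow_eq,
      show 2 * a + (-b + -b) = (a - b) + (a - b) by ring, sgn_add, sgn_mul_self, one_mul]
    congr 1
    ring
  simp only [symIndex, Equiv.subRight_apply]
  rw [← h1, show a - b + d = a + d - b by ring]
  ring

end TetIndex

/-! ### Two lattices in an acyclic complex -/

section Torsion

set_option linter.unusedSectionVars false

open Matrix PowerSeries

variable {k : Type*} [Field k] {V E F : Type*} [Fintype V] [Fintype E] [Fintype F]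
  [DecidableEq V] [DecidableEq E] [DecidableEq F]

theorem exists_right_inverse_of_vecMul_injective (M : Matrix F E k)
    (h : ∀ g : F → k, g ᵥ* M = 0 → g = 0) : ∃ S : Matrix E F k, M * S = 1 := by
  have h1 : LinearIndependent k M.row := by
    rw [← Matrix.vecMul_injective_iff]
    exact (injective_iff_map_eq_zero (Matrix.vecMulLinear M)).2 h
  have h2 : Function.Surjective M.mulVec := by
    have h3 := h1.rank_matrix
    rw [Matrix.rank] at h3
    have h4 : LinearMap.range M.mulVecLin = ⊤ := by
      apply Submodule.eq_top_of_finrank_eq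
      rw [h3, Module.finrank_fintype_fun_eq_card]
    exact LinearMap.range_eq_top.1 h4
  exact Matrix.mulVec_surjective_iff_exists_right_inverse.1 h2

/-- The determinant of the matrix `(A | S)`. -/
noncomputable def joinDet {R : Type*} [CommRing R] (η : V ⊕ F ≃ E) (A : Matrix E V R)
    (S : Matrix E F R) : R := ((fromCols A S).submatrix η id).det

theorem joinDet_mul {R : Type*} [CommRing R] (η : V ⊕ F ≃ E) (A : Matrix E V R)
    (S : Matrix E F R) (Z : Matrix V V R) (X : Matrix V F R) (Y : Matrix F F R) :
    joinDet η (A * Z) (A * X + S * Y) = joinDet η A S * (Z.det * Y.det) := by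
  have : (fromCols (A * Z) (A * X + S * Y)).submatrix η id =
      (fromCols A S).submatrix η id * fromBlocks Z X 0 Y := by
    rw [← Matrix.submatrix_id_id (fromBlocks Z X 0 Y),
      ← Matrix.submatrix_mul _ _ _ _ _ Function.bijective_id,
      Matrix.fromCols_mul_fromBlocks]
    simp
  rw [joinDet, this, det_mul, det_fromBlocks_zero₂₁, joinDet]

theorem mul_joinDet {R : Type*} [CommRing R] (η : V ⊕ F ≃ E) (A : Matrix E V R)
    (S : Matrix E F R) (Z : Matrix E E R) :
    joinDet η (Z * A) (Z * S) = Z.det * joinDet η A S := by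
  have : (fromCols (Z * A) (Z * S)).submatrix η id =
      Z.submatrix η η * (fromCols A S).submatrix η id := by
    rw [← Matrix.mul_fromCols, ← Matrix.submatrix_mul _ _ _ _ _ η.bijective]
  rw [joinDet, this, det_mul, det_submatrix_equiv_self, joinDet]

/-- An approximate splitting of an acyclic complex, which makes both of its determinants units. -/
theorem exists_section (η : V ⊕ F ≃ E) (A₀ : Matrix E V k⟦X⟧) (A₁ : Matrix F E k⟦X⟧)
    (hA : A₁ * A₀ = 0)
    (hinj : ∀ h : V → k, A₀.map (constantCoeff (R := k)) *ᵥ h = 0 → h = 0)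
    (hsurj : ∀ g : F → k, g ᵥ* A₁.map (constantCoeff (R := k)) = 0 → g = 0) :
    ∃ S : Matrix E F k⟦X⟧, constantCoeff (joinDet η A₀ S) ≠ 0 ∧
      constantCoeff (A₁ * S).det = 1 := by
  -- a right inverse of `A₁` modulo `X`, lifted to constant power series
  obtain ⟨S, hS⟩ := exists_right_inverse_of_vecMul_injective _ hsurj
  have hS' : (S.map (C (R := k))).map (constantCoeff (R := k)) = S := by
    ext i j
    simp
  refine ⟨S.map (C (R := k)), ?_, ?_⟩
  · rw [joinDet, RingHom.map_det]
    intro h0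
    obtain ⟨v, hv, hv0⟩ := exists_mulVec_eq_zero_iff.2 h0
    apply hv
    have e1 : (constantCoeff (R := k)).mapMatrix
        ((fromCols A₀ (S.map (C (R := k)))).submatrix η id) =
        (fromCols (A₀.map (constantCoeff (R := k))) S).submatrix η id := by
      ext i j
      rcases j with j | j <;> simp
    have e2 : fromCols (A₀.map (constantCoeff (R := k))) S *ᵥ v = 0 := by
      ext i
      have := congrFun hv0 (η.symm i)
      rw [e1] at this
      simpa [Matrix.mulVec, dotProduct] using this
    have e3 : v = Sum.elim (v ∘ Sum.inl) (v ∘ Sum.inr) := by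
      ext (i | i) <;> rfl
    rw [e3, fromCols_mulVec_sumElim] at e2
    have e4 := congrArg (A₁.map (constantCoeff (R := k)) *ᵥ ·) e2
    have e5 : A₁.map (constantCoeff (R := k)) * A₀.map (constantCoeff (R := k)) = 0 := by
      rw [← Matrix.map_mul, hA]
      ext
      simp
    simp only [mulVec_add, mulVec_mulVec, e5, hS, zero_mulVec, one_mulVec, zero_add,
      mulVec_zero] at e4
    rw [e4, mulVec_zero, add_zero] at e2
    rw [e3, hinj _ e2, e4]
    ext (i | i) <;> rfl
  · rw [RingHom.map_det]
    have : (constantCoeff (R := k)).mapMatrix (A₁ * S.map (C (R := k))) = 1 := by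
      rw [RingHom.mapMatrix_apply, Matrix.map_mul, hS', hS]
    rw [this, det_one]

theorem eq_of_X_pow_mul_eq {a b : ℕ} {u v : k⟦X⟧} (hu : constantCoeff u ≠ 0)
    (hv : constantCoeff v ≠ 0) (h : (X : k⟦X⟧) ^ a * u = X ^ b * v) : a = b := by
  have key : ∀ {a b : ℕ} {u v : k⟦X⟧}, constantCoeff u ≠ 0 → X ^ a * u = X ^ b * v → b ≤ a := by
    intro a b u v hu h
    by_contra hlt
    have h1 := congrArg (coeff a) h
    rw [coeff_X_pow_mul', coeff_X_pow_mul', if_pos le_rfl, if_neg hlt, Nat.sub_self] at h1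
    exact hu (by simpa using h1)
  exact le_antisymm (key hv h.symm) (key hu h)

/-- The torsion of a based acyclic complex of length two is multiplicative: if two complexes over
`k⟦X⟧` are exact modulo `X`, and are related by an isomorphism over the field of fractions that
multiplies the basis vectors by powers of `X`, then the alternating sum of the
exponents vanishes. -/
theorem sum_exponents_eq (hcard : Fintype.card V + Fintype.card F = Fintype.card E)
    {A₀ B₀ : Matrix E V k⟦X⟧} {A₁ B₁ : Matrix F E k⟦X⟧} (hA : A₁ * A₀ = 0) (hB : B₁ * B₀ = 0)
    (hA₀ : ∀ h : V → k, A₀.map (constantCoeff (R := k)) *ᵥ h = 0 → h = 0)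
    (hA₁ : ∀ g : F → k, g ᵥ* A₁.map (constantCoeff (R := k)) = 0 → g = 0)
    (hB₀ : ∀ h : V → k, B₀.map (constantCoeff (R := k)) *ᵥ h = 0 → h = 0)
    (hB₁ : ∀ g : F → k, g ᵥ* B₁.map (constantCoeff (R := k)) = 0 → g = 0)
    {φ₀ : V → ℕ} {φ₁ : E → ℕ} {φ₂ : F → ℕ}
    (h₀ : ∀ e v, X ^ φ₁ e * A₀ e v = B₀ e v * X ^ φ₀ v)
    (h₁ : ∀ f e, X ^ φ₂ f * A₁ f e = B₁ f e * X ^ φ₁ e) :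
    ∑ v, φ₀ v + ∑ f, φ₂ f = ∑ e, φ₁ e := by
  obtain ⟨η⟩ : Nonempty (V ⊕ F ≃ E) := Fintype.card_eq.1 (by rw [Fintype.card_sum, hcard])
  obtain ⟨S, hS1, hS2⟩ := exists_section η A₀ A₁ hA hA₀ hA₁
  obtain ⟨T, hT1, hT2⟩ := exists_section η B₀ B₁ hB hB₀ hB₁
  set Z₀ : Matrix V V k⟦X⟧ := diagonal fun v => X ^ φ₀ v with hZ₀
  set Z₁ : Matrix E E k⟦X⟧ := diagonal fun e => X ^ φ₁ e with hZ₁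
  set Z₂ : Matrix F F k⟦X⟧ := diagonal fun f => X ^ φ₂ f with hZ₂
  have e0 : Z₁ * A₀ = B₀ * Z₀ := by
    ext1 i j
    rw [hZ₀, hZ₁, diagonal_mul, mul_diagonal, h₀]
  have e1 : Z₂ * A₁ = B₁ * Z₁ := by
    ext1 i j
    rw [hZ₂, hZ₁, diagonal_mul, mul_diagonal, h₁]
  -- solve `Z₁ S = B₀ W + T Y`
  obtain ⟨W, Y, hWY⟩ : ∃ (W : Matrix V F k⟦X⟧) (Y : Matrix F F k⟦X⟧),
      Z₁ * S = B₀ * W + T * Y := by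
    set M := (fromCols B₀ T).submatrix η id with hM
    have hMu : IsUnit M.det := by
      rw [PowerSeries.isUnit_iff_constantCoeff]
      exact isUnit_iff_ne_zero.2 hT1
    set N := M⁻¹ * (Z₁ * S).submatrix η id with hN
    have h1 : M * N = (Z₁ * S).submatrix η id := by
      rw [hN, ← Matrix.mul_assoc, Matrix.mul_nonsing_inv _ hMu, Matrix.one_mul]
    refine ⟨N.submatrix Sum.inl id, N.submatrix Sum.inr id, ?_⟩
    ext1 i j
    have h2 := congrFun (congrFun h1 (η.symm i)) j
    simp only [Matrix.mul_apply, hM, submatrix_apply, Equiv.apply_symm_apply, id,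
      Fintype.sum_sum_type, fromCols_apply_inl, fromCols_apply_inr] at h2
    simp only [Matrix.mul_apply, Matrix.add_apply, submatrix_apply, id]
    exact h2.symm
  have d1 : Z₁.det * joinDet η A₀ S = joinDet η B₀ T * (Z₀.det * Y.det) := by
    rw [← mul_joinDet, e0, hWY, joinDet_mul]
  have d2 : Z₂.det * (A₁ * S).det = (B₁ * T).det * Y.det := by
    rw [← det_mul, ← det_mul, ← Matrix.mul_assoc, e1, Matrix.mul_assoc, hWY, Matrix.mul_add,
      ← Matrix.mul_assoc, hB, Matrix.zero_mul, zero_add, Matrix.mul_assoc]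
  rw [hZ₁, hZ₀, det_diagonal, det_diagonal, Finset.prod_pow_eq_pow_sum,
    Finset.prod_pow_eq_pow_sum] at d1
  rw [hZ₂, det_diagonal, Finset.prod_pow_eq_pow_sum] at d2
  -- the powers of `X` in the two determinant identities, all other factors being units
  refine (eq_of_X_pow_mul_eq (u := joinDet η A₀ S * (B₁ * T).det)
    (v := joinDet η B₀ T * (A₁ * S).det) ?_ ?_ ?_).symm
  · rw [map_mul, hT2, mul_one]
    exact hS1
  · rw [map_mul, hS2, mul_one]
    exact hT1
  · rw [pow_add]
    linear_combination (B₁ * T).det * d1 - joinDet η B₀ T * X ^ (∑ v, φ₀ v) * d2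

end Torsion

/-! ### Triangulated tori and normal curves -/

/-- The quotient by a fixed-point free involution. -/
def halfSetoid {X : Type*} (ε : Perm X) (hε : ∀ x, ε (ε x) = x) : Setoid X where
  r x y := y = x ∨ y = ε x
  iseqv := ⟨fun _ => Or.inl rfl, by
    rintro x y (rfl | rfl)
    · exact Or.inl rfl
    · exact Or.inr (hε x).symm, by
    rintro x y z (rfl | rfl) (rfl | rfl)
    · exact Or.inl rfl
    · exact Or.inr rfl
    · exact Or.inr rfl
    · exact Or.inl (hε x)⟩

/-- The type of orbits of a fixed-point free involution. -/
def Half {X : Type*} (ε : Perm X) (hε : ∀ x, ε (ε x) = x) : Type _ := Quotient (halfSetoid ε hε)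

namespace Half

variable {X : Type*} {ε : Perm X} {hε : ∀ x, ε (ε x) = x}

/-- The orbit of an element. -/
def mk (hε : ∀ x, ε (ε x) = x) (x : X) : Half ε hε := Quotient.mk (halfSetoid ε hε) x

theorem mk_eq_mk {x y : X} : mk hε x = mk hε y ↔ y = x ∨ y = ε x := Quotient.eq

theorem mk_apply (x : X) : mk hε (ε x) = mk hε x := (mk_eq_mk.2 (Or.inr rfl)).symm

theorem ind {p : Half ε hε → Prop} (h : ∀ x, p (mk hε x)) (q) : p q := Quotient.ind h q

noncomputable instance [Fintype X] : Fintype (Half ε hε) :=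
  @Fintype.ofFinite _ (Quotient.finite _)

noncomputable instance : DecidableEq (Half ε hε) := Classical.decEq _

open Classical in
theorem sum_ite_mk_eq [Fintype X] {R : Type*} [AddCommMonoid R] (hne : ∀ x, ε x ≠ x)
    (y : X) (F : X → R) : (∑ x, if mk hε x = mk hε y then F x else 0) = F y + F (ε y) := by
  rw [← Finset.sum_filter]
  have : Finset.univ.filter (fun x => mk hε x = mk hε y) = {y, ε y} := by
    ext x
    simp only [Finset.mem_filter, Finset.mem_univ, true_and, Finset.mem_insert,
      Finset.mem_singleton, mk_eq_mk]
    constructor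
    · rintro (rfl | rfl)
      · exact Or.inl rfl
      · exact Or.inr (hε x).symm
    · rintro (rfl | rfl)
      · exact Or.inl rfl
      · exact Or.inr (hε y).symm
  rw [this, Finset.sum_pair (hne y).symm]

theorem sum_mk [Fintype X] {R : Type*} [AddCommMonoid R] (hne : ∀ x, ε x ≠ x)
    (F : Half ε hε → R) : ∑ x, F (mk hε x) = 2 • ∑ q, F q := by
  classical
  have h1 : ∀ x, F (mk hε x) = ∑ q, if mk hε x = q then F q else 0 := fun x => by simp
  simp only [h1]
  rw [Finset.sum_comm, Finset.smul_sum]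
  refine Finset.sum_congr rfl fun q _ => ?_
  induction q using ind with
  | h y => rw [sum_ite_mk_eq hne y (fun _ => F (mk hε y)), two_nsmul]

end Half

/-- The pairs `(d, j)` with `j < m d`. -/
abbrev Box {D : Type*} (m : D → ℕ) := {x : D × ℕ // x.2 < m x.1}

/-- The dependent pairs that make up a box. -/
def boxEquiv {D : Type*} (m : D → ℕ) : (Σ d, Fin (m d)) ≃ Box m where
  toFun x := ⟨(x.1, x.2), x.2.2⟩
  invFun x := ⟨x.1.1, ⟨x.1.2, x.2⟩⟩
  left_inv _ := rfl
  right_inv _ := rfl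

noncomputable instance {D : Type*} [Fintype D] (m : D → ℕ) : Fintype (Box m) :=
  Fintype.ofEquiv _ (boxEquiv m)

noncomputable instance {D : Type*} (m : D → ℕ) : DecidableEq (Box m) := Classical.decEq _

theorem sum_box {D : Type*} [Fintype D] (m : D → ℕ) {R : Type*} [AddCommMonoid R]
    (F : D → ℕ → R) : ∑ x : Box m, F x.1.1 x.1.2 = ∑ d, ∑ j ∈ Finset.range (m d), F d j := by
  rw [← (boxEquiv m).sum_comp, Fintype.sum_sigma]
  refine Finset.sum_congr rfl fun d _ => ?_
  exact Fin.sum_univ_eq_sum_range (fun j => F d j) (m d)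

/-- A triangulated closed connected surface with `2V = F`, i.e. a torus. Its triangles `A` have
corners `D` at the vertices `P`; `rot` is the anticlockwise rotation of the corners of a
triangle. The corner `d` also stands for the side from `d` to `rot d` of its triangle, and
`flip d` is the same side, seen from the adjacent triangle with the opposite orientation. -/
structure TriTorus (D P A : Type*) [Fintype P] [Fintype A] where
  rot : Perm D
  flip : Perm D
  vert : D → P
  tri : D → A
  rot_rot_rot : ∀ d, rot (rot (rot d)) = d
  flip_flip : ∀ d, flip (flip d) = d
  rot_ne : ∀ d, rot d ≠ d
  flip_ne : ∀ d, flip d ≠ d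
  vert_flip : ∀ d, vert (flip d) = vert (rot d)
  tri_rot : ∀ d, tri (rot d) = tri d
  vert_surj : Function.Surjective vert
  tri_surj : Function.Surjective tri
  vert_ind : ∀ f : D → Prop, (∀ d, f (rot (flip d)) ↔ f d) → ∀ d d', vert d = vert d' →
    (f d ↔ f d')
  tri_eq : ∀ d d', tri d = tri d' → d' = d ∨ d' = rot d ∨ d' = rot (rot d)
  conn : ∀ f : D → Prop, (∀ d, f (rot d) ↔ f d) → (∀ d, f (flip d) ↔ f d) →
    ∀ d d', (f d ↔ f d')
  card_eq : 2 * Fintype.card P = Fintype.card A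

namespace TriTorus

set_option linter.unusedSectionVars false

variable {D P A : Type*} [Fintype D] [Fintype P] [Fintype A] (S : TriTorus D P A)

theorem sum_tri {R : Type*} [AddCommMonoid R] (F : A → R) : ∑ d, F (S.tri d) = 3 • ∑ a, F a := by
  classical
  have h1 : ∀ d, F (S.tri d) = ∑ a, if S.tri d = a then F a else 0 := fun d => by simp
  simp only [h1]
  rw [Finset.sum_comm, Finset.smul_sum]
  refine Finset.sum_congr rfl fun a _ => ?_
  obtain ⟨d, rfl⟩ := S.tri_surj a
  rw [← Finset.sum_filter]
  have : Finset.univ.filter (fun x => S.tri x = S.tri d) = {d, S.rot d, S.rot (S.rot d)} := by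
    ext x
    simp only [Finset.mem_filter, Finset.mem_univ, true_and, Finset.mem_insert,
      Finset.mem_singleton]
    constructor
    · intro h
      exact S.tri_eq d x h.symm
    · rintro (rfl | rfl | rfl) <;> simp [S.tri_rot]
  have h2 := S.rot_ne d
  have h3 := S.rot_ne (S.rot d)
  have h4 : S.rot (S.rot d) ≠ d := by
    intro h
    have := S.rot_rot_rot d
    rw [h] at this
    exact h2 this
  rw [this, Finset.sum_insert, Finset.sum_pair h3.symm]
  · rw [succ_nsmul, two_nsmul]
    abel
  · simp only [Finset.mem_insert, Finset.mem_singleton, not_or]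
    exact ⟨h2.symm, h4.symm⟩

theorem vert_rot_flip (d : D) : S.vert (S.rot (S.flip d)) = S.vert d := by
  rw [← S.vert_flip, S.flip_flip]

/-- Normal curves without orientation, given by the numbers of arcs around the corners. -/
structure Curve where
  num : D → ℕ
  matching : ∀ d, num d + num (S.rot d) = num (S.rot (S.flip d)) + num (S.flip d)

namespace Curve

variable {S} (C : S.Curve)

/-- The number of intersection points with a side. -/
def pts (d : D) : ℕ := C.num d + C.num (S.rot d)

theorem pts_flip (d : D) : C.pts (S.flip d) = C.pts d := by
  rw [pts, pts, C.matching d, add_comm]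

theorem pts_rot_symm (d : D) : C.pts (S.rot.symm d) = C.num (S.rot.symm d) + C.num d := by
  simp [pts]

/-- The arcs of the curve, the arc `(d, i)` being the `i`-th one around the corner `d`. -/
abbrev Arc := Box C.num

/-- The segments into which the curve divides the sides, as seen from a triangle. -/
abbrev SegD := Box fun d => C.pts d + 1

/-- The intersection points with the sides, as seen from a triangle. -/
abbrev PtD := Box C.pts

/-- The same segment, seen from the other triangle. -/
def segFlip : Perm C.SegD where
  toFun x := ⟨(S.flip x.1.1, C.pts x.1.1 - x.1.2), by
    have := C.pts_flip x.1.1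
    have := x.2
    simp only at *
    omega⟩
  invFun x := ⟨(S.flip x.1.1, C.pts x.1.1 - x.1.2), by
    have := C.pts_flip x.1.1
    have := x.2
    simp only at *
    omega⟩
  left_inv x := by
    ext
    · simp [S.flip_flip]
    · have := C.pts_flip x.1.1
      have := x.2
      simp only at *
      omega
  right_inv x := by
    ext
    · simp [S.flip_flip]
    · have := C.pts_flip x.1.1
      have := x.2
      simp only at *
      omega

/-- The same intersection point, seen from the other triangle. -/
def ptFlip : Perm C.PtD where
  toFun x := ⟨(S.flip x.1.1, C.pts x.1.1 - 1 - x.1.2), by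
    have := C.pts_flip x.1.1
    have := x.2
    simp only at *
    omega⟩
  invFun x := ⟨(S.flip x.1.1, C.pts x.1.1 - 1 - x.1.2), by
    have := C.pts_flip x.1.1
    have := x.2
    simp only at *
    omega⟩
  left_inv x := by
    ext
    · simp [S.flip_flip]
    · have := C.pts_flip x.1.1
      have := x.2
      simp only at *
      omega
  right_inv x := by
    ext
    · simp [S.flip_flip]
    · have := C.pts_flip x.1.1
      have := x.2
      simp only at *
      omega

theorem segFlip_segFlip (x : C.SegD) : C.segFlip (C.segFlip x) = x := C.segFlip.left_inv x

theorem ptFlip_ptFlip (x : C.PtD) : C.ptFlip (C.ptFlip x) = x := C.ptFlip.left_inv x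

theorem segFlip_ne (x : C.SegD) : C.segFlip x ≠ x :=
  fun h => S.flip_ne x.1.1 (congrArg (fun y => y.1.1) h)

theorem ptFlip_ne (x : C.PtD) : C.ptFlip x ≠ x :=
  fun h => S.flip_ne x.1.1 (congrArg (fun y => y.1.1) h)

/-- The segments of the sides. -/
abbrev Seg := Half C.segFlip C.segFlip_segFlip

/-- The intersection points of the curve with the sides. -/
abbrev Pt := Half C.ptFlip C.ptFlip_ptFlip

/-- The pieces into which the curve divides the triangles: the middle one in each triangle,
and the one on the inside of each arc, where the corner is. -/
abbrev Piece := A ⊕ C.Arc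

/-- The piece between the arcs `i - 1` and `i` around the corner `d`. -/
noncomputable def pc (d : D) (i : ℕ) : C.Piece :=
  if h : i < C.num d then Sum.inr ⟨(d, i), h⟩ else Sum.inl (S.tri d)

theorem pc_of_le {d : D} {i : ℕ} (h : C.num d ≤ i) : C.pc d i = Sum.inl (S.tri d) :=
  dif_neg (by omega)

theorem pc_arc (a : C.Arc) : C.pc a.1.1 a.1.2 = Sum.inr a := dif_pos a.2

/-- The piece at the segment `j` of the side `d`. -/
noncomputable def sp (d : D) (j : ℕ) : C.Piece :=
  if j < C.num d then C.pc d j else C.pc (S.rot d) (C.pts d - j)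

theorem sp_of_le {d : D} {j : ℕ} (h : j ≤ C.num d) : C.sp d j = C.pc d j := by
  unfold sp
  split_ifs with h1
  · rfl
  · have : j = C.num d := by omega
    subst this
    rw [C.pc_of_le le_rfl, C.pc_of_le (by simp [pts]), S.tri_rot]

theorem sp_of_ge {d : D} {j : ℕ} (h : C.num d ≤ j) : C.sp d j = C.pc (S.rot d) (C.pts d - j) :=
  if_neg (by omega)

/-- The arc that ends at the intersection point `(d, j)`, in the triangle of `d`. -/
def arcAt (x : C.PtD) : C.Arc :=
  if h : x.1.2 < C.num x.1.1 then ⟨x.1, h⟩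
  else ⟨(S.rot x.1.1, C.pts x.1.1 - 1 - x.1.2), by
    have := x.2
    simp only [pts] at *
    omega⟩

/-- Each arc has two ends. -/
def ptEquiv : C.PtD ≃ C.Arc × Bool where
  toFun x := (C.arcAt x, decide (x.1.2 < C.num x.1.1))
  invFun y := if y.2 then ⟨y.1.1, by
      have := y.1.2
      simp only [pts]
      omega⟩
    else ⟨(S.rot.symm y.1.1.1, C.pts (S.rot.symm y.1.1.1) - 1 - y.1.1.2), by
      have := y.1.2
      have := C.pts_rot_symm y.1.1.1
      simp only
      omega⟩
  left_inv x := by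
    have hx := x.2
    by_cases h : x.1.2 < C.num x.1.1
    · simp [h, arcAt]
    · simp only [h, arcAt, decide_false, dite_false, Bool.false_eq_true, if_false]
      ext
      · simp
      · simp only [Equiv.symm_apply_apply]
        omega
  right_inv y := by
    obtain ⟨⟨⟨d, i⟩, hi⟩, b⟩ := y
    have := C.pts_rot_symm d
    cases b
    · have h : ¬ (C.pts (S.rot.symm d) - 1 - i < C.num (S.rot.symm d)) := by
        simp only at hi
        omega
      simp only [Bool.false_eq_true, if_false, arcAt, h, dite_false, decide_false, Prod.mk.injEq,
        and_true]
      ext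
      · simp
      · simp only at hi this ⊢
        omega
    · simp only at hi
      simp [arcAt, hi]

/-- The piece on the inner side (towards its corner) and on the outer side of an arc. -/
noncomputable def side (a : C.Arc) (b : Bool) : C.Piece :=
  if b then C.pc a.1.1 a.1.2 else C.pc a.1.1 (a.1.2 + 1)

/-- Whether the segment before the intersection point is on the inner side of the arc that ends at
it. -/
def inner (x : C.PtD) : Bool := decide (x.1.2 < C.num x.1.1)

theorem sp_eq_side (x : C.PtD) : C.sp x.1.1 x.1.2 = C.side (C.arcAt x) (C.inner x) := by
  have hx := x.2
  by_cases h : x.1.2 < C.num x.1.1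
  · simp [inner, h, arcAt, side, C.sp_of_le h.le]
  · simp only [inner, h, arcAt, side, C.sp_of_ge (not_lt.1 h), decide_false, dite_false,
      Bool.false_eq_true, if_false]
    congr 1
    omega

theorem sp_succ_eq_side (x : C.PtD) :
    C.sp x.1.1 (x.1.2 + 1) = C.side (C.arcAt x) (!C.inner x) := by
  have hx := x.2
  by_cases h : x.1.2 < C.num x.1.1
  · simp [inner, h, arcAt, side, C.sp_of_le (Nat.succ_le_of_lt h)]
  · simp only [inner, h, arcAt, side, C.sp_of_ge (show C.num x.1.1 ≤ x.1.2 + 1 by omega),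
      decide_false, dite_false, Bool.not_false, if_true]
    congr 1
    omega

theorem sp_pts (d : D) : C.sp (S.flip d) (C.pts d) = C.sp (S.rot (S.flip d)) 0 := by
  rw [C.sp_of_le (Nat.zero_le _), C.sp_of_ge (by have := C.pts_flip d; simp only [pts] at *; omega),
    C.pts_flip, Nat.sub_self]

end Curve

end TriTorus

/-! ### The refined dual complex of a curve on a torus -/

namespace TriTorus

set_option linter.unusedSectionVars false

variable {D P A : Type*} [Fintype D] [Fintype P] [Fintype A] {S : TriTorus D P A}

namespace Curve

variable (C : S.Curve)

/-- The segment before an intersection point. -/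
def segOf (x : C.PtD) : C.SegD := ⟨x.1, Nat.lt_succ_of_lt x.2⟩

/-- The segment after an intersection point. -/
def segSucc (x : C.PtD) : C.SegD := ⟨(x.1.1, x.1.2 + 1), Nat.succ_lt_succ x.2⟩

/-- The first segment of a side. -/
def segZero (d : D) : C.SegD := ⟨(d, 0), Nat.succ_pos _⟩

theorem segFlip_segOf (x : C.PtD) : C.segFlip (C.segOf x) = C.segSucc (C.ptFlip x) := by
  have hx := x.2
  have h1 : (C.segFlip (C.segOf x)).1.2 = C.pts x.1.1 - x.1.2 := rfl
  have h2 : (C.segSucc (C.ptFlip x)).1.2 = C.pts x.1.1 - 1 - x.1.2 + 1 := rfl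
  refine Subtype.ext (Prod.ext rfl ?_)
  rw [h1, h2]
  omega

theorem segFlip_segSucc (x : C.PtD) : C.segFlip (C.segSucc x) = C.segOf (C.ptFlip x) := by
  rw [← C.ptFlip_ptFlip x, ← segFlip_segOf, segFlip_segFlip, ptFlip_ptFlip]

/-- The piece at a segment, in the triangle from which the segment is seen. -/
noncomputable def spz (z : C.SegD) : C.Piece := C.sp z.1.1 z.1.2

theorem spz_segOf (x : C.PtD) : C.spz (C.segOf x) = C.side (C.arcAt x) (C.inner x) :=
  C.sp_eq_side x

theorem spz_segSucc (x : C.PtD) : C.spz (C.segSucc x) = C.side (C.arcAt x) (!C.inner x) :=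
  C.sp_succ_eq_side x

theorem spz_segFlip_segZero (d : D) :
    C.spz (C.segFlip (C.segZero d)) = C.spz (C.segZero (S.rot (S.flip d))) := C.sp_pts d

theorem two_mul_card_seg :
    2 * Fintype.card C.Seg = 2 * Fintype.card C.Arc + Fintype.card D := by
  have h1 : ∑ _x : C.SegD, 1 = 2 • ∑ _q : C.Seg, 1 :=
    Half.sum_mk (hε := C.segFlip_segFlip) C.segFlip_ne fun _ => 1
  have h2 : ∑ _x : C.PtD, 1 = _ := sum_box (R := ℕ) C.pts fun _ _ => 1
  have h3 : ∑ _x : C.SegD, 1 = _ := sum_box (R := ℕ) (fun d => C.pts d + 1) fun _ _ => 1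
  have h4 := Fintype.card_congr C.ptEquiv
  simp only [Finset.sum_const, Finset.card_univ, smul_eq_mul, mul_one, Finset.card_range,
    Finset.sum_add_distrib, Fintype.card_prod, Fintype.card_bool] at *
  omega

theorem card_pt : Fintype.card C.Pt = Fintype.card C.Arc := by
  have h1 : ∑ _x : C.PtD, 1 = 2 • ∑ _q : C.Pt, 1 :=
    Half.sum_mk (hε := C.ptFlip_ptFlip) C.ptFlip_ne fun _ => 1
  have h4 := Fintype.card_congr C.ptEquiv
  simp only [Finset.sum_const, Finset.card_univ, smul_eq_mul, mul_one,
    Fintype.card_prod, Fintype.card_bool] at *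
  omega

/-- The Euler characteristic of the torus is zero. -/
theorem card_piece_add :
    Fintype.card C.Piece + Fintype.card (C.Pt ⊕ P) = Fintype.card (C.Arc ⊕ C.Seg) := by
  have h1 := C.two_mul_card_seg
  have h2 := C.card_pt
  have h3 := S.card_eq
  have h4 := S.sum_tri (R := ℕ) fun _ => 1
  simp only [Finset.sum_const, Finset.card_univ, smul_eq_mul, mul_one, Fintype.card_sum] at *
  omega

/-- Exponents of the incidence coefficients in the cochain complex of the cell structure dual to
the subdivision of the torus by a curve and the sides: `wa` for an arc and the pieces on its two
sides, `u d` for the other incidences across the triangle of `d` at its side `d`, and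
`y d` for a vertex and the first segment of the side `d`. -/
structure Weight where
  u : D → ℕ
  y : D → ℕ
  wa : C.Arc → Bool → ℕ
  wa_flip : ∀ x, wa (C.arcAt (C.ptFlip x)) (C.inner (C.ptFlip x)) = wa (C.arcAt x) (!C.inner x)
  u_rot : ∀ d, u (S.rot d) + y (S.rot d) = u d + y (S.flip d)

namespace Weight

open Classical Matrix

variable {C} (W : C.Weight) {R : Type*} [CommRing R] (t : R)

/-- The coboundary from pieces to arcs and segments. -/
noncomputable def cob₀ : Matrix (C.Arc ⊕ C.Seg) C.Piece R
  | .inl a, v => (if C.side a true = v then t ^ W.wa a true else 0) +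
      if C.side a false = v then t ^ W.wa a false else 0
  | .inr s, v => ∑ z : C.SegD, if Half.mk C.segFlip_segFlip z = s then
      if C.spz z = v then t ^ W.u z.1.1 else 0 else 0

/-- The coboundary from arcs and segments to intersection points and vertices. -/
noncomputable def cob₁ : Matrix (C.Pt ⊕ P) (C.Arc ⊕ C.Seg) R
  | .inl q, .inl a => ∑ x : C.PtD, if Half.mk C.ptFlip_ptFlip x = q then
      if C.arcAt x = a then t ^ W.u x.1.1 else 0 else 0
  | .inl q, .inr s => ∑ x : C.PtD, if Half.mk C.ptFlip_ptFlip x = q then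
      if Half.mk C.segFlip_segFlip (C.segOf x) = s then t ^ W.wa (C.arcAt x) (C.inner x) else 0
      else 0
  | .inr _, .inl _ => 0
  | .inr p, .inr s => ∑ d : D, if S.vert d = p then
      if Half.mk C.segFlip_segFlip (C.segZero d) = s then t ^ W.y d else 0 else 0

theorem cob₀_map {R' : Type*} [CommRing R'] (f : R →+* R') :
    (W.cob₀ t).map f = W.cob₀ (f t) := by
  ext (a | s) v
  · simp [cob₀, apply_ite f]
  · simp [cob₀, apply_ite f]

theorem cob₁_map {R' : Type*} [CommRing R'] (f : R →+* R') :
    (W.cob₁ t).map f = W.cob₁ (f t) := by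
  ext (q | p) (a | s) <;> simp [cob₁, apply_ite f]

theorem cob₀_mulVec_arc (h : C.Piece → R) (a : C.Arc) : (W.cob₀ t *ᵥ h) (.inl a) =
    t ^ W.wa a true * h (C.side a true) + t ^ W.wa a false * h (C.side a false) := by
  simp [Matrix.mulVec, dotProduct, cob₀, add_mul, Finset.sum_add_distrib]

theorem sum_sum_ite {X Y : Type*} [Fintype X] [Fintype Y] [DecidableEq Y] (p : X → Prop)
    [DecidablePred p] (f : X → Y)
    (r : X → R) (h : Y → R) :
    ∑ y, (∑ x, if p x then if f x = y then r x else 0 else 0) * h y =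
      ∑ x, if p x then r x * h (f x) else 0 := by
  simp only [Finset.sum_mul]
  rw [Finset.sum_comm]
  refine Finset.sum_congr rfl fun x _ => ?_
  split_ifs <;> simp

theorem sum_sum_ite' {X Y : Type*} [Fintype X] [Fintype Y] [DecidableEq Y] (p : X → Prop)
    [DecidablePred p] (f : X → Y)
    (r : X → R) (h : Y → R) :
    ∑ y, h y * (∑ x, if f x = y then if p x then r x else 0 else 0) =
      ∑ x, if p x then h (f x) * r x else 0 := by
  simp only [Finset.mul_sum]
  rw [Finset.sum_comm]
  refine Finset.sum_congr rfl fun x _ => ?_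
  split_ifs <;> simp

theorem cob₀_mulVec_seg (h : C.Piece → R) (z : C.SegD) :
    (W.cob₀ t *ᵥ h) (.inr (Half.mk C.segFlip_segFlip z)) =
      t ^ W.u z.1.1 * h (C.spz z) + t ^ W.u (S.flip z.1.1) * h (C.spz (C.segFlip z)) := by
  simp only [Matrix.mulVec, dotProduct, cob₀]
  rw [sum_sum_ite, show S.flip z.1.1 = (C.segFlip z).1.1 from rfl]
  convert Half.sum_ite_mk_eq C.segFlip_ne z (fun z => t ^ W.u z.1.1 * h (C.spz z)) using 1

theorem cob₁_mulVec_pt (w : C.Arc ⊕ C.Seg → R) (x : C.PtD) :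
    (W.cob₁ t *ᵥ w) (.inl (Half.mk C.ptFlip_ptFlip x)) =
      (t ^ W.u x.1.1 * w (.inl (C.arcAt x)) +
        t ^ W.u (S.flip x.1.1) * w (.inl (C.arcAt (C.ptFlip x)))) +
      (t ^ W.wa (C.arcAt x) (C.inner x) * w (.inr (Half.mk C.segFlip_segFlip (C.segOf x))) +
        t ^ W.wa (C.arcAt (C.ptFlip x)) (C.inner (C.ptFlip x)) *
          w (.inr (Half.mk C.segFlip_segFlip (C.segOf (C.ptFlip x))))) := by
  simp only [Matrix.mulVec, dotProduct, cob₁, Fintype.sum_sum_type]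
  rw [sum_sum_ite _ _ _ fun a => w (.inl a), sum_sum_ite _ _ _ fun s => w (.inr s)]
  rw [show S.flip x.1.1 = (C.ptFlip x).1.1 from rfl]
  congr 1
  · convert Half.sum_ite_mk_eq C.ptFlip_ne x
      (fun x => t ^ W.u x.1.1 * w (.inl (C.arcAt x))) using 1
  · convert Half.sum_ite_mk_eq C.ptFlip_ne x
      (fun x => t ^ W.wa (C.arcAt x) (C.inner x) *
        w (.inr (Half.mk C.segFlip_segFlip (C.segOf x)))) using 1

theorem cob₁_mulVec_vert (w : C.Arc ⊕ C.Seg → R) (p : P) :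
    (W.cob₁ t *ᵥ w) (.inr p) = ∑ d, if S.vert d = p then
      t ^ W.y d * w (.inr (Half.mk C.segFlip_segFlip (C.segZero d))) else 0 := by
  simp only [Matrix.mulVec, dotProduct, cob₁, Fintype.sum_sum_type, zero_mul,
    Finset.sum_const_zero, zero_add]
  rw [sum_sum_ite _ _ _ fun s => w (.inr s)]

/-- The coboundaries form a complex in characteristic two. -/
theorem cob₁_mul_cob₀ [CharP R 2] : W.cob₁ t * W.cob₀ t = 0 := by
  have two : ∀ r : R, r + r = 0 := CharTwo.add_self_eq_zero
  suffices H : ∀ h, W.cob₁ t *ᵥ (W.cob₀ t *ᵥ h) = 0 by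
    ext1 i j
    have := congrFun (H (Pi.single j 1)) i
    rw [Matrix.mulVec_mulVec] at this
    simpa using this
  intro h
  ext1 i
  rcases i with q | p
  · induction q using Half.ind with
    | h x =>
      rw [cob₁_mulVec_pt]
      simp only [cob₀_mulVec_arc, cob₀_mulVec_seg, Pi.zero_apply]
      rw [C.segFlip_segOf, C.segFlip_segOf, C.ptFlip_ptFlip, C.spz_segOf, C.spz_segOf,
        C.spz_segSucc, C.spz_segSucc]
      have e1 := W.wa_flip x
      have e2 := W.wa_flip (C.ptFlip x)
      rw [C.ptFlip_ptFlip] at e2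
      have e3 : (C.segOf x).1.1 = x.1.1 := rfl
      have e4 : (C.segOf (C.ptFlip x)).1.1 = S.flip x.1.1 := rfl
      rw [e3, e4, S.flip_flip]
      cases hb : C.inner x <;> cases hb' : C.inner (C.ptFlip x) <;>
      · simp only [hb, hb', Bool.not_true, Bool.not_false] at e1 e2 ⊢
        rw [← e1, ← e2]
        ring_nf
        simp only [CharTwo.two_eq_zero, mul_zero, add_zero]
  · rw [cob₁_mulVec_vert]
    simp only [cob₀_mulVec_seg, Pi.zero_apply, C.spz_segFlip_segZero]
    have e1 : ∀ d, (C.segZero d).1.1 = d := fun d => rfl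
    simp only [e1]
    have e2 : ∀ d, (if S.vert d = p then t ^ W.y d * (t ^ W.u d * h (C.spz (C.segZero d)) +
        t ^ W.u (S.flip d) * h (C.spz (C.segZero (S.rot (S.flip d))))) else 0) =
        (if S.vert d = p then t ^ (W.u d + W.y d) * h (C.spz (C.segZero d)) else 0) +
        if S.vert d = p then t ^ (W.y d + W.u (S.flip d)) *
          h (C.spz (C.segZero (S.rot (S.flip d)))) else 0 := by
      intro d
      split_ifs
      · ring
      · simp
    rw [Finset.sum_congr rfl fun d _ => e2 d, Finset.sum_add_distrib,
      ← (S.flip.trans S.rot).sum_comp, ← Finset.sum_add_distrib]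
    refine Finset.sum_eq_zero fun d _ => ?_
    simp only [Equiv.trans_apply, S.vert_rot_flip]
    split_ifs
    · rw [W.u_rot, S.flip_flip, add_comm (W.u (S.flip d))]
      exact two _
    · simp

theorem vecMul_cob₁_arc (g : C.Pt ⊕ P → R) (a : C.Arc) : (g ᵥ* W.cob₁ t) (.inl a) =
    ∑ b : Bool, g (.inl (Half.mk C.ptFlip_ptFlip (C.ptEquiv.symm (a, b)))) *
      t ^ W.u (C.ptEquiv.symm (a, b)).1.1 := by
  simp only [Matrix.vecMul, dotProduct, cob₁, Fintype.sum_sum_type, mul_zero,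
    Finset.sum_const_zero, add_zero]
  rw [sum_sum_ite' _ _ _ fun q => g (.inl q), ← C.ptEquiv.symm.sum_comp, Fintype.sum_prod_type]
  have e : ∀ a b, C.arcAt (C.ptEquiv.symm (a, b)) = a := fun a b =>
    congrArg Prod.fst (C.ptEquiv.apply_symm_apply (a, b))
  simp only [e]
  rw [Fintype.sum_eq_single a]
  · simp
  · intro a' ha'
    simp [ha']

/-- The contribution of the end of a segment to the coboundary `cob₁`. -/
noncomputable def endVal (g : C.Pt ⊕ P → R) (d : D) (j : ℕ) : R :=
  if h : j < C.pts d then g (.inl (Half.mk C.ptFlip_ptFlip ⟨(d, j), h⟩)) *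
      t ^ W.wa (C.arcAt ⟨(d, j), h⟩) (C.inner ⟨(d, j), h⟩)
  else g (.inr (S.vert (S.flip d))) * t ^ W.y (S.flip d)

theorem endVal_of_lt (g : C.Pt ⊕ P → R) {d : D} {j : ℕ} (h : j < C.pts d) :
    W.endVal t g d j = g (.inl (Half.mk C.ptFlip_ptFlip ⟨(d, j), h⟩)) *
      t ^ W.wa (C.arcAt ⟨(d, j), h⟩) (C.inner ⟨(d, j), h⟩) := dif_pos h

theorem endVal_of_ge (g : C.Pt ⊕ P → R) {d : D} {j : ℕ} (h : ¬ j < C.pts d) :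
    W.endVal t g d j = g (.inr (S.vert (S.flip d))) * t ^ W.y (S.flip d) := dif_neg h

theorem vecMul_cob₁_seg (g : C.Pt ⊕ P → R) (z : C.SegD) :
    (g ᵥ* W.cob₁ t) (.inr (Half.mk C.segFlip_segFlip z)) =
      W.endVal t g z.1.1 z.1.2 + W.endVal t g (C.segFlip z).1.1 (C.segFlip z).1.2 := by
  simp only [Matrix.vecMul, dotProduct, cob₁, Fintype.sum_sum_type]
  rw [sum_sum_ite' _ _ _ fun q => g (.inl q), sum_sum_ite' _ _ _ fun p => g (.inr p)]
  -- each segment, as seen from a triangle, starts at a vertex or follows exactly one point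
  have h1 : ∀ (z : C.SegD) (F : C.PtD → R), (∑ x, if C.segOf x = z then F x else 0) =
      if h : z.1.2 < C.pts z.1.1 then F ⟨z.1, h⟩ else 0 := by
    intro z F
    split_ifs with h
    · rw [Fintype.sum_eq_single (⟨z.1, h⟩ : C.PtD), if_pos (show C.segOf ⟨z.1, h⟩ = z from Subtype.ext rfl)]
      intro x hx
      rw [if_neg]
      rintro rfl
      exact hx rfl
    · refine Finset.sum_eq_zero fun x _ => if_neg ?_
      rintro rfl
      exact h x.2
  have h2 : ∀ (z : C.SegD) (F : D → R), (∑ d, if C.segZero d = z then F d else 0) =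
      if z.1.2 = 0 then F z.1.1 else 0 := by
    intro z F
    split_ifs with h
    · rw [Fintype.sum_eq_single z.1.1, if_pos]
      · exact Subtype.ext (Prod.ext rfl h.symm)
      · intro x hx
        rw [if_neg]
        rintro rfl
        exact hx rfl
    · refine Finset.sum_eq_zero fun x _ => if_neg ?_
      rintro rfl
      exact h rfl
  have h3 : ∀ {X : Type _} [Fintype X] (f : X → C.SegD) (F : X → R),
      (∑ x, if Half.mk C.segFlip_segFlip (f x) = Half.mk C.segFlip_segFlip z then F x else 0) =
      (∑ x, if f x = z then F x else 0) + ∑ x, if f x = C.segFlip z then F x else 0 := by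
    intro X _ f F
    rw [← Finset.sum_add_distrib]
    refine Finset.sum_congr rfl fun x _ => ?_
    have hz := C.segFlip_ne z
    simp only [Half.mk_eq_mk]
    by_cases h1 : f x = z
    · rw [if_pos (Or.inl h1.symm), if_pos h1, if_neg (by rw [h1]; exact hz.symm), add_zero]
    · by_cases h2 : f x = C.segFlip z
      · rw [if_pos (Or.inr (by rw [h2, C.segFlip_segFlip])), if_neg h1, if_pos h2, zero_add]
      · rw [if_neg, if_neg h1, if_neg h2, add_zero]
        rintro (h | h)
        · exact h1 h.symm
        · exact h2 (by rw [h, C.segFlip_segFlip])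
  rw [h3, h3, h1, h1, h2, h2]
  have hz := z.2
  have e1 : (C.segFlip z).1.1 = S.flip z.1.1 := rfl
  have e2 : (C.segFlip z).1.2 = C.pts z.1.1 - z.1.2 := rfl
  have e3 := C.pts_flip z.1.1
  by_cases a1 : z.1.2 < C.pts z.1.1
  · have a3 : ¬ (C.segFlip z).1.2 = 0 := by omega
    rw [W.endVal_of_lt t g a1, dif_pos a1, if_neg a3, add_zero, add_assoc]
    congr 1
    by_cases a2 : (C.segFlip z).1.2 < C.pts (C.segFlip z).1.1
    · have a4 : ¬ z.1.2 = 0 := by rw [e1, e3, e2] at a2; omega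
      rw [W.endVal_of_lt t g a2, dif_pos a2, if_neg a4, add_zero]
    · have a4 : z.1.2 = 0 := by rw [e1, e3, e2] at a2; omega
      rw [W.endVal_of_ge t g a2, dif_neg a2, if_pos a4, zero_add, e1, S.flip_flip]
  · have a3 : (C.segFlip z).1.2 = 0 := by simp only at hz; omega
    rw [W.endVal_of_ge t g a1, dif_neg a1, if_pos a3, zero_add, ← add_assoc,
      add_comm _ (g (.inr (S.vert (C.segFlip z).1.1)) * _)]
    congr 1
    by_cases a2 : (C.segFlip z).1.2 < C.pts (C.segFlip z).1.1
    · have a4 : ¬ z.1.2 = 0 := by rw [e1, e3, e2] at a2; simp only at hz; omega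
      rw [W.endVal_of_lt t g a2, dif_pos a2, if_neg a4, add_zero]
    · have a4 : z.1.2 = 0 := by rw [e1, e3, e2] at a2; simp only at hz; omega
      rw [W.endVal_of_ge t g a2, dif_neg a2, if_pos a4, zero_add, e1, S.flip_flip]

end Weight

end Curve

end TriTorus

/-! ### Coboundaries with prescribed defect, and strands of a curve -/

namespace TriTorus

set_option linter.unusedSectionVars false

variable {D P A : Type*} [Fintype D] [Fintype P] [Fintype A] {S : TriTorus D P A}

variable (S) in
/-- `c` is the coboundary of the vertex function `n` and the triangle function `m`, and
`2 ∑ n + ∑ m = r`. -/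
def HasDefect (c : D → ℤ) (r : ℤ) : Prop :=
  ∃ (n : P → ℤ) (m : A → ℤ), (∀ d, c d = n (S.vert d) + m (S.tri d)) ∧
    2 * ∑ p, n p + ∑ a, m a = r

variable (S) in
/-- `c` is the coboundary of a vertex function and a triangle function. -/
def IsCob (c : D → ℤ) : Prop :=
  ∃ (n : P → ℤ) (m : A → ℤ), ∀ d, c d = n (S.vert d) + m (S.tri d)

theorem HasDefect.isCob {c : D → ℤ} {r : ℤ} (h : S.HasDefect c r) : S.IsCob c := by
  obtain ⟨n, m, h, -⟩ := h
  exact ⟨n, m, h⟩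

theorem IsCob.hasDefect {c : D → ℤ} (h : S.IsCob c) : ∃ r, S.HasDefect c r := by
  obtain ⟨n, m, h⟩ := h
  exact ⟨_, n, m, h, rfl⟩

theorem hasDefect_zero : S.HasDefect 0 0 := ⟨0, 0, by simp, by simp⟩

theorem HasDefect.add {c c' : D → ℤ} {r r' : ℤ} (h : S.HasDefect c r) (h' : S.HasDefect c' r') :
    S.HasDefect (c + c') (r + r') := by
  obtain ⟨n, m, h1, h2⟩ := h
  obtain ⟨n', m', h1', h2'⟩ := h'
  refine ⟨n + n', m + m', fun d => ?_, ?_⟩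
  · simp only [Pi.add_apply, h1, h1']
    ring
  · simp only [Pi.add_apply, Finset.sum_add_distrib, ← h2, ← h2']
    ring

theorem HasDefect.smul {c : D → ℤ} {r : ℤ} (h : S.HasDefect c r) (k : ℤ) :
    S.HasDefect (k • c) (k * r) := by
  obtain ⟨n, m, h1, h2⟩ := h
  refine ⟨k • n, k • m, fun d => ?_, ?_⟩
  · simp only [Pi.smul_apply, smul_eq_mul, h1]
    ring
  · simp only [Pi.smul_apply, smul_eq_mul, ← Finset.mul_sum, ← h2]
    ring

theorem HasDefect.sub {c c' : D → ℤ} {r r' : ℤ} (h : S.HasDefect c r) (h' : S.HasDefect c' r') :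
    S.HasDefect (c - c') (r - r') := by
  convert h.add (h'.smul (-1)) using 1
  · simp [sub_eq_add_neg]
  · ring

theorem IsCob.add {c c' : D → ℤ} (h : S.IsCob c) (h' : S.IsCob c') : S.IsCob (c + c') := by
  obtain ⟨_, h⟩ := h.hasDefect
  obtain ⟨_, h'⟩ := h'.hasDefect
  exact (h.add h').isCob

theorem IsCob.sub {c c' : D → ℤ} (h : S.IsCob c) (h' : S.IsCob c') : S.IsCob (c - c') := by
  obtain ⟨_, h⟩ := h.hasDefect
  obtain ⟨_, h'⟩ := h'.hasDefect
  exact (h.sub h').isCob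

theorem IsCob.smul {c : D → ℤ} (h : S.IsCob c) (k : ℤ) : S.IsCob (k • c) := by
  obtain ⟨_, h⟩ := h.hasDefect
  exact (h.smul k).isCob

/-- The defect is well defined, as the constant `1` on vertices cancels `-1` on triangles and `2V
= F`. -/
theorem HasDefect.unique [Nonempty D] {c : D → ℤ} {r r' : ℤ} (h : S.HasDefect c r)
    (h' : S.HasDefect c r') : r = r' := by
  have h0 := h.sub h'
  rw [sub_self] at h0
  obtain ⟨n, m, h1, h2⟩ := h0
  obtain ⟨d₀⟩ := ‹Nonempty D›
  have h3 : ∀ d, n (S.vert d) = n (S.vert d₀) := by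
    intro d
    have e1 : ∀ d, n (S.vert (S.rot d)) = n (S.vert d) := by
      intro d
      have a := h1 d
      have b := h1 (S.rot d)
      rw [S.tri_rot] at b
      simp only [Pi.zero_apply] at a b
      linarith
    refine (S.conn (fun d => n (S.vert d) = n (S.vert d₀)) ?_ ?_ d₀ d).1 rfl
    · intro d
      rw [e1]
    · intro d
      rw [S.vert_flip, e1]
  have h4 : ∀ p, n p = n (S.vert d₀) := fun p => by
    obtain ⟨d, rfl⟩ := S.vert_surj p
    exact h3 d
  have h5 : ∀ a, m a = - n (S.vert d₀) := fun a => by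
    obtain ⟨d, rfl⟩ := S.tri_surj a
    have := h1 d
    rw [h4] at this
    simp only [Pi.zero_apply] at this
    linarith
  simp only [h4, h5, Finset.sum_const, Finset.card_univ, nsmul_eq_mul] at h2
  rw [← S.card_eq] at h2
  push_cast at h2
  linarith

/-- The first homology is torsion-free. -/
theorem isCob_of_smul {c : D → ℤ} {k : ℤ} (hk : k ≠ 0) (h : S.IsCob (k • c)) : S.IsCob c := by
  obtain ⟨n, m, h⟩ := h
  by_cases hD : Nonempty D
  swap
  · exact ⟨0, 0, fun d => absurd ⟨d⟩ hD⟩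
  obtain ⟨d₀⟩ := hD
  -- the vertex function is constant modulo `k`, and the triangle function is its negative
  have e1 : ∀ d, k ∣ n (S.vert (S.rot d)) - n (S.vert d) := by
    intro d
    have a := h d
    have b := h (S.rot d)
    rw [S.tri_rot] at b
    simp only [Pi.smul_apply, smul_eq_mul] at a b
    exact ⟨c (S.rot d) - c d, by linarith⟩
  have e2 : ∀ d, k ∣ n (S.vert d) - n (S.vert d₀) := by
    intro d
    refine (S.conn (fun d => k ∣ n (S.vert d) - n (S.vert d₀)) ?_ ?_ d₀ d).1 (by simp)
    · intro d
      constructor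
      · intro h
        simpa using dvd_sub h (e1 d)
      · intro h
        simpa using dvd_add (e1 d) h
    · intro d
      rw [S.vert_flip]
      constructor
      · intro h
        simpa using dvd_sub h (e1 d)
      · intro h
        simpa using dvd_add (e1 d) h
  have e3 : ∀ d, k ∣ m (S.tri d) + n (S.vert d₀) := by
    intro d
    have a := h d
    simp only [Pi.smul_apply, smul_eq_mul] at a
    have : m (S.tri d) + n (S.vert d₀) = k * c d - (n (S.vert d) - n (S.vert d₀)) := by linarith
    rw [this]
    exact dvd_sub (dvd_mul_right _ _) (e2 d)
  refine ⟨fun p => (n p - n (S.vert d₀)) / k, fun a => (m a + n (S.vert d₀)) / k, fun d => ?_⟩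
  obtain ⟨u, hu⟩ := e2 d
  obtain ⟨v, hv⟩ := e3 d
  simp only
  rw [hu, hv, Int.mul_ediv_cancel_left _ hk, Int.mul_ediv_cancel_left _ hk]
  have a := h d
  simp only [Pi.smul_apply, smul_eq_mul] at a
  exact mul_left_cancel₀ hk (by linarith)

namespace Curve

variable (C : S.Curve)

variable {C} in
/-- A function on arcs with a sense of rotation around the corners, as seen in the direction of the
side at an intersection point. -/
def atPt (f : C.Arc → ℤ) (x : C.PtD) : ℤ := if C.inner x then f (C.arcAt x) else - f (C.arcAt x)

/-- An oriented component of the curve: `jump a` is `1` if it runs anticlockwise along the arc `a`,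
`-1` if it runs clockwise, and `0` if the arc does not belong to it. -/
structure Strand where
  jump : C.Arc → ℤ
  jump_cases : ∀ a, jump a = 0 ∨ jump a = 1 ∨ jump a = -1
  atPt_flip : ∀ x, atPt jump (C.ptFlip x) = - atPt jump x
  conn : ∀ f : C.Arc → Prop, (∀ x, jump (C.arcAt x) ≠ 0 → f (C.arcAt x) →
    f (C.arcAt (C.ptFlip x))) → ∀ a b, jump a ≠ 0 → jump b ≠ 0 → f a → f b

variable {C}

/-- A function on arcs, extended by zero. -/
noncomputable def ext (f : C.Arc → ℤ) (d : D) (i : ℕ) : ℤ :=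
  if h : i < C.num d then f ⟨(d, i), h⟩ else 0

/-- The sum over the arcs around a corner. -/
noncomputable def total (f : C.Arc → ℤ) (d : D) : ℤ := ∑ i ∈ Finset.range (C.num d), ext f d i

theorem total_smul (f : C.Arc → ℤ) (k : ℤ) : total (fun a => k * f a) = k • total f := by
  ext d
  simp only [total, ext, Pi.smul_apply, smul_eq_mul, Finset.mul_sum]
  exact Finset.sum_congr rfl fun i _ => by split_ifs <;> simp

theorem total_add (f g : C.Arc → ℤ) : total (fun a => f a + g a) = total f + total g := by
  ext d
  simp only [total, ext, Pi.add_apply, ← Finset.sum_add_distrib]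
  exact Finset.sum_congr rfl fun i _ => by split_ifs <;> simp

theorem atPt_smul (f : C.Arc → ℤ) (k : ℤ) (x : C.PtD) :
    atPt (fun a => k * f a) x = k * atPt f x := by
  unfold atPt
  split_ifs <;> ring

theorem sum_ext (f : C.Arc → ℤ) : ∑ d, total f d = ∑ a, f a := by
  unfold total
  rw [← sum_box C.num (ext f)]
  exact Finset.sum_congr rfl fun a _ => dif_pos a.2

/-- The difference of a function on pieces across an arc. -/
noncomputable def diff (h : C.Piece → ℤ) (a : C.Arc) : ℤ := h (C.side a true) - h (C.side a false)

theorem atPt_diff (h : C.Piece → ℤ) (x : C.PtD) :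
    atPt (diff h) x = h (C.spz (C.segOf x)) - h (C.spz (C.segSucc x)) := by
  rw [spz_segOf, spz_segSucc, atPt, diff]
  cases C.inner x <;> simp

theorem atPt_diff_flip {h : C.Piece → ℤ} (hs : ∀ z, h (C.spz (C.segFlip z)) = h (C.spz z))
    (x : C.PtD) : atPt (diff h) (C.ptFlip x) = - atPt (diff h) x := by
  rw [atPt_diff, atPt_diff, ← hs (C.segOf _), ← hs (C.segSucc _), segFlip_segOf, segFlip_segSucc,
    ptFlip_ptFlip]
  ring

theorem exists_vert_eq (g : D → ℤ) (hg : ∀ d, g (S.rot (S.flip d)) = g d) :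
    ∃ n : P → ℤ, ∀ d, n (S.vert d) = g d := by
  choose r hr using S.vert_surj
  refine ⟨fun p => g (r p), fun d => ?_⟩
  exact (S.vert_ind (fun d' => g d' = g d) (fun d' => by rw [hg]) d (r (S.vert d))
    (hr _).symm).1 rfl

theorem exists_tri_eq {X : Type*} (g : D → X) (hg : ∀ d, g (S.rot d) = g d) :
    ∃ n : A → X, ∀ d, n (S.tri d) = g d := by
  choose r hr using S.tri_surj
  refine ⟨fun p => g (r p), fun d => ?_⟩
  rcases S.tri_eq d (r (S.tri d)) (hr _).symm with h | h | h <;> simp only [h, hg]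

/-- A function on pieces that does not change across the sides exhibits its total jumps as a
coboundary. -/
theorem isCob_total_diff {h : C.Piece → ℤ} (hs : ∀ z, h (C.spz (C.segFlip z)) = h (C.spz z)) :
    S.IsCob (total (diff h)) := by
  obtain ⟨n, hn⟩ := exists_vert_eq (S := S) (fun d => h (C.spz (C.segZero d))) (fun d => by
    rw [← C.spz_segFlip_segZero, hs])
  refine ⟨n, fun a => - h (.inl a), fun d => ?_⟩
  have h1 : ∀ i ∈ Finset.range (C.num d), ext (diff h) d i = h (C.pc d i) - h (C.pc d (i + 1)) := by
    intro i hi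
    rw [ext, dif_pos (Finset.mem_range.1 hi)]
    simp [diff, side]
  rw [total, Finset.sum_congr rfl h1, Finset.sum_range_sub', C.pc_of_le le_rfl, hn, spz,
    ← C.sp_of_le (Nat.zero_le _)]
  rfl

namespace Strand

variable (γ : C.Strand)

/-- A locally constant jump function is constant along a strand. -/
theorem exists_eq_mul {f : C.Arc → ℤ} (hf : ∀ x, atPt f (C.ptFlip x) = - atPt f x) :
    ∃ s, ∀ a, γ.jump a ≠ 0 → f a = s * γ.jump a := by
  by_cases h : ∃ a, γ.jump a ≠ 0
  · obtain ⟨a₀, h₀⟩ := h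
    refine ⟨f a₀ * γ.jump a₀, fun b hb => ?_⟩
    refine γ.conn (fun b => f b = f a₀ * γ.jump a₀ * γ.jump b) ?_ a₀ b h₀ hb ?_
    · intro x _ hx
      have h1 := hf x
      have h2 := γ.atPt_flip x
      simp only [atPt] at h1 h2
      cases hb1 : C.inner x <;> cases hb2 : C.inner (C.ptFlip x) <;>
        simp only [hb1, hb2, if_true, if_false, Bool.false_eq_true] at h1 h2 <;>
        grind
    · rcases γ.jump_cases a₀ with h | h | h <;> simp [h] at h₀ ⊢
  · exact ⟨0, fun a ha => absurd ⟨a, ha⟩ h⟩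

/-- The signed numbers of arcs of the strand around the corners. -/
noncomputable def ct : D → ℤ := total γ.jump

/-- The lift of a residue modulo two. -/
def lift (r : ZMod 2) : ℤ := r.val

theorem lift_eq_zero {r : ZMod 2} : lift r = 0 ↔ r = 0 := by
  revert r; decide

/-- A function modulo two on the pieces that does not change across the sides and vanishes
on one side of an essential strand, without changing elsewhere, is zero. -/
theorem eq_zero_of_jump (hγ : ¬ S.IsCob γ.ct) {n : ℤ} {h : C.Piece → ZMod 2}
    (hs : ∀ z, h (C.spz (C.segFlip z)) = h (C.spz z))
    (h0 : ∀ a, γ.jump a = 0 → h (C.side a true) = h (C.side a false))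
    (h1 : ∀ a, 0 < n * γ.jump a → h (C.side a false) = 0)
    (h2 : ∀ a, n * γ.jump a < 0 → h (C.side a true) = 0) (hn : n ≠ 0) : h = 0 := by
  set h' : C.Piece → ℤ := fun v => lift (h v) with hh'
  have hs' : ∀ z, h' (C.spz (C.segFlip z)) = h' (C.spz z) := fun z => by simp [hh', hs]
  -- the lift to `{0, 1}` jumps by a constant multiple of the strand, which is then a coboundary
  obtain ⟨s, hs1⟩ := γ.exists_eq_mul (atPt_diff_flip hs')
  have hs2 : ∀ a, diff h' a = s * γ.jump a := by
    intro a
    by_cases ha : γ.jump a = 0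
    · simp [diff, hh', h0 a ha, ha]
    · exact hs1 a ha
  have hcob := isCob_total_diff hs'
  have hd : diff h' = fun a => s * γ.jump a := funext hs2
  rw [hd, total_smul] at hcob
  have hstrand : ∃ a, γ.jump a ≠ 0 := by
    by_contra hno
    push Not at hno
    apply hγ
    refine ⟨0, 0, fun d => ?_⟩
    simp [ct, total, ext, hno]
  obtain ⟨a₀, ha₀⟩ := hstrand
  have hnz : n * γ.jump a₀ ≠ 0 := mul_ne_zero hn ha₀
  -- the jumps of the lift are at most one, so `s` would be `1` or `-1`
  have hs0 : s = 0 := by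
    by_contra hs0
    apply hγ
    have hsq : s * s = 1 := by
      have e1 := hs2 a₀
      have e2 : ∀ r r' : ZMod 2, lift r - lift r' = 0 ∨ lift r - lift r' = 1 ∨
        lift r - lift r' = -1 := by decide
      have e3 := e2 (h (C.side a₀ true)) (h (C.side a₀ false))
      simp only [diff, hh'] at e1
      rw [e1] at e3
      rcases γ.jump_cases a₀ with j | j | j
      · exact absurd j ha₀
      all_goals
        rw [j] at e3
        simp only [mul_one, mul_neg] at e3
        rcases e3 with e | e | e
        · exact absurd (by linarith) hs0
        · have : s = 1 ∨ s = -1 := by omega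
          rcases this with rfl | rfl <;> rfl
        · have : s = 1 ∨ s = -1 := by omega
          rcases this with rfl | rfl <;> rfl
    have := hcob.smul s
    rwa [smul_smul, hsq, one_smul] at this
  -- a function without jumps is constant, by connectedness
  have hpc : ∀ d i, h' (C.pc d i) = h' (.inl (S.tri d)) := by
    intro d i
    by_cases hi : C.num d ≤ i
    · rw [C.pc_of_le hi]
    · have e : ∀ j, ∀ i, i + j = C.num d → h' (C.pc d i) = h' (.inl (S.tri d)) := by
        intro j
        induction j with
        | zero => intro i hi; rw [C.pc_of_le (by omega)]
        | succ j ih =>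
          intro i hi
          rw [← ih (i + 1) (by omega)]
          have := hs2 ⟨(d, i), by simp only; omega⟩
          rw [hs0, zero_mul, diff, side, side, if_pos rfl, if_neg (by simp)] at this
          exact sub_eq_zero.1 this
      exact e (C.num d - i) i (by omega)
  have hsp : ∀ z, h' (C.spz z) = h' (.inl (S.tri z.1.1)) := by
    intro z
    rw [spz, sp]
    split_ifs
    · exact hpc _ _
    · rw [hpc, S.tri_rot]
  have hall : ∀ v : C.Piece, h' v = h' (.inl (S.tri a₀.1.1)) := by
    have e : ∀ d, h' (.inl (S.tri d)) = h' (.inl (S.tri a₀.1.1)) := by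
      intro d
      refine (S.conn (fun d => h' (.inl (S.tri d)) = h' (.inl (S.tri a₀.1.1))) ?_ ?_ a₀.1.1 d).1
        rfl
      · intro d
        rw [S.tri_rot]
      · intro d
        have := hs' (C.segZero d)
        rw [hsp, hsp] at this
        have e1 : (C.segFlip (C.segZero d)).1.1 = S.flip d := rfl
        have e2 : (C.segZero d).1.1 = d := rfl
        rw [e1, e2] at this
        rw [this]
    rintro (a | a)
    · obtain ⟨d, rfl⟩ := S.tri_surj a
      exact e d
    · rw [← C.pc_arc a, hpc, e]
  have hz : h' (.inl (S.tri a₀.1.1)) = 0 := by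
    rcases lt_or_gt_of_ne hnz with hlt | hgt
    · rw [← hall (C.side a₀ true), hh']
      simp only
      rw [h2 a₀ hlt]
      rfl
    · rw [← hall (C.side a₀ false), hh']
      simp only
      rw [h1 a₀ hgt]
      rfl
  ext v
  exact lift_eq_zero.1 ((hall v).trans hz)

end Strand

end Curve

end TriTorus

/-! ### Exactness of the complex weighted by a strand -/

namespace TriTorus

set_option linter.unusedSectionVars false

variable {D P A : Type*} [Fintype D] [Fintype P] [Fintype A] {S : TriTorus D P A}

namespace Curve

variable {C : S.Curve}

open Matrix

theorem two_val {a b : ZMod 2} (h : a + b = 0) : a = b := by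
  revert a b; decide

theorem arcAt_symm (a : C.Arc) (b : Bool) : C.arcAt (C.ptEquiv.symm (a, b)) = a :=
  congrArg Prod.fst (C.ptEquiv.apply_symm_apply (a, b))

theorem inner_symm (a : C.Arc) (b : Bool) : C.inner (C.ptEquiv.symm (a, b)) = b :=
  congrArg Prod.snd (C.ptEquiv.apply_symm_apply (a, b))

namespace Weight

variable (W : C.Weight)

theorem endVal_segFlip {g : C.Pt ⊕ P → ZMod 2} (hg : g ᵥ* W.cob₁ (0 : ZMod 2) = 0) (z : C.SegD) :
    W.endVal 0 g (C.segFlip z).1.1 (C.segFlip z).1.2 = W.endVal 0 g z.1.1 z.1.2 := by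
  have := congrFun hg (.inr (Half.mk C.segFlip_segFlip z))
  rw [W.vecMul_cob₁_seg] at this
  exact (two_val this).symm

theorem endVal_succ {g : C.Pt ⊕ P → ZMod 2} (hg : g ᵥ* W.cob₁ (0 : ZMod 2) = 0) (x : C.PtD) :
    W.endVal 0 g x.1.1 (x.1.2 + 1) =
      g (.inl (Half.mk C.ptFlip_ptFlip x)) * 0 ^ W.wa (C.arcAt x) (!C.inner x) := by
  have h1 := W.endVal_segFlip hg (C.segSucc x)
  rw [segFlip_segSucc] at h1
  refine h1.symm.trans ((W.endVal_of_lt 0 g (C.ptFlip x).2).trans ?_)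
  rw [← W.wa_flip, ← Half.mk_apply (hε := C.ptFlip_ptFlip) x]

/-- When the weights at the sides vanish, the segments at the two ends of a piece around a corner have
equal values. -/
theorem endVal_rot (hy : ∀ d, W.y d = 0) (hu : ∀ d, W.u d = 0)
    {g : C.Pt ⊕ P → ZMod 2} (hg : g ᵥ* W.cob₁ (0 : ZMod 2) = 0)
    (d : D) (i : ℕ) (hi : i ≤ C.num (S.rot d)) :
    W.endVal 0 g (S.rot d) i = W.endVal 0 g d (C.pts d - i) := by
  have hsucc := W.endVal_succ hg
  have hpt : ∀ a b b', g (.inl (Half.mk C.ptFlip_ptFlip (C.ptEquiv.symm (a, b)))) =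
      g (.inl (Half.mk C.ptFlip_ptFlip (C.ptEquiv.symm (a, b')))) := by
    intro a b b'
    have h1 := congrFun hg (.inl a)
    rw [W.vecMul_cob₁_arc, Fintype.sum_bool, hu, hu] at h1
    simp only [pow_zero, mul_one, Pi.zero_apply] at h1
    have h2 := two_val h1
    cases b <;> cases b' <;> first | rfl | exact h2 | exact h2.symm
  by_cases hlt : i < C.num (S.rot d)
  · set a : C.Arc := ⟨(S.rot d, i), hlt⟩ with ha
    set x := C.ptEquiv.symm (a, true) with hx
    set x' := C.ptEquiv.symm (a, false) with hx'
    have e1 : x.1 = (S.rot d, i) := rfl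
    have e2 : x'.1 = (d, C.pts d - 1 - i) := by
      simp [hx', ptEquiv, ha]
    have e3 : W.endVal 0 g (S.rot d) i = W.endVal 0 g x.1.1 x.1.2 := by rw [e1]
    have e4 : W.endVal 0 g d (C.pts d - i) = W.endVal 0 g x'.1.1 (x'.1.2 + 1) := by
      rw [e2]
      simp only
      congr 1
      simp only [pts]
      omega
    rw [e3, e4, hsucc, W.endVal_of_lt 0 g x.2]
    rw [show (⟨(x.1.1, x.1.2), x.2⟩ : C.PtD) = x from rfl, hx, hx', inner_symm, inner_symm,
      arcAt_symm, arcAt_symm, hpt a true false]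
    rfl
  · by_cases h0 : i = 0
    · subst h0
      have h1 := W.endVal_segFlip hg (C.segZero (S.rot d))
      have h2 : W.endVal 0 g (S.rot d) 0 = _ := h1.symm
      have h3 : (C.segFlip (C.segZero (S.rot d))).1.2 = C.pts (S.rot d) := Nat.sub_zero _
      have h4 : (C.segFlip (C.segZero (S.rot d))).1.1 = S.flip (S.rot d) := rfl
      rw [h2, h3, h4, ← C.pts_flip, W.endVal_of_ge 0 g (lt_irrefl _), Nat.sub_zero,
        W.endVal_of_ge 0 g (lt_irrefl _), hy, hy, S.flip_flip, S.vert_flip]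
    · obtain ⟨k, rfl⟩ := Nat.exists_eq_succ_of_ne_zero h0
      have hk : k < C.num (S.rot d) := hi
      set a : C.Arc := ⟨(S.rot d, k), hk⟩ with ha
      set x := C.ptEquiv.symm (a, true) with hx
      set x' := C.ptEquiv.symm (a, false) with hx'
      have e1 : x.1 = (S.rot d, k) := rfl
      have e2 : x'.1 = (d, C.pts d - 1 - k) := by
        simp [hx', ptEquiv, ha]
      have e3 : W.endVal 0 g (S.rot d) (k + 1) = W.endVal 0 g x.1.1 (x.1.2 + 1) := by rw [e1]
      have e4 : W.endVal 0 g d (C.pts d - (k + 1)) = W.endVal 0 g x'.1.1 x'.1.2 := by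
        rw [e2]
        simp only
        congr 1
        omega
      rw [e3, e4, hsucc, W.endVal_of_lt 0 g x'.2]
      rw [show (⟨(x'.1.1, x'.1.2), x'.2⟩ : C.PtD) = x' from rfl, hx, hx', inner_symm, inner_symm,
        arcAt_symm, arcAt_symm, hpt a true false]
      rfl

end Weight

namespace Strand

variable (γ : C.Strand)

/-- The exponents that count `n` times the strand. -/
noncomputable def weight (n : ℤ) : C.Weight where
  u _ := 0
  y _ := 0
  wa a b := (if b then n * γ.jump a else - (n * γ.jump a)).toNat
  wa_flip x := by
    have h := γ.atPt_flip x
    simp only [atPt] at h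
    cases h1 : C.inner x <;> cases h2 : C.inner (C.ptFlip x) <;>
    · simp only [h1, h2, if_true, if_false, Bool.false_eq_true, Bool.not_true, Bool.not_false]
        at h ⊢
      first
        | rw [h]; congr 1; ring
        | rw [neg_eq_iff_eq_neg.1 h]; congr 1; ring
  u_rot _ := rfl

/-- Exactness at the pieces, for an essential strand. -/
theorem weight_exact₀ (hγ : ¬ S.IsCob γ.ct) {n : ℤ} (hn : n ≠ 0) {h : C.Piece → ZMod 2}
    (hh : (γ.weight n).cob₀ (0 : ZMod 2) *ᵥ h = 0) : h = 0 := by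
  have hA : ∀ a, _ := fun a => (Weight.cob₀_mulVec_arc _ _ h a).symm.trans (congrFun hh (.inl a))
  refine γ.eq_zero_of_jump hγ (n := n) ?_ ?_ ?_ ?_ hn
  · intro z
    have := congrFun hh (.inr (Half.mk C.segFlip_segFlip z))
    rw [Weight.cob₀_mulVec_seg] at this
    simp only [weight, pow_zero, one_mul, Pi.zero_apply] at this
    exact (two_val this).symm
  · intro a ha
    have := hA a
    simp only [weight, ha, mul_zero, neg_zero, ite_self, Int.toNat_zero, pow_zero, one_mul,
      Pi.zero_apply] at this
    exact two_val this
  · intro a ha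
    have := hA a
    simp only [weight, if_true, if_false, Bool.false_eq_true, Pi.zero_apply] at this
    rw [zero_pow (by omega), zero_mul, zero_add, show (-(n * γ.jump a)).toNat = 0 by omega,
      pow_zero, one_mul] at this
    exact this
  · intro a ha
    have := hA a
    simp only [weight, if_true, if_false, Bool.false_eq_true, Pi.zero_apply] at this
    rw [zero_pow (M₀ := ZMod 2) (n := (-(n * γ.jump a)).toNat) (by omega), zero_mul, add_zero,
      show (n * γ.jump a).toNat = 0 by omega, pow_zero, one_mul] at this
    exact this

/-- Exactness at the points and vertices, for an essential strand. -/
theorem weight_exact₁ (hγ : ¬ S.IsCob γ.ct) {n : ℤ} (hn : n ≠ 0) {g : C.Pt ⊕ P → ZMod 2}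
    (hg : g ᵥ* (γ.weight n).cob₁ (0 : ZMod 2) = 0) : g = 0 := by
  set W := γ.weight n with hW
  set G := W.endVal 0 g with hG
  have hrot : ∀ d i, i ≤ C.num (S.rot d) → G (S.rot d) i = G d (C.pts d - i) :=
    W.endVal_rot (fun _ => rfl) (fun _ => rfl) hg
  -- the values at the ends of the segments give a function on the pieces
  obtain ⟨H₀, hH₀⟩ := exists_tri_eq (S := S) (fun d => G d (C.num d)) (fun d => by
    rw [hrot d _ le_rfl]
    congr 1
    simp [pts])
  set H : C.Piece → ZMod 2 := Sum.elim H₀ fun a => G a.1.1 a.1.2 with hH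
  have hpc : ∀ d i, i ≤ C.num d → H (C.pc d i) = G d i := by
    intro d i hi
    rcases hi.lt_or_eq with h | rfl
    · exact congrArg H (C.pc_arc ⟨(d, i), h⟩)
    · rw [C.pc_of_le le_rfl]
      exact hH₀ d
  have hsp : ∀ z : C.SegD, H (C.spz z) = G z.1.1 z.1.2 := by
    intro z
    have hz := z.2
    rw [spz, sp]
    simp only [pts] at hz
    split_ifs with h
    · exact hpc _ _ h.le
    · rw [hpc _ _ (by simp only [pts]; omega), hrot _ _ (by simp only [pts]; omega)]
      congr 1
      simp only [pts]
      omega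
  have hsucc : ∀ x : C.PtD, G x.1.1 (x.1.2 + 1) = _ := W.endVal_succ hg
  have hcur : ∀ x : C.PtD, G x.1.1 x.1.2 =
      g (.inl (Half.mk C.ptFlip_ptFlip x)) * 0 ^ W.wa (C.arcAt x) (C.inner x) :=
    fun x => W.endVal_of_lt 0 g x.2
  have hin : ∀ a, H (C.side a true) =
      g (.inl (Half.mk C.ptFlip_ptFlip (C.ptEquiv.symm (a, true)))) * 0 ^ W.wa a true := by
    intro a
    have h1 := hcur (C.ptEquiv.symm (a, true))
    have h2 := hsp (C.segOf (C.ptEquiv.symm (a, true)))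
    rw [spz_segOf, arcAt_symm, inner_symm] at h2
    rw [arcAt_symm, inner_symm] at h1
    exact h2.trans h1
  have hout : ∀ a, H (C.side a false) =
      g (.inl (Half.mk C.ptFlip_ptFlip (C.ptEquiv.symm (a, true)))) * 0 ^ W.wa a false := by
    intro a
    have h1 := hsucc (C.ptEquiv.symm (a, true))
    have h2 := hsp (C.segSucc (C.ptEquiv.symm (a, true)))
    rw [spz_segSucc, arcAt_symm, inner_symm] at h2
    rw [arcAt_symm, inner_symm] at h1
    exact h2.trans h1
  have hwt : ∀ a, W.wa a true = (n * γ.jump a).toNat := fun a => by simp [hW, weight]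
  have hwf : ∀ a, W.wa a false = (-(n * γ.jump a)).toNat := fun a => by simp [hW, weight]
  -- it vanishes on the side of the strand where the weight is positive
  have hzero : H = 0 := by
    refine γ.eq_zero_of_jump hγ (n := -n) ?_ ?_ ?_ ?_ (neg_ne_zero.2 hn)
    · intro z
      rw [hsp, hsp]
      exact W.endVal_segFlip hg z
    · intro a ha
      rw [hin, hout, hwt, hwf, ha, mul_zero, neg_zero]
    · intro a ha
      rw [hout, hwf, zero_pow (by rw [neg_mul] at ha; omega), mul_zero]
    · intro a ha
      rw [hin, hwt, zero_pow (by rw [neg_mul] at ha; omega), mul_zero]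
  have hG0 : ∀ z : C.SegD, G z.1.1 z.1.2 = 0 := fun z => by rw [← hsp, hzero]; rfl
  ext (q | p)
  · induction q using Half.ind with
    | h x =>
      have h1 := hcur x
      have h2 := hsucc x
      rw [show G x.1.1 x.1.2 = 0 from hG0 (C.segOf x)] at h1
      rw [show G x.1.1 (x.1.2 + 1) = 0 from hG0 (C.segSucc x)] at h2
      have h3 : W.wa (C.arcAt x) (C.inner x) = 0 ∨ W.wa (C.arcAt x) (!C.inner x) = 0 := by
        cases C.inner x <;> simp only [Bool.not_true, Bool.not_false, hwt, hwf] <;> omega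
      rcases h3 with h | h
      · rw [h, pow_zero, mul_one] at h1
        exact h1.symm
      · rw [h, pow_zero, mul_one] at h2
        exact h2.symm
  · obtain ⟨d, rfl⟩ := S.vert_surj p
    have h1 : G (S.flip d) (C.pts d) = 0 := hG0 (C.segFlip (C.segZero d))
    rw [hG, ← C.pts_flip d, W.endVal_of_ge 0 g (lt_irrefl _), S.flip_flip] at h1
    simpa [hW, weight] using h1

end Strand

end Curve

end TriTorus

/-! ### Exactness of the complex weighted by a height -/

section Torsion

open PowerSeries

theorem X_pow_toNat_mul {k : Type*} [Field k] {a b : ℤ} {u v : ℕ} (ha : 0 ≤ a) (hb : 0 ≤ b)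
    (h : a + u = v + b) : (X : k⟦X⟧) ^ a.toNat * X ^ u = X ^ v * X ^ b.toNat := by
  rw [← pow_add, ← pow_add]
  congr 1
  omega

/-- A bound for finitely many integers. -/
theorem exists_nonneg_add {V : Type*} [Fintype V] (f : V → ℤ) :
    ∃ B : ℕ, ∀ K : ℤ, B ≤ K → ∀ v, 0 ≤ f v + K := by
  refine ⟨∑ v, (f v).natAbs, fun K hK v => ?_⟩
  have := Finset.single_le_sum (f := fun v => (f v).natAbs) (fun _ _ => Nat.zero_le _)
    (Finset.mem_univ v)
  omega

end Torsion

theorem Half.exists_lift {X Y : Type*} {ε : Perm X} {hε : ∀ x, ε (ε x) = x} (f : X → Y)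
    (hf : ∀ x, f (ε x) = f x) : ∃ g : Half ε hε → Y, ∀ x, g (Half.mk hε x) = f x := by
  refine ⟨Quotient.lift f ?_, fun x => rfl⟩
  rintro x y (rfl | rfl)
  · rfl
  · exact (hf x).symm

namespace TriTorus

set_option linter.unusedSectionVars false

variable {D P A : Type*} [Fintype D] [Fintype P] [Fintype A] {S : TriTorus D P A}

variable (S) in
/-- The cocycle condition for functions on corners. -/
def IsClosed (c : D → ℤ) : Prop :=
  ∀ d, c d - c (S.rot d) = c (S.rot (S.flip d)) - c (S.flip d)

variable (S) in
/-- There is no non-empty set of vertices that is closed under passing to neighbours of the same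
height and has no lower neighbours, heights being measured by the closed cochain `c`. -/
def NoLocalMin (c : D → ℤ) : Prop :=
  ∀ Z : P → Prop, (∀ d, Z (S.vert d) → c d ≤ c (S.rot d) ∧
    (c (S.rot d) = c d → Z (S.vert (S.rot d)))) → ∀ p, ¬ Z p

variable (S) in
/-- The maximum of a cochain on a triangle. -/
def triMax (c : D → ℤ) (d : D) : ℤ := max (c d) (max (c (S.rot d)) (c (S.rot (S.rot d))))

variable (S) in
/-- The maximum of a cochain on a side. -/
def sideMax (c : D → ℤ) (d : D) : ℤ := max (c d) (c (S.rot d))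

theorem triMax_rot (c : D → ℤ) (d : D) : S.triMax c (S.rot d) = S.triMax c d := by
  simp only [triMax, S.rot_rot_rot]
  omega

theorem sideMax_le (c : D → ℤ) (d : D) : S.sideMax c d ≤ S.triMax c d := by
  simp only [triMax, sideMax]
  omega

theorem le_sideMax (c : D → ℤ) (d : D) : c d ≤ S.sideMax c d := le_max_left _ _

namespace Curve

variable {C : S.Curve}

open Matrix

variable (C) in
/-- The exponents that measure the heights of the cells with respect to a closed cochain. -/
def heightWeight {c : D → ℤ} (hc : S.IsClosed c) : C.Weight where
  u d := (S.triMax c d - S.sideMax c d).toNat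
  y d := (S.sideMax c d - c d).toNat
  wa _ _ := 0
  wa_flip _ := rfl
  u_rot d := by
    have h := hc d
    have h1 := S.triMax_rot c d
    have h2 := S.sideMax_le c d
    have h3 := S.sideMax_le c (S.rot d)
    have h4 := S.le_sideMax c d
    have h5 := S.le_sideMax c (S.rot d)
    have h6 := S.le_sideMax c (S.flip d)
    have h7 : S.sideMax c (S.flip d) - c (S.flip d) = S.sideMax c d - c (S.rot d) := by
      simp only [sideMax]
      omega
    omega

variable {c : D → ℤ} (hc : S.IsClosed c)

theorem triMax_eq_of_u {d : D} (h : (C.heightWeight hc).u d = 0) :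
    S.sideMax c d = S.triMax c d := by
  have := S.sideMax_le c d
  simp only [heightWeight] at h
  omega

/-- Exactness at the pieces, for heights without local maxima. -/
theorem heightWeight_exact₀ (hmax : S.NoLocalMin (-c)) {h : C.Piece → ZMod 2}
    (hh : (C.heightWeight hc).cob₀ (0 : ZMod 2) *ᵥ h = 0) : h = 0 := by
  set W := C.heightWeight hc with hW
  have harc : ∀ a, h (C.side a true) = h (C.side a false) := by
    intro a
    have := congrFun hh (.inl a)
    rw [Weight.cob₀_mulVec_arc] at this
    simp only [hW, heightWeight, pow_zero, one_mul, Pi.zero_apply] at this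
    exact two_val this
  -- the arcs have weight zero, so `h` is a function on the triangles
  have hpc : ∀ d i, h (C.pc d i) = h (.inl (S.tri d)) := by
    intro d i
    by_cases hi : C.num d ≤ i
    · rw [C.pc_of_le hi]
    · have e : ∀ j, ∀ i, i + j = C.num d → h (C.pc d i) = h (.inl (S.tri d)) := by
        intro j
        induction j with
        | zero => intro i hi; rw [C.pc_of_le (by omega)]
        | succ j ih =>
          intro i hi
          rw [← ih (i + 1) (by omega)]
          exact harc ⟨(d, i), by simp only; omega⟩
      exact e (C.num d - i) i (by omega)
  have hsp : ∀ z, h (C.spz z) = h (.inl (S.tri z.1.1)) := by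
    intro z
    rw [spz, sp]
    split_ifs
    · exact hpc _ _
    · rw [hpc, S.tri_rot]
  have hseg : ∀ d, 0 ^ W.u d * h (.inl (S.tri d)) +
      0 ^ W.u (S.flip d) * h (.inl (S.tri (S.flip d))) = 0 := by
    intro d
    have := congrFun hh (.inr (Half.mk C.segFlip_segFlip (C.segZero d)))
    rw [Weight.cob₀_mulVec_seg, hsp, hsp] at this
    exact this
  -- a triangle in the support and a highest corner of it
  have hZ := hmax fun p => ∃ d, S.vert d = p ∧ c d = S.triMax c d ∧ h (.inl (S.tri d)) ≠ 0
  have hu : ∀ d, (c d = S.triMax c d ∨ c (S.rot d) = S.triMax c d) → W.u d = 0 := by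
    intro d hd
    simp only [hW, heightWeight, triMax, sideMax] at hd ⊢
    omega
  have hcross : ∀ d, (c d = S.triMax c d ∨ c (S.rot d) = S.triMax c d) →
      h (.inl (S.tri d)) ≠ 0 → S.sideMax c (S.flip d) = S.triMax c (S.flip d) ∧
      h (.inl (S.tri (S.flip d))) ≠ 0 := by
    intro d hd hne
    have h1 := hseg d
    rw [hu d hd, pow_zero, one_mul] at h1
    have h2 : W.u (S.flip d) = 0 := by
      by_contra h0
      rw [zero_pow h0, zero_mul, add_zero] at h1
      exact hne h1
    refine ⟨triMax_eq_of_u hc h2, ?_⟩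
    rw [h2, pow_zero, one_mul] at h1
    rwa [← two_val h1]
  -- the support of `h` propagates around a highest vertex of a triangle in it
  have hall : ∀ d d', S.vert d = S.vert d' →
      (c d = S.triMax c d ∧ h (.inl (S.tri d)) ≠ 0) →
      (c d' = S.triMax c d' ∧ h (.inl (S.tri d')) ≠ 0) := by
    have hfwd : ∀ d, (c d = S.triMax c d ∧ h (.inl (S.tri d)) ≠ 0) →
        c (S.rot (S.flip d)) = S.triMax c (S.rot (S.flip d)) ∧
          h (.inl (S.tri (S.rot (S.flip d)))) ≠ 0 := by
      rintro d ⟨h1, h2⟩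
      obtain ⟨h3, h4⟩ := hcross d (Or.inl h1) h2
      rw [S.tri_rot, triMax_rot]
      refine ⟨?_, h4⟩
      have h5 := hc d
      simp only [triMax, sideMax] at h1 h3 ⊢
      omega
    intro d d' hv
    refine (S.vert_ind (fun d => c d = S.triMax c d ∧ h (.inl (S.tri d)) ≠ 0) ?_ d d' hv).1
    intro d
    refine ⟨fun hd => ?_, hfwd d⟩
    -- going back around the vertex, through the other side
    obtain ⟨h1, h2⟩ := hd
    rw [S.tri_rot] at h2
    rw [triMax_rot] at h1
    obtain ⟨h3, h4⟩ := hcross (S.flip d) (Or.inr h1) h2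
    rw [S.flip_flip] at h3 h4
    refine ⟨?_, h4⟩
    have h5 := hc d
    simp only [triMax, sideMax] at h1 h3 ⊢
    omega
  have hzero : ∀ d, h (.inl (S.tri d)) = 0 := by
    intro d
    by_contra hne
    have hd : ∃ e, S.tri e = S.tri d ∧ c e = S.triMax c e := by
      have : c d = S.triMax c d ∨ c (S.rot d) = S.triMax c d ∨
          c (S.rot (S.rot d)) = S.triMax c d := by
        simp only [triMax]
        omega
      rcases this with h | h | h
      · exact ⟨d, rfl, h⟩
      · exact ⟨S.rot d, S.tri_rot d, by rw [triMax_rot]; exact h⟩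
      · exact ⟨S.rot (S.rot d), by rw [S.tri_rot, S.tri_rot], by
          rw [triMax_rot, triMax_rot]; exact h⟩
    obtain ⟨e, he1, he2⟩ := hd
    refine hZ ?_ (S.vert e) ⟨e, rfl, he2, by rwa [he1]⟩
    rintro d ⟨e, hv, he⟩
    obtain ⟨h1, h2⟩ := hall e d hv he
    constructor
    · simp only [Pi.neg_apply, triMax] at h1 ⊢
      omega
    · intro heq
      refine ⟨S.rot d, rfl, ?_, ?_⟩
      · rw [triMax_rot]
        simp only [Pi.neg_apply, triMax] at heq h1 ⊢
        omega
      · rwa [S.tri_rot]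
  ext v
  rcases v with a | a
  · obtain ⟨d, rfl⟩ := S.tri_surj a
    exact hzero d
  · rw [← C.pc_arc a, hpc, hzero]
    rfl

/-- Exactness at the points and vertices, for heights without local minima. -/
theorem heightWeight_exact₁ (hmin : S.NoLocalMin c) {g : C.Pt ⊕ P → ZMod 2}
    (hg : g ᵥ* (C.heightWeight hc).cob₁ (0 : ZMod 2) = 0) : g = 0 := by
  set W := C.heightWeight hc with hW
  -- along a side the function is constant, so it is given by its values at the vertices
  have hval : ∀ d j, j ≤ C.pts d → W.endVal 0 g d j = W.endVal 0 g d 0 := by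
    intro d j
    induction j with
    | zero => intro _; rfl
    | succ j ih =>
      intro hj
      rw [← ih (Nat.le_of_succ_le hj)]
      have h1 : W.endVal 0 g d (j + 1) = _ := W.endVal_succ hg ⟨(d, j), hj⟩
      rw [h1, W.endVal_of_lt 0 g (d := d) (j := j) hj]
      simp [hW, heightWeight]
  have hy : ∀ d, W.y d = 0 ↔ c (S.rot d) ≤ c d := by
    intro d
    simp only [hW, heightWeight, sideMax]
    omega
  have hside : ∀ d, g (.inr (S.vert d)) * 0 ^ W.y d =
      g (.inr (S.vert (S.rot d))) * 0 ^ W.y (S.flip d) := by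
    intro d
    have h1 : W.endVal 0 g (S.flip d) (C.pts d) = W.endVal 0 g d 0 :=
      W.endVal_segFlip hg (C.segZero d)
    rw [← C.pts_flip, W.endVal_of_ge 0 g (lt_irrefl _), S.flip_flip, ← hval d _ le_rfl,
      W.endVal_of_ge 0 g (lt_irrefl _), S.vert_flip] at h1
    exact h1
  have hv : ∀ p, g (.inr p) = 0 := by
    intro p
    by_contra hne
    refine hmin (fun p => g (.inr p) ≠ 0) ?_ p hne
    intro d hd
    have h1 := hside d
    have h2 := hc d
    have hd1 := hy d
    have hd2 := hy (S.flip d)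
    constructor
    · by_contra hlt
      rw [hd1.2 (by omega), zero_pow (show W.y (S.flip d) ≠ 0 by rw [Ne, hd2]; omega)] at h1
      simp only [pow_zero, mul_one, mul_zero] at h1
      exact hd h1
    · intro heq
      rw [hd1.2 (by omega), hd2.2 (by omega), pow_zero, mul_one, mul_one] at h1
      rwa [← h1]
  ext (q | p)
  · induction q using Half.ind with
    | h x =>
      have h1 := W.endVal_of_lt 0 g x.2
      have h2 : W.wa (C.arcAt ⟨(x.1.1, x.1.2), x.2⟩) (C.inner ⟨(x.1.1, x.1.2), x.2⟩) = 0 := rfl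
      rw [h2, pow_zero, mul_one, hval _ _ x.2.le, ← hval x.1.1 _ le_rfl,
        W.endVal_of_ge 0 g (lt_irrefl _), hv, zero_mul] at h1
      exact h1.symm
  · exact hv p

end Curve

end TriTorus

/-! ### The defect of a curve and of its strands -/

namespace TriTorus

set_option linter.unusedSectionVars false

variable {D P A : Type*} [Fintype D] [Fintype P] [Fintype A] {S : TriTorus D P A}

namespace Curve

variable {C : S.Curve}

/-- The function on pieces that vanishes on the middle pieces of the triangles and jumps by `f` across
the arcs. -/
noncomputable def level (f : C.Arc → ℤ) : C.Piece → ℤ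
  | .inl _ => 0
  | .inr a => ∑ i ∈ Finset.Ico a.1.2 (C.num a.1.1), ext f a.1.1 i

theorem level_pc (f : C.Arc → ℤ) (d : D) (i : ℕ) :
    level f (C.pc d i) = ∑ i ∈ Finset.Ico i (C.num d), ext f d i := by
  by_cases h : i < C.num d
  · rw [C.pc_arc ⟨(d, i), h⟩, level]
  · rw [C.pc_of_le (not_lt.1 h), Finset.Ico_eq_empty h, level, Finset.sum_empty]

theorem diff_level (f : C.Arc → ℤ) (a : C.Arc) : diff (level f) a = f a := by
  rw [diff, side, side, if_pos rfl, if_neg (by simp), level_pc, level_pc,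
    Finset.sum_eq_sum_Ico_succ_bot a.2, add_sub_cancel_right]
  exact dif_pos a.2

theorem level_pc_zero (f : C.Arc → ℤ) (d : D) : level f (C.pc d 0) = total f d := by
  rw [level_pc, total, Finset.range_eq_Ico]

variable (C) in
/-- The triangle that contains a piece. -/
def triOf : C.Piece → A
  | .inl a => a
  | .inr a => S.tri a.1.1

theorem triOf_pc (d : D) (i : ℕ) : C.triOf (C.pc d i) = S.tri d := by
  unfold pc
  split_ifs <;> rfl

theorem triOf_spz (z : C.SegD) : C.triOf (C.spz z) = S.tri z.1.1 := by
  rw [spz, sp]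
  split_ifs
  · rw [triOf_pc]
  · rw [triOf_pc, S.tri_rot]

theorem triOf_side (a : C.Arc) (b : Bool) : C.triOf (C.side a b) = S.tri a.1.1 := by
  rw [side]
  split_ifs <;> rw [triOf_pc]

theorem tri_arcAt (x : C.PtD) : S.tri (C.arcAt x).1.1 = S.tri x.1.1 := by
  unfold arcAt
  split_ifs
  · rfl
  · exact S.tri_rot _

namespace Strand

open PowerSeries

variable (γ : C.Strand) {c : D → ℤ}

set_option maxHeartbeats 1600000 in
/-- The defect between a multiple of an essential strand and a tight closed cochain in the same
class depends on the cochain only. This compares the two lattices given by the exponents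
of the strand and of the heights in one acyclic complex. -/
theorem defect_eq (hc : S.IsClosed c) (hγ : ¬ S.IsCob γ.ct) (hmin : S.NoLocalMin c) (hmax : S.NoLocalMin (-c))
    {n : ℤ} (hn : n ≠ 0) {r : ℤ} (hr : S.HasDefect (n • γ.ct - c) r) :
    3 * r = 2 * ∑ d, S.triMax c d - 3 * ∑ d, S.sideMax c d := by
  classical
  obtain ⟨nP, m, h1, rfl⟩ := hr
  obtain ⟨M, hM⟩ := exists_tri_eq (S := S) (S.triMax c) fun d => S.triMax_rot c d
  set J : C.Arc → ℤ := fun a => n * γ.jump a with hJ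
  have hJt : total J = n • γ.ct := total_smul _ _
  have hJflip : ∀ x, atPt J (C.ptFlip x) = - atPt J x := fun x => by
    rw [hJ, atPt_smul, atPt_smul, γ.atPt_flip]
    ring
  have hJpt : ∀ x, atPt J x = level J (C.spz (C.segOf x)) - level J (C.spz (C.segSucc x)) := by
    intro x
    rw [← atPt_diff]
    simp only [atPt, diff_level]
  -- the exponents of the cells
  set ψ₀ : C.Piece → ℤ := fun v => - m (C.triOf v) - M (C.triOf v) + level J v with hψ₀
  set ψa : C.Arc → ℤ := fun a => ψ₀ (C.side a true) - max (J a) 0 with hψa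
  set ψz : C.SegD → ℤ := fun z => - m (S.tri z.1.1) - S.sideMax c z.1.1 + level J (C.spz z) with hψz
  have hz0 : ∀ d, ψz (C.segFlip (C.segZero d)) = ψz (C.segZero d) := by
    intro d
    have e1 : ψz (C.segFlip (C.segZero d)) = - m (S.tri (S.flip d)) - S.sideMax c (S.flip d) +
        level J (C.spz (C.segFlip (C.segZero d))) := rfl
    have e2 : ψz (C.segZero d) = - m (S.tri d) - S.sideMax c d + level J (C.spz (C.segZero d)) :=
      rfl
    have e3 : ∀ d, level J (C.spz (C.segZero d)) = (n • γ.ct) d := by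
      intro d
      rw [← hJt, ← level_pc_zero]
      exact congrArg _ (C.sp_of_le (Nat.zero_le _))
    rw [e1, e2, C.spz_segFlip_segZero, e3, e3]
    have f1 := h1 d
    have f2 := h1 (S.rot (S.flip d))
    rw [S.vert_rot_flip, S.tri_rot] at f2
    simp only [Pi.sub_apply] at f1 f2
    have f3 := hc d
    simp only [sideMax]
    omega
  have hzf : ∀ z, ψz (C.segFlip z) = ψz z := by
    rintro ⟨⟨d, j⟩, hj⟩
    induction j with
    | zero => exact hz0 d
    | succ j ih =>
      have hj' : j < C.pts d := Nat.lt_of_succ_lt_succ hj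
      set x : C.PtD := ⟨(d, j), hj'⟩ with hx
      have ih' : ψz (C.segFlip (C.segOf x)) = ψz (C.segOf x) := ih (Nat.lt_of_succ_lt hj)
      change ψz (C.segFlip (C.segSucc x)) = ψz (C.segSucc x)
      have f1 := hJpt x
      have f2 := hJpt (C.ptFlip x)
      rw [hJflip] at f2
      rw [segFlip_segOf] at ih'
      rw [segFlip_segSucc]
      have g1 : ψz (C.segSucc x) = - m (S.tri d) - S.sideMax c d +
        level J (C.spz (C.segSucc x)) := rfl
      have g2 : ψz (C.segOf x) = - m (S.tri d) - S.sideMax c d +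
        level J (C.spz (C.segOf x)) := rfl
      have g3 : ψz (C.segSucc (C.ptFlip x)) = - m (S.tri (S.flip d)) - S.sideMax c (S.flip d) +
        level J (C.spz (C.segSucc (C.ptFlip x))) := rfl
      have g4 : ψz (C.segOf (C.ptFlip x)) = - m (S.tri (S.flip d)) - S.sideMax c (S.flip d) +
        level J (C.spz (C.segOf (C.ptFlip x))) := rfl
      omega
  set ψx : C.PtD → ℤ := fun x => ψz (C.segOf x) - max (atPt J x) 0 with hψx
  have hxf : ∀ x, ψx (C.ptFlip x) = ψx x := by
    intro x
    have g1 : ψx (C.ptFlip x) = ψz (C.segOf (C.ptFlip x)) - max (- atPt J x) 0 := by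
      rw [hψx, ← hJflip]
    have g2 : ψx x = ψz (C.segOf x) - max (atPt J x) 0 := rfl
    have g3 : ψz (C.segSucc x) - ψz (C.segOf x) = - atPt J x := by
      rw [hJpt]
      have g1 : ψz (C.segSucc x) = - m (S.tri x.1.1) - S.sideMax c x.1.1 +
        level J (C.spz (C.segSucc x)) := rfl
      have g2 : ψz (C.segOf x) = - m (S.tri x.1.1) - S.sideMax c x.1.1 +
        level J (C.spz (C.segOf x)) := rfl
      omega
    rw [← segFlip_segSucc, hzf] at g1
    omega
  obtain ⟨ψs : C.Seg → ℤ, hψs⟩ := Half.exists_lift (hε := C.segFlip_segFlip) ψz hzf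
  obtain ⟨ψp : C.Pt → ℤ, hψp⟩ := Half.exists_lift (hε := C.ptFlip_ptFlip) ψx hxf
  obtain ⟨B₀, hB₀⟩ := exists_nonneg_add ψ₀
  obtain ⟨B₁, hB₁⟩ := exists_nonneg_add ψa
  obtain ⟨B₂, hB₂⟩ := exists_nonneg_add ψs
  obtain ⟨B₃, hB₃⟩ := exists_nonneg_add ψp
  obtain ⟨B₄, hB₄⟩ := exists_nonneg_add nP
  -- a common shift makes the exponents natural numbers; it drops out as the Euler characteristic
  -- is zero
  set K : ℤ := B₀ + B₁ + B₂ + B₃ + B₄ with hK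
  replace hB₀ := hB₀ K (by omega)
  replace hB₁ := hB₁ K (by omega)
  replace hB₂ := hB₂ K (by omega)
  replace hB₃ := hB₃ K (by omega)
  replace hB₄ := hB₄ K (by omega)
  set W := γ.weight n with hW
  set V := C.heightWeight hc with hV
  have hWu : ∀ d, W.u d = 0 := fun d => rfl
  have hWy : ∀ d, W.y d = 0 := fun d => rfl
  have hVa : ∀ a b, V.wa a b = 0 := fun a b => rfl
  have hWt : ∀ a, (W.wa a true : ℤ) = max (J a) 0 := fun a => by simp [hW, weight, hJ]
  have hWf : ∀ a, (W.wa a false : ℤ) = max (- J a) 0 := fun a => by simp [hW, weight, hJ]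
  have hVu : ∀ d, (V.u d : ℤ) = M (S.tri d) - S.sideMax c d := fun d => by
    have := S.sideMax_le c d
    rw [hM]
    simp only [hV, heightWeight]
    omega
  have hVy : ∀ d, (V.y d : ℤ) = S.sideMax c d - c d := fun d => by
    have := S.le_sideMax c d
    simp only [hV, heightWeight]
    omega
  have hside : ∀ a, ψ₀ (C.side a true) - ψ₀ (C.side a false) = J a := by
    intro a
    rw [← diff_level J a, diff]
    simp only [hψ₀, triOf_side]
    ring
  have : CharP (ZMod 2)⟦X⟧ 2 :=
    charP_of_injective_ringHom (f := PowerSeries.C (R := ZMod 2)) PowerSeries.C_injective 2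
  have key := sum_exponents_eq (k := ZMod 2) C.card_piece_add
    (A₀ := W.cob₀ X) (A₁ := W.cob₁ X) (B₀ := V.cob₀ X) (B₁ := V.cob₁ X)
    (W.cob₁_mul_cob₀ X) (V.cob₁_mul_cob₀ X)
    (fun h hh => by
      rw [W.cob₀_map, constantCoeff_X] at hh
      exact γ.weight_exact₀ hγ hn hh)
    (fun g hg => by
      rw [W.cob₁_map, constantCoeff_X] at hg
      exact γ.weight_exact₁ hγ hn hg)
    (fun h hh => by
      rw [V.cob₀_map, constantCoeff_X] at hh
      exact heightWeight_exact₀ hc hmax hh)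
    (fun g hg => by
      rw [V.cob₁_map, constantCoeff_X] at hg
      exact heightWeight_exact₁ hc hmin hg)
    (φ₀ := fun v => (ψ₀ v + K).toNat)
    (φ₁ := Sum.elim (fun a => (ψa a + K).toNat) fun s => (ψs s + K).toNat)
    (φ₂ := Sum.elim (fun q => (ψp q + K).toNat) fun p => (nP p + K).toNat)
    (by
      rintro (a | s) v
      · simp only [Weight.cob₀, Sum.elim_inl, mul_add, add_mul, mul_ite, ite_mul, mul_zero,
          zero_mul]
        congr 1
        · split_ifs with h
          · subst h
            refine X_pow_toNat_mul (hB₁ a) (hB₀ _) ?_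
            rw [hWt, hVa, hψa]
            push_cast
            ring
          · rfl
        · split_ifs with h
          · subst h
            refine X_pow_toNat_mul (hB₁ a) (hB₀ _) ?_
            have := hside a
            rw [hWf, hVa]
            simp only [hψa]
            push_cast
            omega
          · rfl
      · simp only [Weight.cob₀, Sum.elim_inr, Finset.mul_sum, Finset.sum_mul, mul_ite, ite_mul,
          mul_zero, zero_mul]
        refine Finset.sum_congr rfl fun z _ => ?_
        split_ifs with h h'
        · subst h h'
          refine X_pow_toNat_mul (hB₂ _) (hB₀ _) ?_
          rw [hψs, hWu, hVu]
          simp only [hψz, hψ₀, triOf_spz]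
          push_cast
          ring
        · rfl
        · rfl)
    (by
      rintro (q | p) (a | s)
      · simp only [Weight.cob₁, Sum.elim_inl, Finset.mul_sum, Finset.sum_mul, mul_ite, ite_mul,
          mul_zero, zero_mul]
        refine Finset.sum_congr rfl fun x _ => ?_
        split_ifs with h h'
        · subst h h'
          refine X_pow_toNat_mul (hB₃ _) (hB₁ _) ?_
          rw [hψp, hWu, hVu]
          have h1 := hside (C.arcAt x)
          have h2 : C.spz (C.segOf x) = _ := C.spz_segOf x
          have h3 := C.triOf_side (C.arcAt x) true
          rw [tri_arcAt] at h3
          have h4 := C.triOf_side (C.arcAt x) false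
          rw [tri_arcAt] at h4
          have h5 : (C.segOf x).1.1 = x.1.1 := rfl
          simp only [hψx, hψa, hψz, hψ₀, h2, h5, atPt] at h1 ⊢
          cases C.inner x <;> simp only [h3, h4, if_true, if_false, Bool.false_eq_true] at h1 ⊢ <;>
            push_cast <;> omega
        · rfl
        · rfl
      · simp only [Weight.cob₁, Sum.elim_inl, Sum.elim_inr, Finset.mul_sum, Finset.sum_mul,
          mul_ite, ite_mul, mul_zero, zero_mul]
        refine Finset.sum_congr rfl fun x _ => ?_
        split_ifs with h h'
        · subst h h'
          refine X_pow_toNat_mul (hB₃ _) (hB₂ _) ?_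
          rw [hψp, hVa, hψs]
          have h1 : (W.wa (C.arcAt x) (C.inner x) : ℤ) = max (atPt J x) 0 := by
            rw [atPt]
            cases C.inner x
            · exact hWf _
            · exact hWt _
          rw [h1, hψx]
          push_cast
          ring
        · rfl
        · rfl
      · simp [Weight.cob₁]
      · simp only [Weight.cob₁, Sum.elim_inr, Finset.mul_sum, Finset.sum_mul,
          mul_ite, ite_mul, mul_zero, zero_mul]
        refine Finset.sum_congr rfl fun d _ => ?_
        split_ifs with h h'
        · subst h h'
          refine X_pow_toNat_mul (hB₄ _) (hB₂ _) ?_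
          rw [hWy, hVy, hψs]
          have e2 : ψz (C.segZero d) = - m (S.tri d) - S.sideMax c d +
            level J (C.spz (C.segZero d)) := rfl
          have e3 : level J (C.spz (C.segZero d)) = (n • γ.ct) d := by
            rw [← hJt, ← level_pc_zero]
            exact congrArg _ (C.sp_of_le (Nat.zero_le _))
          have f1 := h1 d
          simp only [Pi.sub_apply] at f1
          rw [e2, e3]
          push_cast
          omega
        · rfl
        · rfl)
  -- evaluation of the sum of the exponents
  have key' : ∑ v, (ψ₀ v + K) + (∑ q, (ψp q + K) + ∑ p, (nP p + K)) =
      ∑ a, (ψa a + K) + ∑ s, (ψs s + K) := by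
    have := congrArg (Nat.cast : ℕ → ℤ) key
    rw [Fintype.sum_sum_type (α₁ := C.Pt), Fintype.sum_sum_type (α₁ := C.Arc) (α₂ := C.Seg)] at this
    simp only [Sum.elim_inl, Sum.elim_inr, Nat.cast_add, Nat.cast_sum,
      Int.toNat_of_nonneg (hB₀ _), Int.toNat_of_nonneg (hB₁ _), Int.toNat_of_nonneg (hB₂ _),
      Int.toNat_of_nonneg (hB₃ _), Int.toNat_of_nonneg (hB₄ _)] at this
    exact this
  have hcard : (Fintype.card C.Piece : ℤ) + (Fintype.card C.Pt + Fintype.card P) =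
      Fintype.card C.Arc + Fintype.card C.Seg := by
    have := C.card_piece_add
    rw [Fintype.card_sum (α := C.Pt), Fintype.card_sum (α := C.Arc) (β := C.Seg)] at this
    exact_mod_cast this
  replace hcard := congrArg (· * K) hcard
  simp only [Finset.sum_add_distrib, Finset.sum_const, Finset.card_univ, nsmul_eq_mul] at key'
  simp only [add_mul] at hcard
  have s0 : ∑ v, ψ₀ v = ∑ a, (- m a - M a) + ∑ a : C.Arc, ψ₀ (C.side a true) := by
    rw [Fintype.sum_sum_type]
    congr 1
    · exact Finset.sum_congr rfl fun a _ => by simp [hψ₀, triOf, level]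
    · refine Finset.sum_congr rfl fun a _ => ?_
      rw [side, if_pos rfl, C.pc_arc]
  have s1 : ∑ a, ψa a = ∑ a, ψ₀ (C.side a true) - ∑ a, max (J a) 0 := by
    rw [← Finset.sum_sub_distrib]
  have s2 : ∑ z, ψz z = 2 * ∑ s, ψs s := by
    have h1 := Half.sum_mk (hε := C.segFlip_segFlip) C.segFlip_ne ψs
    rw [two_nsmul, ← two_mul] at h1
    rw [← h1]
    exact Finset.sum_congr rfl fun z _ => (hψs z).symm
  have s3 : ∑ x, ψx x = 2 * ∑ q, ψp q := by
    have h1 := Half.sum_mk (hε := C.ptFlip_ptFlip) C.ptFlip_ne ψp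
    rw [two_nsmul, ← two_mul] at h1
    rw [← h1]
    exact Finset.sum_congr rfl fun z _ => (hψp z).symm
  set ψ' : D → ℕ → ℤ := fun d j => - m (S.tri d) - S.sideMax c d + level J (C.sp d j) with hψ'
  have s4 : ∑ z, ψz z = ∑ x, ψz (C.segOf x) + ∑ d, ψ' d (C.pts d) := by
    have e1 : ∑ z, ψz z = _ := sum_box (fun d => C.pts d + 1) ψ'
    have e2 : ∑ x, ψz (C.segOf x) = _ := sum_box C.pts ψ'
    rw [e1, e2, ← Finset.sum_add_distrib]
    exact Finset.sum_congr rfl fun d _ => Finset.sum_range_succ _ _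
  have s5 : ∑ d, ψ' d (C.pts d) = - (3 * ∑ a, m a) - ∑ d, S.sideMax c d + ∑ a, J a := by
    have e1 : ∀ d, ψ' d (C.pts d) = - m (S.tri d) - S.sideMax c d + total J (S.rot d) := by
      intro d
      simp only [hψ']
      rw [C.sp_of_ge (by simp [pts]), Nat.sub_self, level_pc_zero]
    simp only [e1, Finset.sum_add_distrib, Finset.sum_sub_distrib, Finset.sum_neg_distrib]
    have e2 := S.sum_tri m
    rw [nsmul_eq_mul] at e2
    rw [e2, Equiv.sum_comp S.rot, sum_ext]
    norm_num
  have s6 : ∑ x, ψx x = ∑ x, ψz (C.segOf x) - ∑ a, (2 * max (J a) 0 - J a) := by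
    simp only [hψx, Finset.sum_sub_distrib]
    congr 1
    rw [← C.ptEquiv.symm.sum_comp, Fintype.sum_prod_type, ← Finset.sum_sub_distrib]
    refine Finset.sum_congr rfl fun a _ => ?_
    rw [Fintype.sum_bool]
    simp only [atPt, arcAt_symm, inner_symm, if_true, if_false, Bool.false_eq_true]
    omega
  have s7 : ∑ d, S.triMax c d = 3 * ∑ a, M a := by
    have e2 := S.sum_tri M
    rw [nsmul_eq_mul] at e2
    rw [← Finset.sum_congr rfl fun d _ => hM d, e2]
    norm_num
  rw [s7]
  simp only [Finset.sum_sub_distrib, Finset.sum_neg_distrib, ← Finset.mul_sum] at s0 s6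
  linarith

end Strand

end Curve

end TriTorus

/-! ### Tight cocycles and disjoint strands -/

/-- A complex of Euler characteristic zero that is exact at both ends is exact in the middle. -/
theorem exists_mulVec_eq_of_exact {k V E F : Type*} [Field k] [Fintype V] [Fintype E] [Fintype F]
    [DecidableEq V] [DecidableEq E] [DecidableEq F]
    (hcard : Fintype.card V + Fintype.card F = Fintype.card E) {M : Matrix E V k}
    {N : Matrix F E k} (hNM : N * M = 0) (hM : ∀ h, M.mulVec h = 0 → h = 0)
    (hN : ∀ g, N.vecMul g = 0 → g = 0) {w : E → k} (hw : N.mulVec w = 0) :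
    ∃ h, M.mulVec h = w := by
  have h1 : LinearIndependent k N.row := by
    rw [← Matrix.vecMul_injective_iff]
    exact (injective_iff_map_eq_zero (Matrix.vecMulLinear N)).2 hN
  have h2 : Module.finrank k (LinearMap.range N.mulVecLin) = Fintype.card F := h1.rank_matrix
  have h3 := LinearMap.finrank_range_add_finrank_ker N.mulVecLin
  have h4 : LinearMap.ker M.mulVecLin = ⊥ :=
    LinearMap.ker_eq_bot'.2 fun h hh => hM h hh
  have h5 := LinearMap.finrank_range_of_inj (LinearMap.ker_eq_bot.1 h4)
  rw [Module.finrank_fintype_fun_eq_card] at h3 h5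
  have h6 : LinearMap.range M.mulVecLin ≤ LinearMap.ker N.mulVecLin := by
    rintro _ ⟨v, rfl⟩
    simp [hNM]
  have h7 := Submodule.eq_of_le_of_finrank_eq h6 (by omega)
  have h8 : w ∈ LinearMap.ker N.mulVecLin := hw
  rw [← h7] at h8
  exact h8

namespace TriTorus

set_option linter.unusedSectionVars false

variable {D P A : Type*} [Fintype D] [Fintype P] [Fintype A] {S : TriTorus D P A}

theorem isCob_zero : S.IsCob 0 := hasDefect_zero.isCob

theorem IsCob.isClosed {c : D → ℤ} (h : S.IsCob c) : S.IsClosed c := by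
  obtain ⟨n, m, h⟩ := h
  intro d
  rw [h, h, h, h, S.vert_flip, S.vert_rot_flip, S.tri_rot, S.tri_rot]
  ring

theorem IsClosed.add {c c' : D → ℤ} (h : S.IsClosed c) (h' : S.IsClosed c') :
    S.IsClosed (c + c') := by
  intro d
  have h1 := h d
  have h2 := h' d
  simp only [Pi.add_apply]
  linarith

theorem IsClosed.smul {c : D → ℤ} (h : S.IsClosed c) (k : ℤ) : S.IsClosed (k • c) := by
  intro d
  have h1 := h d
  simp only [Pi.smul_apply, smul_eq_mul, ← mul_sub, h1]

/-- The total variation along the sides. -/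
def variation (S : TriTorus D P A) (c : D → ℤ) : ℕ := ∑ d, (c d - c (S.rot d)).natAbs

/-- Raising the vertices of a set without lower neighbours decreases the variation. -/
theorem noLocalMin_of_minimal {c : D → ℤ} (hc : S.IsClosed c) (hcob : ¬ S.IsCob c)
    (hmin : ∀ c', S.IsCob (c' - c) → S.variation c ≤ S.variation c') : S.NoLocalMin c := by
  classical
  intro Z hZ p hp
  set c' : D → ℤ := c + fun d => if Z (S.vert d) then 1 else 0 with hc'
  have h1 := hmin c' ⟨fun p => if Z p then 1 else 0, 0, fun d => by simp [hc']⟩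
  -- the variation drops by one at each side that leaves the set, so no side leaves it
  have h2 : ∀ d, (c' d - c' (S.rot d)).natAbs +
      (if Z (S.vert d) ↔ Z (S.vert (S.rot d)) then 0 else 1) = (c d - c (S.rot d)).natAbs := by
    intro d
    have a1 := hZ d
    have a2 := hZ (S.flip d)
    rw [S.vert_flip, S.vert_rot_flip] at a2
    have a3 := hc d
    simp only [hc', Pi.add_apply]
    by_cases b1 : Z (S.vert d) <;> by_cases b2 : Z (S.vert (S.rot d)) <;>
      simp only [b1, b2, if_true, if_false, true_imp_iff, false_imp_iff, iff_true, iff_false,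
        not_true, iff_self, imp_false] at a1 a2 ⊢ <;> omega
  have h3 : ∀ d, Z (S.vert d) ↔ Z (S.vert (S.rot d)) := by
    by_contra hno
    push Not at hno
    obtain ⟨d, hd⟩ := hno
    refine absurd h1 (not_le.2 ?_)
    refine Finset.sum_lt_sum (fun d _ => by rw [← h2 d]; omega) ⟨d, Finset.mem_univ _, ?_⟩
    rw [← h2 d, if_neg (by tauto)]
    omega
  obtain ⟨d₀, rfl⟩ := S.vert_surj p
  have h4 : ∀ d, Z (S.vert d) := fun d =>
    (S.conn (fun d => Z (S.vert d)) (fun d => (h3 d).symm)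
      (fun d => by rw [S.vert_flip]; exact (h3 d).symm) d₀ d).1 hp
  have h5 : ∀ d, c (S.rot d) = c d := by
    intro d
    have a1 := (hZ d (h4 d)).1
    have a2 := (hZ (S.rot d) (h4 _)).1
    have a3 := (hZ (S.rot (S.rot d)) (h4 _)).1
    rw [S.rot_rot_rot] at a3
    omega
  obtain ⟨m, hm⟩ := Curve.exists_tri_eq (S := S) c h5
  exact hcob ⟨0, m, fun d => by simp [hm]⟩

/-- A nontrivial class contains a cocycle without local minima or maxima. -/
theorem exists_tight {c : D → ℤ} (hc : S.IsClosed c) (hcob : ¬ S.IsCob c) :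
    ∃ c', S.IsClosed c' ∧ S.IsCob (c - c') ∧ S.NoLocalMin c' ∧ S.NoLocalMin (-c') := by
  obtain ⟨c', h1, h2⟩ := (measure S.variation).wf.has_min {c' | S.IsCob (c - c')}
    ⟨c, by simpa using isCob_zero⟩
  have h1' : S.IsCob (c - c') := h1
  have hc' : S.IsClosed c' := by
    have := hc.add (h1'.smul (-1)).isClosed
    convert this using 1
    module
  have hcob' : ¬ S.IsCob c' := by
    intro h
    apply hcob
    convert h1'.add h using 1
    module
  have hmin : ∀ c'', S.IsCob (c'' - c') → S.variation c' ≤ S.variation c'' := by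
    intro c'' h
    refine not_lt.1 (h2 c'' ?_)
    have := h1'.sub h
    rwa [sub_sub_sub_cancel_right] at this
  refine ⟨c', hc', h1', noLocalMin_of_minimal hc' hcob' hmin, noLocalMin_of_minimal ?_ ?_ ?_⟩
  · have := hc'.smul (-1)
    rwa [neg_one_smul] at this
  · intro h
    apply hcob'
    have := h.smul (-1)
    rwa [neg_one_smul, neg_neg] at this
  · have hneg : ∀ c, S.variation (-c) = S.variation c := by
      intro c
      refine Finset.sum_congr rfl fun d _ => ?_
      simp only [Pi.neg_apply]
      omega
    intro c'' h
    rw [hneg, ← hneg c'']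
    apply hmin
    have := h.smul (-1)
    convert this using 1
    module

namespace Curve

variable {C : S.Curve}

open Matrix

theorem isClosed_total {f : C.Arc → ℤ} (hf : ∀ x, atPt f (C.ptFlip x) = - atPt f x) :
    S.IsClosed (total f) := by
  have hpt : ∀ x, atPt f x = level f (C.spz (C.segOf x)) - level f (C.spz (C.segSucc x)) := by
    intro x
    rw [← atPt_diff]
    simp only [atPt, diff_level]
  have h1 : ∀ z : C.SegD, level f (C.spz z) - level f (C.spz (C.segFlip z)) =
      level f (C.spz (C.segZero z.1.1)) - level f (C.spz (C.segFlip (C.segZero z.1.1))) := by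
    rintro ⟨⟨d, j⟩, hj⟩
    induction j with
    | zero => rfl
    | succ j ih =>
      have hj' : j < C.pts d := Nat.lt_of_succ_lt_succ hj
      set x : C.PtD := ⟨(d, j), hj'⟩ with hx
      rw [← ih (Nat.lt_of_succ_lt hj)]
      change level f (C.spz (C.segSucc x)) - level f (C.spz (C.segFlip (C.segSucc x))) =
        level f (C.spz (C.segOf x)) - level f (C.spz (C.segFlip (C.segOf x)))
      have f1 := hpt x
      have f2 := hpt (C.ptFlip x)
      rw [hf] at f2
      rw [segFlip_segOf, segFlip_segSucc]
      linarith
  intro d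
  have h2 := h1 ⟨(d, C.pts d), Nat.lt_succ_self _⟩
  have e1 : C.spz (C.segFlip ⟨(d, C.pts d), Nat.lt_succ_self _⟩) = C.pc (S.flip d) 0 := by
    have : (C.segFlip ⟨(d, C.pts d), Nat.lt_succ_self _⟩) = C.segZero (S.flip d) :=
      Subtype.ext (Prod.ext rfl (Nat.sub_self _))
    rw [this]
    exact C.sp_of_le (Nat.zero_le _)
  have e2 : C.spz ⟨(d, C.pts d), Nat.lt_succ_self _⟩ = C.pc (S.rot d) 0 := by
    rw [spz, C.sp_of_ge (by simp [pts]), Nat.sub_self]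
  have e3 : ∀ d, C.spz (C.segZero d) = C.pc d 0 := fun d => C.sp_of_le (Nat.zero_le _)
  rw [e1, e2, e3, C.spz_segFlip_segZero, e3] at h2
  simp only [level_pc_zero] at h2
  linarith

namespace Strand

/-- Two disjoint essential strands are homologous up to sign. -/
theorem exists_isCob_sub {γ₁ γ₂ : C.Strand} (hdisj : ∀ a, γ₁.jump a = 0 ∨ γ₂.jump a = 0)
    (h₁ : ¬ S.IsCob γ₁.ct) (h₂ : ¬ S.IsCob γ₂.ct) :
    ∃ ε : ℤ, ε * ε = 1 ∧ S.IsCob (ε • γ₂.ct - γ₁.ct) := by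
  classical
  set W := γ₁.weight 1 with hW
  have hWt : ∀ a, W.wa a true = (γ₁.jump a).toNat := fun a => by simp [hW, weight]
  have hWf : ∀ a, W.wa a false = (-γ₁.jump a).toNat := fun a => by simp [hW, weight]
  -- the indicator function of the second strand is a cocycle of the complex cut along the first
  -- one
  set w : C.Arc ⊕ C.Seg → ZMod 2 := Sum.elim (fun a => if γ₂.jump a = 0 then 0 else 1) 0 with hw
  obtain ⟨h, hh⟩ := exists_mulVec_eq_of_exact C.card_piece_add (W.cob₁_mul_cob₀ 0)
    (fun h => γ₁.weight_exact₀ h₁ one_ne_zero) (fun g => γ₁.weight_exact₁ h₁ one_ne_zero)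
    (w := w) (by
      ext (q | p)
      · induction q using Half.ind with
        | h x =>
          rw [Weight.cob₁_mulVec_pt]
          have h1 := γ₂.atPt_flip x
          have h2 : γ₂.jump (C.arcAt x) = 0 ↔ γ₂.jump (C.arcAt (C.ptFlip x)) = 0 := by
            simp only [atPt] at h1
            split_ifs at h1 <;> omega
          simp only [hw, Sum.elim_inl, Sum.elim_inr, hW, weight, pow_zero, one_mul, Pi.zero_apply,
            mul_zero, add_zero, h2]
          exact CharTwo.add_self_eq_zero _
      · rw [Weight.cob₁_mulVec_vert]
        simp [hw])
  have harc : ∀ a, (0 : ZMod 2) ^ W.wa a true * h (C.side a true) +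
      0 ^ W.wa a false * h (C.side a false) = if γ₂.jump a = 0 then 0 else 1 := by
    intro a
    rw [← Weight.cob₀_mulVec_arc]
    exact congrFun hh (.inl a)
  set h' : C.Piece → ℤ := fun v => lift (h v) with hh'
  have hs' : ∀ z, h' (C.spz (C.segFlip z)) = h' (C.spz z) := by
    intro z
    have := congrFun hh (.inr (Half.mk C.segFlip_segFlip z))
    rw [Weight.cob₀_mulVec_seg] at this
    simp only [hW, weight, pow_zero, one_mul, hw, Sum.elim_inr, Pi.zero_apply] at this
    simp only [hh', two_val this]
  -- the lift to `{0, 1}` exhibits a combination of the two strands as a coboundary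
  obtain ⟨s₁, hs₁⟩ := γ₁.exists_eq_mul (atPt_diff_flip hs')
  obtain ⟨s₂, hs₂⟩ := γ₂.exists_eq_mul (atPt_diff_flip hs')
  have hdiff : diff h' = fun a => s₁ * γ₁.jump a + s₂ * γ₂.jump a := by
    ext a
    by_cases a1 : γ₁.jump a = 0
    · by_cases a2 : γ₂.jump a = 0
      · have := harc a
        rw [hWt, hWf, a1, if_pos a2] at this
        simp only [neg_zero, Int.toNat_zero, pow_zero, one_mul] at this
        simp [diff, hh', two_val this, a1, a2]
      · rw [hs₂ a a2, a1]
        ring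
    · rw [hs₁ a a1, (hdisj a).resolve_left a1]
      ring
  have hcob := isCob_total_diff hs'
  rw [hdiff, total_add, total_smul, total_smul] at hcob
  have hex : ∀ γ : C.Strand, ¬ S.IsCob γ.ct → ∃ a, γ.jump a ≠ 0 := by
    intro γ hγ
    by_contra hno
    push Not at hno
    apply hγ
    refine ⟨0, 0, fun d => ?_⟩
    simp [ct, total, ext, hno]
  obtain ⟨a₁, ha₁⟩ := hex γ₁ h₁
  obtain ⟨a₂, ha₂⟩ := hex γ₂ h₂
  have hdb : ∀ r r' : ZMod 2, lift r - lift r' = 0 ∨ lift r - lift r' = 1 ∨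
    lift r - lift r' = -1 := by decide
  have hdb' : ∀ r r' : ZMod 2, r + r' = 1 → lift r - lift r' = 1 ∨
    lift r - lift r' = -1 := by decide
  have c₁ : s₁ = 0 ∨ s₁ = 1 ∨ s₁ = -1 := by
    have e1 := hs₁ a₁ ha₁
    have e2 := hdb (h (C.side a₁ true)) (h (C.side a₁ false))
    simp only [diff, hh'] at e1
    rw [e1] at e2
    rcases γ₁.jump_cases a₁ with j | j | j
    · exact absurd j ha₁
    all_goals
      rw [j] at e2
      omega
  have c₂ : s₂ = 1 ∨ s₂ = -1 := by
    have e1 := hs₂ a₂ ha₂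
    have e2 := harc a₂
    rw [hWt, hWf, (hdisj a₂).resolve_right ha₂, if_neg ha₂] at e2
    simp only [neg_zero, Int.toNat_zero, pow_zero, one_mul] at e2
    have e3 := hdb' _ _ e2
    simp only [diff, hh'] at e1
    rw [e1] at e3
    rcases γ₂.jump_cases a₂ with j | j | j
    · exact absurd j ha₂
    all_goals
      rw [j] at e3
      omega
  have hs2 : s₂ * s₂ = 1 := by rcases c₂ with h | h <;> rw [h] <;> rfl
  -- `s₁ = 0` is excluded, since the second strand is essential
  rcases c₁ with h | h | h
  · rw [h, zero_smul, zero_add] at hcob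
    have := hcob.smul s₂
    rw [smul_smul, hs2, one_smul] at this
    exact absurd this h₂
  · refine ⟨-s₂, by linarith, ?_⟩
    convert hcob.smul (-1) using 1
    change _ = (-1 : ℤ) • (s₁ • γ₁.ct + s₂ • γ₂.ct)
    rw [h]
    module
  · refine ⟨s₂, hs2, ?_⟩
    convert hcob using 1
    change _ = s₁ • γ₁.ct + s₂ • γ₂.ct
    rw [h]
    module

end Strand

end Curve

end TriTorus

/-! ### Homologous essential curves -/

namespace TriTorus

set_option linter.unusedSectionVars false

variable {D P A : Type*} [Fintype D] [Fintype P] [Fintype A] {S : TriTorus D P A}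

namespace Curve

variable {C : S.Curve}

theorem Strand.isClosed (γ : C.Strand) : S.IsClosed γ.ct := isClosed_total γ.atPt_flip

/-- Disjoint essential strands are homologous up to sign, with defect zero. -/
theorem Strand.hasDefect_sub {γ₁ γ₂ : C.Strand} (hdisj : ∀ a, γ₁.jump a = 0 ∨ γ₂.jump a = 0)
    (h₁ : ¬ S.IsCob γ₁.ct) (h₂ : ¬ S.IsCob γ₂.ct) :
    ∃ ε : ℤ, S.HasDefect (γ₂.ct - ε • γ₁.ct) 0 := by
  obtain ⟨ε, hε, hcob⟩ := exists_isCob_sub hdisj h₁ h₂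
  obtain ⟨c, hc, hc1, hmin, hmax⟩ := exists_tight γ₁.isClosed h₁
  obtain ⟨r₁, hr₁⟩ := hc1.hasDefect
  obtain ⟨r₂, hr₂⟩ := (hcob.add hc1).hasDefect
  rw [sub_add_sub_cancel] at hr₂
  have e₁ := γ₁.defect_eq hc h₁ hmin hmax one_ne_zero (by rwa [one_smul])
  have e₂ := γ₂.defect_eq hc h₂ hmin hmax (n := ε) (by rintro rfl; simp at hε) hr₂
  have h := (hr₂.sub hr₁).smul ε
  rw [sub_sub_sub_cancel_right, smul_sub, smul_smul, hε, one_smul,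
    show r₂ - r₁ = 0 by omega, mul_zero] at h
  exact ⟨ε, h⟩

variable (C) in
/-- The two arcs that meet at an intersection point. -/
def Adjacent (a b : C.Arc) : Prop := ∃ x, a = C.arcAt x ∧ b = C.arcAt (C.ptFlip x)

variable (C) in
/-- The components of the curve. -/
def compSetoid : Setoid C.Arc := Relation.EqvGen.setoid C.Adjacent

variable (C) in
/-- An orientation of the curve: each arc runs anticlockwise or clockwise around its corner. -/
structure Orientation where
  sgn : C.Arc → ℤ
  sgn_cases : ∀ a, sgn a = 1 ∨ sgn a = -1
  atPt_flip : ∀ x, atPt sgn (C.ptFlip x) = - atPt sgn x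

namespace Orientation

variable (o : C.Orientation)

open Classical in
/-- The component of an arc. -/
noncomputable def strand (a₀ : C.Arc) : C.Strand where
  jump a := if C.compSetoid a₀ a then o.sgn a else 0
  jump_cases a := by
    split_ifs
    · exact Or.inr (o.sgn_cases a)
    · exact Or.inl rfl
  atPt_flip x := by
    have h1 : C.compSetoid (C.arcAt x) (C.arcAt (C.ptFlip x)) :=
      Relation.EqvGen.rel _ _ ⟨x, rfl, rfl⟩
    have h2 : C.compSetoid a₀ (C.arcAt (C.ptFlip x)) ↔ C.compSetoid a₀ (C.arcAt x) :=
      ⟨fun h => C.compSetoid.trans h (C.compSetoid.symm h1), fun h => C.compSetoid.trans h h1⟩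
    have h3 := o.atPt_flip x
    simp only [atPt] at h3 ⊢
    by_cases h : C.compSetoid a₀ (C.arcAt x)
    · simpa only [h2, h, if_true] using h3
    · simp only [h2, h, if_false, neg_zero, ite_self]
  conn f hf a b ha hb hfa := by
    have key : ∀ a b, Relation.EqvGen C.Adjacent a b → C.compSetoid a₀ a → (f a ↔ f b) := by
      intro a b hab
      induction hab with
      | rel a b h =>
        obtain ⟨x, rfl, rfl⟩ := h
        have h1 : C.compSetoid (C.arcAt x) (C.arcAt (C.ptFlip x)) :=
          Relation.EqvGen.rel _ _ ⟨x, rfl, rfl⟩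
        have hs : ∀ a, o.sgn a ≠ 0 := fun a => by rcases o.sgn_cases a with h | h <;> simp [h]
        intro h2
        refine ⟨hf x (by rw [if_pos h2]; exact hs _), fun h3 => ?_⟩
        have := hf (C.ptFlip x) (by rw [if_pos (C.compSetoid.trans h2 h1)]; exact hs _) h3
        rwa [C.ptFlip_ptFlip] at this
      | refl a => exact fun _ => Iff.rfl
      | symm a b h ih => exact fun h1 => (ih (C.compSetoid.trans h1 (C.compSetoid.symm h))).symm
      | trans a b c h1 h2 ih1 ih2 =>
        exact fun h => (ih1 h).trans (ih2 (C.compSetoid.trans h h1))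
    have ha' : C.compSetoid a₀ a := by
      by_contra h
      exact ha (if_neg h)
    have hb' : C.compSetoid a₀ b := by
      by_contra h
      exact hb (if_neg h)
    exact (key a b (C.compSetoid.trans (C.compSetoid.symm ha') hb') ha').1 hfa

/-- No component is homologically trivial. -/
def Essential : Prop := ∀ a, ¬ S.IsCob (o.strand a).ct

variable {o}

theorem total_sum {ι : Type*} (s : Finset ι) (f : ι → C.Arc → ℤ) :
    total (fun a => ∑ i ∈ s, f i a) = ∑ i ∈ s, total (f i) := by
  classical
  ext d
  simp only [total, ext, Finset.sum_apply]
  rw [Finset.sum_comm]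
  refine Finset.sum_congr rfl fun i _ => ?_
  split_ifs <;> simp

/-- An essential curve is trivial or homologous to a multiple of one of its components, with
defect zero. -/
theorem Essential.hasDefect_sub (ho : o.Essential) (a₀ : C.Arc) :
    ∃ k : ℤ, S.HasDefect (total o.sgn - k • (o.strand a₀).ct) 0 := by
  classical
  have h1 : ∀ a, ∃ ε : ℤ, S.HasDefect ((o.strand a).ct - ε • (o.strand a₀).ct) 0 := by
    intro a
    by_cases h : C.compSetoid a₀ a
    · refine ⟨1, ?_⟩
      have : (o.strand a).jump = (o.strand a₀).jump := by
        ext b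
        have : C.compSetoid a b ↔ C.compSetoid a₀ b :=
          ⟨C.compSetoid.trans h, C.compSetoid.trans (C.compSetoid.symm h)⟩
        simp only [strand, this]
      rw [one_smul, Strand.ct, Strand.ct, this, sub_self]
      exact hasDefect_zero
    · refine Strand.hasDefect_sub (fun b => ?_) (ho a₀) (ho a)
      simp only [strand]
      by_cases h1 : C.compSetoid a₀ b
      · right
        rw [if_neg]
        exact fun h2 => h (C.compSetoid.trans h1 (C.compSetoid.symm h2))
      · left
        rw [if_neg h1]
  have : Fintype (Quotient C.compSetoid) := @Fintype.ofFinite _ (Quotient.finite _)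
  -- the curve is the sum of its components
  have h2 : o.sgn = fun a => ∑ q : Quotient C.compSetoid, (o.strand q.out).jump a := by
    ext a
    rw [Finset.sum_eq_single (Quotient.mk C.compSetoid a)]
    · simp only [strand]
      rw [if_pos (Quotient.mk_out (s := C.compSetoid) a)]
    · intro q _ hq
      simp only [strand]
      rw [if_neg]
      intro h
      apply hq
      rw [← Quotient.out_eq q]
      exact Quotient.sound h
    · simp
  have h3 : ∀ s : Finset (Quotient C.compSetoid), ∃ k : ℤ,
      S.HasDefect (∑ q ∈ s, (o.strand q.out).ct - k • (o.strand a₀).ct) 0 := by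
    intro s
    induction s using Finset.induction_on with
    | empty => exact ⟨0, by simpa using hasDefect_zero⟩
    | insert q s hq ih =>
      obtain ⟨k, hk⟩ := ih
      obtain ⟨ε, hε⟩ := h1 q.out
      refine ⟨ε + k, ?_⟩
      rw [Finset.sum_insert hq]
      convert hε.add hk using 1
      · module
      · rfl
  obtain ⟨k, hk⟩ := h3 Finset.univ
  refine ⟨k, ?_⟩
  rw [h2, total_sum]
  exact hk

/-- Two homologous essential curves have defect zero. -/
theorem Essential.hasDefect_total_sub {C C' : S.Curve} {o : C.Orientation} {o' : C'.Orientation}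
    (ho : o.Essential) (ho' : o'.Essential) (hcob : S.IsCob (total o.sgn - total o'.sgn)) :
    S.HasDefect (total o.sgn - total o'.sgn) 0 := by
  have alt : ∀ {C : S.Curve} {o : C.Orientation}, o.Essential → S.HasDefect (total o.sgn) 0 ∨
      ∃ (γ : C.Strand) (k : ℤ), ¬ S.IsCob γ.ct ∧ k ≠ 0 ∧
        S.HasDefect (total o.sgn - k • γ.ct) 0 := by
    intro C o ho
    by_cases hne : Nonempty C.Arc
    · obtain ⟨a₀⟩ := hne
      obtain ⟨k, hk⟩ := ho.hasDefect_sub a₀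
      by_cases h0 : k = 0
      · left
        rwa [h0, zero_smul, sub_zero] at hk
      · exact Or.inr ⟨o.strand a₀, k, ho a₀, h0, hk⟩
    · left
      have : total o.sgn = 0 := by
        ext d
        refine Finset.sum_eq_zero fun i hi => ?_
        exact absurd ⟨⟨(d, i), Finset.mem_range.1 hi⟩⟩ hne
      rw [this]
      exact hasDefect_zero
  rcases alt ho with h | ⟨γ, k, hγ, hk, h⟩ <;> rcases alt ho' with h' | ⟨γ', k', hγ', hk', h'⟩
  · simpa using h.sub h'
  · refine absurd (isCob_of_smul hk' ?_) hγ'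
    have := (h.isCob.sub hcob).sub h'.isCob
    convert this using 1
    module
  · refine absurd (isCob_of_smul hk ?_) hγ
    have := (h'.isCob.add hcob).sub h.isCob
    convert this using 1
    module
  -- both multiples have the same defect relative to a tight cocycle in their common class
  · have h1 : ¬ S.IsCob (k • γ.ct) := fun h => hγ (isCob_of_smul hk h)
    obtain ⟨c, hc, hc1, hmin, hmax⟩ := exists_tight (γ.isClosed.smul k) h1
    obtain ⟨r, hr⟩ := hc1.hasDefect
    have h2 : S.IsCob (k' • γ'.ct - c) := by
      have := hc1.sub ((hcob.sub h.isCob).add h'.isCob)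
      convert this using 1
      module
    obtain ⟨r', hr'⟩ := h2.hasDefect
    have e := γ.defect_eq hc hγ hmin hmax hk hr
    have e' := γ'.defect_eq hc hγ' hmin hmax hk' hr'
    have := (h.add (hr.sub hr')).sub h'
    rw [show 0 + (r - r') - 0 = 0 by omega] at this
    convert this using 1
    module

end Orientation

end Curve

end TriTorus

/-! ### The boundary tori of an ideal triangulation -/

theorem exists_even_perm (v w : Fin 4) (h : v ≠ w) :
    ∃ σ : Perm (Fin 4), Perm.sign σ = 1 ∧ σ 0 = v ∧ σ 1 = w := by
  revert v w
  decide

theorem even_perm_ext {σ σ' : Perm (Fin 4)} (h : Perm.sign σ = Perm.sign σ') (h0 : σ 0 = σ' 0)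
    (h1 : σ 1 = σ' 1) : σ = σ' := by
  have key : ∀ ρ : Perm (Fin 4), Perm.sign ρ = 1 → ρ 0 = 0 → ρ 1 = 1 → ρ = 1 := by decide
  have := key (σ⁻¹ * σ') (by simp [h]) (by simp [← h0]) (by simp [← h1])
  exact inv_mul_eq_one.1 this

namespace TetFlag

variable {τ : Type*}

theorem corner_reorder (x : TetFlag τ) : (x.reorder (swap 2 3)).corner = x.corner := by
  apply Subtype.ext
  simp [corner, reorder, swap_apply_of_ne_of_ne]

theorem other_other (x : TetFlag τ) : x.other.other = x := by
  simp [other, reorder, mul_assoc]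

theorem sign_other (x : TetFlag τ) : Perm.sign x.other.2 = - Perm.sign x.2 := by
  simp [other, reorder]

theorem other_fst (x : TetFlag τ) : x.other.1 = x.1 := rfl

theorem other_zero (x : TetFlag τ) : x.other.2 0 = x.2 0 := by
  simp [other, reorder, swap_apply_of_ne_of_ne]

/-- The positively oriented flag at a corner. -/
noncomputable def ofCorner (c : Corner τ) : TetFlag τ :=
  (c.1.1, (exists_even_perm c.1.2.1 c.1.2.2 c.2).choose)

theorem sign_ofCorner (c : Corner τ) : Perm.sign (ofCorner c).2 = 1 :=
  (exists_even_perm c.1.2.1 c.1.2.2 c.2).choose_spec.1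

theorem corner_ofCorner (c : Corner τ) : (ofCorner c).corner = c := by
  have h := (exists_even_perm c.1.2.1 c.1.2.2 c.2).choose_spec.2
  exact Subtype.ext (Prod.ext rfl (Prod.ext h.1 h.2))

theorem ofCorner_corner {x : TetFlag τ} (h : Perm.sign x.2 = 1) : ofCorner x.corner = x := by
  have h1 := corner_ofCorner x.corner
  have h2 := congrArg Subtype.val h1
  simp only [corner, Prod.mk.injEq] at h2
  exact Prod.ext rfl (even_perm_ext ((sign_ofCorner _).trans h.symm) h2.2.1 h2.2.2)

/-- The next corner of the triangle, anticlockwise. -/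
def turn (x : TetFlag τ) : TetFlag τ := x.reorder (swap 1 2 * swap 2 3)

theorem sign_turn (x : TetFlag τ) : Perm.sign x.turn.2 = Perm.sign x.2 := by
  simp [turn, reorder]

theorem corner_turn (x : TetFlag τ) : x.turn.corner = x.other.corner := by
  apply Subtype.ext
  simp [corner, turn, other, reorder, swap_apply_of_ne_of_ne]

theorem turn_turn_turn (x : TetFlag τ) : x.turn.turn.turn = x := by
  have : (swap 1 2 * swap 2 3 * (swap 1 2 * swap 2 3) * (swap 1 2 * swap 2 3) : Perm (Fin 4)) = 1 := by
    decide
  simp only [turn, reorder, mul_assoc] at this ⊢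
  rw [this, mul_one]

end TetFlag

namespace FacePairing

variable {τ : Type*} (T : FacePairing τ)

theorem cross_cross (x : TetFlag τ) : T.cross (T.cross x) = x := by
  simp [cross, T.adj_adj, T.glue_glue]

theorem cross_reorder (x : TetFlag τ) {π : Perm (Fin 4)} (h : π 3 = 3) :
    T.cross (x.reorder π) = (T.cross x).reorder π := by
  simp [cross, TetFlag.reorder, h, mul_assoc]

theorem cross_other (x : TetFlag τ) : T.cross x.other = (T.cross x).other :=
  T.cross_reorder x (by decide)

theorem sign_cross (x : TetFlag τ) : Perm.sign (T.cross x).2 = - Perm.sign x.2 := by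
  simp [cross, T.sign_glue]

/-- The same side, seen from the other triangle. -/
def across (x : TetFlag τ) : TetFlag τ := (T.cross x).other

theorem sign_across (x : TetFlag τ) : Perm.sign (T.across x).2 = Perm.sign x.2 := by
  simp [across, TetFlag.sign_other, sign_cross]

theorem across_across (x : TetFlag τ) : T.across (T.across x) = x := by
  rw [across, across, cross_other, TetFlag.other_other, cross_cross]

/-- The next corner of the same truncation triangle, anticlockwise. -/
noncomputable def rot : Perm (Corner τ) where
  toFun c := (TetFlag.ofCorner c).turn.corner
  invFun c := (TetFlag.ofCorner c).turn.turn.corner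
  left_inv c := by
    dsimp only
    rw [TetFlag.ofCorner_corner (by rw [TetFlag.sign_turn, TetFlag.sign_ofCorner]),
      TetFlag.turn_turn_turn, TetFlag.corner_ofCorner]
  right_inv c := by
    dsimp only
    rw [TetFlag.ofCorner_corner (by
      rw [TetFlag.sign_turn, TetFlag.sign_turn, TetFlag.sign_ofCorner]),
      TetFlag.turn_turn_turn, TetFlag.corner_ofCorner]

/-- The side from the corner `c` to `rot c` of its triangle, seen from the other triangle. -/
noncomputable def flip : Perm (Corner τ) where
  toFun c := (T.across (TetFlag.ofCorner c)).corner
  invFun c := (T.across (TetFlag.ofCorner c)).corner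
  left_inv c := by
    dsimp only
    rw [TetFlag.ofCorner_corner (by rw [sign_across, TetFlag.sign_ofCorner]),
      across_across, TetFlag.corner_ofCorner]
  right_inv c := by
    dsimp only
    rw [TetFlag.ofCorner_corner (by rw [sign_across, TetFlag.sign_ofCorner]),
      across_across, TetFlag.corner_ofCorner]

theorem rot_corner {x : TetFlag τ} (h : Perm.sign x.2 = 1) :
    rot x.corner = x.other.corner := by
  rw [rot, Equiv.coe_fn_mk, TetFlag.ofCorner_corner h, TetFlag.corner_turn]

theorem flip_corner {x : TetFlag τ} (h : Perm.sign x.2 = 1) :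
    T.flip x.corner = (T.cross x).other.corner := by
  rw [flip, Equiv.coe_fn_mk, TetFlag.ofCorner_corner h, across]

theorem rot_flip_corner {x : TetFlag τ} (h : Perm.sign x.2 = 1) :
    rot (T.flip x.corner) = (T.cross x).corner := by
  rw [flip_corner T h, rot_corner, TetFlag.other_other]
  rw [TetFlag.sign_other, sign_cross, h, neg_neg]

theorem rot_rot_rot (c : Corner τ) : rot (rot (rot c)) = c := by
  have h := TetFlag.sign_ofCorner c
  have : rot.symm c = rot (rot c) := by
    change (TetFlag.ofCorner c).turn.turn.corner =
      (TetFlag.ofCorner (TetFlag.ofCorner c).turn.corner).turn.corner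
    rw [TetFlag.ofCorner_corner (by rw [TetFlag.sign_turn, h])]
  rw [← this, Equiv.apply_symm_apply]

theorem flip_flip (c : Corner τ) : T.flip (T.flip c) = c := T.flip.left_inv c

theorem flip_ne (c : Corner τ) : T.flip c ≠ c := by
  intro h
  have h1 := T.flip_corner (TetFlag.sign_ofCorner c)
  rw [TetFlag.corner_ofCorner, h] at h1
  set x := TetFlag.ofCorner c with hx
  have h2 := TetFlag.ofCorner_corner (x := (T.cross x).other)
    (by rw [TetFlag.sign_other, sign_cross, hx, TetFlag.sign_ofCorner, neg_neg])
  rw [← h1] at h2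
  apply T.not_self x.1 (x.2 3)
  have h3 := congrArg Prod.fst h2
  have h4 := congrArg (fun y : TetFlag τ => y.2 3) h2
  simp only [← hx, TetFlag.other, TetFlag.reorder, cross] at h3 h4
  rw [Prod.mk.injEq]
  refine ⟨h3.symm, ?_⟩
  rw [Perm.mul_apply, swap_apply_of_ne_of_ne (by decide) (by decide)] at h4
  exact h4.symm

/-- The truncation triangle of a corner. -/
def triangle (c : Corner τ) : τ × Fin 4 := (c.1.1, c.1.2.1)

theorem triangle_corner (x : TetFlag τ) : triangle x.corner = (x.1, x.2 0) := rfl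

theorem triangle_rot (c : Corner τ) : triangle (rot c) = triangle c := by
  rw [← TetFlag.corner_ofCorner c, rot_corner (TetFlag.sign_ofCorner c), triangle_corner,
    triangle_corner, TetFlag.other_zero, TetFlag.other_fst]

theorem rot_ne (c : Corner τ) : rot c ≠ c := by
  rw [← TetFlag.corner_ofCorner c, rot_corner (TetFlag.sign_ofCorner c)]
  intro h
  have := congrArg (fun c : Corner τ => c.1.2.2) h
  simp [TetFlag.corner, TetFlag.other, TetFlag.reorder] at this

theorem triangle_eq {c c' : Corner τ} (h : triangle c = triangle c') :
    c' = c ∨ c' = rot c ∨ c' = rot (rot c) := by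
  have key : ∀ (ρ : Perm (Fin 4)) (w : Fin 4), w ≠ ρ 0 → w = ρ 1 ∨ w = ρ 2 ∨ w = ρ 3 := by
    intro ρ w hw
    obtain ⟨i, rfl⟩ := ρ.surjective w
    fin_cases i <;> simp at hw ⊢
  have h0 := TetFlag.sign_ofCorner c
  rw [← TetFlag.corner_ofCorner c] at h ⊢
  set x := TetFlag.ofCorner c
  have h1 : rot (rot x.corner) = x.turn.turn.corner := by
    rw [rot_corner h0, ← TetFlag.corner_turn, rot_corner (by rw [TetFlag.sign_turn, h0]),
      ← TetFlag.corner_turn]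
  rw [h1, rot_corner h0, ← TetFlag.corner_turn]
  obtain ⟨⟨t, v, w⟩, hvw⟩ := c'
  simp only [triangle, TetFlag.corner, Prod.mk.injEq] at h
  obtain ⟨rfl, rfl⟩ := h
  rcases key x.2 w (Ne.symm hvw) with rfl | rfl | rfl
  · left; rfl
  · right; left
    apply Subtype.ext
    simp [TetFlag.corner, TetFlag.turn, TetFlag.reorder, swap_apply_of_ne_of_ne]
  · right; right
    apply Subtype.ext
    simp [TetFlag.corner, TetFlag.turn, TetFlag.reorder, swap_apply_of_ne_of_ne]

theorem edgeEnd_cross (x : TetFlag τ) : T.edgeEnd (T.cross x).corner = T.edgeEnd x.corner :=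
  (Quot.sound ⟨x, rfl, rfl⟩).symm

theorem edgeEnd_flip (c : Corner τ) : T.edgeEnd (T.flip c) = T.edgeEnd (rot c) := by
  rw [← TetFlag.corner_ofCorner c, flip_corner T (TetFlag.sign_ofCorner c),
    rot_corner (TetFlag.sign_ofCorner c), ← cross_other, edgeEnd_cross]

theorem cusp_cross (x : TetFlag τ) :
    T.cusp (triangle (T.cross x).corner) = T.cusp (triangle x.corner) :=
  (Quot.sound ⟨x, rfl, rfl⟩).symm

theorem cusp_flip (c : Corner τ) : T.cusp (triangle (T.flip c)) = T.cusp (triangle c) := by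
  rw [← TetFlag.corner_ofCorner c, flip_corner T (TetFlag.sign_ofCorner c), triangle_corner,
    TetFlag.other_zero, TetFlag.other_fst, ← triangle_corner, cusp_cross]

theorem cusp_rot (c : Corner τ) : T.cusp (triangle (rot c)) = T.cusp (triangle c) := by
  rw [triangle_rot]

/-- Each flag or its mirror image is positively oriented. -/
theorem sign_cases (x : TetFlag τ) : Perm.sign x.2 = 1 ∨ Perm.sign (T.cross x).2 = 1 := by
  rw [sign_cross]
  rcases Int.units_eq_one_or (Perm.sign x.2) with h | h <;> simp [h]

/-- A property of corners that is invariant under going around a vertex is a property of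
vertices. -/
theorem edgeEnd_ind {f : Corner τ → Prop} (hf : ∀ c, f (rot (T.flip c)) ↔ f c)
    {c c' : Corner τ} (h : T.edgeEnd c = T.edgeEnd c') : f c ↔ f c' := by
  have h1 := Quot.eqvGen_exact h
  clear h
  induction h1 with
  | rel a b h =>
    obtain ⟨x, rfl, rfl⟩ := h
    rcases T.sign_cases x with h | h
    · rw [← T.rot_flip_corner h, hf]
    · rw [← hf (T.cross x).corner, T.rot_flip_corner h, cross_cross]
  | refl a => rfl
  | symm a b _ ih => exact ih.symm
  | trans a b c _ _ ih1 ih2 => exact ih1.trans ih2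

theorem cusp_ind {f : Corner τ → Prop} (hf : ∀ c, f (rot c) ↔ f c)
    (hf' : ∀ c, f (T.flip c) ↔ f c)
    {c c' : Corner τ} (h : T.cusp (triangle c) = T.cusp (triangle c')) : f c ↔ f c' := by
  have h0 : ∀ {c c' : Corner τ}, triangle c = triangle c' → (f c ↔ f c') := by
    intro c c' h
    rcases triangle_eq h with rfl | rfl | rfl <;> simp only [hf]
  have h1 := Quot.eqvGen_exact h
  clear h
  have h2 : ∀ a b : τ × Fin 4, Relation.EqvGen (fun a b : τ × Fin 4 =>
      ∃ x : TetFlag τ, a = (x.1, x.2 0) ∧ b = ((T.cross x).1, (T.cross x).2 0)) a b →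
      ∀ c c' : Corner τ, triangle c = a → triangle c' = b → (f c ↔ f c') := by
    intro a b hab
    induction hab with
    | rel a b h =>
      obtain ⟨x, rfl, rfl⟩ := h
      intro c c' hc hc'
      rw [h0 (c' := x.corner) hc, h0 (c' := (T.cross x).corner) hc']
      rcases T.sign_cases x with h | h
      · rw [← T.rot_flip_corner h, hf, hf']
      · have := T.rot_flip_corner h
        rw [cross_cross] at this
        rw [← this, hf, hf']
    | refl a => intro c c' hc hc'; exact h0 (hc.trans hc'.symm)
    | symm a b _ ih => intro c c' hc hc'; exact (ih c' c hc' hc).symm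
    | trans a b d _ _ ih1 ih2 =>
      intro c c' hc hc'
      obtain ⟨w, hw⟩ := exists_ne b.2
      exact (ih1 c ⟨(b.1, b.2, w), hw.symm⟩ hc rfl).trans (ih2 _ c' rfl hc')
  exact h2 _ _ h1 c c' rfl rfl

section Torus

variable [Fintype τ]

instance : Finite T.EdgeEnd := inferInstanceAs (Finite (Quot _))
instance : Finite T.Cusp := inferInstanceAs (Finite (Quot _))
instance : Finite T.Edge := inferInstanceAs (Finite (Quot _))

noncomputable instance : Fintype T.EdgeEnd := Fintype.ofFinite _
noncomputable instance : Fintype T.Cusp := Fintype.ofFinite _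
noncomputable instance : Fintype T.Edge := Fintype.ofFinite _
noncomputable instance : DecidableEq T.EdgeEnd := Classical.decEq _
noncomputable instance : DecidableEq T.Cusp := Classical.decEq _
noncomputable instance : DecidableEq T.Edge := Classical.decEq _

/-- The corners at a cusp. -/
abbrev CuspCorner (κ : T.Cusp) := {c : Corner τ // T.cusp (triangle c) = κ}

/-- The vertices of the triangulation of the torus at a cusp. -/
abbrev CuspEnd (κ : T.Cusp) :=
  {p : T.EdgeEnd // ∃ c : Corner τ, T.edgeEnd c = p ∧ T.cusp (c.1.1, c.1.2.1) = κ}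

/-- The truncation triangles at a cusp. -/
abbrev CuspTriangle (κ : T.Cusp) := {a : τ × Fin 4 // T.cusp a = κ}

noncomputable instance (κ : T.Cusp) : Fintype (T.CuspCorner κ) := Fintype.ofFinite _
noncomputable instance (κ : T.Cusp) : Fintype (T.CuspEnd κ) := Fintype.ofFinite _
noncomputable instance (κ : T.Cusp) : Fintype (T.CuspTriangle κ) := Fintype.ofFinite _

/-- The triangulated torus at a cusp. -/
noncomputable def torus (hT : T.IsIdealTriangulation) (κ : T.Cusp) :
    TriTorus (T.CuspCorner κ) (T.CuspEnd κ) (T.CuspTriangle κ) where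
  rot := rot.subtypePerm fun c => by rw [cusp_rot]
  flip := T.flip.subtypePerm fun c => by rw [cusp_flip]
  vert c := ⟨T.edgeEnd c.1, c.1, rfl, c.2⟩
  tri c := ⟨triangle c.1, c.2⟩
  rot_rot_rot c := Subtype.ext (rot_rot_rot c.1)
  flip_flip c := Subtype.ext (T.flip_flip c.1)
  rot_ne c h := rot_ne c.1 (congrArg Subtype.val h)
  flip_ne c h := T.flip_ne c.1 (congrArg Subtype.val h)
  vert_flip c := Subtype.ext (T.edgeEnd_flip c.1)
  tri_rot c := Subtype.ext (triangle_rot c.1)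
  vert_surj := by
    rintro ⟨p, c, rfl, hc⟩
    exact ⟨⟨c, hc⟩, rfl⟩
  tri_surj := by
    rintro ⟨⟨t, v⟩, h⟩
    obtain ⟨w, hw⟩ := exists_ne v
    exact ⟨⟨⟨(t, v, w), hw.symm⟩, h⟩, rfl⟩
  vert_ind f hf c c' h := by
    have := T.edgeEnd_ind (f := fun c => ∀ h : T.cusp (triangle c) = κ, f ⟨c, h⟩) (fun c => by
      have h1 : T.cusp (triangle (rot (T.flip c))) = T.cusp (triangle c) := by
        rw [cusp_rot, cusp_flip]
      exact ⟨fun h2 h3 => (hf ⟨c, h3⟩).1 (h2 (h1.trans h3)),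
        fun h2 h3 => (hf ⟨c, h1.symm.trans h3⟩).2 (h2 _)⟩) (congrArg Subtype.val h)
    exact ⟨fun h1 => this.1 (fun _ => h1) c'.2, fun h1 => this.2 (fun _ => h1) c.2⟩
  tri_eq c c' h := by
    rcases triangle_eq (congrArg Subtype.val h) with h | h | h
    · exact Or.inl (Subtype.ext h)
    · exact Or.inr (Or.inl (Subtype.ext h))
    · exact Or.inr (Or.inr (Subtype.ext h))
  conn f hf hf' c c' := by
    have := T.cusp_ind (f := fun c => ∀ h : T.cusp (triangle c) = κ, f ⟨c, h⟩) (fun c => by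
      have h1 := T.cusp_rot c
      exact ⟨fun h2 h3 => (hf ⟨c, h3⟩).1 (h2 (h1.trans h3)),
        fun h2 h3 => (hf ⟨c, h1.symm.trans h3⟩).2 (h2 _)⟩) (fun c => by
      have h1 := T.cusp_flip c
      exact ⟨fun h2 h3 => (hf' ⟨c, h3⟩).1 (h2 (h1.trans h3)),
        fun h2 h3 => (hf' ⟨c, h1.symm.trans h3⟩).2 (h2 _)⟩) (c.2.trans c'.2.symm)
    exact ⟨fun h1 => this.1 (fun _ => h1) c'.2, fun h1 => this.2 (fun _ => h1) c.2⟩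
  card_eq := by
    have h := hT κ
    rw [← Nat.card_coe_set_eq, ← Nat.card_coe_set_eq] at h
    rw [← Nat.card_eq_fintype_card, ← Nat.card_eq_fintype_card]
    exact h

end Torus

end FacePairing

/-! ### Essential multi-curves on the cusps -/

namespace FacePairing

variable {τ : Type*} [Fintype τ] (T : FacePairing τ)

theorem mem_boundaries_iff {c : Corner τ → ℤ} : c ∈ T.boundaries ↔
    ∃ (n : T.EdgeEnd → ℤ) (m : τ × Fin 4 → ℤ), ∀ d, c d = n (T.edgeEnd d) + m (triangle d) := by
  classical
  constructor
  · intro h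
    refine AddSubgroup.closure_induction (p := fun c _ => ∃ (n : T.EdgeEnd → ℤ)
      (m : τ × Fin 4 → ℤ), ∀ d, c d = n (T.edgeEnd d) + m (triangle d)) ?_ ?_ ?_ ?_ h
    · rintro _ (⟨a, rfl⟩ | ⟨p, rfl⟩)
      · refine ⟨0, fun b => if b = a then 1 else 0, fun d => ?_⟩
        simp only [triangleChain, triangle, Pi.zero_apply, zero_add]
        congr
      · refine ⟨fun b => if b = p then 1 else 0, 0, fun d => ?_⟩
        simp only [vertexChain, Pi.zero_apply, add_zero]
    · exact ⟨0, 0, fun _ => rfl⟩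
    · rintro _ _ _ _ ⟨n, m, h⟩ ⟨n', m', h'⟩
      exact ⟨n + n', m + m', fun d => by simp only [Pi.add_apply, h, h']; ring⟩
    · rintro _ _ ⟨n, m, h⟩
      exact ⟨-n, -m, fun d => by simp only [Pi.neg_apply, h]; ring⟩
  · rintro ⟨n, m, h⟩
    have h1 : c = ∑ p, n p • T.vertexChain p + ∑ a, m a • triangleChain a := by
      ext d
      simp only [Pi.add_apply, Finset.sum_apply, Pi.smul_apply, smul_eq_mul, vertexChain,
        triangleChain, mul_ite, mul_one, mul_zero, h]
      rw [Finset.sum_ite_eq, Finset.sum_ite_eq]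
      simp [triangle]
    rw [h1]
    refine add_mem (sum_mem fun p _ => zsmul_mem (AddSubgroup.subset_closure ?_) _)
      (sum_mem fun p _ => zsmul_mem (AddSubgroup.subset_closure ?_) _)
    · exact Or.inr ⟨p, rfl⟩
    · exact Or.inl ⟨p, rfl⟩

variable {T} (hT : T.IsIdealTriangulation)

theorem torus_rot_corner {κ : T.Cusp} {d : T.CuspCorner κ} {x : TetFlag τ}
    (h : Perm.sign x.2 = 1) (hd : d.1 = x.corner) :
    ((T.torus hT κ).rot d).1 = x.other.corner :=
  (congrArg rot hd).trans (rot_corner h)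

theorem torus_flip_corner {κ : T.Cusp} {d : T.CuspCorner κ} {x : TetFlag τ}
    (h : Perm.sign x.2 = 1) (hd : d.1 = x.corner) :
    ((T.torus hT κ).flip d).1 = (T.cross x).other.corner :=
  (congrArg T.flip hd).trans (T.flip_corner h)

theorem torus_rot_flip_corner {κ : T.Cusp} {d : T.CuspCorner κ} {x : TetFlag τ}
    (h : Perm.sign x.2 = 1) (hd : d.1 = x.corner) :
    ((T.torus hT κ).rot ((T.torus hT κ).flip d)).1 = (T.cross x).corner :=
  (congrArg (fun c => rot (T.flip c)) hd).trans (T.rot_flip_corner h)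

namespace NormalCurve

variable (n : T.NormalCurve)

/-- The part of a normal curve on the torus at a cusp. -/
noncomputable def atCusp (κ : T.Cusp) : (T.torus hT κ).Curve where
  num d := n.num d.1
  matching d := by
    obtain ⟨x, h, hd⟩ : ∃ x : TetFlag τ, Perm.sign x.2 = 1 ∧ d.1 = x.corner :=
      ⟨_, TetFlag.sign_ofCorner d.1, (TetFlag.corner_ofCorner _).symm⟩
    rw [torus_rot_corner hT h hd, torus_flip_corner hT h hd, torus_rot_flip_corner hT h hd, hd,
      n.matching]

theorem pts_atCusp {κ : T.Cusp} {d : T.CuspCorner κ} {x : TetFlag τ}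
    (h : Perm.sign x.2 = 1) (hd : d.1 = x.corner) :
    (n.atCusp hT κ).pts d = n.num x.corner + n.num x.other.corner := by
  change n.num d.1 + n.num ((T.torus hT κ).rot d).1 = _
  rw [torus_rot_corner hT h hd, hd]

/-- An arc of the curve at a cusp, as a numbered arc. -/
def arcVal {κ : T.Cusp} (a : (n.atCusp hT κ).Arc) : Corner τ × ℕ := (a.1.1.1, a.1.2)

theorem arcVal_arcAt {κ : T.Cusp} (p : (n.atCusp hT κ).PtD) {x : TetFlag τ}
    (h : Perm.sign x.2 = 1) (hx : p.1.1.1 = x.corner) :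
    n.arcVal hT ((n.atCusp hT κ).arcAt p) = if p.1.2 < n.num x.corner then (x.corner, p.1.2)
      else (x.other.corner, n.num x.corner + n.num x.other.corner - 1 - p.1.2) := by
  have h1 : (n.atCusp hT κ).num p.1.1 = n.num x.corner := congrArg n.num hx
  unfold TriTorus.Curve.arcAt
  by_cases h2 : p.1.2 < n.num x.corner
  · rw [dif_pos (by rw [h1]; exact h2), if_pos h2]
    exact Prod.ext hx rfl
  · rw [dif_neg (by rw [h1]; exact h2), if_neg h2]
    refine Prod.ext ?_ ?_
    · exact torus_rot_corner hT h hx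
    · change _ - 1 - _ = _
      rw [n.pts_atCusp hT h hx]

/-- The two arcs at an intersection point, in terms of `next`. -/
theorem exists_next {κ : T.Cusp} (p : (n.atCusp hT κ).PtD) :
    ∃ (y : TetFlag τ) (i : ℕ), i < n.num y.corner ∧
      n.arcVal hT ((n.atCusp hT κ).arcAt p) = (y.corner, i) ∧
      n.arcVal hT ((n.atCusp hT κ).arcAt ((n.atCusp hT κ).ptFlip p)) = n.next y i ∧
      ((n.atCusp hT κ).inner p = true ↔ Perm.sign y.2 = 1) ∧
      ((n.atCusp hT κ).inner ((n.atCusp hT κ).ptFlip p) = true ↔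
        ((Perm.sign y.2 = 1) ↔ ¬ i < n.num (T.cross y).corner)) := by
  obtain ⟨x, h, hx⟩ : ∃ x : TetFlag τ, Perm.sign x.2 = 1 ∧ p.1.1.1 = x.corner :=
    ⟨_, TetFlag.sign_ofCorner p.1.1.1, (TetFlag.corner_ofCorner _).symm⟩
  have h' : Perm.sign (T.cross x).other.2 = 1 := by
    rw [TetFlag.sign_other, sign_cross, h, neg_neg]
  have hp := p.2
  rw [n.pts_atCusp hT h hx] at hp
  have hN := n.matching x
  have e1 := n.arcVal_arcAt hT p h hx
  have e2 := n.arcVal_arcAt hT ((n.atCusp hT κ).ptFlip p) h' (torus_flip_corner hT h hx)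
  have e3 : ((n.atCusp hT κ).ptFlip p).1.2 =
      n.num x.corner + n.num x.other.corner - 1 - p.1.2 := by
    change _ - 1 - _ = _
    rw [n.pts_atCusp hT h hx]
  have e4 : (n.atCusp hT κ).inner p = true ↔ p.1.2 < n.num x.corner := by
    rw [TriTorus.Curve.inner, decide_eq_true_iff, ← hx]
    rfl
  have e5 : (n.atCusp hT κ).inner ((n.atCusp hT κ).ptFlip p) = true ↔
      n.num x.corner + n.num x.other.corner - 1 - p.1.2 < n.num (T.cross x).other.corner := by
    rw [TriTorus.Curve.inner, decide_eq_true_iff, ← e3, ← torus_flip_corner hT h hx]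
    rfl
  rw [e3, TetFlag.other_other] at e2
  by_cases hlt : p.1.2 < n.num x.corner
  · rw [if_pos hlt] at e1
    refine ⟨x, p.1.2, hlt, e1, ?_, by simp [e4, hlt, h], ?_⟩
    · rw [e2, next]
      split_ifs with a b b
      · omega
      · rfl
      · congr 1
        omega
      · omega
    · rw [e5]
      simp only [h, true_iff]
      omega
  · rw [if_neg hlt] at e1
    have hs : Perm.sign x.other.2 = -1 := by rw [TetFlag.sign_other, h]
    refine ⟨x.other, _, ?_, e1, ?_, ?_, ?_⟩
    · omega
    · rw [e2, next, cross_other, TetFlag.other_other, TetFlag.other_other]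
      split_ifs with a
      · rfl
      · congr 1
        omega
    · rw [e4, hs]
      simp [hlt]
    · rw [e5, hs, cross_other]
      simp

/-- Each end of an arc is an intersection point. -/
theorem exists_pt {κ : T.Cusp} (y : TetFlag τ) {i : ℕ} (hi : i < n.num y.corner)
    (hκ : T.cusp (triangle y.corner) = κ) :
    ∃ p, n.arcVal hT ((n.atCusp hT κ).arcAt p) = (y.corner, i) ∧
      n.arcVal hT ((n.atCusp hT κ).arcAt ((n.atCusp hT κ).ptFlip p)) = n.next y i := by
  set a : (n.atCusp hT κ).Arc := ⟨(⟨y.corner, hκ⟩, i), hi⟩ with ha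
  have key : ∀ b : Bool, (b = true ↔ Perm.sign y.2 = 1) →
      ∃ p, n.arcVal hT ((n.atCusp hT κ).arcAt p) = (y.corner, i) ∧
        n.arcVal hT ((n.atCusp hT κ).arcAt ((n.atCusp hT κ).ptFlip p)) = n.next y i := by
    intro b hb
    obtain ⟨z, j, hj, h1, h2, h3, -⟩ := n.exists_next hT ((n.atCusp hT κ).ptEquiv.symm (a, b))
    rw [TriTorus.Curve.arcAt_symm] at h1
    rw [TriTorus.Curve.inner_symm, hb] at h3
    have h4 : (y.corner, i) = (z.corner, j) := h1
    rw [Prod.mk.injEq] at h4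
    obtain ⟨h5, rfl⟩ := h4
    have h6 : Perm.sign z.2 = Perm.sign y.2 := by
      rcases Int.units_eq_one_or (Perm.sign z.2) with a | a <;>
        rcases Int.units_eq_one_or (Perm.sign y.2) with b | b <;> simp [a, b] at h3 ⊢
    have h7 : z = y := by
      have h8 := congrArg Subtype.val h5
      simp only [TetFlag.corner, Prod.mk.injEq] at h8
      exact Prod.ext h8.1.symm (even_perm_ext h6 h8.2.1.symm h8.2.2.symm)
    subst h7
    exact ⟨_, by rw [TriTorus.Curve.arcAt_symm]; rfl, h2⟩
  rcases Int.units_eq_one_or (Perm.sign y.2) with h | h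
  · exact key true (by simp [h])
  · exact key false (by simp [h])

theorem arcVal_injective {κ : T.Cusp} : Function.Injective (n.arcVal hT (κ := κ)) := by
  intro a b h
  have h1 := congrArg Prod.fst h
  have h2 := congrArg Prod.snd h
  exact Subtype.ext (Prod.ext (Subtype.ext h1) h2)

/-- The components of the curve at a cusp are components of the whole curve. -/
theorem sameComponent_iff {κ : T.Cusp} (a : (n.atCusp hT κ).Arc) (b : Corner τ × ℕ) :
    n.SameComponent (n.arcVal hT a) b ↔
      ∃ b', n.arcVal hT b' = b ∧ (n.atCusp hT κ).compSetoid a b' := by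
  constructor
  · intro h
    have key : ∀ a b, Relation.EqvGen n.Consecutive a b →
        (∀ a' : (n.atCusp hT κ).Arc, n.arcVal hT a' = a →
          ∃ b', n.arcVal hT b' = b ∧ (n.atCusp hT κ).compSetoid a' b') ∧
        (∀ a' : (n.atCusp hT κ).Arc, n.arcVal hT a' = b →
          ∃ b', n.arcVal hT b' = a ∧ (n.atCusp hT κ).compSetoid a' b') := by
      intro a b hab
      induction hab with
      | rel a b h =>
        obtain ⟨x, i, hi, rfl, rfl⟩ := h
        have hκ : T.cusp (triangle (n.next x i).1) = T.cusp (triangle x.corner) := by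
          rw [next]
          split_ifs
          · exact T.cusp_cross x
          · rw [← cross_other]
            exact T.cusp_cross x.other
        have main : T.cusp (triangle x.corner) = κ → ∃ a' b' : (n.atCusp hT κ).Arc,
            n.arcVal hT a' = (x.corner, i) ∧ n.arcVal hT b' = n.next x i ∧
              (n.atCusp hT κ).compSetoid a' b' := by
          intro h
          obtain ⟨p, h1, h2⟩ := n.exists_pt hT x hi h
          exact ⟨_, _, h1, h2, Relation.EqvGen.rel _ _ ⟨p, rfl, rfl⟩⟩
        constructor
        · intro a' ha'
          obtain ⟨u, v, h1, h2, h3⟩ := main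
            ((congrArg (fun q => T.cusp (triangle q.1)) ha').symm.trans a'.1.1.2)
          obtain rfl := n.arcVal_injective hT (ha'.trans h1.symm)
          exact ⟨v, h2, h3⟩
        · intro a' ha'
          obtain ⟨u, v, h1, h2, h3⟩ := main (hκ.symm.trans
            ((congrArg (fun q => T.cusp (triangle q.1)) ha').symm.trans a'.1.1.2))
          obtain rfl := n.arcVal_injective hT (ha'.trans h2.symm)
          exact ⟨u, h1, (n.atCusp hT κ).compSetoid.symm h3⟩
      | refl a => exact ⟨fun a' h => ⟨a', h, (n.atCusp hT κ).compSetoid.refl _⟩,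
          fun a' h => ⟨a', h, (n.atCusp hT κ).compSetoid.refl _⟩⟩
      | symm a b _ ih => exact ih.symm
      | trans a b c _ _ ih1 ih2 =>
        constructor
        · intro a' ha'
          obtain ⟨b', hb', h1⟩ := ih1.1 a' ha'
          obtain ⟨c', hc', h2⟩ := ih2.1 b' hb'
          exact ⟨c', hc', (n.atCusp hT κ).compSetoid.trans h1 h2⟩
        · intro a' ha'
          obtain ⟨b', hb', h1⟩ := ih2.2 a' ha'
          obtain ⟨c', hc', h2⟩ := ih1.2 b' hb'
          exact ⟨c', hc', (n.atCusp hT κ).compSetoid.trans h1 h2⟩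
    exact (key _ _ h).1 a rfl
  · rintro ⟨b', rfl, h⟩
    have key : ∀ a b, Relation.EqvGen (n.atCusp hT κ).Adjacent a b →
        Relation.EqvGen n.Consecutive (n.arcVal hT a) (n.arcVal hT b) := by
      intro a b hab
      induction hab with
      | rel a b h =>
        obtain ⟨p, rfl, rfl⟩ := h
        obtain ⟨y, i, hi, h1, h2, -⟩ := n.exists_next hT p
        exact Relation.EqvGen.rel _ _ ⟨y, i, hi, h1, h2⟩
      | refl a => exact Relation.EqvGen.refl _
      | symm a b _ ih => exact ih.symm
      | trans a b c _ _ ih1 ih2 => exact ih1.trans _ _ _ ih2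
    exact key _ _ h

end NormalCurve

namespace OrientedCurve

variable (ϖ : T.OrientedCurve)

/-- The orientation of the part of an oriented curve at a cusp. -/
noncomputable def atCusp (κ : T.Cusp) : (ϖ.toNormalCurve.atCusp hT κ).Orientation where
  sgn a := ϖ.orient a.1.1.1 a.1.2
  sgn_cases a := by
    rcases Int.units_eq_one_or (ϖ.orient a.1.1.1 a.1.2) with h | h <;> simp [h]
  atPt_flip p := by
    obtain ⟨y, i, hi, h1, h2, h3, h4⟩ := ϖ.toNormalCurve.exists_next hT p
    have e : ∀ a : (ϖ.toNormalCurve.atCusp hT κ).Arc, (ϖ.orient a.1.1.1 a.1.2 : ℤ) =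
      ϖ.orient (ϖ.toNormalCurve.arcVal hT a).1 (ϖ.toNormalCurve.arcVal hT a).2 := fun _ => rfl
    simp only [TriTorus.Curve.atPt, h3, h4, e, h1, h2, NormalCurve.next]
    by_cases h : i < ϖ.num (T.cross y).corner
    · have := ϖ.orient_same y i hi h
      simp only [h, if_true, this]
      by_cases hs : Perm.sign y.2 = 1 <;> simp [hs]
    · have := ϖ.orient_other y i hi (not_lt.1 h)
      simp only [h, if_false, this]
      by_cases hs : Perm.sign y.2 = 1 <;> simp [hs]

theorem total_atCusp (κ : T.Cusp) (d : T.CuspCorner κ) :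
    TriTorus.Curve.total (ϖ.atCusp hT κ).sgn d = ϖ.turning d.1 := by
  refine Finset.sum_congr rfl fun i hi => ?_
  exact dif_pos (Finset.mem_range.1 hi)

/-- The curves at the cusps are essential. -/
theorem essential_atCusp (h : ϖ.Essential) (κ : T.Cusp) : (ϖ.atCusp hT κ).Essential := by
  classical
  rintro a ⟨n, m, hnm⟩
  refine h a.1.1.1 a.1.2 a.2 (T.mem_boundaries_iff.2 ?_)
  refine ⟨fun p => if hp : ∃ c : Corner τ, T.edgeEnd c = p ∧ T.cusp (c.1.1, c.1.2.1) = κ then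
    n ⟨p, hp⟩ else 0, fun b => if hb : T.cusp b = κ then m ⟨b, hb⟩ else 0, fun d => ?_⟩
  have hsame := ϖ.toNormalCurve.sameComponent_iff hT a
  dsimp only
  by_cases hd : T.cusp (triangle d) = κ
  · rw [dif_pos ⟨d, rfl, hd⟩, dif_pos hd]
    refine Eq.trans ?_ (hnm ⟨d, hd⟩)
    refine Finset.sum_congr rfl fun i hi => ?_
    have hi := Finset.mem_range.1 hi
    rw [TriTorus.Curve.ext, dif_pos (show i < (ϖ.toNormalCurve.atCusp hT κ).num ⟨d, hd⟩ from hi)]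
    have : ϖ.toNormalCurve.SameComponent (a.1.1.1, a.1.2) (d, i) ↔
        (ϖ.toNormalCurve.atCusp hT κ).compSetoid a ⟨(⟨d, hd⟩, i), hi⟩ := by
      refine (hsame (d, i)).trans ⟨?_, fun h => ⟨_, rfl, h⟩⟩
      rintro ⟨b', hb', h⟩
      rwa [ϖ.toNormalCurve.arcVal_injective hT
        (hb'.trans (show (d, i) = ϖ.toNormalCurve.arcVal hT ⟨(⟨d, hd⟩, i), hi⟩ from rfl))] at h
    simp only [this]
    rfl
  · rw [dif_neg, dif_neg hd, add_zero]
    · refine Finset.sum_eq_zero fun i _ => if_neg fun h => hd ?_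
      obtain ⟨b', hb', -⟩ := (hsame (d, i)).1 h
      rw [← show b'.1.1.1 = d from congrArg Prod.fst hb']
      exact b'.1.1.2
    · rintro ⟨c, hc, hκ⟩
      apply hd
      rw [← hκ]
      have hh : ∀ e, T.cusp (triangle (rot (T.flip e))) = κ ↔ T.cusp (triangle e) = κ := fun e => by
        rw [cusp_rot, cusp_flip]
      exact ((T.edgeEnd_ind (f := fun c => T.cusp (triangle c) = κ) hh hc).1 hκ).trans hκ.symm

/-- Two homologous essential curves differ by the coboundary of a vertex function and a triangle function
whose defect is zero. -/
theorem exists_defect_zero {ϖ ϖ' : T.OrientedCurve} (hT : T.IsIdealTriangulation)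
    (h : ϖ.Essential) (h' : ϖ'.Essential) (hb : ϖ.turning - ϖ'.turning ∈ T.boundaries) :
    ∃ (n : T.EdgeEnd → ℤ) (m : τ × Fin 4 → ℤ),
      (∀ d, ϖ.turning d - ϖ'.turning d = n (T.edgeEnd d) + m (triangle d)) ∧
      2 * ∑ p, n p + ∑ a, m a = 0 := by
  classical
  obtain ⟨n, m, hnm⟩ := T.mem_boundaries_iff.1 hb
  refine ⟨n, m, hnm, ?_⟩
  have key : ∀ κ : T.Cusp, 2 * ∑ p : T.CuspEnd κ, n p + ∑ a : T.CuspTriangle κ, m a = 0 := by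
    intro κ
    have h0 : (T.torus hT κ).HasDefect (TriTorus.Curve.total (ϖ.atCusp hT κ).sgn -
        TriTorus.Curve.total (ϖ'.atCusp hT κ).sgn)
        (2 * ∑ p : T.CuspEnd κ, n p + ∑ a : T.CuspTriangle κ, m a) := by
      refine ⟨fun p => n p, fun a => m a, fun d => ?_, rfl⟩
      rw [Pi.sub_apply, total_atCusp, total_atCusp]
      exact hnm d.1
    have h1 := TriTorus.Curve.Orientation.Essential.hasDefect_total_sub
      (ϖ.essential_atCusp hT h κ) (ϖ'.essential_atCusp hT h' κ) h0.isCob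
    obtain ⟨⟨t, v⟩, hv⟩ := Quot.exists_rep κ
    obtain ⟨w, hw⟩ := exists_ne v
    have : Nonempty (T.CuspCorner κ) := ⟨⟨⟨(t, v, w), hw.symm⟩, hv⟩⟩
    exact h0.unique h1
  -- the sums over all vertices and triangles are sums over the cusps
  have hcusp : ∀ p : T.EdgeEnd, ∃ κ, ∃ c : Corner τ, T.edgeEnd c = p ∧
      T.cusp (c.1.1, c.1.2.1) = κ := by
    intro p
    obtain ⟨c, hc⟩ := Quot.exists_rep p
    exact ⟨_, c, hc, rfl⟩
  choose f hf using hcusp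
  have hfib : ∀ p κ, f p = κ ↔ ∃ c : Corner τ, T.edgeEnd c = p ∧ T.cusp (c.1.1, c.1.2.1) = κ := by
    intro p κ
    constructor
    · rintro rfl
      exact hf p
    · rintro ⟨c, hc, hκ⟩
      obtain ⟨c', hc', hκ'⟩ := hf p
      have hh : ∀ e, T.cusp (triangle (rot (T.flip e))) = κ ↔ T.cusp (triangle e) = κ := fun e => by
        rw [cusp_rot, cusp_flip]
      exact hκ'.symm.trans ((T.edgeEnd_ind (f := fun c => T.cusp (triangle c) = κ) hh (hc.trans hc'.symm)).1 hκ)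
  have s1 : ∑ p, n p = ∑ κ, ∑ p : T.CuspEnd κ, n p := by
    rw [← Finset.sum_fiberwise _ f]
    refine Finset.sum_congr rfl fun κ _ => ?_
    exact Finset.sum_subtype _ (fun p => by simp [hfib]) _
  have s2 : ∑ a, m a = ∑ κ, ∑ a : T.CuspTriangle κ, m a := by
    rw [← Finset.sum_fiberwise _ T.cusp]
    refine Finset.sum_congr rfl fun κ _ => ?_
    exact Finset.sum_subtype _ (fun p => by simp) _
  rw [s1, s2, Finset.mul_sum, ← Finset.sum_add_distrib]
  exact Finset.sum_eq_zero fun κ _ => key κ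

end OrientedCurve

end FacePairing

/-! ### The 3D index as a sum over a lattice -/

/-- The sums of a function of the edges of a tetrahedron over the pairs of opposite edges. -/
def oppSum (f : Fin 4 → Fin 4 → ℤ) : Fin 3 → ℤ := ![f 0 1 + f 2 3, f 0 2 + f 1 3, f 0 3 + f 1 2]

namespace TetIndex

/-- The contribution of a tetrahedron to the 3D index, as a function of integer labels of its
edges. -/
noncomputable def tetSym (f : Fin 4 → Fin 4 → ℤ) : LaurentSeries ℤ :=
  symIndex (oppSum f 0) (oppSum f 1) (oppSum f 2)

theorem tetSym_comp {f : Fin 4 → Fin 4 → ℤ} (hf : ∀ v w, f v w = f w v) (π : Perm (Fin 4)) :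
    tetSym (fun v w => f (π v) (π w)) = tetSym f := by
  have hπ : π ∈ Submonoid.closure (Set.range fun i : Fin 3 => swap i.castSucc i.succ) := by
    rw [Equiv.Perm.mclosure_swap_castSucc_succ]
    trivial
  revert f
  induction hπ using Submonoid.closure_induction with
  | mem x h =>
    obtain ⟨i, rfl⟩ := h
    intro f hf
    fin_cases i
    · have : tetSym (fun v w => f (swap 0 1 v) (swap 0 1 w)) =
          symIndex (f 0 1 + f 2 3) (f 0 3 + f 1 2) (f 0 2 + f 1 3) := by
        simp [tetSym, oppSum, swap_apply_of_ne_of_ne, hf 1 0, add_comm]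
      refine this.trans ?_
      rw [symIndex_swap₂₃]
      rfl
    · have : tetSym (fun v w => f (swap 1 2 v) (swap 1 2 w)) =
          symIndex (f 0 2 + f 1 3) (f 0 1 + f 2 3) (f 0 3 + f 1 2) := by
        simp [tetSym, oppSum, swap_apply_of_ne_of_ne, hf 2 1]
      refine this.trans ?_
      rw [symIndex_swap₁₂]
      rfl
    · have : tetSym (fun v w => f (swap 2 3 v) (swap 2 3 w)) =
          symIndex (f 0 1 + f 2 3) (f 0 3 + f 1 2) (f 0 2 + f 1 3) := by
        simp [tetSym, oppSum, swap_apply_of_ne_of_ne, hf 3 2]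
      refine this.trans ?_
      rw [symIndex_swap₂₃]
      rfl
  | one => intro f _; rfl
  | mul x y _ _ hx hy =>
    intro f hf
    exact (hy (f := fun v w => f (x v) (x w)) fun v w => hf _ _).trans (hx hf)

end TetIndex

namespace FacePairing

variable {τ : Type*} (T : FacePairing τ)

/-- The labels on the edges of a tetrahedron given by a chain on the boundary and a function on the
edges of the triangulation. -/
def edgeLabel (c : Corner τ → ℤ) (k : T.Edge → ℤ) (t : τ) (v w : Fin 4) : ℤ :=
  if h : v ≠ w then c ⟨(t, v, w), h⟩ + c ⟨(t, w, v), h.symm⟩ + k (T.edge ⟨(t, v, w), h⟩) else 0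

theorem edge_symm {t : τ} {v w : Fin 4} (h : v ≠ w) :
    T.edge ⟨(t, v, w), h⟩ = T.edge ⟨(t, w, v), h.symm⟩ := by
  obtain ⟨σ, -, rfl, rfl⟩ := exists_even_perm v w h
  refine Quot.sound ⟨(t, σ), rfl, Or.inr (Subtype.ext ?_)⟩
  simp [TetFlag.corner, TetFlag.reorder]

theorem edgeLabel_symm (c : Corner τ → ℤ) (k : T.Edge → ℤ) (t : τ) (v w : Fin 4) :
    T.edgeLabel c k t v w = T.edgeLabel c k t w v := by
  by_cases h : v = w
  · rw [h]
  · have h' : w ≠ v := fun e => h e.symm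
    rw [edgeLabel, edgeLabel, dif_pos h, dif_pos h', T.edge_symm h]
    ring

section Index

variable [Fintype τ]

theorem sum_mul_edgeCoeff (k : T.Edge → ℤ) (t : τ) (a : Fin 3) : ∑ E, k E * T.edgeCoeff E t a =
    ∑ v : Fin 4, ∑ w : Fin 4,
      if h : v < w then if quadType v w = a then k (T.edge ⟨(t, v, w), h.ne⟩) else 0 else 0 := by
  simp only [edgeCoeff, Finset.mul_sum]
  rw [Finset.sum_comm]
  refine Finset.sum_congr rfl fun v _ => ?_
  rw [Finset.sum_comm]
  refine Finset.sum_congr rfl fun w _ => ?_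
  by_cases h1 : v < w
  · by_cases h2 : quadType v w = a <;> simp [h1, h2]
  · simp [h1]

/-- The labels summed over opposite edges are turning numbers plus coefficients of
edge equations. -/
theorem oppSum_edgeLabel (c : Corner τ → ℤ) (k : T.Edge → ℤ) (t : τ) (a : Fin 3) :
    oppSum (T.edgeLabel c k t) a = turningNumber c t a + ∑ E, k E * T.edgeCoeff E t a := by
  rw [sum_mul_edgeCoeff]
  fin_cases a <;>
  · simp [oppSum, edgeLabel, turningNumber, Fin.sum_univ_four, quadType]
    ring

/-- The summand of the 3D index at a function on the edges, in symmetric form. -/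
noncomputable def latticeTerm (c : Corner τ → ℤ) (k : T.Edge → ℤ) : LaurentSeries ℤ :=
  TetIndex.negSqrtQPow (2 * ∑ E, k E) * ∏ t, TetIndex.tetSym (T.edgeLabel c k t)

/-- Functions on the edges with equal sums over the three pairs of opposite edges of each
tetrahedron. -/
def flatLattice : AddSubgroup (T.Edge → ℤ) where
  carrier := {k | ∀ t a, ∑ E, k E * T.edgeCoeff E t a = ∑ E, k E * T.edgeCoeff E t 0}
  zero_mem' t a := by simp
  add_mem' h h' t a := by
    simp only [Pi.add_apply, add_mul, Finset.sum_add_distrib, h t a, h' t a]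
  neg_mem' h t a := by
    simp only [Pi.neg_apply, neg_mul, Finset.sum_neg_distrib, h t a]

variable {T}

/-- An angle structure pairs the coefficients of the edge equations with the sum of the values. -/
theorem two_mul_sum_of_flat {α : τ → Fin 3 → ℝ} (hα : T.IsGeneralisedAngleStructure α)
    {k : T.Edge → ℤ} (hk : k ∈ T.flatLattice) :
    2 * ∑ E, k E = ∑ t, ∑ E, k E * T.edgeCoeff E t 0 := by
  have h1 : ∑ E, (k E : ℝ) * (2 * Real.pi) =
      ∑ t, (∑ E, (k E : ℝ) * T.edgeCoeff E t 0) * Real.pi := by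
    calc ∑ E, (k E : ℝ) * (2 * Real.pi)
        = ∑ E, (k E : ℝ) * ∑ t, ∑ a, (T.edgeCoeff E t a : ℝ) * α t a :=
          Finset.sum_congr rfl fun E _ => by rw [hα.edge]
      _ = ∑ t, ∑ a, (∑ E, (k E : ℝ) * T.edgeCoeff E t a) * α t a := by
          simp only [Finset.mul_sum, Finset.sum_mul]
          rw [Finset.sum_comm]
          refine Finset.sum_congr rfl fun t _ => ?_
          rw [Finset.sum_comm]
          exact Finset.sum_congr rfl fun a _ => Finset.sum_congr rfl fun E _ => by ring
      _ = ∑ t, (∑ E, (k E : ℝ) * T.edgeCoeff E t 0) * Real.pi := by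
          refine Finset.sum_congr rfl fun t _ => ?_
          have h2 : ∀ a, ∑ E, (k E : ℝ) * T.edgeCoeff E t a =
              ∑ E, (k E : ℝ) * T.edgeCoeff E t 0 := fun a => by
            exact_mod_cast hk t a
          simp only [h2, ← Finset.mul_sum, Fin.sum_univ_three, hα.tetrahedron t]
  rw [← Finset.sum_mul, ← Finset.sum_mul] at h1
  have h3 : ((2 * ∑ E, k E : ℤ) : ℝ) = ((∑ t, ∑ E, k E * T.edgeCoeff E t 0 : ℤ) : ℝ) := by
    push_cast
    have := Real.pi_pos
    have := mul_right_cancel₀ this.ne' (b := Real.pi)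
      (a := 2 * ∑ E, (k E : ℝ)) (c := ∑ t, ∑ E, (k E : ℝ) * T.edgeCoeff E t 0) (by linarith)
    exact this
  exact_mod_cast h3

theorem tetSym_eq_of_oppSum {f g : Fin 4 → Fin 4 → ℤ} {s : ℤ}
    (h : ∀ a, oppSum f a = oppSum g a + s) :
    TetIndex.tetSym f = TetIndex.negSqrtQPow (-s) * TetIndex.tetSym g := by
  rw [TetIndex.tetSym, h, h, h, TetIndex.symIndex_add, TetIndex.tetSym]

theorem prod_negSqrtQPow {ι : Type*} (s : Finset ι) (f : ι → ℤ) :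
    ∏ i ∈ s, TetIndex.negSqrtQPow (f i) = TetIndex.negSqrtQPow (∑ i ∈ s, f i) := by
  classical
  induction s using Finset.induction_on with
  | empty => simp
  | insert i s hi ih => rw [Finset.prod_insert hi, Finset.sum_insert hi, ih,
      TetIndex.negSqrtQPow_add]

/-- Chains and edge functions whose opposite sums differ by a constant in each tetrahedron. -/
theorem latticeTerm_eq_of_oppSum {c c' : Corner τ → ℤ} {k k' : T.Edge → ℤ} {s : τ → ℤ}
    (h : ∀ t a, oppSum (T.edgeLabel c k t) a = oppSum (T.edgeLabel c' k' t) a + s t)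
    (hs : 2 * ∑ E, k E - ∑ t, s t = 2 * ∑ E, k' E) :
    T.latticeTerm c k = T.latticeTerm c' k' := by
  rw [latticeTerm, latticeTerm, ← hs, Finset.prod_congr rfl fun t _ => tetSym_eq_of_oppSum (h t),
    Finset.prod_mul_distrib, prod_negSqrtQPow, ← mul_assoc, ← TetIndex.negSqrtQPow_add,
    Finset.sum_neg_distrib, sub_eq_add_neg]

/-- The flat lattice does not change the summands of the index. -/
theorem latticeTerm_add_flat {α : τ → Fin 3 → ℝ} (hα : T.IsGeneralisedAngleStructure α)
    (c : Corner τ → ℤ) (k : T.Edge → ℤ) {κ : T.Edge → ℤ} (hκ : κ ∈ T.flatLattice) :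
    T.latticeTerm c (k + κ) = T.latticeTerm c k := by
  refine latticeTerm_eq_of_oppSum (s := fun t => ∑ E, κ E * T.edgeCoeff E t 0) ?_ ?_
  · intro t a
    rw [oppSum_edgeLabel, oppSum_edgeLabel, ← hκ t a]
    simp only [Pi.add_apply, add_mul, Finset.sum_add_distrib]
    ring
  · rw [← two_mul_sum_of_flat hα hκ]
    simp only [Pi.add_apply, Finset.sum_add_distrib]
    ring

variable (T) in
/-- The lattice of edge functions modulo those that do not change the summands of the index. -/
abbrev EdgeLattice := (T.Edge → ℤ) ⧸ T.flatLattice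

theorem latticeTerm_eq_of_mk_eq (hα : T.HasIndexStructure) (c : Corner τ → ℤ)
    {k k' : T.Edge → ℤ} (h : (k : T.EdgeLattice) = k') :
    T.latticeTerm c k = T.latticeTerm c k' := by
  obtain ⟨α, hα⟩ := hα
  have h1 := (QuotientAddGroup.eq).1 h
  rw [show k' = k + (-k + k') by abel, latticeTerm_add_flat (hα fun _ => 0).1 c k h1]

variable (T) in
/-- The summands of the index, as a function on the lattice. -/
noncomputable def quotTerm (c : Corner τ → ℤ) (l : T.EdgeLattice) : LaurentSeries ℤ :=
  T.latticeTerm c l.out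

theorem quotTerm_mk (hα : T.HasIndexStructure) (c : Corner τ → ℤ) (k : T.Edge → ℤ) :
    T.quotTerm c k = T.latticeTerm c k :=
  latticeTerm_eq_of_mk_eq hα c (Quotient.out_eq _)

/-- Extension by zero of a function on a set of edges. -/
noncomputable def extZero {S : Finset T.Edge} (k : S → ℤ) (E : T.Edge) : ℤ := if h : E ∈ S then k ⟨E, h⟩ else 0

theorem sum_extZero {S : Finset T.Edge} {M : Type*} [AddCommGroup M] (k : S → ℤ)
    (f : T.Edge → M) : ∑ E, extZero k E • f E = ∑ E : S, k E • f E := by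
  rw [← Finset.sum_subset (Finset.subset_univ S), ← Finset.sum_coe_sort]
  · exact Finset.sum_congr rfl fun E _ => by rw [extZero, dif_pos E.2]
  · intro E _ hE
    rw [extZero, dif_neg hE, zero_smul]

theorem indexTerm_eq (Q : τ → Fin 3) (ϖ : T.OrientedCurve) (S : Finset T.Edge) (k : S → ℤ) :
    T.indexTerm Q ϖ S k = T.latticeTerm ϖ.turning (extZero k) := by
  have h : ∀ t, TetIndex.tetSym (T.edgeLabel ϖ.turning (extZero k) t) =
      TetIndex.negSqrtQPow (-(turningNumber ϖ.turning t (Q t) +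
        ∑ E : S, k E * T.edgeCoeff E t (Q t))) *
      TetIndex.tetIndex
      (-(turningNumber ϖ.turning t (Q t + 1) - turningNumber ϖ.turning t (Q t))
        - ∑ E, k E * T.nzB Q E t)
      ((turningNumber ϖ.turning t (Q t + 2) - turningNumber ϖ.turning t (Q t))
        + ∑ E, k E * T.nzA Q E t) := by
    intro t
    set x := oppSum (T.edgeLabel ϖ.turning (extZero k) t) with hx
    have hx' : ∀ a, x a = turningNumber ϖ.turning t a + ∑ E : S, k E * T.edgeCoeff E t a := by
      intro a
      rw [hx, oppSum_edgeLabel]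
      congr 1
      exact sum_extZero k fun E => T.edgeCoeff E t a
    have h1 : ∀ q : Fin 3, TetIndex.symIndex (x 0) (x 1) (x 2) =
        TetIndex.symIndex (x (q + 2)) (x q) (x (q + 1)) := by
      intro q
      fin_cases q
      · change _ = TetIndex.symIndex (x 2) (x 0) (x 1)
        rw [TetIndex.symIndex_swap₁₂ (x 0) (x 2), TetIndex.symIndex_swap₂₃ (x 0) (x 1)]
      · rfl
      · change _ = TetIndex.symIndex (x 1) (x 2) (x 0)
        rw [TetIndex.symIndex_swap₂₃ (x 1) (x 0), TetIndex.symIndex_swap₁₂ (x 0) (x 1)]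
    rw [TetIndex.tetSym, ← hx, h1 (Q t), TetIndex.symIndex, hx', hx', hx']
    congr 2
    · simp only [nzB, mul_sub, Finset.sum_sub_distrib]
      ring
    · simp only [nzA, mul_sub, Finset.sum_sub_distrib]
      ring
  rw [latticeTerm, Finset.prod_congr rfl fun t _ => h t, Finset.prod_mul_distrib,
    prod_negSqrtQPow, ← mul_assoc, ← TetIndex.negSqrtQPow_add, indexTerm]
  congr 2
  have h2 := sum_extZero k fun E => (2 : ℤ)
  simp only [smul_eq_mul] at h2
  rw [mul_comm, Finset.sum_mul, h2]
  simp only [nu, mul_sub, Finset.sum_sub_distrib, Finset.sum_neg_distrib, Finset.sum_add_distrib,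
    Finset.mul_sum]
  rw [Finset.sum_comm]
  ring

end Index

end FacePairing

/-! ### Homology invariance of the 3D index -/

namespace FacePairing

variable {τ : Type*} (T : FacePairing τ)

/-- The same edge of a tetrahedron, seen from its other end. -/
def rev : Perm (Corner τ) where
  toFun c := ⟨(c.1.1, c.1.2.2, c.1.2.1), c.2.symm⟩
  invFun c := ⟨(c.1.1, c.1.2.2, c.1.2.1), c.2.symm⟩
  left_inv _ := rfl
  right_inv _ := rfl

theorem rev_rev (c : Corner τ) : rev (rev c) = c := rfl

theorem rev_ne (c : Corner τ) : rev c ≠ c := by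
  intro h
  exact c.2.symm (congrArg (fun c : Corner τ => c.1.2.1) h)

theorem rev_corner (x : TetFlag τ) : rev x.corner = (x.reorder (swap 0 1)).corner := by
  apply Subtype.ext
  simp [rev, TetFlag.corner, TetFlag.reorder]

theorem cross_rev (x : TetFlag τ) : (T.cross (x.reorder (swap 0 1))).corner =
    rev (T.cross x).corner := by
  rw [rev_corner, cross_reorder _ _ (by decide)]

theorem edgeEnd_rev {c c' : Corner τ} (h : T.edgeEnd c = T.edgeEnd c') :
    T.edgeEnd (rev c) = T.edgeEnd (rev c') := by
  have h1 := Quot.eqvGen_exact h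
  clear h
  induction h1 with
  | rel a b h =>
    obtain ⟨x, rfl, rfl⟩ := h
    rw [← cross_rev, edgeEnd_cross, rev_corner]
  | refl a => rfl
  | symm a b _ ih => exact ih.symm
  | trans a b c _ _ ih1 ih2 => exact ih1.trans ih2

/-- The rotation of the corners around the vertices of the boundary. -/
noncomputable def around : Perm (Corner τ) := rot * T.flip

theorem around_corner {x : TetFlag τ} (h : Perm.sign x.2 = 1) :
    T.around x.corner = (T.cross x).corner := T.rot_flip_corner h

theorem around_rev_around (c : Corner τ) : T.around (rev (T.around c)) = rev c := by
  obtain ⟨x, h, rfl⟩ : ∃ x : TetFlag τ, Perm.sign x.2 = 1 ∧ c = x.corner :=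
    ⟨_, TetFlag.sign_ofCorner c, (TetFlag.corner_ofCorner _).symm⟩
  rw [around_corner T h, ← cross_rev, around_corner, cross_cross, rev_corner]
  rw [sign_cross]
  simp [TetFlag.reorder, h]

/-- The two ends of an edge are different vertices of the triangulation of the boundary. -/
theorem edgeEnd_rev_ne (c : Corner τ) : T.edgeEnd (rev c) ≠ T.edgeEnd c := by
  intro h
  have h1 : ∃ n : ℤ, (T.around ^ n) c = rev c := by
    refine (T.edgeEnd_ind (f := fun d => ∃ n : ℤ, (T.around ^ n) c = d) ?_ h).2 ⟨0, rfl⟩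
    intro d
    constructor
    · rintro ⟨n, hn⟩
      refine ⟨n - 1, T.around.injective ?_⟩
      rw [← Perm.mul_apply, ← zpow_one_add, add_sub_cancel, hn]
      rfl
    · rintro ⟨n, rfl⟩
      refine ⟨1 + n, ?_⟩
      rw [zpow_one_add]
      rfl
  obtain ⟨n, hn⟩ := h1
  -- reversal conjugates the rotation around a vertex to its inverse, so it is a reflection of the
  -- orbit
  have hconj : ∀ k : ℤ, ∀ c, rev ((T.around ^ k) c) = (T.around ^ (-k)) (rev c) := by
    intro k c
    have e1 : (rev * T.around * rev⁻¹ : Perm (Corner τ)) = T.around⁻¹ := by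
      have e2 : (T.around * rev * T.around : Perm (Corner τ)) = rev := by
        ext1 d
        exact T.around_rev_around d
      rw [mul_inv_eq_iff_eq_mul, eq_inv_mul_iff_mul_eq, ← mul_assoc]
      exact e2
    rw [zpow_neg, ← inv_zpow, ← e1, conj_zpow]
    simp
  obtain ⟨k, hk⟩ := Int.even_or_odd' n
  set y := (T.around ^ k) c with hy
  have hrev : rev y = (T.around ^ (n - k)) c := by
    rw [hy, hconj, ← hn, ← Perm.mul_apply, ← zpow_add]
    congr 2
    ring
  -- a reflection fixes a corner, or the face between two corners, which would be glued to itself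
  rcases hk with hk | hk
  · rw [hk, show 2 * k - k = k by ring] at hrev
    exact rev_ne y hrev
  · rw [hk, show 2 * k + 1 - k = 1 + k by ring, zpow_one_add, Perm.mul_apply, ← hy] at hrev
    obtain ⟨x, h, hx⟩ : ∃ x : TetFlag τ, Perm.sign x.2 = 1 ∧ y = x.corner :=
      ⟨_, TetFlag.sign_ofCorner y, (TetFlag.corner_ofCorner _).symm⟩
    rw [hx, around_corner T h, rev_corner] at hrev
    have h1 := congrArg Subtype.val hrev
    simp only [TetFlag.corner, Prod.mk.injEq] at h1
    have h2 : (x.reorder (swap 0 1)).2 = (T.cross x).2 :=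
      even_perm_ext (by rw [sign_cross]; simp [TetFlag.reorder, h]) h1.2.1 h1.2.2
    apply T.not_self x.1 (x.2 3)
    rw [Prod.mk.injEq]
    refine ⟨h1.1.symm, ?_⟩
    have h3 := congrArg (fun σ : Perm (Fin 4) => σ 3) h2
    simp only [TetFlag.reorder, cross, Perm.mul_apply] at h3
    rw [swap_apply_of_ne_of_ne (by decide) (by decide)] at h3
    exact h3.symm

theorem edge_eq_iff {c c' : Corner τ} : T.edge c = T.edge c' ↔
    T.edgeEnd c' = T.edgeEnd c ∨ T.edgeEnd c' = T.edgeEnd (rev c) := by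
  have hrev : ∀ c, T.edge (rev c) = T.edge c := fun c => (T.edge_symm c.2).symm
  constructor
  · intro h
    have h1 := Quot.eqvGen_exact h
    clear h
    induction h1 with
    | rel a b h =>
      obtain ⟨x, rfl, rfl | rfl⟩ := h
      · exact Or.inl (T.edgeEnd_cross x)
      · rw [← rev_corner]
        exact Or.inr rfl
    | refl a => exact Or.inl rfl
    | symm a b _ ih =>
      rcases ih with h | h
      · exact Or.inl h.symm
      · exact Or.inr (T.edgeEnd_rev h).symm
    | trans a b c _ _ ih1 ih2 =>
      rcases ih1 with h | h <;> rcases ih2 with h' | h'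
      · exact Or.inl (h'.trans h)
      · exact Or.inr (h'.trans (T.edgeEnd_rev h))
      · exact Or.inr (h'.trans h)
      · exact Or.inl (h'.trans (T.edgeEnd_rev h))
  · have hend : ∀ {c c'}, T.edgeEnd c = T.edgeEnd c' → T.edge c = T.edge c' := by
      intro c c' h
      have h1 := Quot.eqvGen_exact h
      clear h
      induction h1 with
      | rel a b h =>
        obtain ⟨x, rfl, rfl⟩ := h
        exact Quot.sound ⟨x, rfl, Or.inl rfl⟩
      | refl a => rfl
      | symm a b _ ih => exact ih.symm
      | trans a b c _ _ ih1 ih2 => exact ih1.trans ih2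
    rintro (h | h)
    · exact (hend h).symm
    · rw [← hrev c]
      exact (hend h).symm

theorem edge_rev (c : Corner τ) : T.edge (rev c) = T.edge c :=
  (T.edge_eq_iff.2 (Or.inr rfl)).symm

section Sums

variable [Fintype τ]

/-- The sum of a function on the two ends of the edges. -/
theorem exists_endSum (n : T.EdgeEnd → ℤ) : ∃ k : T.Edge → ℤ,
    (∀ c, k (T.edge c) = n (T.edgeEnd c) + n (T.edgeEnd (rev c))) ∧ ∑ E, k E = ∑ p, n p := by
  classical
  have hr : Function.Surjective T.edge := Quot.exists_rep
  choose r hr using hr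
  have hk : ∀ c, n (T.edgeEnd (r (T.edge c))) + n (T.edgeEnd (rev (r (T.edge c)))) =
      n (T.edgeEnd c) + n (T.edgeEnd (rev c)) := by
    intro c
    rcases T.edge_eq_iff.1 (hr (T.edge c)) with h | h
    · rw [h, T.edgeEnd_rev h]
    · rw [h, T.edgeEnd_rev h, rev_rev, add_comm]
  refine ⟨fun E => n (T.edgeEnd (r E)) + n (T.edgeEnd (rev (r E))), hk, ?_⟩
  -- each edge has exactly two ends
  have hs : Function.Surjective T.edgeEnd := Quot.exists_rep
  choose s hs using hs
  rw [← Finset.sum_fiberwise _ (fun p => T.edge (s p))]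
  refine Finset.sum_congr rfl fun E _ => ?_
  have : Finset.univ.filter (fun p => T.edge (s p) = E) =
      {T.edgeEnd (r E), T.edgeEnd (rev (r E))} := by
    ext p
    simp only [Finset.mem_filter, Finset.mem_univ, true_and, Finset.mem_insert,
      Finset.mem_singleton]
    rw [← hr E, eq_comm, T.edge_eq_iff, hs, hr]
  rw [this, Finset.sum_pair (T.edgeEnd_rev_ne _).symm]

variable {T}

/-- The index does not depend on the curve in its class. -/
theorem hasLaurentSum_quotTerm_iff (hT : T.IsIdealTriangulation) (hα : T.HasIndexStructure)
    {ϖ ϖ' : T.OrientedCurve} (h : ϖ.Essential) (h' : ϖ'.Essential)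
    (hb : ϖ.turning - ϖ'.turning ∈ T.boundaries) (I : LaurentSeries ℤ) :
    TetIndex.HasLaurentSum (T.quotTerm ϖ.turning) I ↔
      TetIndex.HasLaurentSum (T.quotTerm ϖ'.turning) I := by
  obtain ⟨n, m, hnm, h0⟩ := OrientedCurve.exists_defect_zero hT h h' hb
  obtain ⟨k₀, hk₀, hk₀s⟩ := T.exists_endSum n
  -- vertex functions translate the lattice, and triangle functions shift the labels of a
  -- tetrahedron
  have key : ∀ k, T.latticeTerm ϖ.turning k = T.latticeTerm ϖ'.turning (k + k₀) := by
    intro k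
    refine latticeTerm_eq_of_oppSum (s := fun t => ∑ v, m (t, v)) ?_ ?_
    · intro t a
      have e : ∀ v w (h : v ≠ w), T.edgeLabel ϖ.turning k t v w =
          T.edgeLabel ϖ'.turning (k + k₀) t v w + (m (t, v) + m (t, w)) := by
        intro v w h
        have e1 := hnm ⟨(t, v, w), h⟩
        have e2 := hnm ⟨(t, w, v), h.symm⟩
        have e3 := hk₀ ⟨(t, v, w), h⟩
        have e4 : T.edgeEnd (rev ⟨(t, v, w), h⟩) = T.edgeEnd ⟨(t, w, v), h.symm⟩ := rfl
        rw [e4] at e3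
        have e5 : triangle (⟨(t, v, w), h⟩ : Corner τ) = (t, v) := rfl
        have e6 : triangle (⟨(t, w, v), h.symm⟩ : Corner τ) = (t, w) := rfl
        rw [e5] at e1
        rw [e6] at e2
        rw [edgeLabel, edgeLabel, dif_pos h, dif_pos h, Pi.add_apply, e3]
        linarith
      rw [Fin.sum_univ_four]
      fin_cases a <;>
      · simp only [oppSum, Fin.zero_eta, Fin.mk_one, Fin.reduceFinMk, Matrix.cons_val]
        rw [e _ _ (by decide), e _ _ (by decide)]
        ring
    · simp only [Pi.add_apply, Finset.sum_add_distrib, hk₀s]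
      rw [Fintype.sum_prod_type] at h0
      linarith
  have hq : ∀ l, T.quotTerm ϖ.turning l = T.quotTerm ϖ'.turning (l + (k₀ : T.EdgeLattice)) := by
    intro l
    obtain ⟨k, rfl⟩ := QuotientAddGroup.mk_surjective l
    rw [← QuotientAddGroup.mk_add, quotTerm_mk hα, quotTerm_mk hα, key]
  rw [show T.quotTerm ϖ.turning = fun l => T.quotTerm ϖ'.turning
    (Equiv.addRight (k₀ : T.EdgeLattice) l) from funext hq]
  exact TetIndex.hasLaurentSum_comp_equiv_iff _

/-- The flat lattice consists of the relations among the rows of the matrix `(a | b)`. -/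
theorem mem_flatLattice_iff (Q : τ → Fin 3) (k : T.Edge → ℤ) :
    k ∈ T.flatLattice ↔ ∑ E, k E • T.nzRow Q E = 0 := by
  have e : ∀ t, (∑ E, k E • T.nzRow Q E) t =
      (∑ E, k E * T.edgeCoeff E t (Q t + 2) - ∑ E, k E * T.edgeCoeff E t (Q t),
        ∑ E, k E * T.edgeCoeff E t (Q t + 1) - ∑ E, k E * T.edgeCoeff E t (Q t)) := by
    intro t
    rw [Finset.sum_apply]
    simp only [Pi.smul_apply, nzRow, nzA, nzB, Prod.smul_mk, smul_eq_mul, mul_sub]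
    refine Prod.ext ?_ ?_
    · rw [Prod.fst_sum, Finset.sum_sub_distrib]
    · rw [Prod.snd_sum, Finset.sum_sub_distrib]
  constructor
  · intro h
    ext1 t
    rw [e, h t (Q t + 2), h t (Q t + 1), h t (Q t), sub_self]
    rfl
  · intro h t a
    have h1 := e t
    rw [h, eq_comm, Pi.zero_apply, Prod.mk_eq_zero] at h1
    obtain ⟨h2, h3⟩ := h1
    have key : ∀ q a : Fin 3, a = q ∨ a = q + 1 ∨ a = q + 2 := by decide
    have key' : ∀ a, ∑ E, k E * T.edgeCoeff E t a = ∑ E, k E * T.edgeCoeff E t (Q t) := by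
      intro a
      rcases key (Q t) a with h | h | h <;> rw [h]
      · linarith
      · linarith
    rw [key' a, key' 0]

/-- A basic set of edges parametrises the lattice. -/
noncomputable def basicEquiv {Q : τ → Fin 3} {S : Finset T.Edge} (hS : T.IsBasic Q S) :
    (S → ℤ) ≃ T.EdgeLattice :=
  Equiv.ofBijective (fun k => (extZero k : T.Edge → ℤ)) (by
    constructor
    · intro k k' h
      have h1 := QuotientAddGroup.eq.1 h
      rw [mem_flatLattice_iff Q] at h1
      have h2 : ∑ E : S, (k' E - k E) • T.nzRow Q E = 0 := by
        rw [← sum_extZero, ← h1]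
        refine Finset.sum_congr rfl fun E _ => ?_
        congr 1
        simp only [extZero, Pi.add_apply, Pi.neg_apply]
        split_ifs <;> ring
      have h3 := Fintype.linearIndependent_iff.1 hS.1 _ h2
      ext E
      linarith [h3 E]
    · intro l
      obtain ⟨k, rfl⟩ := QuotientAddGroup.mk_surjective l
      have h1 : ∑ E, k E • T.nzRow Q E ∈ Submodule.span ℤ (Set.range (T.nzRow Q)) :=
        sum_mem fun E _ => Submodule.smul_mem _ _ (Submodule.subset_span ⟨E, rfl⟩)
      rw [← hS.2, Submodule.mem_span_range_iff_exists_fun] at h1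
      obtain ⟨k', hk'⟩ := h1
      refine ⟨k', QuotientAddGroup.eq.2 ?_⟩
      rw [mem_flatLattice_iff Q]
      simp only [Pi.add_apply, Pi.neg_apply, add_smul, neg_smul, Finset.sum_add_distrib,
        Finset.sum_neg_distrib, sum_extZero, hk', neg_add_cancel])

/-- The 3D index is a sum over the lattice, whichever basic set and quad choice are used. -/
theorem hasLaurentSum_indexTerm_iff (hα : T.HasIndexStructure) {Q : τ → Fin 3}
    {S : Finset T.Edge} (hS : T.IsBasic Q S) (ϖ : T.OrientedCurve) (I : LaurentSeries ℤ) :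
    TetIndex.HasLaurentSum (T.indexTerm Q ϖ S) I ↔
      TetIndex.HasLaurentSum (T.quotTerm ϖ.turning) I := by
  rw [← TetIndex.hasLaurentSum_comp_equiv_iff (basicEquiv hS)]
  have : T.indexTerm Q ϖ S = fun k => T.quotTerm ϖ.turning (basicEquiv hS k) := by
    ext1 k
    rw [indexTerm_eq]
    exact (quotTerm_mk hα _ _).symm
  rw [this]

end Sums

end FacePairing

/-! ### Convergence of the 3D index -/

/-- The smallest of the three sums over opposite edges. -/
def oppMin (f : Fin 4 → Fin 4 → ℤ) : ℤ := min (oppSum f 0) (min (oppSum f 1) (oppSum f 2))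

/-- The amounts by which the sums over opposite edges exceed the smallest one of them. -/
def oppExcess (f : Fin 4 → Fin 4 → ℤ) (a : Fin 3) : ℤ := oppSum f a - oppMin f

theorem oppExcess_nonneg (f : Fin 4 → Fin 4 → ℤ) (a : Fin 3) : 0 ≤ oppExcess f a := by
  fin_cases a <;> simp [oppExcess, oppMin]

theorem exists_oppExcess_eq_zero (f : Fin 4 → Fin 4 → ℤ) : ∃ a, oppExcess f a = 0 := by
  unfold oppExcess oppMin
  rcases min_choice (oppSum f 0) (min (oppSum f 1) (oppSum f 2)) with h | h
  · exact ⟨0, by omega⟩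
  · rcases min_choice (oppSum f 1) (oppSum f 2) with h' | h'
    · exact ⟨1, by omega⟩
    · exact ⟨2, by omega⟩

theorem TetIndex.lowerBound_tetSym (f : Fin 4 → Fin 4 → ℤ) :
    LowerBound (oppExcess f 0 * oppExcess f 1 + oppExcess f 1 * oppExcess f 2 +
      oppExcess f 2 * oppExcess f 0 - oppMin f) (tetSym f) := by
  refine lowerBound_symIndex (by simp [oppMin]) (by simp [oppMin]) (by simp [oppMin]) ?_
  obtain ⟨a, ha⟩ := exists_oppExcess_eq_zero f
  unfold oppExcess at ha
  fin_cases a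
  · exact Or.inl (by simpa [sub_eq_zero] using ha)
  · exact Or.inr (Or.inl (by simpa [sub_eq_zero] using ha))
  · exact Or.inr (Or.inr (by simpa [sub_eq_zero] using ha))

/-- A quadratic form that is nonnegative away from a bounded set compensates for negative
angles. -/
theorem le_sum_angle_add_mul {y α : Fin 3 → ℝ} {A : ℝ} (hA : 0 ≤ A) (hα : ∀ a, -A ≤ α a)
    (hy : ∀ a, 0 ≤ y a) (h0 : ∃ a, y a = 0) (q : Fin 3) (hq : ∀ a, y a ≤ y q) :
    α q * y q - A ^ 2 ≤ α 0 * y 0 + α 1 * y 1 + α 2 * y 2 +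
      Real.pi * (y 0 * y 1 + y 1 * y 2 + y 2 * y 0) := by
  have key : ∀ m M β : ℝ, 0 ≤ m → m ≤ M → -A ≤ β → - A ^ 2 ≤ β * m + Real.pi * (m * M) := by
    intro m M β h1 h2 h3
    have h4 : m * M ≤ Real.pi * (m * M) :=
      le_mul_of_one_le_left (mul_nonneg h1 (h1.trans h2)) (by linarith [Real.pi_gt_three])
    have h5 : -A * m ≤ β * m := mul_le_mul_of_nonneg_right h3 h1
    nlinarith [sq_nonneg (m - A), mul_nonneg h1 (sub_nonneg.2 h2), mul_nonneg h1 hA]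
  obtain ⟨a, ha⟩ := h0
  have h0 := hy 0
  have h1 := hy 1
  have h2 := hy 2
  have k0 := hq 0
  have k1 := hq 1
  have k2 := hq 2
  have hA2 : 0 ≤ A ^ 2 := sq_nonneg A
  have l0 := key _ _ _ h0 k0 (hα 0)
  have l1 := key _ _ _ h1 k1 (hα 1)
  have l2 := key _ _ _ h2 k2 (hα 2)
  by_cases haq : a = q
  · rw [← haq, ha] at k0 k1 k2
    rw [← haq, ha, le_antisymm k0 h0, le_antisymm k1 h1, le_antisymm k2 h2]
    linarith
  · fin_cases q <;> fin_cases a <;>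
      simp only [Fin.zero_eta, Fin.mk_one, Fin.reduceFinMk, not_true_eq_false] at ha haq l0 l1 l2 ⊢ <;>
      simp only [ha, mul_zero, zero_mul, add_zero, zero_add] at l0 l1 l2 ⊢ <;>
      linarith

namespace FacePairing

variable {τ : Type*} {T : FacePairing τ} [Fintype τ]

/-- The degree from which on the summand of the index may have nonzero coefficients. -/
noncomputable def termDeg (T : FacePairing τ) (c : Corner τ → ℤ) (k : T.Edge → ℤ) : ℤ :=
  2 * ∑ E, k E + ∑ t, (oppExcess (T.edgeLabel c k t) 0 * oppExcess (T.edgeLabel c k t) 1 +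
    oppExcess (T.edgeLabel c k t) 1 * oppExcess (T.edgeLabel c k t) 2 +
    oppExcess (T.edgeLabel c k t) 2 * oppExcess (T.edgeLabel c k t) 0 -
    oppMin (T.edgeLabel c k t))

theorem lowerBound_latticeTerm (c : Corner τ → ℤ) (k : T.Edge → ℤ) :
    TetIndex.LowerBound (T.termDeg c k) (T.latticeTerm c k) :=
  (TetIndex.lowerBound_negSqrtQPow _).mul
    (TetIndex.LowerBound.prod _ fun _ _ => TetIndex.lowerBound_tetSym _)

/-- The degree bound in terms of an angle structure. -/
theorem pi_mul_termDeg {α : τ → Fin 3 → ℝ} (hα : T.IsGeneralisedAngleStructure α)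
    (c : Corner τ → ℤ) (k : T.Edge → ℤ) : Real.pi * T.termDeg c k =
      ∑ t, (∑ a, α t a * oppExcess (T.edgeLabel c k t) a +
        Real.pi * (oppExcess (T.edgeLabel c k t) 0 * oppExcess (T.edgeLabel c k t) 1 +
          oppExcess (T.edgeLabel c k t) 1 * oppExcess (T.edgeLabel c k t) 2 +
          oppExcess (T.edgeLabel c k t) 2 * oppExcess (T.edgeLabel c k t) 0)) -
      ∑ t, ∑ a, α t a * turningNumber c t a := by
  have h1 : ∑ E, (k E : ℝ) * (2 * Real.pi) =
      ∑ t, ∑ a, (∑ E, (k E : ℝ) * T.edgeCoeff E t a) * α t a := by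
    calc ∑ E, (k E : ℝ) * (2 * Real.pi)
        = ∑ E, (k E : ℝ) * ∑ t, ∑ a, (T.edgeCoeff E t a : ℝ) * α t a :=
          Finset.sum_congr rfl fun E _ => by rw [hα.edge]
      _ = ∑ t, ∑ a, (∑ E, (k E : ℝ) * T.edgeCoeff E t a) * α t a := by
          simp only [Finset.mul_sum, Finset.sum_mul]
          rw [Finset.sum_comm]
          refine Finset.sum_congr rfl fun t _ => ?_
          rw [Finset.sum_comm]
          exact Finset.sum_congr rfl fun a _ => Finset.sum_congr rfl fun E _ => by ring
  have h2 : ∀ t, ∑ a, (∑ E, (k E : ℝ) * T.edgeCoeff E t a) * α t a =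
      ∑ a, α t a * oppExcess (T.edgeLabel c k t) a + Real.pi * oppMin (T.edgeLabel c k t) -
        ∑ a, α t a * turningNumber c t a := by
    intro t
    have h3 : ∀ a, ∑ E, (k E : ℝ) * T.edgeCoeff E t a =
        oppExcess (T.edgeLabel c k t) a + oppMin (T.edgeLabel c k t) - turningNumber c t a := by
      intro a
      have := T.oppSum_edgeLabel c k t a
      have h4 : ∑ E, k E * T.edgeCoeff E t a =
        oppExcess (T.edgeLabel c k t) a + oppMin (T.edgeLabel c k t) - turningNumber c t a := by
        unfold oppExcess
        linarith
      exact_mod_cast h4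
    simp only [h3, Fin.sum_univ_three]
    rw [← hα.tetrahedron t]
    ring
  simp only [h2, Finset.sum_add_distrib, Finset.sum_sub_distrib, ← Finset.sum_mul] at h1
  simp only [termDeg, Int.cast_add, Int.cast_mul, Int.cast_sum, Int.cast_sub, Int.cast_ofNat,
    Finset.sum_add_distrib, Finset.sum_sub_distrib, mul_add, mul_sub, Finset.mul_sum] at h1 ⊢
  have h5 : ∑ E, Real.pi * (2 * (k E : ℝ)) = (∑ E, (k E : ℝ)) * (2 * Real.pi) := by
    rw [Finset.sum_mul]
    exact Finset.sum_congr rfl fun E _ => by ring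
  linarith

/-- The excesses determine the point of the lattice. -/
theorem eq_of_oppExcess_eq {c : Corner τ → ℤ} {k k' : T.Edge → ℤ}
    (h : ∀ t a, oppExcess (T.edgeLabel c k t) a = oppExcess (T.edgeLabel c k' t) a) :
    (k : T.EdgeLattice) = k' := by
  refine QuotientAddGroup.eq.2 fun t a => ?_
  have h1 := T.oppSum_edgeLabel c k t
  have h2 := T.oppSum_edgeLabel c k' t
  have h3 := h t a
  have h4 := h t 0
  unfold oppExcess at h3 h4
  simp only [Pi.add_apply, Pi.neg_apply, add_mul, neg_mul, Finset.sum_add_distrib,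
    Finset.sum_neg_distrib]
  linarith [h1 a, h1 0, h2 a, h2 0]

/-- The index structure bounds the excesses by the degree. -/
theorem finite_termDeg_le (hα : T.HasIndexStructure) (c : Corner τ → ℤ) (d : ℤ) :
    {l : T.EdgeLattice | T.termDeg c l.out ≤ d}.Finite := by
  classical
  obtain ⟨α, hα⟩ := hα
  have hsub : {l : T.EdgeLattice | T.termDeg c l.out ≤ d} ⊆ ⋃ Q : τ → Fin 3,
      {l | T.termDeg c l.out ≤ d ∧ ∀ t a, oppExcess (T.edgeLabel c l.out t) a ≤
        oppExcess (T.edgeLabel c l.out t) (Q t)} := by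
    intro l hl
    choose Q hQ using fun t => Finite.exists_max (oppExcess (T.edgeLabel c l.out t))
    exact Set.mem_iUnion.2 ⟨Q, hl, hQ⟩
  refine (Set.finite_iUnion fun Q => ?_).subset hsub
  -- the angle structure that is positive at the quad types with the largest excess
  obtain ⟨hQ, hpos⟩ := hα Q
  set A : ℝ := ∑ t, ∑ a, |α Q t a| with hA
  have hA0 : 0 ≤ A := by positivity
  have hAα : ∀ t a, -A ≤ α Q t a := by
    intro t a
    have h1 : |α Q t a| ≤ ∑ a, |α Q t a| :=
      Finset.single_le_sum (f := fun a => |α Q t a|) (fun _ _ => abs_nonneg _) (Finset.mem_univ a)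
    have h2 : ∑ a, |α Q t a| ≤ A := Finset.single_le_sum (f := fun t => ∑ a, |α Q t a|)
      (fun _ _ => by positivity) (Finset.mem_univ t)
    linarith [neg_abs_le (α Q t a)]
  set B : ℝ := Real.pi * d + ∑ t, ∑ a, α Q t a * turningNumber c t a + Fintype.card τ * A ^ 2
    with hB
  let C : τ → Fin 3 → ℤ := fun t _ => ⌈B / α Q t (Q t)⌉
  refine Set.Finite.of_finite_image (f := fun l t a => oppExcess (T.edgeLabel c l.out t) a)
    ((Set.finite_Icc (0 : τ → Fin 3 → ℤ) C).subset ?_) ?_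
  · rintro _ ⟨l, ⟨hl, hmax⟩, rfl⟩
    refine ⟨fun t a => oppExcess_nonneg _ _, fun t a => (hmax t a).trans ?_⟩
    have h1 := pi_mul_termDeg hQ c l.out
    have h2 : ∀ t, α Q t (Q t) * oppExcess (T.edgeLabel c l.out t) (Q t) - A ^ 2 ≤
        ∑ a, α Q t a * oppExcess (T.edgeLabel c l.out t) a +
        Real.pi * (oppExcess (T.edgeLabel c l.out t) 0 * oppExcess (T.edgeLabel c l.out t) 1 +
          oppExcess (T.edgeLabel c l.out t) 1 * oppExcess (T.edgeLabel c l.out t) 2 +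
          oppExcess (T.edgeLabel c l.out t) 2 * oppExcess (T.edgeLabel c l.out t) 0) := by
      intro t
      rw [Fin.sum_univ_three]
      refine le_sum_angle_add_mul (y := fun a => (oppExcess (T.edgeLabel c l.out t) a : ℝ))
        hA0 (hAα t) (fun a => by exact_mod_cast oppExcess_nonneg _ _) ?_ (Q t)
        fun a => by exact_mod_cast hmax t a
      obtain ⟨a, ha⟩ := exists_oppExcess_eq_zero (T.edgeLabel c l.out t)
      exact ⟨a, by exact_mod_cast ha⟩
    have h3 := Finset.sum_le_sum fun t (_ : t ∈ Finset.univ) => h2 t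
    have h4 : Real.pi * T.termDeg c l.out ≤ Real.pi * d :=
      mul_le_mul_of_nonneg_left (by exact_mod_cast hl) Real.pi_pos.le
    rw [Finset.sum_sub_distrib, Finset.sum_const, Finset.card_univ, nsmul_eq_mul] at h3
    have h5 : α Q t (Q t) * oppExcess (T.edgeLabel c l.out t) (Q t) ≤
        ∑ t, α Q t (Q t) * oppExcess (T.edgeLabel c l.out t) (Q t) :=
      Finset.single_le_sum (f := fun t => α Q t (Q t) * oppExcess (T.edgeLabel c l.out t) (Q t))
        (fun t _ => mul_nonneg (hpos t).le (by exact_mod_cast oppExcess_nonneg _ _))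
        (Finset.mem_univ t)
    have h6 : (oppExcess (T.edgeLabel c l.out t) (Q t) : ℝ) ≤ B / α Q t (Q t) := by
      rw [le_div_iff₀ (hpos t)]
      linarith
    exact_mod_cast h6.trans (Int.le_ceil _)
  · intro l _ l' _ h
    have h1 := eq_of_oppExcess_eq fun t a => congrFun (congrFun h t) a
    rwa [QuotientAddGroup.out_eq', QuotientAddGroup.out_eq'] at h1

/-- The sum over the lattice converges. -/
theorem exists_hasLaurentSum_quotTerm (hα : T.HasIndexStructure) (c : Corner τ → ℤ) :
    ∃ I, TetIndex.HasLaurentSum (T.quotTerm c) I :=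
  TetIndex.exists_hasLaurentSum (fun l => T.termDeg c l.out)
    (fun l => lowerBound_latticeTerm c l.out) (finite_termDeg_le hα c)

end FacePairing

/-! ### Existence of basic sets of edges -/

namespace FacePairing

variable {τ : Type*} (T : FacePairing τ)

theorem edge_cross (x : TetFlag τ) : T.edge (T.cross x).corner = T.edge x.corner :=
  (Quot.sound ⟨x, rfl, Or.inl rfl⟩).symm

theorem edgeLabel_zero (k : T.Edge → ℤ) (t : τ) {v w : Fin 4} (h : v ≠ w) :
    T.edgeLabel 0 k t v w = k (T.edge ⟨(t, v, w), h⟩) := by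
  simp [edgeLabel, h]

/-- The function on the edges of a tetrahedron with equal sums over the pairs of opposite edges come
from functions on the vertices. -/
theorem exists_vertex_function {e : Fin 4 → Fin 4 → ℤ} (he : ∀ v w, e v w = e w v)
    (h : ∀ a, oppSum e a = oppSum e 0) :
    ∃ f : Fin 4 → ℤ, ∀ v w, v ≠ w → 2 * e v w = f v + f w := by
  have h1 := h 1
  have h2 := h 2
  simp only [oppSum, Matrix.cons_val] at h1 h2
  refine ⟨![e 0 1 + e 0 2 - e 1 2, e 0 1 + e 1 2 - e 0 2, e 0 2 + e 1 2 - e 0 1,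
    e 0 3 + e 1 3 - e 0 1], fun v w hvw => ?_⟩
  have e1 := he 1 0
  have e2 := he 2 0
  have e3 := he 3 0
  have e4 := he 2 1
  have e5 := he 3 1
  have e6 := he 3 2
  fin_cases v <;> fin_cases w <;> first | exact absurd rfl hvw | skip
  all_goals
    simp only [Fin.zero_eta, Fin.mk_one, Fin.reduceFinMk, Matrix.cons_val]
    omega

theorem oppSum_flat_of_vertex_function {e : Fin 4 → Fin 4 → ℤ} {f : Fin 4 → ℤ}
    (h : ∀ v w, v ≠ w → 2 * e v w = f v + f w) (a : Fin 3) : oppSum e a = oppSum e 0 := by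
  have h1 := h 0 1 (by decide)
  have h2 := h 0 2 (by decide)
  have h3 := h 0 3 (by decide)
  have h4 := h 1 2 (by decide)
  have h5 := h 1 3 (by decide)
  have h6 := h 2 3 (by decide)
  fin_cases a
  · rfl
  all_goals
    simp only [oppSum, Fin.mk_one, Fin.reduceFinMk, Matrix.cons_val]
    omega

section

variable [Fintype τ] {T}

theorem mem_flatLattice_iff_oppSum (k : T.Edge → ℤ) : k ∈ T.flatLattice ↔
    ∀ t a, oppSum (T.edgeLabel 0 k t) a = oppSum (T.edgeLabel 0 k t) 0 := by
  have h0 : ∀ t a, turningNumber (0 : Corner τ → ℤ) t a = 0 := fun t a => by simp [turningNumber]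
  simp only [oppSum_edgeLabel, h0, zero_add]
  rfl

/-- The elements of the lattice `flatLattice` are the sums over the end points of functions on the
cusps. -/
theorem mem_flatLattice_iff_cusp (k : T.Edge → ℤ) : k ∈ T.flatLattice ↔
    ∃ F : T.Cusp → ℤ, ∀ c, 2 * k (T.edge c) =
      F (T.cusp (triangle c)) + F (T.cusp (triangle (rev c))) := by
  rw [mem_flatLattice_iff_oppSum]
  constructor
  · intro h
    choose f hf using fun t => exists_vertex_function (T.edgeLabel_symm 0 k t) (h t)
    have hf' : ∀ c : Corner τ, 2 * k (T.edge c) = f c.1.1 c.1.2.1 + f c.1.1 c.1.2.2 := by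
      rintro ⟨⟨t, v, w⟩, hvw⟩
      rw [← T.edgeLabel_zero k t hvw]
      exact hf t v w hvw
    have hx : ∀ x : TetFlag τ, f x.1 (x.2 0) = k (T.edge x.corner) + k (T.edge x.other.corner) -
        k (T.edge (x.reorder (swap 0 1 * swap 1 2)).corner) := by
      intro x
      have h1 := hf' x.corner
      have h2 := hf' x.other.corner
      have h3 := hf' (x.reorder (swap 0 1 * swap 1 2)).corner
      have p0 : (swap 0 1 * swap 1 2 : Perm (Fin 4)) 0 = 1 := by decide
      have p1 : (swap 0 1 * swap 1 2 : Perm (Fin 4)) 1 = 2 := by decide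
      have p2 : (swap 1 2 : Perm (Fin 4)) 0 = 0 := by decide
      have p3 : (swap 1 2 : Perm (Fin 4)) 1 = 2 := by decide
      simp only [TetFlag.corner, TetFlag.other, TetFlag.reorder, Perm.mul_apply, p0, p1, p2,
        p3] at h1 h2 h3 ⊢
      linarith
    refine ⟨Quot.lift (fun a => f a.1 a.2) ?_, fun c => hf' c⟩
    rintro a b ⟨x, rfl, rfl⟩
    change f x.1 (x.2 0) = f (T.cross x).1 ((T.cross x).2 0)
    rw [hx, hx, ← cross_other, ← T.cross_reorder x (by decide), edge_cross, edge_cross, edge_cross]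
  · rintro ⟨F, hF⟩ t a
    refine oppSum_flat_of_vertex_function (f := fun v => F (T.cusp (t, v))) (fun v w hvw => ?_) a
    rw [T.edgeLabel_zero k t hvw]
    exact hF _

/-- Functions on the cusps with even sums along edges define elements of the flat lattice. -/
theorem exists_flat_of_even (G : T.Cusp → ℤ)
    (h : ∀ c, Even (G (T.cusp (triangle c)) + G (T.cusp (triangle (rev c))))) :
    ∃ k ∈ T.flatLattice, ∀ c, 2 * k (T.edge c) =
      G (T.cusp (triangle c)) + G (T.cusp (triangle (rev c))) := by
  let k : T.Edge → ℤ := Quot.lift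
    (fun c => (G (T.cusp (triangle c)) + G (T.cusp (triangle (rev c)))) / 2) (by
      rintro a b ⟨x, rfl, rfl | rfl⟩
      · rw [← cross_rev, cusp_cross, cusp_cross, rev_corner]
      · rw [← rev_corner, rev_rev, add_comm])
  have hk : ∀ c, 2 * k (T.edge c) =
      G (T.cusp (triangle c)) + G (T.cusp (triangle (rev c))) := fun c =>
    Int.mul_ediv_cancel' (h c).two_dvd
  exact ⟨k, (mem_flatLattice_iff_cusp k).2 ⟨G, hk⟩, hk⟩

/-- A nonzero element of the lattice can be replaced by one that vanishes at the same edges and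
takes the value `1` or `-1` at some edge. -/
theorem exists_flat_unit {κ : T.Edge → ℤ} (hκ : κ ∈ T.flatLattice) (h0 : κ ≠ 0) :
    ∃ κ' ∈ T.flatLattice, (∀ E, κ E = 0 → κ' E = 0) ∧ ∃ E, IsUnit (κ' E) := by
  obtain ⟨F, hF⟩ := (mem_flatLattice_iff_cusp κ).1 hκ
  have hsign : ∀ c, κ (T.edge c) = 0 →
      (F (T.cusp (triangle c))).sign + (F (T.cusp (triangle (rev c)))).sign = 0 := by
    intro c hc
    have h1 := hF c
    rw [hc] at h1
    rw [show F (T.cusp (triangle c)) = - F (T.cusp (triangle (rev c))) by omega, Int.sign_neg]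
    ring
  -- `κ` is half the sum of `F` over end points; replace `F` by twice its sign or by its sign
  by_cases hmix : ∃ c, F (T.cusp (triangle c)) ≠ 0 ∧ F (T.cusp (triangle (rev c))) = 0
  · obtain ⟨c, h1, h2⟩ := hmix
    obtain ⟨k, hk, hk'⟩ := exists_flat_of_even (fun κ => 2 * (F κ).sign)
      fun c => (even_two_mul _).add (even_two_mul _)
    refine ⟨k, hk, fun E hE => ?_, T.edge c, ?_⟩
    · obtain ⟨c, rfl⟩ := Quot.exists_rep E
      have h3 := hk' c
      have h4 := hsign c hE
      change k (T.edge c) = 0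
      omega
    · have h3 := hk' c
      rw [h2, Int.sign_zero] at h3
      rw [show k (T.edge c) = (F (T.cusp (triangle c))).sign by omega]
      exact Int.isUnit_iff_natAbs_eq.2 (Int.natAbs_sign_of_ne_zero h1)
  · have hcases : ∀ n : ℤ, n ≠ 0 → n.sign = 1 ∨ n.sign = -1 := fun n hn => by
      rcases lt_or_gt_of_ne hn with h | h
      · exact Or.inr (Int.sign_eq_neg_one_of_neg h)
      · exact Or.inl (Int.sign_eq_one_of_pos h)
    have hmix' : ∀ c, F (T.cusp (triangle c)) ≠ 0 → F (T.cusp (triangle (rev c))) ≠ 0 :=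
      fun c h1 h2 => hmix ⟨c, h1, h2⟩
    obtain ⟨k, hk, hk'⟩ := exists_flat_of_even (fun κ => (F κ).sign) (by
      intro c
      by_cases h : F (T.cusp (triangle c)) = 0
      · have h1 : F (T.cusp (triangle (rev c))) = 0 := by
          by_contra h1
          exact hmix' _ h1 h
        rw [h, h1]
        exact ⟨0, rfl⟩
      · rcases hcases _ h with h1 | h1 <;> rcases hcases _ (hmix' c h) with h2 | h2 <;>
          rw [h1, h2] <;> decide)
    refine ⟨k, hk, fun E hE => ?_, ?_⟩
    · obtain ⟨c, rfl⟩ := Quot.exists_rep E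
      have h3 := hk' c
      have h4 := hsign c hE
      change k (T.edge c) = 0
      omega
    · obtain ⟨E, hE⟩ := Function.ne_iff.1 h0
      obtain ⟨c, rfl⟩ := Quot.exists_rep E
      have h1 : ∃ t v, F (T.cusp (t, v)) ≠ 0 := by
        by_contra hcon
        push Not at hcon
        have h1 := hF c
        have h2 := hcon (triangle c).1 (triangle c).2
        have h3 := hcon (triangle (rev c)).1 (triangle (rev c)).2
        apply hE
        change κ (T.edge c) = 0
        rw [show F (T.cusp (triangle c)) = 0 from h2,
          show F (T.cusp (triangle (rev c))) = 0 from h3] at h1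
        omega
      obtain ⟨t, v, hv⟩ := h1
      have hw : ∀ w, F (T.cusp (t, w)) ≠ 0 := by
        intro w
        by_cases hvw : v = w
        · rwa [← hvw]
        · exact hmix' ⟨(t, v, w), hvw⟩ hv
      -- two of three vertices have the same sign
      have hpair : ∀ v w : Fin 4, v ≠ w →
          (F (T.cusp (t, v))).sign = (F (T.cusp (t, w))).sign → ∃ E, IsUnit (k E) := by
        intro v w hvw hs
        refine ⟨T.edge ⟨(t, v, w), hvw⟩, ?_⟩
        have h1 : 2 * k (T.edge ⟨(t, v, w), hvw⟩) =
          (F (T.cusp (t, v))).sign + (F (T.cusp (t, w))).sign := hk' ⟨(t, v, w), hvw⟩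
        rw [← hs] at h1
        rw [show k (T.edge ⟨(t, v, w), hvw⟩) = (F (T.cusp (t, v))).sign by omega]
        exact Int.isUnit_iff_natAbs_eq.2 (Int.natAbs_sign_of_ne_zero (hw v))
      by_cases h1 : (F (T.cusp (t, 0))).sign = (F (T.cusp (t, 1))).sign
      · exact hpair 0 1 (by decide) h1
      by_cases h2 : (F (T.cusp (t, 0))).sign = (F (T.cusp (t, 2))).sign
      · exact hpair 0 2 (by decide) h2
      refine hpair 1 2 (by decide) ?_
      have e0 := hcases _ (hw 0)
      have e1 := hcases _ (hw 1)
      have e2 := hcases _ (hw 2)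
      omega

/-- The complement of a set of edges on which the flat lattice can be prescribed is basic. -/
theorem exists_isBasic (Q : τ → Fin 3) : ∃ S, T.IsBasic Q S := by
  classical
  -- a maximal set of edges where the values of the elements of the lattice can be prescribed
  let P : Finset T.Edge → Prop := fun C => ∀ g : T.Edge → ℤ, ∃ κ ∈ T.flatLattice, ∀ E ∈ C, κ E = g E
  obtain ⟨C, hC⟩ := (Set.toFinite {C | P C}).exists_maximal
    ⟨∅, fun g => ⟨0, zero_mem _, by simp⟩⟩
  have hinj : ∀ κ ∈ T.flatLattice, (∀ E ∈ C, κ E = 0) → κ = 0 := by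
    intro κ hκ hκC
    by_contra h0
    obtain ⟨κ', hκ', hz, E, hE⟩ := exists_flat_unit hκ h0
    have hEC : E ∉ C := fun h => hE.ne_zero (hz E (hκC E h))
    have hP : P (insert E C) := by
      intro g
      obtain ⟨κ₁, h1, h2⟩ := hC.1 g
      refine ⟨κ₁ + ((g E - κ₁ E) * κ' E) • κ', add_mem h1 (zsmul_mem hκ' _), ?_⟩
      intro E' hE'
      rw [Finset.mem_insert] at hE'
      simp only [Pi.add_apply, Pi.smul_apply, smul_eq_mul]
      rcases hE' with rfl | hE'
      · rw [mul_assoc, Int.isUnit_mul_self hE]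
        ring
      · rw [hz E' (hκC E' hE'), h2 E' hE', mul_zero, add_zero]
    exact hEC (hC.2 hP (Finset.subset_insert E C) (Finset.mem_insert_self E C))
  refine ⟨Cᶜ, ?_, le_antisymm (Submodule.span_mono ?_) (Submodule.span_le.2 ?_)⟩
  · rw [Fintype.linearIndependent_iff]
    intro g hg E
    rw [← sum_extZero, ← mem_flatLattice_iff] at hg
    have h1 := hinj _ hg fun E hE => by simp [extZero, hE]
    have h2 := congrFun h1 E
    rwa [extZero, dif_pos E.2] at h2
  · rintro _ ⟨E, rfl⟩
    exact ⟨E, rfl⟩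
  · rintro _ ⟨E, rfl⟩
    by_cases hE : E ∈ C
    · obtain ⟨κ, h1, h2⟩ := hC.1 (Pi.single E 1)
      rw [mem_flatLattice_iff Q, ← Finset.sum_add_sum_compl C] at h1
      have h3 : ∑ E' ∈ C, κ E' • T.nzRow Q E' = T.nzRow Q E := by
        rw [Finset.sum_eq_single_of_mem E hE]
        · rw [h2 E hE, Pi.single_eq_same, one_smul]
        · intro E' hE' hne
          rw [h2 E' hE', Pi.single_eq_of_ne hne, zero_smul]
      rw [h3] at h1
      rw [SetLike.mem_coe, eq_neg_of_add_eq_zero_left h1]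
      exact neg_mem (sum_mem fun E' hE' => Submodule.smul_mem _ _
        (Submodule.subset_span ⟨⟨E', hE'⟩, rfl⟩))
    · exact Submodule.subset_span ⟨⟨E, Finset.mem_compl.2 hE⟩, rfl⟩

end

end FacePairing

/-! ### Existence of essential curves -/

namespace FacePairing

variable {τ : Type*} {T : FacePairing τ}

/-- The normal curve with signed numbers of arcs `c`, where all arcs around a corner run in the same
direction.  On each side of each triangle, either `c` does not change from one triangle to the
other, or the arcs that end there all cross it in the same direction. -/
def signedCurve (c : Corner τ → ℤ) (hc : c ∈ T.cycles)
    (h : ∀ x : TetFlag τ, c x.corner = c (T.cross x).corner ∨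
      c x.corner * c x.other.corner ≤ 0 ∧ c (T.cross x).corner * c (T.cross x).other.corner ≤ 0) :
    T.OrientedCurve where
  num d := (c d).natAbs
  matching x := by
    have h1 := hc x
    rcases h x with h2 | ⟨h2, h3⟩
    · rw [show c x.other.corner = c (T.cross x).other.corner by omega, h2]
    · have key : ∀ a b : ℤ, a * b ≤ 0 → a.natAbs + b.natAbs = (a - b).natAbs := by
        intro a b hab
        rcases mul_nonpos_iff.1 hab with h | h <;> omega
      rw [key _ _ h2, key _ _ h3, h1]
  orient d _ := if 0 ≤ c d then 1 else -1
  orient_same x i h1 h2 := by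
    have h3 := hc x
    rcases h x with h4 | ⟨h4, h5⟩
    · rw [h4]
    · rcases mul_nonpos_iff.1 h4 with h4 | h4 <;> rcases mul_nonpos_iff.1 h5 with h5 | h5 <;>
        split_ifs <;> first | rfl | omega
  orient_other x i h1 h2 := by
    have h3 := hc x
    rcases h x with h4 | ⟨h4, h5⟩
    · rw [h4] at h1
      omega
    · rcases mul_nonpos_iff.1 h4 with h4 | h4 <;> rcases mul_nonpos_iff.1 h5 with h5 | h5 <;>
        split_ifs <;> first | rfl | exact (neg_neg _).symm | omega

theorem turning_signedCurve {c : Corner τ → ℤ} (hc : c ∈ T.cycles)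
    (h : ∀ x : TetFlag τ, c x.corner = c (T.cross x).corner ∨
      c x.corner * c x.other.corner ≤ 0 ∧ c (T.cross x).corner * c (T.cross x).other.corner ≤ 0) :
    (signedCurve c hc h).turning = c := by
  ext d
  simp only [OrientedCurve.turning, signedCurve, Finset.sum_const, Finset.card_range, nsmul_eq_mul,
    Int.natCast_natAbs]
  split_ifs with h0
  · rw [abs_of_nonneg h0]
    simp
  · rw [abs_of_neg (not_le.1 h0)]
    simp

theorem abs_sub_natCast {c : ℤ} {n : ℕ} (h : n ≤ c.natAbs) :
    |c - (if 0 ≤ c then 1 else -1) * n| + |(if 0 ≤ c then 1 else -1) * (n : ℤ)| = |c| := by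
  split_ifs with h1
  · rw [one_mul, abs_of_nonneg (by omega), abs_of_nonneg (by omega), abs_of_nonneg h1]
    ring
  · rw [neg_one_mul, abs_of_nonpos (by omega), abs_of_nonpos (by omega), abs_of_neg (not_le.1 h1)]
    ring

/-- If no nonzero boundary can be split off from `c`, then the curve has no trivial component. -/
theorem essential_signedCurve {c : Corner τ → ℤ} (hc : c ∈ T.cycles)
    (h : ∀ x : TetFlag τ, c x.corner = c (T.cross x).corner ∨
      c x.corner * c x.other.corner ≤ 0 ∧ c (T.cross x).corner * c (T.cross x).other.corner ≤ 0)
    (hmin : ∀ b ∈ T.boundaries, (∀ d, |c d - b d| + |b d| = |c d|) →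
      (∀ x : TetFlag τ, c x.corner = c (T.cross x).corner →
        b x.corner = b (T.cross x).corner) → b = 0) :
    (signedCurve c hc h).Essential := by
  classical
  intro d i hi hb
  set ϖ := signedCurve c hc h with hϖ
  set cnt : Corner τ → ℕ := fun e => ((Finset.range (c e).natAbs).filter fun j =>
    ϖ.toNormalCurve.SameComponent (d, i) (e, j)).card with hcnt
  have hval : ∀ e, ϖ.componentTurning (d, i) e = (if 0 ≤ c e then 1 else -1) * cnt e := by
    intro e
    have h1 : ∀ j, ((ϖ.orient e j : ℤˣ) : ℤ) = if 0 ≤ c e then 1 else -1 := by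
      intro j
      simp only [hϖ, signedCurve]
      split_ifs <;> rfl
    have h2 : ϖ.num e = (c e).natAbs := rfl
    simp only [OrientedCurve.componentTurning, h1, h2]
    rw [← Finset.sum_filter, Finset.sum_const, nsmul_eq_mul, mul_comm]
  have hle : ∀ e, cnt e ≤ (c e).natAbs := fun e =>
    (Finset.card_filter_le _ _).trans (Finset.card_range _).le
  -- a null-homologous component would be a boundary that splits off
  have h0 := hmin _ hb (fun e => by
    rw [hval e]
    exact abs_sub_natCast (hle e)) (fun x hx => by
    rw [hval, hval, ← hx]
    congr 2
    rw [hcnt]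
    dsimp only
    rw [hx]
    congr 1
    refine Finset.filter_congr fun j hj => ?_
    have hj1 : j < ϖ.num x.corner := by
      change j < (c x.corner).natAbs
      rw [hx]
      exact Finset.mem_range.1 hj
    have hj2 : j < ϖ.num (T.cross x).corner := Finset.mem_range.1 hj
    have hcons : ϖ.toNormalCurve.SameComponent (x.corner, j) ((T.cross x).corner, j) :=
      .rel _ _ ⟨x, j, hj1, rfl, by rw [NormalCurve.next, if_pos hj2]⟩
    exact ⟨fun h => h.trans _ _ _ hcons, fun h => h.trans _ _ _ (hcons.symm _ _)⟩)
  have h1 := hval d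
  have h2 : 0 < cnt d := Finset.card_pos.2 ⟨i, Finset.mem_filter.2
    ⟨Finset.mem_range.2 hi, Relation.EqvGen.refl _⟩⟩
  rw [h0, Pi.zero_apply] at h1
  split_ifs at h1 <;> omega

theorem TetFlag.other_corner_ne (x : TetFlag τ) : x.other.corner ≠ x.corner := by
  intro h
  have h1 := congrArg (fun d : Corner τ => d.1.2.2) h
  simp [TetFlag.corner, TetFlag.other, TetFlag.reorder] at h1

section

variable [Fintype τ]

theorem boundaries_le_cycles : T.boundaries ≤ T.cycles := by
  intro c hc
  obtain ⟨n, m, h⟩ := T.mem_boundaries_iff.1 hc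
  intro x
  rw [h, h, h, h, edgeEnd_cross, ← cross_other, edgeEnd_cross, cross_other, triangle_corner,
    triangle_corner, triangle_corner, triangle_corner, TetFlag.other_zero, TetFlag.other_zero,
    TetFlag.other_fst, TetFlag.other_fst]
  ring

/-- Each homology class contains a cycle that is shortest among its representatives.  It crosses each
side of each truncation triangle in one direction only. -/
theorem exists_shortest {c : Corner τ → ℤ} (hc : c ∈ T.cycles) :
    ∃ c₀ ∈ T.cycles, c₀ - c ∈ T.boundaries ∧
      (∀ x : TetFlag τ, c₀ x.corner * c₀ x.other.corner ≤ 0) ∧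
      ∀ b ∈ T.boundaries, (∀ d, |c₀ d - b d| + |b d| = |c₀ d|) → b = 0 := by
  classical
  obtain ⟨c₀, h0, hmin⟩ := (measure fun c : Corner τ → ℤ => ∑ d, (c d).natAbs).wf.has_min
    {c' | c' - c ∈ T.boundaries} ⟨c, by simp⟩
  have hc₀ : c₀ ∈ T.cycles := by
    have := add_mem (boundaries_le_cycles h0) hc
    rwa [sub_add_cancel] at this
  have hmin' : ∀ b ∈ T.boundaries, ∑ d, |c₀ d| ≤ ∑ d, |c₀ d - b d| := by
    intro b hb
    have h1 : ¬ (∑ d, ((c₀ - b) d).natAbs < ∑ d, (c₀ d).natAbs) := hmin (c₀ - b) (by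
      change c₀ - b - c ∈ T.boundaries
      rw [sub_right_comm]
      exact sub_mem h0 hb)
    have h2 : ((∑ d, (c₀ d).natAbs : ℕ) : ℤ) ≤ ((∑ d, ((c₀ - b) d).natAbs : ℕ) : ℤ) := by
      exact_mod_cast not_lt.1 h1
    simpa using h2
  refine ⟨c₀, hc₀, h0, ?_, ?_⟩
  · -- otherwise the triangle could be subtracted
    have key : ∀ (x : TetFlag τ) (s : ℤ), s = 1 ∨ s = -1 →
        ¬ (0 < s * c₀ x.corner ∧ 0 < s * c₀ x.other.corner) := by
      rintro x s hs ⟨h1, h2⟩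
      have h3 := hmin' (fun d => s * triangleChain (x.1, x.2 0) d) (by
        refine T.mem_boundaries_iff.2 ⟨0, fun a => if a = (x.1, x.2 0) then s else 0, fun d => ?_⟩
        simp only [triangleChain, triangle, Pi.zero_apply, zero_add, mul_ite, mul_one, mul_zero]
        congr)
      have h4 : ∀ d, |c₀ d - s * triangleChain (x.1, x.2 0) d| ≤ |c₀ d| +
          ((if triangle d = triangle x.corner then 1 else 0) -
            (if d = x.corner then 2 else 0) - (if d = x.other.corner then 2 else 0)) := by
        intro d
        have e : triangleChain (x.1, x.2 0) d = if triangle d = triangle x.corner then 1 else 0 := by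
          rw [triangle_corner]
          rfl
        rw [e]
        by_cases e1 : d = x.corner
        · subst e1
          rw [if_pos rfl, if_pos rfl, if_neg (TetFlag.other_corner_ne x).symm]
          rcases hs with rfl | rfl <;> grind
        · by_cases e2 : d = x.other.corner
          · subst e2
            rw [if_pos (by rw [triangle_corner, triangle_corner, TetFlag.other_zero,
              TetFlag.other_fst]), if_neg e1, if_pos rfl]
            rcases hs with rfl | rfl <;> grind
          · rw [if_neg e1, if_neg e2]
            split_ifs <;> rcases hs with rfl | rfl <;> grind
      have h5 := h3.trans (Finset.sum_le_sum fun d _ => h4 d)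
      rw [Finset.sum_add_distrib, Finset.sum_sub_distrib, Finset.sum_sub_distrib,
        Finset.sum_ite_eq', Finset.sum_ite_eq', if_pos (Finset.mem_univ _),
        if_pos (Finset.mem_univ _), Finset.sum_boole] at h5
      have h6 : (Finset.univ.filter fun d => triangle d = triangle x.corner).card ≤ 3 := by
        refine (Finset.card_le_card (t := {x.corner, rot x.corner, rot (rot x.corner)}) ?_).trans
          Finset.card_le_three
        intro d hd
        simpa using triangle_eq (Finset.mem_filter.1 hd).2.symm
      have h7 : ((Finset.univ.filter fun d => triangle d = triangle x.corner).card : ℤ) ≤ 3 := by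
        exact_mod_cast h6
      push_cast at h5
      linarith
    intro x
    by_contra hcon
    rcases mul_pos_iff.1 (not_le.1 hcon) with h1 | h1
    · exact key x 1 (Or.inl rfl) (by simpa using h1)
    · exact key x (-1) (Or.inr rfl) (by simpa using h1)
  · intro b hb h
    have h1 := hmin' b hb
    have h2 : ∑ d, |b d| ≤ 0 := by
      rw [← Finset.sum_congr rfl fun d _ => h d, Finset.sum_add_distrib] at h1
      linarith
    ext d
    have h3 := Finset.single_le_sum (f := fun d => |b d|) (fun d _ => abs_nonneg (b d))
      (Finset.mem_univ d)
    exact abs_nonpos_iff.1 (h3.trans h2)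

end

end FacePairing

/-! ### The 0-2 move -/

namespace ZeroTwoMove

variable {τ τ' : Type*} {T : FacePairing τ} {T' : FacePairing τ'} (m : ZeroTwoMove T T')

/-- The flags of the new triangulation, in the labelling of the vertices used for the move. -/
def flag (s : τ ⊕ Fin 2) (ρ : Perm (Fin 4)) : TetFlag τ' := (m.tet s, m.lab s * ρ)

/-- The flags of the old tetrahedra, as flags of the new triangulation. -/
def old (x : TetFlag τ) : TetFlag τ' := m.flag (.inl x.1) x.2

/-- The last tetrahedron of the half-book. -/
def last : TetFlag τ := T.rotate^[m.len] m.start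

/-- The faces of the half-book that are glued to the first new tetrahedron: the flag with the
vertices `ρ` of the first new tetrahedron sees, through its face opposite `ρ 3`, the half-book. -/
def IsBook (ρ : Perm (Fin 4)) (x : TetFlag τ) : Prop :=
  ρ 3 = 3 ∧ x = m.start.reorder ρ ∨ ρ 3 = 2 ∧ x = m.last.reorder ρ

theorem exists_flag (x : TetFlag τ') : ∃ s ρ, x = m.flag s ρ :=
  ⟨m.tet.symm x.1, (m.lab (m.tet.symm x.1))⁻¹ * x.2, by simp [flag]⟩

theorem flag_other (s : τ ⊕ Fin 2) (ρ : Perm (Fin 4)) :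
    (m.flag s ρ).other = m.flag s (ρ * swap 1 2) := by
  simp [flag, TetFlag.other, TetFlag.reorder, mul_assoc]

theorem old_other (x : TetFlag τ) : (m.old x).other = m.old x.other := m.flag_other _ _

theorem rotate_last : T.rotate^[m.len + 1] m.start = T.cross (m.last.reorder (swap 2 3)) := by
  rw [Function.iterate_succ_apply']
  rfl

theorem reorder_reorder (x : TetFlag τ) (π ρ : Perm (Fin 4)) :
    (x.reorder π).reorder ρ = x.reorder (π * ρ) := by
  simp [TetFlag.reorder, mul_assoc]

theorem cross_flag {s s' : τ ⊕ Fin 2} {f : Fin 4} {g : Perm (Fin 4)}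
    (h : T'.adj (m.tet s) (m.lab s f) = m.tet s' ∧
      T'.glue (m.tet s) (m.lab s f) = m.lab s' * g * (m.lab s)⁻¹)
    {ρ : Perm (Fin 4)} (hρ : ρ 3 = f) : T'.cross (m.flag s ρ) = m.flag s' (g * ρ) := by
  subst hρ
  simp only [FacePairing.cross, flag, Perm.mul_apply, h.1, h.2]
  simp [mul_assoc]

theorem IsBook.cross_new {ρ : Perm (Fin 4)} {x : TetFlag τ} (h : m.IsBook ρ x) :
    T'.cross (m.flag (.inr 0) ρ) = m.old x := by
  rcases h with ⟨h, rfl⟩ | ⟨h, rfl⟩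
  · exact m.cross_flag m.glue_one_three h
  · exact m.cross_flag m.glue_one_two h

theorem IsBook.cross_new' {ρ : Perm (Fin 4)} {x : TetFlag τ} (h : m.IsBook ρ x) :
    T'.cross (m.flag (.inr 1) (swap 0 1 * ρ)) = m.old (T.cross x) := by
  rcases h with ⟨h, rfl⟩ | ⟨h, rfl⟩
  · rw [m.cross_flag m.glue_two_three (by rw [Perm.mul_apply, h]; decide),
      T.cross_reorder _ h]
    simp [old, TetFlag.reorder, mul_assoc]
  · rw [m.cross_flag m.glue_two_two (by rw [Perm.mul_apply, h]; decide), m.rotate_last,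
      show m.last.reorder ρ = (m.last.reorder (swap 2 3)).reorder (swap 2 3 * ρ) by
        rw [reorder_reorder, swap_mul_self_mul],
      T.cross_reorder (m.last.reorder (swap 2 3)) (π := swap 2 3 * ρ)
        (by rw [Perm.mul_apply, h]; decide)]
    simp [old, TetFlag.reorder, mul_assoc]

theorem cross_new_new {ρ : Perm (Fin 4)} (h : ρ 3 = 0 ∨ ρ 3 = 1) :
    T'.cross (m.flag (.inr 0) ρ) = m.flag (.inr 1) (swap 0 1 * ρ) := by
  rcases h with h | h
  · exact m.cross_flag m.glue_zero h
  · exact m.cross_flag m.glue_one h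

/-- The gluings of the old tetrahedra: each face either keeps its neighbour, or is one of the sides of
the two triangles. -/
theorem cross_old (x : TetFlag τ) : T'.cross (m.old x) = m.old (T.cross x) ∨
    ∃ ρ, m.IsBook ρ x ∨ m.IsBook ρ (T.cross x) := by
  have hreorder : ∀ (y : TetFlag τ), x.1 = y.1 → x = y.reorder (y.2⁻¹ * x.2) := by
    intro y h
    ext1
    · exact h
    · simp [TetFlag.reorder]
  by_cases h1 : (x.1, x.2 3) = (m.start.1, m.start.2 3)
  · obtain ⟨h1, h2⟩ := Prod.mk.inj h1
    exact Or.inr ⟨_, Or.inl (Or.inl ⟨by simp [h2], hreorder m.start h1⟩)⟩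
  by_cases h2 : (x.1, x.2 3) = ((T.cross m.start).1, (T.cross m.start).2 3)
  · obtain ⟨h1, h2⟩ := Prod.mk.inj h2
    refine Or.inr ⟨(T.cross m.start).2⁻¹ * x.2, Or.inr (Or.inl ⟨?_, ?_⟩)⟩
    · simp [h2]
    · have := hreorder _ h1
      rw [this, T.cross_reorder _ (by simp [h2]), T.cross_cross]
      simp [TetFlag.reorder]
  by_cases h3 : (x.1, x.2 3) = (m.last.1, m.last.2 2)
  · obtain ⟨h1, h2⟩ := Prod.mk.inj h3
    exact Or.inr ⟨_, Or.inl (Or.inr ⟨by simp [h2], hreorder m.last h1⟩)⟩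
  by_cases h4 : (x.1, x.2 3) = ((T.rotate^[m.len + 1] m.start).1,
      (T.rotate^[m.len + 1] m.start).2 3)
  · obtain ⟨h1, h2⟩ := Prod.mk.inj h4
    set y := T.rotate^[m.len + 1] m.start with hy
    refine Or.inr ⟨swap 2 3 * (y.2⁻¹ * x.2), Or.inr (Or.inr ⟨?_, ?_⟩)⟩
    · simp [h2]
    · have h5 := hreorder _ h1
      have h6 : T.cross y = m.last.reorder (swap 2 3) := by
        rw [hy, m.rotate_last, T.cross_cross]
      rw [← reorder_reorder, ← h6, ← T.cross_reorder _ (by simp [h2]), ← h5]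
  · exact Or.inl (m.cross_flag (m.glue_old x.1 (x.2 3) h1 h2 h3 h4) rfl)

/-- To check a symmetric relation between the two sides of all faces of the new triangulation. -/
theorem cross_ind {P : TetFlag τ' → TetFlag τ' → Prop} (hsymm : ∀ x y, P x y → P y x)
    (hold : ∀ x, T'.cross (m.old x) = m.old (T.cross x) → P (m.old x) (m.old (T.cross x)))
    (hbook : ∀ ρ x, m.IsBook ρ x → P (m.flag (.inr 0) ρ) (m.old x) ∧
      P (m.flag (.inr 1) (swap 0 1 * ρ)) (m.old (T.cross x)))
    (hnew : ∀ ρ : Perm (Fin 4), ρ 3 = 0 ∨ ρ 3 = 1 →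
      P (m.flag (.inr 0) ρ) (m.flag (.inr 1) (swap 0 1 * ρ))) (x : TetFlag τ') :
    P x (T'.cross x) := by
  have hex : ∀ ρ : Perm (Fin 4), (∃ x, m.IsBook ρ x) ∨ ρ 3 = 0 ∨ ρ 3 = 1 := by
    intro ρ
    have : ∀ i : Fin 4, i = 3 ∨ i = 2 ∨ i = 0 ∨ i = 1 := by decide
    rcases this (ρ 3) with h | h | h
    · exact Or.inl ⟨_, Or.inl ⟨h, rfl⟩⟩
    · exact Or.inl ⟨_, Or.inr ⟨h, rfl⟩⟩
    · exact Or.inr h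
  obtain ⟨s, ρ, rfl⟩ := m.exists_flag x
  rcases s with t | i
  · change P (m.old (t, ρ)) (T'.cross (m.old (t, ρ)))
    rcases m.cross_old (t, ρ) with h | ⟨π, h | h⟩
    · have := hold _ h
      rwa [h]
    · have h1 := hsymm _ _ (hbook π _ h).1
      rw [← h.cross_new, T'.cross_cross, h.cross_new]
      exact h1
    · have h1 := hsymm _ _ (hbook π _ h).2
      have h2 := h.cross_new'
      rw [T.cross_cross] at h1 h2
      rw [← h2, T'.cross_cross, h2]
      exact h1
  · have hi : i = 0 ∨ i = 1 := by omega
    rcases hi with rfl | rfl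
    · rcases hex ρ with ⟨x, h⟩ | h
      · rw [h.cross_new]
        exact (hbook ρ x h).1
      · rw [m.cross_new_new h]
        exact hnew ρ h
    · rw [← swap_mul_self_mul 0 1 ρ]
      rcases hex (swap 0 1 * ρ) with ⟨x, h⟩ | h
      · rw [h.cross_new']
        exact (hbook _ x h).2
      · have h1 := hsymm _ _ (hnew _ h)
        rw [← m.cross_new_new h] at h1 ⊢
        rwa [T'.cross_cross]

/-- To check a symmetric relation between the two sides of all faces of the old triangulation. -/
theorem cross_old_ind {P : TetFlag τ → TetFlag τ → Prop} (hsymm : ∀ x y, P x y → P y x)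
    (hold : ∀ x, T'.cross (m.old x) = m.old (T.cross x) → P x (T.cross x))
    (hbook : ∀ ρ x, m.IsBook ρ x → P x (T.cross x)) (x : TetFlag τ) : P x (T.cross x) := by
  rcases m.cross_old x with h | ⟨ρ, h | h⟩
  · exact hold x h
  · exact hbook ρ x h
  · have := hsymm _ _ (hbook ρ _ h)
    rwa [T.cross_cross] at this

/-- The corners of the new triangulation, in the labelling of the vertices used for the move. -/
def cornerAt (s : τ ⊕ Fin 2) (v w : Fin 4) (h : v ≠ w) : Corner τ' :=
  ⟨(m.tet s, m.lab s v, m.lab s w), by simpa using h⟩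

/-- The corners of the old tetrahedra, as corners of the new triangulation. -/
def oldCorner (d : Corner τ) : Corner τ' := m.cornerAt (.inl d.1.1) d.1.2.1 d.1.2.2 d.2

theorem corner_flag (s : τ ⊕ Fin 2) (ρ : Perm (Fin 4)) :
    (m.flag s ρ).corner = m.cornerAt s (ρ 0) (ρ 1) (by simp) := rfl

theorem corner_old (x : TetFlag τ) : (m.old x).corner = m.oldCorner x.corner := rfl

theorem restrict_apply (c : Corner τ' → ℤ) (d : Corner τ) : m.restrict c d = c (m.oldCorner d) :=
  rfl

/-- A function on the corners of the new triangulation from one on the old corners and one on the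
vertices of the new tetrahedra. -/
def glueCorner {X : Type*} (f : Corner τ → X) (N : Fin 2 → Fin 4 → Fin 4 → X) (d : Corner τ') : X :=
  match h : m.tet.symm d.1.1 with
  | .inl t => f ⟨(t, (m.lab (.inl t))⁻¹ d.1.2.1, (m.lab (.inl t))⁻¹ d.1.2.2), by simpa using d.2⟩
  | .inr i => N i ((m.lab (.inr i))⁻¹ d.1.2.1) ((m.lab (.inr i))⁻¹ d.1.2.2)

theorem glueCorner_old {X : Type*} (f : Corner τ → X) (N : Fin 2 → Fin 4 → Fin 4 → X)
    (d : Corner τ) : m.glueCorner f N (m.oldCorner d) = f d := by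
  unfold glueCorner
  split
  · rename_i t h
    have ht : t = d.1.1 := by simpa [oldCorner, cornerAt] using h.symm
    subst ht
    congr 1
    apply Subtype.ext
    simp [oldCorner, cornerAt]
  · rename_i i h
    simp [oldCorner, cornerAt] at h

theorem glueCorner_new {X : Type*} (f : Corner τ → X) (N : Fin 2 → Fin 4 → Fin 4 → X)
    (i : Fin 2) (v w : Fin 4) (h : v ≠ w) :
    m.glueCorner f N (m.cornerAt (.inr i) v w h) = N i v w := by
  unfold glueCorner
  split
  · rename_i t h
    simp [cornerAt] at h
  · rename_i j h
    have hj : j = i := by simpa [cornerAt] using h.symm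
    subst hj
    simp [cornerAt]

theorem glueCorner_flag {X : Type*} (f : Corner τ → X) (N : Fin 2 → Fin 4 → Fin 4 → X) (i : Fin 2)
    (ρ : Perm (Fin 4)) : m.glueCorner f N (m.flag (.inr i) ρ).corner = N i (ρ 0) (ρ 1) :=
  m.glueCorner_new f N i _ _ (by simp)

/-- Every corner of the new triangulation is old or new. -/
theorem corner_cases (d : Corner τ') : (∃ d₀, d = m.oldCorner d₀) ∨
    ∃ i v w, ∃ h : v ≠ w, d = m.cornerAt (.inr i) v w h := by
  obtain ⟨s, ρ, h⟩ := m.exists_flag (TetFlag.ofCorner d)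
  have h1 := TetFlag.corner_ofCorner d
  rw [h] at h1
  rcases s with t | i
  · exact Or.inl ⟨TetFlag.corner (t, ρ), h1.symm⟩
  · exact Or.inr ⟨i, ρ 0, ρ 1, by simp, h1.symm⟩

end ZeroTwoMove

/-! ### Extension of cycles and boundaries under the move -/

namespace FacePairing

variable {τ : Type*}

/-- The value of a chain at the corner `(v, w)` of a tetrahedron with ordered vertices. -/
def flagVal (c : Corner τ → ℤ) (x : TetFlag τ) (v w : Fin 4) : ℤ :=
  if h : v ≠ w then c ⟨(x.1, x.2 v, x.2 w), by simpa using h⟩ else 0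

theorem reorder_corner (c : Corner τ → ℤ) (x : TetFlag τ) (ρ : Perm (Fin 4)) :
    c (x.reorder ρ).corner = flagVal c x (ρ 0) (ρ 1) := by
  rw [flagVal, dif_pos (by simp)]
  rfl

theorem reorder_other_corner (c : Corner τ → ℤ) (x : TetFlag τ) (ρ : Perm (Fin 4)) :
    c (x.reorder ρ).other.corner = flagVal c x (ρ 0) (ρ 2) := by
  rw [flagVal, dif_pos (by simp)]
  congr 1

theorem edgeEnd_rotate_iterate (T : FacePairing τ) (x : TetFlag τ) (n : ℕ) :
    T.edgeEnd (T.rotate^[n] x).corner = T.edgeEnd x.corner := by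
  induction n with
  | zero => rfl
  | succ n ih => rw [Function.iterate_succ_apply', rotate, edgeEnd_cross,
      TetFlag.corner_reorder, ih]

end FacePairing

theorem perm_three_eq_three : ∀ ρ : Perm (Fin 4), ρ 3 = 3 →
    ρ 0 = 0 ∧ ρ 1 = 1 ∧ ρ 2 = 2 ∨ ρ 0 = 0 ∧ ρ 1 = 2 ∧ ρ 2 = 1 ∨ ρ 0 = 1 ∧ ρ 1 = 0 ∧ ρ 2 = 2 ∨
    ρ 0 = 1 ∧ ρ 1 = 2 ∧ ρ 2 = 0 ∨ ρ 0 = 2 ∧ ρ 1 = 0 ∧ ρ 2 = 1 ∨ ρ 0 = 2 ∧ ρ 1 = 1 ∧ ρ 2 = 0 := by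
  decide

theorem perm_three_eq_two : ∀ ρ : Perm (Fin 4), ρ 3 = 2 →
    ρ 0 = 0 ∧ ρ 1 = 1 ∧ ρ 2 = 3 ∨ ρ 0 = 0 ∧ ρ 1 = 3 ∧ ρ 2 = 1 ∨ ρ 0 = 1 ∧ ρ 1 = 0 ∧ ρ 2 = 3 ∨
    ρ 0 = 1 ∧ ρ 1 = 3 ∧ ρ 2 = 0 ∨ ρ 0 = 3 ∧ ρ 1 = 0 ∧ ρ 2 = 1 ∨ ρ 0 = 3 ∧ ρ 1 = 1 ∧ ρ 2 = 0 := by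
  decide

namespace ZeroTwoMove

open FacePairing

variable {τ τ' : Type*} {T : FacePairing τ} {T' : FacePairing τ'} (m : ZeroTwoMove T T')

/-- The vertices of the two new tetrahedra correspond to each other under `swap 0 1`: a pair of
functions that are exchanged. -/
def twin {X : Type*} (N : Fin 4 → Fin 4 → X) (i : Fin 2) (v w : Fin 4) : X :=
  if i = 0 then N v w else N (swap 0 1 v) (swap 0 1 w)

/-- The normal coordinates in the first new tetrahedron of a curve that does not turn around the edge
`uv`.  Where it crosses one of the two triangles near `u` or `v`, it turns around `ux` or `uy`, and
`vx` or `vy`; near `x` and `y` it turns around the vertex `u`. -/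
def newVal (c : Corner τ → ℤ) : Fin 4 → Fin 4 → ℤ :=
  let A := flagVal c m.start
  let B := flagVal c m.last
  ![![0, 0, A 0 2 - A 0 1, B 0 3 - B 0 1], ![0, 0, A 1 2 - A 1 0, B 1 3 - B 1 0],
    ![A 2 0 - A 2 1, 0, 0, 0], ![B 3 0 - B 3 1, 0, 0, 0]]

/-- The extension of a cycle to the new triangulation. -/
def extend (c : Corner τ → ℤ) : Corner τ' → ℤ := m.glueCorner c (twin (m.newVal c))

theorem extend_oldCorner (c : Corner τ → ℤ) (d : Corner τ) :
    m.extend c (m.oldCorner d) = c d := m.glueCorner_old _ _ _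

theorem restrict_extend (c : Corner τ → ℤ) : m.restrict (m.extend c) = c := by
  ext d
  exact m.extend_oldCorner c d

theorem extend_flag_zero (c : Corner τ → ℤ) (ρ : Perm (Fin 4)) :
    m.extend c (m.flag (.inr 0) ρ).corner = m.newVal c (ρ 0) (ρ 1) := m.glueCorner_flag _ _ _ _

theorem extend_flag_one (c : Corner τ → ℤ) (ρ : Perm (Fin 4)) :
    m.extend c (m.flag (.inr 1) (swap 0 1 * ρ)).corner = m.newVal c (ρ 0) (ρ 1) := by
  refine (m.glueCorner_flag _ _ _ _).trans ?_
  simp [twin]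

/-- The extension satisfies the cycle condition at the sides of the two triangles. -/
theorem newVal_sub (c : Corner τ → ℤ) {ρ : Perm (Fin 4)} {x : TetFlag τ} (h : m.IsBook ρ x) :
    m.newVal c (ρ 0) (ρ 1) - m.newVal c (ρ 0) (ρ 2) = c x.corner - c x.other.corner := by
  rcases h with ⟨h, rfl⟩ | ⟨h, rfl⟩ <;> rw [reorder_corner c, reorder_other_corner c]
  · rcases perm_three_eq_three ρ h with h | h | h | h | h | h <;> obtain ⟨h0, h1, h2⟩ := h <;>
      simp [newVal, h0, h1, h2]
  · rcases perm_three_eq_two ρ h with h | h | h | h | h | h <;> obtain ⟨h0, h1, h2⟩ := h <;>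
      simp [newVal, h0, h1, h2]

theorem newVal_mul (c : Corner τ → ℤ) {ρ : Perm (Fin 4)} {x : TetFlag τ} (h : m.IsBook ρ x) :
    m.newVal c (ρ 0) (ρ 1) * m.newVal c (ρ 0) (ρ 2) = 0 := by
  rcases h with ⟨h, rfl⟩ | ⟨h, rfl⟩
  · rcases perm_three_eq_three ρ h with h | h | h | h | h | h <;> obtain ⟨h0, h1, h2⟩ := h <;>
      simp [newVal, h0, h1, h2]
  · rcases perm_three_eq_two ρ h with h | h | h | h | h | h <;> obtain ⟨h0, h1, h2⟩ := h <;>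
      simp [newVal, h0, h1, h2]

theorem swap_one_two_apply (ρ : Perm (Fin 4)) :
    (ρ * swap 1 2 : Perm (Fin 4)) 0 = ρ 0 ∧ (ρ * swap 1 2 : Perm (Fin 4)) 1 = ρ 2 ∧
      (ρ * swap 1 2 : Perm (Fin 4)) 3 = ρ 3 := by
  simp [swap_apply_of_ne_of_ne]

theorem extend_other_zero (c : Corner τ → ℤ) (ρ : Perm (Fin 4)) :
    m.extend c (m.flag (.inr 0) ρ).other.corner = m.newVal c (ρ 0) (ρ 2) := by
  rw [flag_other, extend_flag_zero, (swap_one_two_apply ρ).1, (swap_one_two_apply ρ).2.1]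

theorem extend_other_one (c : Corner τ → ℤ) (ρ : Perm (Fin 4)) :
    m.extend c (m.flag (.inr 1) (swap 0 1 * ρ)).other.corner = m.newVal c (ρ 0) (ρ 2) := by
  rw [flag_other, mul_assoc, extend_flag_one, (swap_one_two_apply ρ).1,
    (swap_one_two_apply ρ).2.1]

theorem extend_old (c : Corner τ → ℤ) (x : TetFlag τ) :
    m.extend c (m.old x).corner = c x.corner := m.extend_oldCorner c x.corner

theorem extend_old_other (c : Corner τ → ℤ) (x : TetFlag τ) :
    m.extend c (m.old x).other.corner = c x.other.corner := by rw [old_other, extend_old]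

theorem extend_mem_cycles {c : Corner τ → ℤ} (hc : c ∈ T.cycles) : m.extend c ∈ T'.cycles := by
  intro x
  refine m.cross_ind (P := fun x y => m.extend c x.corner - m.extend c x.other.corner =
    m.extend c y.corner - m.extend c y.other.corner) (fun x y => Eq.symm) ?_ ?_ ?_ x
  · intro x _
    simp only [extend_old, extend_old_other]
    exact hc x
  · intro ρ x h
    simp only [extend_old, extend_old_other, extend_flag_zero, extend_other_zero, extend_flag_one,
      extend_other_one, m.newVal_sub c h, true_and]
    exact hc x
  · intro ρ _
    simp only [extend_flag_zero, extend_other_zero, extend_flag_one, extend_other_one]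

/-- The condition under which the extension is represented by a normal curve. -/
theorem extend_coherent {c : Corner τ → ℤ} (h : ∀ x : TetFlag τ, c x.corner * c x.other.corner ≤ 0)
    (x : TetFlag τ') : m.extend c x.corner = m.extend c (T'.cross x).corner ∨
      m.extend c x.corner * m.extend c x.other.corner ≤ 0 ∧
      m.extend c (T'.cross x).corner * m.extend c (T'.cross x).other.corner ≤ 0 := by
  refine m.cross_ind (P := fun x y => m.extend c x.corner = m.extend c y.corner ∨
    m.extend c x.corner * m.extend c x.other.corner ≤ 0 ∧
    m.extend c y.corner * m.extend c y.other.corner ≤ 0) ?_ ?_ ?_ ?_ x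
  · rintro x y (h | ⟨h, h'⟩)
    · exact Or.inl h.symm
    · exact Or.inr ⟨h', h⟩
  · intro x _
    simp only [extend_old, extend_old_other]
    exact Or.inr ⟨h _, h _⟩
  · intro ρ x hx
    simp only [extend_old, extend_old_other, extend_flag_zero, extend_other_zero, extend_flag_one,
      extend_other_one, m.newVal_mul c hx]
    exact ⟨Or.inr ⟨le_rfl, h _⟩, Or.inr ⟨le_rfl, h _⟩⟩
  · intro ρ _
    rw [extend_flag_zero, extend_flag_one]
    exact Or.inl rfl

/-- The values of a chain at the corners of the two new tetrahedra, with corresponding vertices. -/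
def newPart (b : Corner τ' → ℤ) (i : Fin 2) (v w : Fin 4) : ℤ :=
  if i = 0 then flagVal b (m.flag (.inr 0) 1) v w else flagVal b (m.flag (.inr 1) (swap 0 1)) v w

theorem newPart_zero (b : Corner τ' → ℤ) (ρ : Perm (Fin 4)) :
    b (m.flag (.inr 0) ρ).corner = m.newPart b 0 (ρ 0) (ρ 1) := by
  rw [newPart, if_pos rfl, ← reorder_corner]
  simp [flag, TetFlag.reorder]

theorem newPart_one (b : Corner τ' → ℤ) (ρ : Perm (Fin 4)) :
    b (m.flag (.inr 1) (swap 0 1 * ρ)).corner = m.newPart b 1 (ρ 0) (ρ 1) := by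
  rw [newPart, if_neg (by decide), ← reorder_corner]
  simp [flag, TetFlag.reorder, mul_assoc]

theorem exists_perm_of_ne : ∀ v w : Fin 4, v ≠ w → ∃ ρ : Perm (Fin 4), ρ 0 = v ∧ ρ 1 = w := by
  decide

theorem exists_perm_of_not_zero_one : ∀ v w : Fin 4, v ≠ w → ¬ (v = 0 ∧ w = 1) →
    ¬ (v = 1 ∧ w = 0) → ∃ ρ : Perm (Fin 4), (ρ 3 = 0 ∨ ρ 3 = 1) ∧ ρ 0 = v ∧ ρ 1 = w := by
  decide

variable [Fintype τ] [Fintype τ']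

/-- A boundary of the new triangulation that does not turn around the edge `uv` restricts to a
boundary of the old one. -/
theorem restrict_mem_boundaries {b : Corner τ' → ℤ} (hb : b ∈ T'.boundaries)
    (h01 : ∀ i, m.newPart b i 0 1 = 0) (h10 : ∀ i, m.newPart b i 1 0 = 0)
    (h02 : m.newPart b 0 0 2 = m.newPart b 1 0 2) (h12 : m.newPart b 0 1 2 = m.newPart b 1 1 2) :
    m.restrict b ∈ T.boundaries := by
  obtain ⟨n', m', h⟩ := T'.mem_boundaries_iff.1 hb
  have e0 : ∀ ρ, m.newPart b 0 (ρ 0) (ρ 1) = n' (T'.edgeEnd (m.flag (.inr 0) ρ).corner) +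
      m' (m.tet (.inr 0), m.lab (.inr 0) (ρ 0)) := fun ρ => by
    rw [← newPart_zero, h]
    rfl
  have e1 : ∀ ρ, m.newPart b 1 (ρ 0) (ρ 1) =
      n' (T'.edgeEnd (m.flag (.inr 1) (swap 0 1 * ρ)).corner) +
      m' (m.tet (.inr 1), m.lab (.inr 1) (swap 0 1 (ρ 0))) := fun ρ => by
    rw [← newPart_one, h]
    rfl
  have hnew : ∀ ρ : Perm (Fin 4), ρ 3 = 0 ∨ ρ 3 = 1 →
      n' (T'.edgeEnd (m.flag (.inr 0) ρ).corner) =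
      n' (T'.edgeEnd (m.flag (.inr 1) (swap 0 1 * ρ)).corner) := by
    intro ρ h
    rw [← m.cross_new_new h, edgeEnd_cross]
  have hcongr : ∀ (s : τ ⊕ Fin 2) (ρ π : Perm (Fin 4)), ρ 0 = π 0 → ρ 1 = π 1 →
      (m.flag s ρ).corner = (m.flag s π).corner := by
    intro s ρ π h0 h1
    apply Subtype.ext
    simp [flag, TetFlag.corner, h0, h1]
  -- corresponding edge ends of the new tetrahedra have the same value, at `uv` because `b`
  -- vanishes there
  have hall : ∀ ρ : Perm (Fin 4), n' (T'.edgeEnd (m.flag (.inr 0) ρ).corner) =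
      n' (T'.edgeEnd (m.flag (.inr 1) (swap 0 1 * ρ)).corner) := by
    intro ρ
    by_cases c1 : ρ 0 = 0 ∧ ρ 1 = 1
    · obtain ⟨π, hπ, p0, p1⟩ := exists_perm_of_not_zero_one 0 2 (by decide) (by decide) (by decide)
      have a1 := e0 ρ
      have a2 := e1 ρ
      have a3 := e0 π
      have a4 := e1 π
      rw [c1.1, c1.2, h01] at a1 a2
      rw [p0, p1, hnew π hπ] at a3
      rw [p0, p1] at a4
      linarith
    by_cases c2 : ρ 0 = 1 ∧ ρ 1 = 0
    · obtain ⟨π, hπ, p0, p1⟩ := exists_perm_of_not_zero_one 1 2 (by decide) (by decide) (by decide)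
      have a1 := e0 ρ
      have a2 := e1 ρ
      have a3 := e0 π
      have a4 := e1 π
      rw [c2.1, c2.2, h10] at a1 a2
      rw [p0, p1, hnew π hπ] at a3
      rw [p0, p1] at a4
      linarith
    obtain ⟨π, hπ, p0, p1⟩ := exists_perm_of_not_zero_one (ρ 0) (ρ 1) (by simp) c1 c2
    rw [hcongr (.inr 0) ρ π p0.symm p1.symm, hnew π hπ,
      hcongr (.inr 1) (swap 0 1 * π) (swap 0 1 * ρ) (by simp [p0]) (by simp [p1])]
  have hf : ∀ x : TetFlag τ, n' (T'.edgeEnd (m.oldCorner x.corner)) =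
      n' (T'.edgeEnd (m.oldCorner (T.cross x).corner)) := by
    refine m.cross_old_ind (P := fun x y => n' (T'.edgeEnd (m.oldCorner x.corner)) =
      n' (T'.edgeEnd (m.oldCorner y.corner))) (fun x y => Eq.symm) ?_ ?_
    · intro x hx
      rw [← corner_old, ← corner_old, ← hx, edgeEnd_cross]
    · intro ρ x hx
      rw [← corner_old, ← corner_old, ← hx.cross_new, ← hx.cross_new', edgeEnd_cross, edgeEnd_cross]
      exact hall ρ
  refine T.mem_boundaries_iff.2 ⟨Quot.lift (fun d => n' (T'.edgeEnd (m.oldCorner d))) ?_,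
    fun a => m' (m.tet (.inl a.1), m.lab (.inl a.1) a.2), fun d => ?_⟩
  · rintro a b ⟨x, rfl, rfl⟩
    exact hf x
  · rw [restrict_apply, h]
    rfl

/-- A cycle of the new triangulation is a boundary if its restriction is one. -/
theorem mem_boundaries_of_restrict {z : Corner τ' → ℤ} (hz : z ∈ T'.cycles)
    (h : m.restrict z ∈ T.boundaries) : z ∈ T'.boundaries := by
  obtain ⟨n, m₀, hn⟩ := T.mem_boundaries_iff.1 h
  have hz' : ∀ d, z (m.oldCorner d) = n (T.edgeEnd d) + m₀ (triangle d) := hn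
  set A := flagVal (fun d => n (T.edgeEnd d)) m.start with hA
  set B := flagVal (fun d => n (T.edgeEnd d)) m.last with hB
  set V := m.newPart z with hV
  -- the values of the boundary function at the ends of the edges of the new tetrahedra
  let N : Fin 4 → Fin 4 → ℤ :=
    ![![0, A 0 1, A 0 2, B 0 3], ![A 1 0, 0, A 1 2, B 1 3],
      ![A 2 0, A 2 1, 0, V 0 2 3 - V 0 2 0 + A 2 0],
      ![B 3 0, B 3 1, V 0 3 2 - V 0 3 0 + B 3 0, 0]]
  have hlast : T.edgeEnd m.last.corner = T.edgeEnd m.start.corner := T.edgeEnd_rotate_iterate _ _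
  have hAB : B 0 1 = A 0 1 := congrArg n hlast
  have hAB' : B 1 0 = A 1 0 := congrArg n (T.edgeEnd_rev hlast)
  have hN : ∀ ρ x, m.IsBook ρ x → N (ρ 0) (ρ 1) = n (T.edgeEnd x.corner) := by
    rintro ρ x (⟨h, rfl⟩ | ⟨h, rfl⟩)
    · rw [reorder_corner fun d => n (T.edgeEnd d)]
      rcases perm_three_eq_three ρ h with h | h | h | h | h | h <;> obtain ⟨h0, h1, h2⟩ := h <;>
        simp [N, h0, h1, hA]
    · rw [reorder_corner fun d => n (T.edgeEnd d)]
      rcases perm_three_eq_two ρ h with h | h | h | h | h | h <;> obtain ⟨h0, h1, h2⟩ := h <;>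
        simp [N, h0, h1, ← hB, hAB, hAB']
  set f : Corner τ' → ℤ := m.glueCorner (fun d => n (T.edgeEnd d)) (twin N) with hf
  have f0 : ∀ ρ, f (m.flag (.inr 0) ρ).corner = N (ρ 0) (ρ 1) := fun ρ =>
    m.glueCorner_flag _ _ _ _
  have f1 : ∀ ρ, f (m.flag (.inr 1) (swap 0 1 * ρ)).corner = N (ρ 0) (ρ 1) := fun ρ => by
    refine (m.glueCorner_flag _ _ _ _).trans ?_
    simp [twin]
  have fold : ∀ x, f (m.old x).corner = n (T.edgeEnd x.corner) := fun x =>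
    m.glueCorner_old (fun d => n (T.edgeEnd d)) (twin N) x.corner
  have hfc : ∀ x, f x.corner = f (T'.cross x).corner := by
    refine m.cross_ind (P := fun x y => f x.corner = f y.corner) (fun x y => Eq.symm) ?_ ?_ ?_
    · intro x _
      rw [fold, fold, edgeEnd_cross]
    · intro ρ x hx
      rw [fold, fold, f0, f1, edgeEnd_cross, hN ρ x hx]
      exact ⟨rfl, rfl⟩
    · intro ρ _
      rw [f0, f1]
  -- the cycle condition determines the values in the new tetrahedra up to triangles
  have hdiff : ∀ ρ x, m.IsBook ρ x → ∀ i, V i (ρ 0) (ρ 1) - V i (ρ 0) (ρ 2) =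
      N (ρ 0) (ρ 1) - N (ρ 0) (ρ 2) := by
    intro ρ x hx i
    have hx' : m.IsBook (ρ * swap 1 2) x.other := by
      rcases hx with ⟨h, rfl⟩ | ⟨h, rfl⟩
      · exact Or.inl ⟨by rw [(swap_one_two_apply ρ).2.2, h], reorder_reorder _ _ _⟩
      · exact Or.inr ⟨by rw [(swap_one_two_apply ρ).2.2, h], reorder_reorder _ _ _⟩
    have k1 := hN _ _ hx
    have k2 := hN _ _ hx'
    rw [(swap_one_two_apply ρ).1, (swap_one_two_apply ρ).2.1] at k2
    have htri : triangle x.other.corner = triangle x.corner := by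
      rw [triangle_corner, triangle_corner, TetFlag.other_zero, TetFlag.other_fst]
    have hi : i = 0 ∨ i = 1 := by omega
    rcases hi with rfl | rfl
    · have k3 := hz (m.flag (.inr 0) ρ)
      rw [hx.cross_new, old_other, flag_other, m.newPart_zero z, m.newPart_zero z,
        (swap_one_two_apply ρ).1, (swap_one_two_apply ρ).2.1, corner_old, corner_old, hz', hz',
        htri] at k3
      rw [k1, k2, hV, k3]
      ring
    · have k3 := hz (m.flag (.inr 1) (swap 0 1 * ρ))
      rw [hx.cross_new', old_other, flag_other, mul_assoc, m.newPart_one z, m.newPart_one z,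
        (swap_one_two_apply ρ).1, (swap_one_two_apply ρ).2.1, corner_old, corner_old, hz', hz',
        ← cross_other, edgeEnd_cross, edgeEnd_cross, cross_other] at k3
      have htri' : triangle (T.cross x).other.corner = triangle (T.cross x).corner := by
        rw [triangle_corner, triangle_corner, TetFlag.other_zero, TetFlag.other_fst]
      rw [htri'] at k3
      rw [k1, k2, hV, k3]
      ring
  have hsame : ∀ ρ : Perm (Fin 4), ρ 3 = 0 ∨ ρ 3 = 1 → V 0 (ρ 0) (ρ 1) - V 0 (ρ 0) (ρ 2) =
      V 1 (ρ 0) (ρ 1) - V 1 (ρ 0) (ρ 2) := by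
    intro ρ h
    have k := hz (m.flag (.inr 0) ρ)
    rw [m.cross_new_new h, flag_other, flag_other, mul_assoc, m.newPart_zero z, m.newPart_zero z,
      m.newPart_one z, m.newPart_one z, (swap_one_two_apply ρ).1, (swap_one_two_apply ρ).2.1] at k
    exact k
  let M : Fin 2 → Fin 4 → ℤ := fun i =>
    ![V i 0 1 - N 0 1, V i 1 0 - N 1 0, V i 2 0 - N 2 0, V i 3 0 - N 3 0]
  have hVN : ∀ i v w, v ≠ w → V i v w = N v w + M i v := by
    intro i
    have d3 : ∀ v w u, (∃ ρ : Perm (Fin 4), ρ 3 = 3 ∧ ρ 0 = v ∧ ρ 1 = w ∧ ρ 2 = u) →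
        V i v w - V i v u = N v w - N v u := by
      rintro _ _ _ ⟨ρ, h, rfl, rfl, rfl⟩
      exact hdiff ρ _ (Or.inl ⟨h, rfl⟩) i
    have d2 : ∀ v w u, (∃ ρ : Perm (Fin 4), ρ 3 = 2 ∧ ρ 0 = v ∧ ρ 1 = w ∧ ρ 2 = u) →
        V i v w - V i v u = N v w - N v u := by
      rintro _ _ _ ⟨ρ, h, rfl, rfl, rfl⟩
      exact hdiff ρ _ (Or.inr ⟨h, rfl⟩) i
    have d1 : ∀ v w u, (∃ ρ : Perm (Fin 4), ρ 3 = 1 ∧ ρ 0 = v ∧ ρ 1 = w ∧ ρ 2 = u) →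
        V 0 v w - V 0 v u = V i v w - V i v u := by
      rintro _ _ _ ⟨ρ, h, rfl, rfl, rfl⟩
      have hi : i = 0 ∨ i = 1 := by omega
      rcases hi with rfl | rfl
      · rfl
      · exact hsame ρ (Or.inr h)
    have a1 := d3 0 1 2 (by decide)
    have a2 := d3 1 0 2 (by decide)
    have a3 := d3 2 0 1 (by decide)
    have a4 := d2 0 1 3 (by decide)
    have a5 := d2 1 0 3 (by decide)
    have a6 := d2 3 0 1 (by decide)
    have a7 := d1 2 3 0 (by decide)
    have a8 := d1 3 2 0 (by decide)
    intro v w hvw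
    simp only [N, Matrix.cons_val] at a1 a2 a3 a4 a5 a6
    fin_cases v <;> fin_cases w <;> first | exact absurd rfl hvw | skip
    all_goals
      simp only [N, M, Fin.zero_eta, Fin.mk_one, Fin.reduceFinMk, Matrix.cons_val]
      linarith
  refine T'.mem_boundaries_iff.2 ⟨Quot.lift f ?_, fun a => match m.tet.symm a.1 with
    | .inl t => m₀ (t, (m.lab (.inl t))⁻¹ a.2)
    | .inr i => M i (if i = 0 then (m.lab (.inr i))⁻¹ a.2 else swap 0 1 ((m.lab (.inr i))⁻¹ a.2)),
    fun d => ?_⟩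
  · rintro a b ⟨x, rfl, rfl⟩
    exact hfc x
  · change z d = f d + _
    rcases m.corner_cases d with ⟨d, rfl⟩ | ⟨i, v, w, hvw, rfl⟩
    · rw [hz', hf, glueCorner_old]
      simp [oldCorner, cornerAt, triangle]
    · obtain ⟨ρ, rfl, rfl⟩ := exists_perm_of_ne v w hvw
      have hi : i = 0 ∨ i = 1 := by omega
      rcases hi with rfl | rfl
      · rw [← corner_flag, f0, m.newPart_zero z, ← hV, hVN _ _ _ hvw]
        simp [triangle, flag, TetFlag.corner]
      · have e : m.cornerAt (.inr 1) (ρ 0) (ρ 1) hvw =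
            (m.flag (.inr 1) (swap 0 1 * (swap 0 1 * ρ))).corner := by
          rw [swap_mul_self_mul]
          rfl
        rw [e, f1, m.newPart_one z, ← hV, hVN _ _ _ (by simp)]
        simp [triangle, flag, TetFlag.corner]

end ZeroTwoMove

/-! ### Essential multi-curves under the move -/

namespace FacePairing

variable {τ : Type*} {T : FacePairing τ}

theorem mk_eq_mk_iff (c c' : T.cycles) :
    QuotientAddGroup.mk (s := T.boundaries.addSubgroupOf T.cycles) c =
      QuotientAddGroup.mk (s := T.boundaries.addSubgroupOf T.cycles) c' ↔
    (c : Corner τ → ℤ) - c' ∈ T.boundaries := by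
  rw [eq_comm, QuotientAddGroup.eq, AddSubgroup.mem_addSubgroupOf]
  simp [neg_add_eq_sub]

theorem homologyClass_eq_iff (ϖ ϖ' : T.OrientedCurve) :
    ϖ.homologyClass = ϖ'.homologyClass ↔ ϖ.turning - ϖ'.turning ∈ T.boundaries :=
  mk_eq_mk_iff _ _

end FacePairing

namespace ZeroTwoMove

open FacePairing

variable {τ τ' : Type*} [Fintype τ] [Fintype τ'] {T : FacePairing τ} {T' : FacePairing τ'}
  (m : ZeroTwoMove T T')

/-- No boundary can be split off from the extension of a shortest cycle. -/
theorem eq_zero_of_extend {c : Corner τ → ℤ}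
    (hmin : ∀ b ∈ T.boundaries, (∀ d, |c d - b d| + |b d| = |c d|) → b = 0)
    {b : Corner τ' → ℤ} (hb : b ∈ T'.boundaries)
    (h : ∀ d, |m.extend c d - b d| + |b d| = |m.extend c d|)
    (hacross : ∀ x : TetFlag τ', m.extend c x.corner = m.extend c (T'.cross x).corner →
      b x.corner = b (T'.cross x).corner) : b = 0 := by
  have hi : ∀ i : Fin 2, i = 0 ∨ i = 1 := by omega
  have hzero : ∀ d, m.extend c d = 0 → b d = 0 := by
    intro d hd
    have h1 := h d
    rw [hd, abs_zero] at h1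
    exact abs_nonpos_iff.1 (by linarith [abs_nonneg (0 - b d)])
  have hV : ∀ i v w, v ≠ w → m.newVal c v w = 0 → m.newPart b i v w = 0 := by
    intro i v w hvw h0
    obtain ⟨ρ, rfl, rfl⟩ := exists_perm_of_ne v w hvw
    rcases hi i with rfl | rfl
    · rw [← newPart_zero]
      exact hzero _ (by rw [extend_flag_zero, h0])
    · rw [← newPart_one]
      exact hzero _ (by rw [extend_flag_one, h0])
  have hsame : ∀ v w, v ≠ w → ¬ (v = 0 ∧ w = 1) → ¬ (v = 1 ∧ w = 0) →
      m.newPart b 0 v w = m.newPart b 1 v w := by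
    intro v w hvw h1 h2
    obtain ⟨ρ, hρ, rfl, rfl⟩ := exists_perm_of_not_zero_one v w hvw h1 h2
    rw [← newPart_zero, ← newPart_one, ← m.cross_new_new hρ]
    refine hacross _ ?_
    rw [m.cross_new_new hρ, extend_flag_zero, extend_flag_one]
  -- the restriction splits off from the shortest cycle
  have hr : m.restrict b = 0 := by
    refine hmin _ (m.restrict_mem_boundaries hb (fun i => hV i 0 1 (by decide) rfl)
      (fun i => hV i 1 0 (by decide) rfl) (hsame 0 2 (by decide) (by decide) (by decide))
      (hsame 1 2 (by decide) (by decide) (by decide))) fun d => ?_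
    have h1 := h (m.oldCorner d)
    rwa [extend_oldCorner] at h1
  have hold : ∀ x : TetFlag τ, b (m.old x).corner = 0 := fun x => congrFun hr x.corner
  have hdiff : ∀ i ρ x, m.IsBook ρ x →
      m.newPart b i (ρ 0) (ρ 1) = m.newPart b i (ρ 0) (ρ 2) := by
    intro i ρ x hx
    rcases hi i with rfl | rfl
    · have k := boundaries_le_cycles hb (m.flag (.inr 0) ρ)
      rw [hx.cross_new, old_other, flag_other, m.newPart_zero b, m.newPart_zero b,
        (swap_one_two_apply ρ).1, (swap_one_two_apply ρ).2.1, hold, hold] at k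
      linarith
    · have k := boundaries_le_cycles hb (m.flag (.inr 1) (swap 0 1 * ρ))
      rw [hx.cross_new', old_other, flag_other, mul_assoc, m.newPart_one b, m.newPart_one b,
        (swap_one_two_apply ρ).1, (swap_one_two_apply ρ).2.1, hold, hold] at k
      linarith
  have d3 : ∀ i v w u, (∃ ρ : Perm (Fin 4), ρ 3 = 3 ∧ ρ 0 = v ∧ ρ 1 = w ∧ ρ 2 = u) →
      m.newPart b i v w = 0 → m.newPart b i v u = 0 := by
    rintro i _ _ _ ⟨ρ, h, rfl, rfl, rfl⟩ h0
    rw [← h0, hdiff i ρ _ (Or.inl ⟨h, rfl⟩)]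
  have d2 : ∀ i v w u, (∃ ρ : Perm (Fin 4), ρ 3 = 2 ∧ ρ 0 = v ∧ ρ 1 = w ∧ ρ 2 = u) →
      m.newPart b i v w = 0 → m.newPart b i v u = 0 := by
    rintro i _ _ _ ⟨ρ, h, rfl, rfl, rfl⟩ h0
    rw [← h0, hdiff i ρ _ (Or.inr ⟨h, rfl⟩)]
  -- each vertex of a new tetrahedron has a corner where `b` vanishes, and the others follow
  have hnew : ∀ i v w, v ≠ w → m.newPart b i v w = 0 := by
    intro i
    have a01 := hV i 0 1 (by decide) rfl
    have a10 := hV i 1 0 (by decide) rfl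
    have a21 := hV i 2 1 (by decide) rfl
    have a31 := hV i 3 1 (by decide) rfl
    intro v w hvw
    fin_cases v <;> fin_cases w <;> first | exact absurd rfl hvw | skip
    · exact a01
    · exact d3 i 0 1 2 (by decide) a01
    · exact d2 i 0 1 3 (by decide) a01
    · exact a10
    · exact d3 i 1 0 2 (by decide) a10
    · exact d2 i 1 0 3 (by decide) a10
    · exact d3 i 2 1 0 (by decide) a21
    · exact a21
    · exact hV i 2 3 (by decide) rfl
    · exact d2 i 3 1 0 (by decide) a31
    · exact a31
    · exact hV i 3 2 (by decide) rfl
  ext d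
  rcases m.corner_cases d with ⟨d, rfl⟩ | ⟨i, v, w, hvw, rfl⟩
  · exact congrFun hr d
  · obtain ⟨ρ, rfl, rfl⟩ := exists_perm_of_ne v w hvw
    rw [← corner_flag]
    rcases hi i with rfl | rfl
    · rw [m.newPart_zero b]
      exact hnew _ _ _ (by simp)
    · rw [← swap_mul_self_mul 0 1 ρ, m.newPart_one b]
      exact hnew _ _ _ (by simp)

/-- Essential curves in corresponding homology classes of the two triangulations that differ only
in the new tetrahedra. -/
theorem exists_essential {h : T.H1} {h' : T'.H1} (hh : m.SameClass h h') :
    ∃ (ϖ : T.OrientedCurve) (ϖ' : T'.OrientedCurve), ϖ.Essential ∧ ϖ.homologyClass = h ∧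
      ϖ'.Essential ∧ ϖ'.homologyClass = h' ∧ ϖ'.turning = m.extend ϖ.turning := by
  obtain ⟨c, c', rfl, rfl, hcc⟩ := hh
  obtain ⟨c₀, hc₀, hb, hcoh, hmin⟩ := exists_shortest c.2
  have h1 : ∀ x : TetFlag τ, c₀ x.corner = c₀ (T.cross x).corner ∨
      c₀ x.corner * c₀ x.other.corner ≤ 0 ∧
        c₀ (T.cross x).corner * c₀ (T.cross x).other.corner ≤ 0 :=
    fun x => Or.inr ⟨hcoh _, hcoh _⟩
  have h2 := m.extend_coherent hcoh
  have hc' := m.extend_mem_cycles hc₀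
  refine ⟨signedCurve c₀ hc₀ h1, signedCurve _ hc' h2,
    essential_signedCurve _ _ fun b hb hd _ => hmin b hb hd, ?_,
    essential_signedCurve _ _ fun b hb hd ha => m.eq_zero_of_extend hmin hb hd ha, ?_, ?_⟩
  · rw [OrientedCurve.homologyClass, mk_eq_mk_iff]
    dsimp only
    rwa [turning_signedCurve]
  · rw [OrientedCurve.homologyClass, mk_eq_mk_iff]
    dsimp only
    rw [turning_signedCurve]
    refine m.mem_boundaries_of_restrict (sub_mem hc' c'.2) ?_
    have : m.restrict (m.extend c₀ - c') = c₀ - c := by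
      rw [hcc, ← m.restrict_extend c₀]
      ext d
      rw [restrict_extend]
      simp [restrict_apply, extend_oldCorner]
    rwa [this]
  · rw [turning_signedCurve, turning_signedCurve]

end ZeroTwoMove

/-! ### The edges under the move -/

namespace FacePairing

variable {τ : Type*} {T : FacePairing τ} [Fintype τ]

/-- A triangulation with a generalised angle structure has as many edges as tetrahedra. -/
theorem card_edge {α : τ → Fin 3 → ℝ} (hα : T.IsGeneralisedAngleStructure α) :
    Fintype.card T.Edge = Fintype.card τ := by
  have h1 : ∀ t a, ∑ E, (T.edgeCoeff E t a : ℝ) = 2 := by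
    intro t a
    have h2 := T.sum_mul_edgeCoeff (fun _ => 1) t a
    have h3 : ∀ a, (∑ v : Fin 4, ∑ w : Fin 4,
        if v < w then if quadType v w = a then (1 : ℤ) else 0 else 0) = 2 := by
      decide
    simp only [one_mul, dite_eq_ite] at h2
    rw [h3 a] at h2
    exact_mod_cast h2
  have h4 : ∑ E : T.Edge, 2 * Real.pi = ∑ t : τ, 2 * Real.pi := by
    calc ∑ E : T.Edge, 2 * Real.pi = ∑ E, ∑ t, ∑ a, (T.edgeCoeff E t a : ℝ) * α t a :=
          Finset.sum_congr rfl fun E _ => (hα.edge E).symm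
      _ = ∑ t : τ, 2 * Real.pi := by
          rw [Finset.sum_comm]
          refine Finset.sum_congr rfl fun t _ => ?_
          rw [Finset.sum_comm, ← hα.tetrahedron t]
          simp only [← Finset.sum_mul, h1, Fin.sum_univ_three]
          ring
  rw [Finset.sum_const, Finset.sum_const, nsmul_eq_mul, nsmul_eq_mul, Finset.card_univ,
    Finset.card_univ] at h4
  have h5 := mul_right_cancel₀ (by positivity) h4
  exact_mod_cast h5

end FacePairing

namespace ZeroTwoMove

open FacePairing

variable {τ τ' : Type*} {T : FacePairing τ} {T' : FacePairing τ'} (m : ZeroTwoMove T T')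

/-- The new edge `xy`. -/
def newEdge : T'.Edge := T'.edge (m.cornerAt (.inr 0) 2 3 (by decide))

/-- The edge `uv` of the first new tetrahedron. -/
def edgeOne : T'.Edge := T'.edge (m.cornerAt (.inr 0) 0 1 (by decide))

/-- The edge `uv` of the second new tetrahedron. -/
def edgeTwo : T'.Edge := T'.edge (m.cornerAt (.inr 1) 0 1 (by decide))

theorem edge_cornerAt_symm (s : τ ⊕ Fin 2) {v w : Fin 4} (h : v ≠ w) :
    T'.edge (m.cornerAt s v w h) = T'.edge (m.cornerAt s w v h.symm) :=
  T'.edge_symm _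

theorem cornerAt_of_eq (s : τ ⊕ Fin 2) {ρ : Perm (Fin 4)} {v w : Fin 4} (h : v ≠ w) (h0 : ρ 0 = v)
    (h1 : ρ 1 = w) : m.cornerAt s v w h = (m.flag s ρ).corner := by
  subst h0 h1
  rfl

/-- Except for the two copies of `uv`, corresponding edges of the new tetrahedra are identified.
-/
theorem edge_flag_one {ρ : Perm (Fin 4)} (h1 : ¬ (ρ 0 = 0 ∧ ρ 1 = 1)) (h2 : ¬ (ρ 0 = 1 ∧ ρ 1 = 0)) :
    T'.edge (m.flag (.inr 1) (swap 0 1 * ρ)).corner = T'.edge (m.flag (.inr 0) ρ).corner := by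
  obtain ⟨π, hπ, p0, p1⟩ := exists_perm_of_not_zero_one (ρ 0) (ρ 1) (by simp) h1 h2
  have e0 := m.cornerAt_of_eq (.inr 0) (ρ := π) (by simp) p0 p1
  have e1 := m.cornerAt_of_eq (.inr 1) (ρ := swap 0 1 * π) (v := swap 0 1 (ρ 0))
    (w := swap 0 1 (ρ 1)) (by simp) (by simp [p0]) (by simp [p1])
  rw [corner_flag, corner_flag, e0]
  refine (congrArg T'.edge e1).trans ?_
  rw [← m.cross_new_new hπ, edge_cross]

/-- The edges on the half-book side of the two triangles belong to the first new tetrahedron. -/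
theorem edge_old_of_book {ρ : Perm (Fin 4)} {x : TetFlag τ} (h : m.IsBook ρ x) :
    T'.edge (m.oldCorner x.corner) = T'.edge (m.flag (.inr 0) ρ).corner := by
  rw [← corner_old, ← h.cross_new, edge_cross]

/-- The edges on the other side of the two triangles belong to the second new tetrahedron. -/
theorem edge_old_of_book' {ρ : Perm (Fin 4)} {x : TetFlag τ} (h : m.IsBook ρ x) :
    T'.edge (m.oldCorner (T.cross x).corner) =
      T'.edge (m.flag (.inr 1) (swap 0 1 * ρ)).corner := by
  rw [← corner_old, ← h.cross_new', edge_cross]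

theorem isBook_one : m.IsBook 1 m.start := Or.inl ⟨rfl, by simp [TetFlag.reorder]⟩

theorem edge_old_start : T'.edge (m.oldCorner m.start.corner) = m.edgeOne :=
  m.edge_old_of_book m.isBook_one

/-- The only old edge that is divided by the move is `uv`. -/
theorem edge_old_eq {d d' : Corner τ} (h : T.edge d = T.edge d') :
    T'.edge (m.oldCorner d) = T'.edge (m.oldCorner d') ∨
      (T'.edge (m.oldCorner d) = m.edgeOne ∨ T'.edge (m.oldCorner d) = m.edgeTwo) ∧
      (T'.edge (m.oldCorner d') = m.edgeOne ∨ T'.edge (m.oldCorner d') = m.edgeTwo) := by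
  have hcross : ∀ x : TetFlag τ, T'.edge (m.oldCorner x.corner) =
      T'.edge (m.oldCorner (T.cross x).corner) ∨
      (T'.edge (m.oldCorner x.corner) = m.edgeOne ∨
        T'.edge (m.oldCorner x.corner) = m.edgeTwo) ∧
      (T'.edge (m.oldCorner (T.cross x).corner) = m.edgeOne ∨
        T'.edge (m.oldCorner (T.cross x).corner) = m.edgeTwo) := by
    refine m.cross_old_ind (P := fun x y => T'.edge (m.oldCorner x.corner) =
      T'.edge (m.oldCorner y.corner) ∨
      (T'.edge (m.oldCorner x.corner) = m.edgeOne ∨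
        T'.edge (m.oldCorner x.corner) = m.edgeTwo) ∧
      (T'.edge (m.oldCorner y.corner) = m.edgeOne ∨
        T'.edge (m.oldCorner y.corner) = m.edgeTwo)) ?_ ?_ ?_
    · rintro x y (h | ⟨h, h'⟩)
      · exact Or.inl h.symm
      · exact Or.inr ⟨h', h⟩
    · intro x hx
      left
      rw [← corner_old, ← corner_old, ← hx, edge_cross]
    · intro ρ x hx
      rw [m.edge_old_of_book hx, m.edge_old_of_book' hx]
      by_cases c1 : ρ 0 = 0 ∧ ρ 1 = 1
      · right
        refine ⟨Or.inl (congrArg _ (m.cornerAt_of_eq _ _ c1.1 c1.2).symm), Or.inr ?_⟩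
        rw [edgeTwo, edge_cornerAt_symm]
        exact congrArg _ (m.cornerAt_of_eq _ _ (by simp [c1.1]) (by simp [c1.2])).symm
      by_cases c2 : ρ 0 = 1 ∧ ρ 1 = 0
      · right
        refine ⟨Or.inl ?_, Or.inr ?_⟩
        · rw [edgeOne, edge_cornerAt_symm]
          exact congrArg _ (m.cornerAt_of_eq _ _ c2.1 c2.2).symm
        · exact congrArg _ (m.cornerAt_of_eq _ _ (by simp [c2.1]) (by simp [c2.2])).symm
      · exact Or.inl (m.edge_flag_one c1 c2).symm
  have h1 := Quot.eqvGen_exact h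
  clear h
  induction h1 with
  | rel a b h =>
    obtain ⟨x, rfl, rfl | rfl⟩ := h
    · exact hcross x
    · left
      rw [← rev_corner]
      exact (T'.edge_rev _).symm
  | refl a => exact Or.inl rfl
  | symm a b _ ih =>
    rcases ih with h | ⟨h, h'⟩
    · exact Or.inl h.symm
    · exact Or.inr ⟨h', h⟩
  | trans a b c _ _ ih1 ih2 =>
    rcases ih1 with h | ⟨h, h'⟩
    · rwa [h]
    · rcases ih2 with k | ⟨k, k'⟩
      · rw [← k]
        exact Or.inr ⟨h, h'⟩
      · exact Or.inr ⟨h, k'⟩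

theorem exists_perm_book : ∀ v w : Fin 4, v ≠ w → ¬ (v = 2 ∧ w = 3) → ¬ (v = 3 ∧ w = 2) →
    ∃ ρ : Perm (Fin 4), (ρ 3 = 3 ∨ ρ 3 = 2) ∧ ρ 0 = v ∧ ρ 1 = w := by
  decide

theorem exists_book {ρ : Perm (Fin 4)} (h : ρ 3 = 3 ∨ ρ 3 = 2) : ∃ x, m.IsBook ρ x := by
  rcases h with h | h
  · exact ⟨_, Or.inl ⟨h, rfl⟩⟩
  · exact ⟨_, Or.inr ⟨h, rfl⟩⟩

/-- Every edge of the first new tetrahedron but `xy` is an old one. -/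
theorem exists_edge_cornerAt_old {v w : Fin 4} (h : v ≠ w) (h1 : ¬ (v = 2 ∧ w = 3))
    (h2 : ¬ (v = 3 ∧ w = 2)) :
    ∃ d, T'.edge (m.cornerAt (.inr 0) v w h) = T'.edge (m.oldCorner d) := by
  obtain ⟨ρ, hρ, rfl, rfl⟩ := exists_perm_book v w h h1 h2
  obtain ⟨x, hx⟩ := m.exists_book hρ
  exact ⟨_, (m.edge_old_of_book hx).symm⟩

/-- Every edge of the new triangulation is `xy` or an old one. -/
theorem exists_edge_old (E : T'.Edge) : E = m.newEdge ∨ ∃ d, E = T'.edge (m.oldCorner d) := by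
  obtain ⟨d, rfl⟩ := Quot.exists_rep E
  change T'.edge d = _ ∨ ∃ d₀, T'.edge d = _
  rcases m.corner_cases d with ⟨d, rfl⟩ | ⟨i, v, w, hvw, rfl⟩
  · exact Or.inr ⟨d, rfl⟩
  obtain ⟨ρ, hρ⟩ : ∃ ρ, m.cornerAt (.inr i) v w hvw =
      (m.flag (.inr i) (if i = 0 then ρ else swap 0 1 * ρ)).corner := by
    obtain ⟨ρ, rfl, rfl⟩ := exists_perm_of_ne v w hvw
    refine ⟨if i = 0 then ρ else swap 0 1 * ρ, ?_⟩
    split_ifs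
    · rfl
    · rw [swap_mul_self_mul]
      rfl
  rw [hρ]
  have hi : i = 0 ∨ i = 1 := by omega
  by_cases c1 : (ρ 0 = 2 ∧ ρ 1 = 3) ∨ (ρ 0 = 3 ∧ ρ 1 = 2)
  · left
    have h0 : T'.edge (m.flag (.inr 0) ρ).corner = m.newEdge := by
      rcases c1 with ⟨h, h'⟩ | ⟨h, h'⟩
      · exact congrArg _ (m.cornerAt_of_eq _ _ h h').symm
      · rw [newEdge, edge_cornerAt_symm]
        exact congrArg _ (m.cornerAt_of_eq _ _ h h').symm
    rcases hi with rfl | rfl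
    · exact h0
    · rw [if_neg (by decide), m.edge_flag_one (by omega) (by omega), h0]
  · right
    obtain ⟨π, hπ, p0, p1⟩ := exists_perm_book (ρ 0) (ρ 1) (by simp) (by tauto) (by tauto)
    obtain ⟨x, hx⟩ := m.exists_book hπ
    rcases hi with rfl | rfl
    · refine ⟨x.corner, ?_⟩
      rw [m.edge_old_of_book hx, if_pos rfl, corner_flag, m.cornerAt_of_eq _ _ p0 p1]
    · refine ⟨(T.cross x).corner, ?_⟩
      rw [m.edge_old_of_book' hx, if_neg (by decide), corner_flag,
        m.cornerAt_of_eq (.inr 1) (ρ := swap 0 1 * π) _ (by simp [p0]) (by simp [p1])]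

variable [Fintype τ] [Fintype τ']

/-- The edges of the new triangulation: the old ones, `xy`, and the second copy of `uv`. -/
theorem exists_edgeEquiv (hα : T.HasIndexStructure) (hα' : T'.HasIndexStructure) :
    ∃ s : T.Edge ⊕ Fin 2 ≃ T'.Edge, s (.inl (T.edge m.start.corner)) = m.edgeOne ∧
      s (.inr 0) = m.newEdge ∧ s (.inr 1) = m.edgeTwo ∧
      ∀ d, T'.edge (m.oldCorner d) = s (.inl (T.edge d)) ∨
        T.edge d = T.edge m.start.corner ∧ T'.edge (m.oldCorner d) = m.edgeTwo := by
  -- representatives of the old edges, `start` for the edge `uv`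
  have hr : ∀ E, ∃ d, T.edge d = E ∧ (E = T.edge m.start.corner → d = m.start.corner) := by
    intro E
    by_cases h : E = T.edge m.start.corner
    · exact ⟨m.start.corner, h.symm, fun _ => rfl⟩
    · obtain ⟨d, rfl⟩ := Quot.exists_rep E
      exact ⟨d, rfl, fun h' => absurd h' h⟩
  choose r hr hr' using hr
  let f : T.Edge ⊕ Fin 2 → T'.Edge :=
    Sum.elim (fun E => T'.edge (m.oldCorner (r E))) ![m.newEdge, m.edgeTwo]
  have hstart : f (.inl (T.edge m.start.corner)) = m.edgeOne := by
    change T'.edge (m.oldCorner (r (T.edge m.start.corner))) = _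
    rw [hr' _ rfl, edge_old_start]
  have hsurj : Function.Surjective f := by
    intro E
    rcases m.exists_edge_old E with rfl | ⟨d, rfl⟩
    · exact ⟨.inr 0, rfl⟩
    · rcases m.edge_old_eq (hr (T.edge d)).symm with h | ⟨h | h, -⟩
      · exact ⟨.inl (T.edge d), h.symm⟩
      · exact ⟨_, hstart.trans h.symm⟩
      · exact ⟨.inr 1, h.symm⟩
  -- the number of edges grows by two, as the number of tetrahedra does
  have hbij : Function.Bijective f := by
    rw [Fintype.bijective_iff_surjective_and_card]
    refine ⟨hsurj, ?_⟩
    obtain ⟨α, hα⟩ := hα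
    obtain ⟨α', hα'⟩ := hα'
    rw [card_edge (hα' fun _ => 0).1, Fintype.card_sum, card_edge (hα fun _ => 0).1,
      ← Fintype.card_congr m.tet, Fintype.card_sum]
  refine ⟨Equiv.ofBijective f hbij, hstart, rfl, rfl, fun d => ?_⟩
  rcases m.edge_old_eq (hr (T.edge d)).symm with h | ⟨h, h'⟩
  · exact Or.inl h
  · have h1 : f (.inl (T.edge d)) = m.edgeOne := by
      rcases h' with h' | h'
      · exact h'
      · have h2 : f (.inl (T.edge d)) = f (.inr 1) := h'
        exact absurd (hbij.1 h2) Sum.inl_ne_inr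
    rcases h with h | h
    · exact Or.inl (h.trans h1.symm)
    · exact Or.inr ⟨Sum.inl_injective (hbij.1 (h1.trans hstart.symm)), h⟩

end ZeroTwoMove

/-! ### The sum over the new edge -/

namespace ZeroTwoMove

open FacePairing

variable {τ τ' : Type*} {T : FacePairing τ} {T' : FacePairing τ'} (m : ZeroTwoMove T T')

/-- The labels on the edges of a tetrahedron of the new triangulation, with the labelling of the
vertices used for the move. -/
def moveLabel (c : Corner τ' → ℤ) (k : T'.Edge → ℤ) (s : τ ⊕ Fin 2) (v w : Fin 4) : ℤ :=
  T'.edgeLabel c k (m.tet s) (m.lab s v) (m.lab s w)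

theorem tetSym_moveLabel (c : Corner τ' → ℤ) (k : T'.Edge → ℤ) (s : τ ⊕ Fin 2) :
    TetIndex.tetSym (T'.edgeLabel c k (m.tet s)) = TetIndex.tetSym (m.moveLabel c k s) :=
  (TetIndex.tetSym_comp (T'.edgeLabel_symm c k (m.tet s)) (m.lab s)).symm

theorem moveLabel_eq (c : Corner τ' → ℤ) (k : T'.Edge → ℤ) (s : τ ⊕ Fin 2) {v w : Fin 4}
    (h : v ≠ w) : m.moveLabel c k s v w = c (m.cornerAt s v w h) + c (m.cornerAt s w v h.symm) +
      k (T'.edge (m.cornerAt s v w h)) := by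
  rw [moveLabel, edgeLabel, dif_pos (by simpa using h)]
  rfl

/-- The labels in the old tetrahedra, of functions that agree on the old edges. -/
theorem moveLabel_old (c : Corner τ → ℤ) {k' : T'.Edge → ℤ} {k : T.Edge → ℤ}
    (h : ∀ d, k' (T'.edge (m.oldCorner d)) = k (T.edge d)) (t : τ) :
    m.moveLabel (m.extend c) k' (.inl t) = T.edgeLabel c k t := by
  ext v w
  by_cases hvw : v = w
  · simp [moveLabel, edgeLabel, hvw]
  · rw [m.moveLabel_eq _ _ _ hvw, edgeLabel, dif_pos hvw]
    have h1 := m.extend_oldCorner c ⟨(t, v, w), hvw⟩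
    have h2 := m.extend_oldCorner c ⟨(t, w, v), fun e => hvw e.symm⟩
    have h3 := h ⟨(t, v, w), hvw⟩
    simp only [oldCorner] at h1 h2 h3
    rw [h1, h2, h3]

theorem moveLabel_one_zero (c : Corner τ → ℤ) (k : T'.Edge → ℤ) :
    m.moveLabel (m.extend c) k (.inr 0) 0 1 = k m.edgeOne := by
  rw [m.moveLabel_eq _ _ _ (by decide), extend, glueCorner_new, glueCorner_new]
  simp [twin, newVal, edgeOne]

theorem moveLabel_one_new (c : Corner τ → ℤ) (k : T'.Edge → ℤ) :
    m.moveLabel (m.extend c) k (.inr 0) 2 3 = k m.newEdge := by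
  rw [m.moveLabel_eq _ _ _ (by decide), extend, glueCorner_new, glueCorner_new]
  simp [twin, newVal, newEdge]

theorem moveLabel_two_zero (c : Corner τ → ℤ) (k : T'.Edge → ℤ) :
    m.moveLabel (m.extend c) k (.inr 1) 0 1 = k m.edgeTwo := by
  rw [m.moveLabel_eq _ _ _ (by decide), extend, glueCorner_new, glueCorner_new]
  simp [twin, newVal, edgeTwo]

/-- The labels of the two new tetrahedra agree except at the two copies of `uv`. -/
theorem moveLabel_two (c : Corner τ → ℤ) (k : T'.Edge → ℤ) {v w : Fin 4} (hvw : v ≠ w)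
    (h1 : ¬ (v = 0 ∧ w = 1)) (h2 : ¬ (v = 1 ∧ w = 0)) :
    m.moveLabel (m.extend c) k (.inr 1) (swap 0 1 v) (swap 0 1 w) =
      m.moveLabel (m.extend c) k (.inr 0) v w := by
  rw [m.moveLabel_eq _ _ _ (by simpa using hvw), m.moveLabel_eq _ _ _ hvw, extend, glueCorner_new,
    glueCorner_new, glueCorner_new, glueCorner_new]
  obtain ⟨ρ, rfl, rfl⟩ := exists_perm_of_ne v w hvw
  have := congrArg k (m.edge_flag_one h1 h2)
  simp only [corner_flag, Perm.mul_apply] at this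
  rw [this]
  simp [twin]

variable [Fintype τ] [Fintype τ']

/-- The sum over the values at the new edge. -/
theorem hasLaurentSum_latticeTerm {s : T.Edge ⊕ Fin 2 ≃ T'.Edge}
    (hs₁ : s (.inl (T.edge m.start.corner)) = m.edgeOne) (hs : s (.inr 0) = m.newEdge)
    (hs₂ : s (.inr 1) = m.edgeTwo)
    (hold : ∀ d, T'.edge (m.oldCorner d) = s (.inl (T.edge d)) ∨
        T.edge d = T.edge m.start.corner ∧ T'.edge (m.oldCorner d) = m.edgeTwo)
    (c : Corner τ → ℤ) (k : T'.Edge → ℤ) :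
    TetIndex.HasLaurentSum
      (fun n : ℤ => T'.latticeTerm (m.extend c) (k + n • Pi.single m.newEdge 1))
      (if k m.edgeOne = k m.edgeTwo then T.latticeTerm c (fun E => k (s (.inl E))) else 0) := by
  set κ : ℤ → T'.Edge → ℤ := fun n => k + n • Pi.single m.newEdge 1 with hκ
  have hκ0 : ∀ n E, E ≠ m.newEdge → κ n E = k E := by
    intro n E hE
    simp [hκ, Pi.single_eq_of_ne hE]
  have hκ1 : ∀ n, κ n m.newEdge = k m.newEdge + n := by
    intro n
    simp [hκ]
  have hne₁ : m.edgeOne ≠ m.newEdge := by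
    rw [← hs₁, ← hs]
    exact s.injective.ne Sum.inl_ne_inr
  have hne₂ : m.edgeTwo ≠ m.newEdge := by
    rw [← hs₂, ← hs]
    exact s.injective.ne (by simp)
  have hne : ∀ d, T'.edge (m.oldCorner d) ≠ m.newEdge := by
    intro d
    rcases hold d with h | ⟨-, h⟩ <;> rw [h]
    · rw [← hs]
      exact s.injective.ne Sum.inl_ne_inr
    · exact hne₂
  have hnew : ∀ n v w, v ≠ w → ¬ (v = 2 ∧ w = 3) → ¬ (v = 3 ∧ w = 2) →
      m.moveLabel (m.extend c) (κ n) (.inr 0) v w = m.moveLabel (m.extend c) k (.inr 0) v w := by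
    intro n v w hvw h1 h2
    obtain ⟨d, hd⟩ := m.exists_edge_cornerAt_old hvw h1 h2
    rw [m.moveLabel_eq _ _ _ hvw, m.moveLabel_eq _ _ _ hvw, hd, hκ0 _ _ (hne d)]
  set f := m.moveLabel (m.extend c) k (.inr 0) with hf
  set B := f 0 2 + f 1 3 with hB
  set C := f 0 3 + f 1 2 with hC
  -- only the first opposite sums of the new tetrahedra involve `xy`; the others agree, up to exchange
  have hsym₁ : ∀ n, TetIndex.tetSym (m.moveLabel (m.extend c) (κ n) (.inr 0)) =
      TetIndex.symIndex (k m.edgeOne + (k m.newEdge + n)) B C := by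
    intro n
    simp only [TetIndex.tetSym, oppSum, Matrix.cons_val]
    rw [moveLabel_one_zero, moveLabel_one_new, hκ0 _ _ hne₁, hκ1, hnew _ _ _ (by decide) (by decide)
      (by decide), hnew _ _ _ (by decide) (by decide) (by decide), hnew _ _ _ (by decide) (by decide)
      (by decide), hnew _ _ _ (by decide) (by decide) (by decide)]
  have hsym₂ : ∀ n, TetIndex.tetSym (m.moveLabel (m.extend c) (κ n) (.inr 1)) =
      TetIndex.symIndex (k m.edgeTwo + (k m.newEdge + n)) B C := by
    intro n
    have e : ∀ v w v' w', swap 0 1 v = v' → swap 0 1 w = w' → v ≠ w → ¬ (v = 0 ∧ w = 1) →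
        ¬ (v = 1 ∧ w = 0) → m.moveLabel (m.extend c) (κ n) (.inr 1) v' w' =
        m.moveLabel (m.extend c) (κ n) (.inr 0) v w := by
      rintro v w _ _ rfl rfl hvw h1 h2
      exact m.moveLabel_two c (κ n) hvw h1 h2
    simp only [TetIndex.tetSym, oppSum, Matrix.cons_val]
    rw [moveLabel_two_zero, e 2 3 2 3 (by decide) (by decide) (by decide) (by decide) (by decide),
      e 1 2 0 2 (by decide) (by decide) (by decide) (by decide) (by decide),
      e 0 3 1 3 (by decide) (by decide) (by decide) (by decide) (by decide),
      e 1 3 0 3 (by decide) (by decide) (by decide) (by decide) (by decide),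
      e 0 2 1 2 (by decide) (by decide) (by decide) (by decide) (by decide),
      moveLabel_one_new, hκ0 _ _ hne₂, hκ1, hnew _ _ _ (by decide) (by decide)
      (by decide), hnew _ _ _ (by decide) (by decide) (by decide), hnew _ _ _ (by decide) (by decide)
      (by decide), hnew _ _ _ (by decide) (by decide) (by decide), TetIndex.symIndex_swap₂₃,
      add_comm (f 1 2), add_comm (f 1 3)]
  have hsum : ∀ n, ∑ E, κ n E = ∑ E, k (s (.inl E)) + (k m.newEdge + n) + k m.edgeTwo := by
    intro n
    rw [← Equiv.sum_comp s, Fintype.sum_sum_type, Fin.sum_univ_two, hs, hs₂, hκ1, hκ0 _ _ hne₂,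
      ← add_assoc]
    congr 3
    ext E
    exact hκ0 _ _ (by rw [← hs]; exact s.injective.ne Sum.inl_ne_inr)
  have hprod : ∀ n, ∏ t, TetIndex.tetSym (m.moveLabel (m.extend c) (κ n) (.inl t)) =
      ∏ t, TetIndex.tetSym (m.moveLabel (m.extend c) k (.inl t)) := by
    intro n
    refine Finset.prod_congr rfl fun t _ => congrArg _ ?_
    ext v w
    by_cases hvw : v = w
    · simp [moveLabel, edgeLabel, hvw]
    · rw [m.moveLabel_eq _ _ _ hvw, m.moveLabel_eq _ _ _ hvw, hκ0]
      exact hne ⟨(t, v, w), hvw⟩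
  set d := k m.edgeTwo - k m.edgeOne with hd
  set G := ∏ t, TetIndex.tetSym (m.moveLabel (m.extend c) k (.inl t)) with hG
  -- the quadratic identity, shifted
  have key := ((TetIndex.hasLaurentSum_symIndex_mul_symIndex d B C).comp_equiv
    (Equiv.addLeft (k m.edgeOne + k m.newEdge))).const_mul
      (TetIndex.negSqrtQPow (2 * (∑ E, k (s (.inl E)) + d)) * G)
  have hval : TetIndex.negSqrtQPow (2 * (∑ E, k (s (.inl E)) + d)) * G * (if d = 0 then 1 else 0) =
      if k m.edgeOne = k m.edgeTwo then T.latticeTerm c (fun E => k (s (.inl E))) else 0 := by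
    by_cases h : k m.edgeOne = k m.edgeTwo
    · have hd0 : d = 0 := by rw [hd, h, sub_self]
      rw [if_pos h, if_pos hd0, hd0, mul_one, add_zero, latticeTerm, hG]
      congr 1
      refine Finset.prod_congr rfl fun t _ => congrArg _ (m.moveLabel_old c (fun e => ?_) t)
      rcases hold e with h1 | ⟨h1, h2⟩
      · rw [h1]
      · rw [h2, h1, hs₁, h]
    · rw [if_neg h, if_neg (by rw [hd, sub_eq_zero]; exact fun e => h e.symm), mul_zero]
  rw [← hval]
  refine key.congr fun n => ?_
  change _ = T'.latticeTerm (m.extend c) (κ n)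
  rw [latticeTerm, ← Equiv.prod_comp m.tet, Fintype.prod_sum_type, Fin.prod_univ_two]
  simp only [tetSym_moveLabel]
  rw [hsym₁, hsym₂, hprod, hsum, Equiv.coe_addLeft]
  dsimp only
  have e1 : k m.edgeOne + k m.newEdge + n + d = k m.edgeTwo + (k m.newEdge + n) := by
    rw [hd]
    ring
  have e2 : 2 * (∑ E, k (s (.inl E)) + (k m.newEdge + n) + k m.edgeTwo) =
      2 * (∑ E, k (s (.inl E)) + d) + 2 * (k m.edgeOne + k m.newEdge + n) := by
    rw [hd]
    ring
  rw [e1, e2, TetIndex.negSqrtQPow_add, add_assoc (k m.edgeOne)]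
  ring

end ZeroTwoMove

/-! ### Equality of the indices -/

namespace FacePairing

variable {τ : Type*} {T : FacePairing τ}

/-- The condition of equal opposite sums does not depend on the order of the vertices. -/
theorem oppSum_flat_comp_iff {f : Fin 4 → Fin 4 → ℤ} (hf : ∀ v w, f v w = f w v)
    (π : Perm (Fin 4)) :
    (∀ a, oppSum (fun v w => f (π v) (π w)) a = oppSum (fun v w => f (π v) (π w)) 0) ↔
      ∀ a, oppSum f a = oppSum f 0 := by
  have key : ∀ {f : Fin 4 → Fin 4 → ℤ}, (∀ v w, f v w = f w v) → ∀ π : Perm (Fin 4),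
      (∀ a, oppSum f a = oppSum f 0) →
      ∀ a, oppSum (fun v w => f (π v) (π w)) a = oppSum (fun v w => f (π v) (π w)) 0 := by
    intro f hf π h
    obtain ⟨g, hg⟩ := exists_vertex_function hf h
    exact oppSum_flat_of_vertex_function fun v w hvw => hg (π v) (π w) (π.injective.ne hvw)
  refine ⟨fun h => ?_, key hf π⟩
  have := key (f := fun v w => f (π v) (π w)) (fun v w => hf _ _) π⁻¹ h
  simpa using this

theorem cusp_rotate_iterate (T : FacePairing τ) (x : TetFlag τ) (n : ℕ) :
    T.cusp (triangle (T.rotate^[n] x).corner) = T.cusp (triangle x.corner) := by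
  induction n with
  | zero => rfl
  | succ n ih => rw [Function.iterate_succ_apply', rotate, cusp_cross,
      TetFlag.corner_reorder, ih]

theorem cusp_rev_rotate_iterate (T : FacePairing τ) (x : TetFlag τ) (n : ℕ) :
    T.cusp (triangle (rev (T.rotate^[n] x).corner)) = T.cusp (triangle (rev x.corner)) := by
  induction n with
  | zero => rfl
  | succ n ih => rw [Function.iterate_succ_apply', rotate, ← cross_rev, cusp_cross, ← rev_corner,
      TetFlag.corner_reorder, ih]

end FacePairing

namespace ZeroTwoMove

open FacePairing

variable {τ τ' : Type*} {T : FacePairing τ} {T' : FacePairing τ'} (m : ZeroTwoMove T T')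

theorem moveLabel_zero_eq (k : T'.Edge → ℤ) (s : τ ⊕ Fin 2) {v w : Fin 4} (h : v ≠ w) :
    m.moveLabel 0 k s v w = k (T'.edge (m.cornerAt s v w h)) := by
  rw [moveLabel_eq _ _ _ _ h]
  simp

theorem moveLabel_zero_old {k' : T'.Edge → ℤ} {k : T.Edge → ℤ}
    (h : ∀ d, k' (T'.edge (m.oldCorner d)) = k (T.edge d)) (t : τ) :
    m.moveLabel 0 k' (.inl t) = T.edgeLabel 0 k t := by
  ext v w
  by_cases hvw : v = w
  · simp [moveLabel, edgeLabel, hvw]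
  · rw [m.moveLabel_zero_eq _ _ hvw, T.edgeLabel_zero _ _ hvw]
    exact h ⟨(t, v, w), hvw⟩

variable [Fintype τ']

theorem mem_flatLattice_iff_moveLabel (k : T'.Edge → ℤ) : k ∈ T'.flatLattice ↔
    ∀ s a, oppSum (m.moveLabel 0 k s) a = oppSum (m.moveLabel 0 k s) 0 := by
  rw [mem_flatLattice_iff_oppSum]
  refine m.tet.surjective.forall.trans (forall_congr' fun s => ?_)
  exact (oppSum_flat_comp_iff (T'.edgeLabel_symm 0 k (m.tet s)) (m.lab s)).symm

variable [Fintype τ]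

/-- An edge function of the new triangulation does not change the summands of its index, up to its
value at the new edge, if it comes from such a function on the old triangulation. -/
theorem exists_add_single_mem_flatLattice {k' : T'.Edge → ℤ} {k : T.Edge → ℤ}
    (h : ∀ d, k' (T'.edge (m.oldCorner d)) = k (T.edge d))
    (hne : ∀ d, T'.edge (m.oldCorner d) ≠ m.newEdge) (hk : k ∈ T.flatLattice) :
    ∃ n : ℤ, k' + n • Pi.single m.newEdge 1 ∈ T'.flatLattice := by
  obtain ⟨F, hF⟩ := (mem_flatLattice_iff_cusp k).1 hk
  -- the values of `F` at the vertices of the new tetrahedra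
  let g : Fin 4 → ℤ := ![F (T.cusp (m.start.1, m.start.2 0)), F (T.cusp (m.start.1, m.start.2 1)),
    F (T.cusp (m.start.1, m.start.2 2)), F (T.cusp (m.last.1, m.last.2 3))]
  have h0 : F (T.cusp (m.last.1, m.last.2 0)) = g 0 :=
    congrArg F (T.cusp_rotate_iterate m.start m.len)
  have h1 : F (T.cusp (m.last.1, m.last.2 1)) = g 1 :=
    congrArg F (T.cusp_rev_rotate_iterate m.start m.len)
  have hg : ∀ ρ x, m.IsBook ρ x → 2 * k (T.edge x.corner) = g (ρ 0) + g (ρ 1) := by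
    rintro ρ x (⟨h, rfl⟩ | ⟨h, rfl⟩)
    · refine (hF _).trans ?_
      change F (T.cusp (m.start.1, m.start.2 (ρ 0))) + F (T.cusp (m.start.1, m.start.2 (ρ 1))) = _
      rcases perm_three_eq_three ρ h with h | h | h | h | h | h <;> obtain ⟨h0, h1, h2⟩ := h <;>
        simp [g, h0, h1]
    · refine (hF _).trans ?_
      change F (T.cusp (m.last.1, m.last.2 (ρ 0))) + F (T.cusp (m.last.1, m.last.2 (ρ 1))) = _
      have h3 : F (T.cusp (m.last.1, m.last.2 3)) = g 3 := rfl
      rcases perm_three_eq_two ρ h with h | h | h | h | h | h <;> obtain ⟨e0, e1, e2⟩ := h <;>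
        rw [e0, e1] <;> simp only [h0, h1, h3]
  have hpair : ∀ v w, v ≠ w → ¬ (v = 2 ∧ w = 3) → ¬ (v = 3 ∧ w = 2) → ∃ n : ℤ, 2 * n = g v + g w := by
    intro v w hvw c1 c2
    obtain ⟨ρ, hρ, rfl, rfl⟩ := exists_perm_book v w hvw c1 c2
    obtain ⟨x, hx⟩ := m.exists_book hρ
    exact ⟨_, hg ρ x hx⟩
  obtain ⟨p, hp⟩ := hpair 0 2 (by decide) (by decide) (by decide)
  obtain ⟨q, hq⟩ := hpair 1 3 (by decide) (by decide) (by decide)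
  obtain ⟨r, hr⟩ := hpair 0 1 (by decide) (by decide) (by decide)
  refine ⟨p + q - r - k' m.newEdge, (m.mem_flatLattice_iff_moveLabel _).2 ?_⟩
  set κ := k' + (p + q - r - k' m.newEdge) • Pi.single m.newEdge (1 : ℤ) with hκ
  have hκ1 : 2 * κ m.newEdge = g 2 + g 3 := by
    have : κ m.newEdge = p + q - r := by simp [hκ]
    rw [this]
    linarith
  have hκ0 : ∀ d, κ (T'.edge (m.oldCorner d)) = k (T.edge d) := by
    intro d
    simp [hκ, Pi.single_eq_of_ne (hne d), h]
  have hnew0 : ∀ ρ : Perm (Fin 4), 2 * κ (T'.edge (m.flag (.inr 0) ρ).corner) =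
      g (ρ 0) + g (ρ 1) := by
    intro ρ
    by_cases c1 : ρ 0 = 2 ∧ ρ 1 = 3
    · rw [c1.1, c1.2, ← hκ1, newEdge, m.cornerAt_of_eq _ _ c1.1 c1.2]
    by_cases c2 : ρ 0 = 3 ∧ ρ 1 = 2
    · rw [c2.1, c2.2, add_comm, ← hκ1, newEdge, edge_cornerAt_symm, m.cornerAt_of_eq _ _ c2.1 c2.2]
    obtain ⟨π, hπ, p0, p1⟩ := exists_perm_book (ρ 0) (ρ 1) (by simp) c1 c2
    obtain ⟨x, hx⟩ := m.exists_book hπ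
    rw [corner_flag, m.cornerAt_of_eq _ _ p0 p1, ← m.edge_old_of_book hx, hκ0, hg π x hx, p0, p1]
  have hnew1 : ∀ ρ : Perm (Fin 4), 2 * κ (T'.edge (m.flag (.inr 1) (swap 0 1 * ρ)).corner) =
      g (ρ 0) + g (ρ 1) := by
    intro ρ
    by_cases c1 : (ρ 0 = 2 ∧ ρ 1 = 3) ∨ (ρ 0 = 3 ∧ ρ 1 = 2)
    · rw [m.edge_flag_one (by omega) (by omega), hnew0]
    obtain ⟨π, hπ, p0, p1⟩ := exists_perm_book (ρ 0) (ρ 1) (by simp) (by tauto) (by tauto)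
    obtain ⟨x, hx⟩ := m.exists_book hπ
    rw [corner_flag, m.cornerAt_of_eq (.inr 1) (ρ := swap 0 1 * π) _ (by simp [p0]) (by simp [p1]),
      ← m.edge_old_of_book' hx, hκ0, edge_cross, hg π x hx, p0, p1]
  rintro (t | i)
  · rw [m.moveLabel_zero_old hκ0]
    exact (mem_flatLattice_iff_oppSum k).1 hk t
  · have hi : i = 0 ∨ i = 1 := by omega
    rcases hi with rfl | rfl
    · refine oppSum_flat_of_vertex_function (f := g) fun v w hvw => ?_
      obtain ⟨ρ, rfl, rfl⟩ := exists_perm_of_ne v w hvw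
      rw [m.moveLabel_zero_eq _ _ hvw]
      exact hnew0 ρ
    · refine oppSum_flat_of_vertex_function (f := fun v => g (swap 0 1 v)) fun v w hvw => ?_
      obtain ⟨ρ, rfl, rfl⟩ := exists_perm_of_ne v w hvw
      rw [m.moveLabel_zero_eq _ _ hvw]
      have := hnew1 (swap 0 1 * ρ)
      rw [swap_mul_self_mul] at this
      exact this

/-- An edge function that extends to the flat lattice of the new triangulation was in the old one.
-/
theorem mem_flatLattice_of_extension {k' : T'.Edge → ℤ} {k : T.Edge → ℤ}
    (h : ∀ d, k' (T'.edge (m.oldCorner d)) = k (T.edge d)) (hk : k' ∈ T'.flatLattice) :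
    k ∈ T.flatLattice := by
  rw [mem_flatLattice_iff_oppSum]
  intro t
  rw [← m.moveLabel_zero_old h]
  exact (m.mem_flatLattice_iff_moveLabel _).1 hk _

/-- The indices of the two triangulations agree. -/
theorem hasLaurentSum_quotTerm (hα : T.HasIndexStructure) (hα' : T'.HasIndexStructure)
    (c : Corner τ → ℤ) {I : LaurentSeries ℤ}
    (hI : TetIndex.HasLaurentSum (T'.quotTerm (m.extend c)) I) :
    TetIndex.HasLaurentSum (T.quotTerm c) I := by
  obtain ⟨s, hs₁, hs, hs₂, hold⟩ := m.exists_edgeEquiv hα hα'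
  have hne : ∀ d, T'.edge (m.oldCorner d) ≠ m.newEdge := by
    intro d
    rw [← hs]
    rcases hold d with h | ⟨-, h⟩ <;> rw [h]
    · exact s.injective.ne Sum.inl_ne_inr
    · rw [← hs₂]
      exact s.injective.ne (by simp)
  set δ : T'.EdgeLattice := ((Pi.single m.newEdge 1 : T'.Edge → ℤ) : T'.EdgeLattice) with hδ
  have hmk : ∀ (k : T'.Edge → ℤ) (n : ℤ), (k : T'.EdgeLattice) + n • δ =
      ((k + n • Pi.single m.newEdge 1 : T'.Edge → ℤ) : T'.EdgeLattice) := fun k n => rfl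
  -- in the first new tetrahedron only one of the opposite sums involves `xy`, so that no multiple of
  -- its indicator function is flat
  have hδn : ∀ n : ℤ, n • δ = 0 → n = 0 := by
    intro n hn
    have h1 := (QuotientAddGroup.eq_zero_iff (n • (Pi.single m.newEdge 1 : T'.Edge → ℤ))).1 hn
    have h2 := (m.mem_flatLattice_iff_moveLabel _).1 h1 (.inr 0) 1
    have h3 : ∀ v w, v ≠ w → ¬ (v = 2 ∧ w = 3) → ¬ (v = 3 ∧ w = 2) →
        m.moveLabel 0 (n • (Pi.single m.newEdge 1 : T'.Edge → ℤ)) (.inr 0) v w = 0 := by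
      intro v w hvw c1 c2
      obtain ⟨d, hd⟩ := m.exists_edge_cornerAt_old hvw c1 c2
      rw [m.moveLabel_zero_eq _ _ hvw, hd]
      simp [Pi.single_eq_of_ne (hne d)]
    have h4 : m.moveLabel 0 (n • (Pi.single m.newEdge 1 : T'.Edge → ℤ)) (.inr 0) 2 3 = n := by
      rw [m.moveLabel_zero_eq _ _ (by decide)]
      change (n • (Pi.single m.newEdge 1 : T'.Edge → ℤ)) m.newEdge = n
      simp
    simp only [oppSum, Matrix.cons_val] at h2
    rw [h3 0 2 (by decide) (by decide) (by decide), h3 1 3 (by decide) (by decide) (by decide),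
      h3 0 1 (by decide) (by decide) (by decide), h4] at h2
    linarith
  -- the extension of edge functions
  let j : (T.Edge → ℤ) →+ (T'.Edge → ℤ) :=
    { toFun := fun k E => Sum.elim k ![0, k (T.edge m.start.corner)] (s.symm E)
      map_zero' := by
        ext E
        rcases s.symm E with E | i
        · rfl
        · fin_cases i <;> rfl
      map_add' := fun k k' => by
        ext E
        simp only [Pi.add_apply]
        rcases s.symm E with E | i
        · rfl
        · fin_cases i <;> simp }
  have hj : ∀ k E, j k (s (.inl E)) = k E := by
    intro k E
    simp [j]
  have hj₀ : ∀ k, j k m.newEdge = 0 := by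
    intro k
    simp [j, ← hs]
  have hj₁ : ∀ k, j k m.edgeOne = k (T.edge m.start.corner) := by
    intro k
    rw [← hs₁, hj]
  have hj₂ : ∀ k, j k m.edgeTwo = k (T.edge m.start.corner) := by
    intro k
    simp [j, ← hs₂]
  have hjold : ∀ k d, j k (T'.edge (m.oldCorner d)) = k (T.edge d) := by
    intro k d
    rcases hold d with h | ⟨h, h'⟩
    · rw [h, hj]
    · rw [h', hj₂, h]
  -- the lattice modulo the values at the new edge
  let Z := AddSubgroup.zmultiples δ
  let π : T'.EdgeLattice → T'.EdgeLattice ⧸ Z := QuotientAddGroup.mk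
  have hπ : ∀ l l', π l = π l' ↔ ∃ n : ℤ, l + n • δ = l' := by
    intro l l'
    rw [QuotientAddGroup.eq, AddSubgroup.mem_zmultiples_iff]
    exact exists_congr fun n => by rw [eq_neg_add_iff_add_eq]
  -- the sums over the fibres of the projection
  have hfib : ∀ (M : T'.EdgeLattice ⧸ Z) (k : T'.Edge → ℤ), π (k : T'.EdgeLattice) = M →
      TetIndex.HasLaurentSum (fun l : {l // π l = M} => T'.quotTerm (m.extend c) l)
        (if k m.edgeOne = k m.edgeTwo then T.latticeTerm c (fun E => k (s (.inl E))) else 0) := by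
    rintro M k rfl
    let e : ℤ ≃ {l // π l = π (k : T'.EdgeLattice)} := Equiv.ofBijective
      (fun n => ⟨(k : T'.EdgeLattice) + n • δ, ((hπ _ _).2 ⟨n, rfl⟩).symm⟩) (by
        constructor
        · intro n n' h
          have h1 : (k : T'.EdgeLattice) + n • δ = (k : T'.EdgeLattice) + n' • δ :=
            congrArg Subtype.val h
          have h2 := add_left_cancel h1
          exact sub_eq_zero.1 (hδn _ (by rw [sub_smul, h2, sub_self]))
        · rintro ⟨l, hl⟩
          obtain ⟨n, hn⟩ := (hπ _ _).1 hl.symm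
          exact ⟨n, Subtype.ext hn⟩)
    rw [← TetIndex.hasLaurentSum_comp_equiv_iff e]
    refine (m.hasLaurentSum_latticeTerm hs₁ hs hs₂ hold c k).congr fun n => ?_
    exact (quotTerm_mk hα' _ _).symm
  choose t ht using fun M : T'.EdgeLattice ⧸ Z => (⟨_, hfib M M.out.out (by
    rw [QuotientAddGroup.out_eq']
    exact QuotientAddGroup.out_eq' M)⟩ :
      ∃ r, TetIndex.HasLaurentSum (fun l : {l // π l = M} => T'.quotTerm (m.extend c) l) r)
  have hsum := hI.fiberwise π ht
  -- the fibres with a nonzero sum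
  let ι : T.EdgeLattice → T'.EdgeLattice ⧸ Z := fun l => π (j l.out : T'.Edge → ℤ)
  have hιj : ∀ k : T.Edge → ℤ, ι k = π (j k : T'.Edge → ℤ) := by
    intro k
    have h1 : -(k : T.EdgeLattice).out + k ∈ T.flatLattice :=
      QuotientAddGroup.eq.1 (QuotientAddGroup.out_eq' _)
    obtain ⟨n, hn⟩ := m.exists_add_single_mem_flatLattice (hjold _) hne h1
    refine (hπ _ _).2 ⟨-n, ?_⟩
    rw [hmk]
    refine QuotientAddGroup.eq.2 ?_
    rw [map_add, map_neg] at hn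
    convert hn using 1
    rw [neg_smul]
    abel
  have hιinj : Function.Injective ι := by
    intro l l' h
    obtain ⟨n, hn⟩ := (hπ _ _).1 h
    rw [hmk] at hn
    have h1 := QuotientAddGroup.eq.1 hn
    have h2 : -l.out + l'.out ∈ T.flatLattice := by
      refine m.mem_flatLattice_of_extension (fun d => ?_) h1
      simp [Pi.single_eq_of_ne (hne d), hjold]
    rw [← QuotientAddGroup.out_eq' l, ← QuotientAddGroup.out_eq' l']
    exact QuotientAddGroup.eq.2 h2
  have hιt : ∀ l, t (ι l) = T.quotTerm c l := by
    intro l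
    refine (ht (ι l)).unique ?_
    have h1 := hfib (ι l) (j l.out) rfl
    rw [if_pos (by rw [hj₁, hj₂])] at h1
    simp only [hj] at h1
    exact h1
  have hιzero : ∀ M, M ∉ Set.range ι → t M = 0 := by
    intro M hM
    obtain ⟨l, rfl⟩ := QuotientAddGroup.mk_surjective M
    obtain ⟨k, rfl⟩ := QuotientAddGroup.mk_surjective l
    have h1 := hfib _ k rfl
    by_cases h : k m.edgeOne = k m.edgeTwo
    · exfalso
      refine hM ⟨((fun E => k (s (.inl E)) : T.Edge → ℤ) : T.EdgeLattice), ?_⟩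
      rw [hιj]
      refine (hπ _ _).2 ⟨k m.newEdge, ?_⟩
      rw [hmk]
      congr 1
      ext E
      obtain ⟨E, rfl⟩ := s.surjective E
      rcases E with E | i
      · have : s (.inl E) ≠ m.newEdge := by
          rw [← hs]
          exact s.injective.ne Sum.inl_ne_inr
        simp [hj, Pi.single_eq_of_ne this]
      · have hi : i = 0 ∨ i = 1 := by omega
        rcases hi with rfl | rfl
        · rw [Pi.add_apply, hs, hj₀]
          simp
        · have h2 : m.edgeTwo ≠ m.newEdge := by
            rw [← hs₂, ← hs]
            exact s.injective.ne (by simp)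
          rw [Pi.add_apply, hs₂, hj₂, hs₁, h]
          simp [Pi.single_eq_of_ne h2]
    · rw [if_neg h] at h1
      exact (ht _).unique h1
  have h1 := (TetIndex.hasLaurentSum_comp_injective_iff hιinj hιzero).2 hsum
  exact h1.congr hιt

end ZeroTwoMove

namespace FacePairing

variable {τ : Type*} [Fintype τ] {T : FacePairing τ}

/-- The index of a class is well defined, with the value given by any essential curve. -/
theorem isIndex_of_essential (hT : T.IsIdealTriangulation) (hα : T.HasIndexStructure)
    {ϖ : T.OrientedCurve} (h : ϖ.Essential) {I : LaurentSeries ℤ}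
    (hI : TetIndex.HasLaurentSum (T.quotTerm ϖ.turning) I) : T.IsIndex ϖ.homologyClass I := by
  refine ⟨exists_isBasic, ⟨ϖ, h, rfl⟩, fun Q S ϖ' hS h' hc => ?_⟩
  rw [hasLaurentSum_indexTerm_iff hα hS,
    hasLaurentSum_quotTerm_iff hT hα h' h ((homologyClass_eq_iff ϖ' ϖ).1 hc)]
  exact hI

end FacePairing

theorem mainTheorem4 {τ τ' : Type*} [Fintype τ] [Fintype τ']
    (T : FacePairing τ) (T' : FacePairing τ')
    (hT : T.IsIdealTriangulation) (hT' : T'.IsIdealTriangulation)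
    (m : ZeroTwoMove T T')
    (hα : T.HasIndexStructure) (hα' : T'.HasIndexStructure)
    (h : T.H1) (h' : T'.H1) (hh : m.SameClass h h') :
    ∃ I : LaurentSeries ℤ, T.IsIndex h I ∧ T'.IsIndex h' I := by
  obtain ⟨ϖ, ϖ', he, rfl, he', rfl, hext⟩ := m.exists_essential hh
  obtain ⟨I, hI⟩ := FacePairing.exists_hasLaurentSum_quotTerm hα' ϖ'.turning
  have hI' := hI
  rw [hext] at hI'
  exact ⟨I, FacePairing.isIndex_of_essential hT hα he (m.hasLaurentSum_quotTerm hα hα' _ hI'),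
    FacePairing.isIndex_of_essential hT' hα' he' hI⟩
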